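/- **Interior.** Let $\Psi,Y$ be real functions of $(r,R)$, of class $C^3$ near every point of the triangle $0\le R\le r\le r_{\max}$ ($r_{\max}>0$), with $\Psi>0$ for $r>0$, $Y>0$, $Y(0,0)=1$, and $u^2:=Y^2+\frac{2\Psi}{R}-1>0$ for $0<R\le r\le r_{\max}$. Put $u>0$ for the positive root, $$G(r,R)=\int_R^r\frac1{Y(r,\sigma)}\,\partial_r\Big(\frac1u\Big)(r,\sigma)\,d\sigma+\frac1{Y(r,r)u(r,r)},$$ and consider the metric $$ds^2=-A\,dr^2-2B\,dR\,dr-C\,dR^2+R^2(d\theta^2+\sin^2\theta\,d\varphi^2),\qquad A=\Big(1-\frac{2\Psi}R\Big)G^2,\ B=-\frac{GY}{u},\ C=\frac1{u^2}.$$ Assume $Ru^2=\alpha r^3+\beta r^2R+\gamma rR^2+\delta R^3+o\big((r^2+R^2)^{3/2}\big)$ as $(r,R)\to(0,0)$, $0<R\le r$, with $\alpha>0$, and $G(r,0)=\xi r^2+o(r^2)$ as $r\to0^+$ with $\xi>\alpha\,\omega_{\rm crit}$, $\omega_{\rm crit}=\frac{26+15\sqrt3}2$. **Exterior.** For $0<r_b<r_{\max}$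 the interior is cut at $r=r_b$ and matched to $$ds^2=-\chi\,dT^2+\chi^{-1}dR^2+R^2(d\theta^2+\sin^2\theta\,d\varphi^2),\qquad \chi(R)=1-\frac{2M(R)}R,$$ where $M$ is $C^1$ on $(0,\infty)$, $M(R)=\Psi(r_b,R)$ for $R\in[0,r_b]$, $M'\ge0$ (nonnegative energy density), and $\limsup_{R\to\infty}M(R)<+\infty$. Let $R_0>r_b$ be an observer radius with $2M(R)<R$ for all $R\in[r_b,R_0]$. **Rays.** Let $\mathfrak S$ be the set of all nonradial future-pointing null geodesics in the plane $\theta=\pi/2$ which emanate from the central singularity (that is, $r\to0^+$ and $R/r\to0$ at the past end), have $r$ increasing along them and lie in $2\Psi<R<r$ until they reach $r=r_b$, and then continue in the exterior, with $R,\theta,\varphi$ and their derivatives along the ray continuous across $r=r_b$, in the region $R>2M(R)$ and with $R$ increasing, up to $R=R_0$. For such a ray, with affine parameter $\kappa$, let $\ell=R^2\,d\varphi/d\kappa\neq0$ and $\omega=\chi\,dT/d\kappa>0$ be its constants of motion in the exterior; its impact parameter is $\ell/\omega$. **The second class.** Let $x_2=\alpha z_2^2$, where $z_2>\sqrt{3/2}$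 is the number with $\frac{4z_2^5}{2z_2^2-3}=\frac\xi\alpha$ and $(5+\sqrt{27})z_2^3<\frac\xi\alpha$. Class (2) consists of the rays in $\mathfrak S$ with $R=x_2r^3+o(r^3)$ and $\varphi\to-\infty$ on approach to the singularity. **Proposition.** The number $x_2$ exists, $x_2>\alpha$, and it depends only on $\alpha$ and $\xi$. For every interior as above there is $\rho\in(0,r_{\max}]$ such that for all $r_b\in(0,\rho)$, all exteriors $M$ and all observers $R_0$ as above: 1. a ray in $\mathfrak S$ with $\ell>0$ satisfies $R=x_2r^3+o(r^3)$ if and only if $\varphi\to-\infty$ on approach to the singularity; 2. class (2) is not empty; 3. for every ray in $\mathfrak S$ that is not in class (2) there is a ray of class (2) with a strictly larger impact parameter; 4. $b=\sup_{\mathfrak S}\ell/\omega$ is finite and equals the supremum of $\ell/\omega$ over class (2). In particular, every ray of largest impact parameter in $\mathfrak S$, if there is one, is of class (2). -/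

import Mathlib

open Set Filter Topology Asymptotics

namespace AnisotropicCollapse

noncomputable section

/-! ### Geodesics in a coordinate chart -/

/-- A (pseudo-Riemannian) metric written in a single chart with four coordinates. -/
abbrev ChartMetric : Type := (Fin 4 → ℝ) → Matrix (Fin 4) (Fin 4) ℝ

/-- The partial derivative `∂_μ g_{νσ}` at the point `x`. -/
def partialMetric (g : ChartMetric) (μ ν σ : Fin 4) (x : Fin 4 → ℝ) : ℝ :=
  deriv (fun t : ℝ => g (Function.update x μ t) ν σ) (x μ)

/-- `x` is an affinely parametrized null geodesic of `g` on the interval `I`, with velocity `v`: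
`x' = v`, `g(v, v) = 0`, and the geodesic equation holds in its covariant form
`d/dκ (g_{μν} v^ν) = (1/2) ∂_μ g_{νσ} v^ν v^σ`. At an end point that belongs to `I` the
derivatives are one-sided. -/
def IsNullGeodesicOn (g : ChartMetric) (x v : ℝ → Fin 4 → ℝ) (I : Set ℝ) : Prop :=
  ∀ s ∈ I,
    HasDerivWithinAt x (v s) I s ∧
    (∑ μ, ∑ ν, g (x s) μ ν * v s μ * v s ν = 0) ∧
    ∀ μ, HasDerivWithinAt (fun t => ∑ ν, g (x t) μ ν * v t ν)
      ((1 / 2) * ∑ ν, ∑ σ, partialMetric g μ ν σ (x s) * v s ν * v s σ) I s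

/-! ### The interior spacetime -/

/-- `u² = Y² + 2Ψ/R - 1`. -/
def uSq (Ψ Y : ℝ → ℝ → ℝ) (r R : ℝ) : ℝ := Y r R ^ 2 + 2 * Ψ r R / R - 1

/-- The positive root `u`. -/
def u (Ψ Y : ℝ → ℝ → ℝ) (r R : ℝ) : ℝ := Real.sqrt (uSq Ψ Y r R)

/-- `G(r, R) = ∫_R^r (1 / Y(r, σ)) ∂_r (1 / u)(r, σ) dσ + 1 / (Y(r, r) u(r, r))`. -/
def G (Ψ Y : ℝ → ℝ → ℝ) (r R : ℝ) : ℝ :=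
  (∫ σ in R..r, (1 / Y r σ) * deriv (fun ρ => 1 / u Ψ Y ρ σ) r) + 1 / (Y r r * u Ψ Y r r)

def coeffA (Ψ Y : ℝ → ℝ → ℝ) (r R : ℝ) : ℝ := (1 - 2 * Ψ r R / R) * G Ψ Y r R ^ 2

def coeffB (Ψ Y : ℝ → ℝ → ℝ) (r R : ℝ) : ℝ := -(G Ψ Y r R * (Y r R / u Ψ Y r R))

def coeffC (Ψ Y : ℝ → ℝ → ℝ) (r R : ℝ) : ℝ := 1 / u Ψ Y r R ^ 2

/-- The interior metric `-A dr² - 2B dR dr - C dR² + R² (dθ² + sin² θ dφ²)` in the area-radius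
coordinates `(x 0, x 1, x 2, x 3) = (r, R, θ, φ)`. -/
def interiorMetric (Ψ Y : ℝ → ℝ → ℝ) : ChartMetric := fun x =>
  !![-coeffA Ψ Y (x 0) (x 1), -coeffB Ψ Y (x 0) (x 1), 0, 0;
     -coeffB Ψ Y (x 0) (x 1), -coeffC Ψ Y (x 0) (x 1), 0, 0;
     0, 0, x 1 ^ 2, 0;
     0, 0, 0, x 1 ^ 2 * Real.sin (x 2) ^ 2]

/-- The interior models, with shells labelled by `r ∈ [0, rmax]`; the shell `r` evolves from
`R = r` on the initial surface down to `R = 0`. -/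
structure IsInterior (α ξ β γ δ rmax : ℝ) (Ψ Y : ℝ → ℝ → ℝ) : Prop where
  rmax_pos : 0 < rmax
  /-- three times continuously differentiable in a neighbourhood of every point of the closed
  triangle `0 ≤ R ≤ r ≤ rmax` -/
  contDiff_Ψ : ∀ r R, 0 ≤ R → R ≤ r → r ≤ rmax → ContDiffAt ℝ 3 (Function.uncurry Ψ) (r, R)
  contDiff_Y : ∀ r R, 0 ≤ R → R ≤ r → r ≤ rmax → ContDiffAt ℝ 3 (Function.uncurry Y) (r, R)
  Ψ_pos : ∀ r R, 0 ≤ R → R ≤ r → r ≤ rmax → 0 < r → 0 < Ψ r R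
  Y_pos : ∀ r R, 0 ≤ R → R ≤ r → r ≤ rmax → 0 < Y r R
  /-- the radicand that defines `u` is positive, so that the metric is defined -/
  uSq_pos : ∀ r R, 0 < R → R ≤ r → r ≤ rmax → 0 < uSq Ψ Y r R
  /-- elementary flatness at the regular centre -/
  Y_center : Y 0 0 = 1
  /-- Taylor development of `R u²` at the centre -/
  taylor : (fun p : ℝ × ℝ => p.2 * uSq Ψ Y p.1 p.2 -
      (α * p.1 ^ 3 + β * p.1 ^ 2 * p.2 + γ * p.1 * p.2 ^ 2 + δ * p.2 ^ 3))
    =o[𝓝[{p : ℝ × ℝ | 0 < p.2 ∧ p.2 ≤ p.1}] (0, 0)]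
      fun p => (p.1 ^ 2 + p.2 ^ 2) ^ (3 / 2 : ℝ)
  /-- Taylor development `G(r, 0) = ξ r² + o(r²)` -/
  taylor_G : (fun r => G Ψ Y r 0 - ξ * r ^ 2) =o[𝓝[>] 0] fun r => r ^ 2

/-- `ω_crit = (26 + 15 √3) / 2`. -/
def omegaCrit : ℝ := (26 + 15 * Real.sqrt 3) / 2

/-! ### The exterior spacetime -/

/-- `χ(R) = 1 - 2 M(R) / R`. -/
def chi (M : ℝ → ℝ) (R : ℝ) : ℝ := 1 - 2 * M R / R

/-- The exterior metric `-χ dT² + χ⁻¹ dR² + R² (dθ² + sin² θ dφ²)` in the coordinates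
`(x 0, x 1, x 2, x 3) = (T, R, θ, φ)`. -/
def exteriorMetric (M : ℝ → ℝ) : ChartMetric := fun x =>
  !![-chi M (x 1), 0, 0, 0;
     0, (chi M (x 1))⁻¹, 0, 0;
     0, 0, x 1 ^ 2, 0;
     0, 0, 0, x 1 ^ 2 * Real.sin (x 2) ^ 2]

/-- `M` is the mass function of an exterior that is matched to the interior along `r = rb`:
the masses agree there for `R ∈ [0, rb]`, the energy density `M' / (4 π R²)` is nonnegative
(a part of the weak energy condition), and `limsup_{R → ∞} M(R) < +∞`. -/
structure IsExteriorMass (Ψ : ℝ → ℝ → ℝ) (rb : ℝ) (M : ℝ → ℝ) : Prop where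
  contDiff : ContDiffOn ℝ 1 M (Ioi 0)
  matching : ∀ R ∈ Icc 0 rb, M R = Ψ rb R
  energy : ∀ R, 0 < R → 0 ≤ deriv M R
  limsup_lt : limsup (fun R => (M R : EReal)) atTop < ⊤

/-! ### Rays from the central singularity to an observer -/

/-- The data of a curve in the matched spacetime: an interior piece on `(start, exit]`, in the
coordinates `(r, R, θ, φ)`, and an exterior piece on `[exit, finish]`, in the coordinates
`(T, R, θ, φ)`, each with its velocity. -/
structure Ray where
  start : ℝ
  exit : ℝ
  finish : ℝ
  pos : ℝ → Fin 4 → ℝ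
  vel : ℝ → Fin 4 → ℝ
  extPos : ℝ → Fin 4 → ℝ
  extVel : ℝ → Fin 4 → ℝ

namespace Ray

/-- The angular momentum `ℓ = R² dφ/dκ`, read off where the ray leaves the interior. -/
def angularMomentum (c : Ray) : ℝ := c.extPos c.exit 1 ^ 2 * c.extVel c.exit 3

/-- The frequency `ω = χ dT/dκ`, the constant of motion of the exterior geodesic. -/
def frequency (M : ℝ → ℝ) (c : Ray) : ℝ := chi M (c.extPos c.exit 1) * c.extVel c.exit 0

/-- The ratio `ℓ / ω`. -/
def impactParameter (M : ℝ → ℝ) (c : Ray) : ℝ := c.angularMomentum / c.frequency M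

/-- `R = x r³ + o(r³)` on approach to the singularity. -/
def HasDirection (c : Ray) (x : ℝ) : Prop :=
  Tendsto (fun s => c.pos s 1 / c.pos s 0 ^ 3) (𝓝[>] c.start) (𝓝 x)

/-- `φ → -∞` on approach to the singularity. -/
def AngleToNegInfinity (c : Ray) : Prop :=
  Tendsto (fun s => c.pos s 3) (𝓝[>] c.start) atBot

end Ray

/-- The set of all nonradial null geodesics, in the plane `θ = π/2`, that emanate from the central
singularity, leave the interior at `r = rb` and are detected at `R = R₀`. -/
structure IsDetectedSingularRay (Ψ Y : ℝ → ℝ → ℝ) (rb : ℝ) (M : ℝ → ℝ) (R₀ : ℝ)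
    (c : Ray) : Prop where
  start_lt : c.start < c.exit
  exit_lt : c.exit < c.finish
  geodesic : IsNullGeodesicOn (interiorMetric Ψ Y) c.pos c.vel (Ioc c.start c.exit)
  /-- the ray stays in the interior chart and outside the trapped region -/
  region : ∀ s ∈ Ioc c.start c.exit, 0 < c.pos s 0 ∧ 0 < c.pos s 1 ∧ c.pos s 1 < c.pos s 0 ∧
    2 * Ψ (c.pos s 0) (c.pos s 1) < c.pos s 1
  equatorial : ∀ s ∈ Ioc c.start c.exit, c.pos s 2 = Real.pi / 2
  /-- the label `r` can be used as a parameter along the ray -/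
  vel_r : ∀ s ∈ Ioc c.start c.exit, 0 < c.vel s 0
  /-- future pointing: the product of the velocity with the comoving 4-velocity `-u ∂_R` is
  negative -/
  future : ∀ s ∈ Ioc c.start c.exit,
    coeffB Ψ Y (c.pos s 0) (c.pos s 1) * c.vel s 0
      + coeffC Ψ Y (c.pos s 0) (c.pos s 1) * c.vel s 1 < 0
  /-- the ray emanates from the central singularity: `r → 0` and `R / r → 0`. (The regular centre,
  prior to the singularity, also has `r = R = 0`; there `R / r` has a positive limit.) -/
  start_r : Tendsto (fun s => c.pos s 0) (𝓝[>] c.start) (𝓝 0)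
  start_R : Tendsto (fun s => c.pos s 1 / c.pos s 0) (𝓝[>] c.start) (𝓝 0)
  exit_r : c.pos c.exit 0 = rb
  /-- the two pieces join across `r = rb`: the functions `R, θ, φ` and their derivatives along the
  ray are continuous. (The remaining component `dT/dκ > 0` is then fixed by the null condition.) -/
  join_pos : ∀ i : Fin 4, i ≠ 0 → c.extPos c.exit i = c.pos c.exit i
  join_vel : ∀ i : Fin 4, i ≠ 0 → c.extVel c.exit i = c.vel c.exit i
  ext_geodesic : IsNullGeodesicOn (exteriorMetric M) c.extPos c.extVel (Icc c.exit c.finish)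
  ext_equatorial : ∀ s ∈ Icc c.exit c.finish, c.extPos s 2 = Real.pi / 2
  /-- the exterior piece lies in the region `R > 2 M(R)`, and is future pointing and outgoing -/
  ext_region : ∀ s ∈ Icc c.exit c.finish, 0 < chi M (c.extPos s 1)
  ext_future : ∀ s ∈ Icc c.exit c.finish, 0 < c.extVel s 0
  ext_outgoing : ∀ s ∈ Icc c.exit c.finish, 0 < c.extVel s 1
  detected : c.extPos c.finish 1 = R₀
  nonradial : c.angularMomentum ≠ 0

/-- `x` is the direction `x₂` of the geodesics of the second class: `x = α z²`, where `z` is the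
root of the root equation `4 z⁵ / (2 z² - 3) = ω`, `ω = ξ / α`, in the range
`ω > (5 + √27) z³`. -/
def IsSecondDirection (α ξ x : ℝ) : Prop :=
  ∃ z : ℝ, 0 < z ∧ 3 < 2 * z ^ 2 ∧ 4 * z ^ 5 / (2 * z ^ 2 - 3) = ξ / α ∧
    (5 + Real.sqrt 27) * z ^ 3 < ξ / α ∧ x = α * z ^ 2

end

end AnisotropicCollapse

open AnisotropicCollapse

namespace AnisotropicCollapse

/-! ### Differential inequalities on a half-line -/

/-! The time t = -log r runs towards the singularity. The unknowns are z = (R / (α r³))^{1/2} and w,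
the cosine of the angle between the ray and the radial direction in the comoving frame. Conservation
of ℓ and the null condition reduce the geodesic equation to a planar system z' = -a, w' = -(1 - w²)
b. The developments of R u² and of G show that this system tends, as t → ∞, to the autonomous one
with 2 z³ w a = `driftZ` and 2 z⁴ w b = `driftW`, where ω = ξ / α. For ω > ω_crit the limiting
system has a saddle (z₂, w₂) with 0 < w₂ < 1 (`exists_saddle`), and class (2) consists of the rays
that converge to it. Every ray from the singularity stays in a box 1/2 ≤ z ≤ Z, 1/6 ≤ w < 1
(`IsDetectedSingularRay.exists_boxSolution`).

Near the saddle `driftZ` increases in both variables, while `driftW` increases in z and decreases in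
w. Quadrants with a corner close to the saddle are therefore invariant forward or backward in time,
also for the perturbed system. This replaces the stable manifold theorem and gives
`trajectory_dichotomy`: a solution in the box either converges to the saddle or enters a quadrant {z
< z₁, w₁ < w}, where it is trapped. In the trap 1 - w² decays exponentially, so that φ stays bounded
and z does not tend to z₂. At the saddle w stays away from 1, so that φ falls at a definite rate.
This is the equivalence of direction and angle (`hasDirection_iff`).

The comparison of impact parameters is a shooting argument (`exists_boxSolution_tendsto_saddle`,
`exists_ray_of_start`). Up to a rotation, an outgoing ray with ℓ = 1 and frequency κ is determined
by its radius R at r = r_b, its w there being `aimCos`. A ray outside class (2) with ℓ > 0 enters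
the trap, which is an open condition on its exit data. From these data the exit radius is moved
outwards until z > Z, which can never be undone towards the singularity, and κ is lowered slightly
at the same time. There is room for this because the ray reaches R₀ without turning back, so that κ²
exceeds χ / R² on a compact interval. Trapping and escape are open and mutually exclusive, so some
intermediate parameter gives neither. Its solution converges to the saddle, and its frequency is
strictly smaller. `IsRaySolution.exists_ray` turns the solution back into a geodesic, matched to the
exterior.

The same argument, begun with a nearly radial ray, shows that class (2) is not empty. Rays with ℓ <
0 have negative impact parameter and need no argument. The supremum is finite because every ray has
to pass the radius α Z² r_b³ while moving outwards (`impactParameter_le`). -/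

lemma eventually_pos_right {f : ℝ → ℝ} {f' x : ℝ} (hf : HasDerivWithinAt f f' (Ioi x) x)
    (h0 : f x = 0) (hpos : 0 < f') : ∀ᶠ y in 𝓝[>] x, 0 < f y := by
  have h := (hasDerivWithinAt_iff_tendsto_slope' (by simp)).1 hf
  filter_upwards [h.eventually (lt_mem_nhds hpos), self_mem_nhdsWithin] with y hy hxy
  have hxy' : 0 < y - x := sub_pos.2 hxy
  rw [slope_def_field, h0, sub_zero] at hy
  exact (div_pos_iff_of_pos_right hxy').1 hy

/-- If the vector field points into the quadrant `{0 ≤ f, 0 ≤ g}` on its edges, the quadrant is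
never left. -/
lemma quadrant_invariant {f g f' g' : ℝ → ℝ} {a b : ℝ}
    (hf : ∀ t ∈ Icc a b, HasDerivWithinAt f (f' t) (Icc a b) t)
    (hg : ∀ t ∈ Icc a b, HasDerivWithinAt g (g' t) (Icc a b) t)
    (hfa : 0 ≤ f a) (hga : 0 ≤ g a)
    (hfe : ∀ t ∈ Icc a b, f t = 0 → 0 ≤ g t → 0 < f' t)
    (hge : ∀ t ∈ Icc a b, g t = 0 → 0 ≤ f t → 0 < g' t) :
    ∀ t ∈ Icc a b, 0 ≤ f t ∧ 0 ≤ g t := by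
  have hfc : ContinuousOn f (Icc a b) := fun t ht => (hf t ht).continuousWithinAt
  have hgc : ContinuousOn g (Icc a b) := fun t ht => (hg t ht).continuousWithinAt
  have hcl : IsClosed ({t | 0 ≤ f t ∧ 0 ≤ g t} ∩ Icc a b) := by
    have h1 := hfc.preimage_isClosed_of_isClosed isClosed_Icc (isClosed_Ici (a := (0 : ℝ)))
    have h2 := hgc.preimage_isClosed_of_isClosed isClosed_Icc (isClosed_Ici (a := (0 : ℝ)))
    convert h1.inter h2 using 1
    ext t; simp; tauto
  -- Continuous induction: the good times form a closed set, and each of them is followed by good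
  -- times. Where a coordinate vanishes its strictly positive derivative pushes it inside; elsewhere
  -- continuity suffices. At the corner both edge conditions apply.
  have aux : ∀ (F F' : ℝ → ℝ), (∀ t ∈ Icc a b, HasDerivWithinAt F (F' t) (Icc a b) t) →
      ∀ x ∈ Ico a b, 0 ≤ F x → (F x = 0 → 0 < F' x) → ∀ᶠ y in 𝓝[>] x, 0 ≤ F y := by
    intro F F' hF x hx h0 h1
    have hd : HasDerivWithinAt F (F' x) (Ioi x) x :=
      (hF x ⟨hx.1, hx.2.le⟩).mono_of_mem_nhdsWithin
        (mem_of_superset (Ioc_mem_nhdsGT hx.2) fun y hy => ⟨hx.1.trans hy.1.le, hy.2⟩)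
    rcases h0.eq_or_lt with h | h
    · exact (eventually_pos_right hd h.symm (h1 h.symm)).mono fun y hy => hy.le
    · exact (hd.continuousWithinAt.eventually (lt_mem_nhds h)).mono fun y hy => hy.le
  intro t ht
  refine hcl.Icc_subset_of_forall_mem_nhdsWithin ⟨hfa, hga⟩ (fun x hx => ?_) ht
  have hx' : x ∈ Icc a b := ⟨hx.2.1, hx.2.2.le⟩
  exact (aux f f' hf x hx.2 hx.1.1 fun h => hfe x hx' h hx.1.2).and
    (aux g g' hg x hx.2 hx.1.2 fun h => hge x hx' h hx.1.1)

/-- Time reversal of `quadrant_invariant`. -/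
lemma quadrant_invariant_backward {f g f' g' : ℝ → ℝ} {a b : ℝ}
    (hf : ∀ t ∈ Icc a b, HasDerivWithinAt f (f' t) (Icc a b) t)
    (hg : ∀ t ∈ Icc a b, HasDerivWithinAt g (g' t) (Icc a b) t)
    (hfb : 0 ≤ f b) (hgb : 0 ≤ g b)
    (hfe : ∀ t ∈ Icc a b, f t = 0 → 0 ≤ g t → f' t < 0)
    (hge : ∀ t ∈ Icc a b, g t = 0 → 0 ≤ f t → g' t < 0) :
    ∀ t ∈ Icc a b, 0 ≤ f t ∧ 0 ≤ g t := by
  have hm : ∀ t ∈ Icc (-b) (-a), -t ∈ Icc a b := fun t ht =>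
    ⟨by linarith [ht.2], by linarith [ht.1]⟩
  have key : ∀ (F F' : ℝ → ℝ), (∀ t ∈ Icc a b, HasDerivWithinAt F (F' t) (Icc a b) t) →
      ∀ t ∈ Icc (-b) (-a), HasDerivWithinAt (fun s => F (-s)) (-F' (-t)) (Icc (-b) (-a)) t := by
    intro F F' hF t ht
    have := (hF (-t) (hm t ht)).comp t (hasDerivAt_neg t).hasDerivWithinAt hm
    simpa [Function.comp_def] using this
  intro t ht
  have := quadrant_invariant (key f f' hf) (key g g' hg) (by simpa using hfb) (by simpa using hgb)
    (fun s hs h1 h2 => by have := hfe (-s) (hm s hs) h1 h2; linarith)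
    (fun s hs h1 h2 => by have := hge (-s) (hm s hs) h1 h2; linarith)
    (-t) ⟨by linarith [ht.2], by linarith [ht.1]⟩
  simpa using this

lemma halfline_invariant {f f' : ℝ → ℝ} {a b : ℝ}
    (hf : ∀ t ∈ Icc a b, HasDerivWithinAt f (f' t) (Icc a b) t) (hfa : 0 ≤ f a)
    (hfe : ∀ t ∈ Icc a b, f t = 0 → 0 < f' t) : ∀ t ∈ Icc a b, 0 ≤ f t := fun t ht =>
  (quadrant_invariant (g := fun _ => 1) (g' := fun _ => 0) hf
    (fun _ _ => hasDerivWithinAt_const _ _ _) hfa zero_le_one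
    (fun s hs h _ => hfe s hs h) (fun _ _ h => absurd h one_ne_zero) t ht).1

lemma halfline_invariant_backward {f f' : ℝ → ℝ} {a b : ℝ}
    (hf : ∀ t ∈ Icc a b, HasDerivWithinAt f (f' t) (Icc a b) t) (hfb : 0 ≤ f b)
    (hfe : ∀ t ∈ Icc a b, f t = 0 → f' t < 0) : ∀ t ∈ Icc a b, 0 ≤ f t := fun t ht =>
  (quadrant_invariant_backward (g := fun _ => 1) (g' := fun _ => 0) hf
    (fun _ _ => hasDerivWithinAt_const _ _ _) hfb zero_le_one
    (fun s hs h _ => hfe s hs h) (fun _ _ h => absurd h one_ne_zero) t ht).1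

lemma antitoneOn_Ici_of_deriv_nonpos {f f' : ℝ → ℝ} {T : ℝ}
    (hf : ∀ t ∈ Ici T, HasDerivWithinAt f (f' t) (Ici T) t) (h : ∀ t ∈ Ici T, f' t ≤ 0) :
    AntitoneOn f (Ici T) := by
  refine antitoneOn_of_hasDerivWithinAt_nonpos (f' := f') (convex_Ici T)
    (fun t ht => (hf t ht).continuousWithinAt) (fun t ht => ?_) fun t ht => ?_
  · exact (hf t (interior_subset ht)).mono interior_subset
  · exact h t (interior_subset ht)

/-- A function cannot decrease at a definite rate for ever while it is bounded below. -/
lemma not_decreasing_of_bddBelow {f f' : ℝ → ℝ} {T c m : ℝ} (hc : 0 < c)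
    (hf : ∀ t ∈ Ici T, HasDerivWithinAt f (f' t) (Ici T) t) (h : ∀ t ∈ Ici T, f' t ≤ -c)
    (hm : ∀ t ∈ Ici T, m ≤ f t) : False := by
  have hanti : AntitoneOn (fun t => f t + c * t) (Ici T) :=
    antitoneOn_Ici_of_deriv_nonpos (f' := fun t => f' t + c * 1)
      (fun t ht => (hf t ht).add ((hasDerivWithinAt_id t _).const_mul c))
      (fun t ht => by linarith [h t ht])
  have hfm := hm T self_mem_Ici
  -- At this time `f` would have dropped by at least f T - m + 1, hence below `m`.
  set t := T + (f T - m + 1) / c with ht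
  have hpos : 0 ≤ (f T - m + 1) / c := div_nonneg (by linarith) hc.le
  have htT : t ∈ Ici T := by rw [mem_Ici]; linarith
  have h1 := hanti self_mem_Ici htT htT
  have h2 : c * t = c * T + (f T - m + 1) := by rw [ht]; field_simp
  have h3 := hm t htT
  simp only at h1
  linarith

/-- The rate is assumed only on {f ≤ a}, but this set is not left once entered, because `f`
decreases at the level `a`. So the rate holds for ever. -/
lemma trapped_decreasing_false {f f' : ℝ → ℝ} {T a c m : ℝ} (hc : 0 < c)
    (hf : ∀ t ∈ Ici T, HasDerivWithinAt f (f' t) (Ici T) t) (ha : f T ≤ a)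
    (h : ∀ t ∈ Ici T, f t ≤ a → f' t ≤ -c) (hm : ∀ t ∈ Ici T, m ≤ f t) : False := by
  refine not_decreasing_of_bddBelow hc hf (fun t ht => h t ht ?_) hm
  have := halfline_invariant (f := fun s => a - f s) (f' := fun s => -f' s) (a := T) (b := t)
    (fun s hs => ((hf s hs.1).mono Icc_subset_Ici_self).const_sub a) (by linarith)
    (fun s hs h0 => by have := h s hs.1 (by linarith); linarith) t ⟨ht, le_rfl⟩
  linarith

lemma trapped_increasing_false {f f' : ℝ → ℝ} {T a c m : ℝ} (hc : 0 < c)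
    (hf : ∀ t ∈ Ici T, HasDerivWithinAt f (f' t) (Ici T) t) (ha : a ≤ f T)
    (h : ∀ t ∈ Ici T, a ≤ f t → c ≤ f' t) (hm : ∀ t ∈ Ici T, f t ≤ m) : False :=
  trapped_decreasing_false (f := fun t => -f t) (f' := fun t => -f' t) (a := -a) (m := -m) hc
    (fun t ht => (hf t ht).neg) (by linarith) (fun t ht h1 => by have := h t ht (by linarith); linarith)
    (fun t ht => by linarith [hm t ht])

/-! ### The limiting planar system -/

/-- `2 z³ w` times the rate of `z` in the limiting system. -/
def driftZ (ω z w : ℝ) : ℝ := w * (ω * z - 2 * z ^ 4) - ω - z ^ 3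

/-- `2 z⁴ w / (1 - w²)` times the rate of `w` in the limiting system. -/
def driftW (ω z w : ℝ) : ℝ := 2 * z * (ω + z ^ 3) - 3 * ω * w

/-- The polynomial whose zeros are the equilibria with `0 < w < 1`. -/
def rootPoly (ω z : ℝ) : ℝ := ω * (2 * z ^ 2 - 3) - 4 * z ^ 5

/-- The saddle `(z₂, w₂)` of the limiting system. -/
structure IsSaddle (ω z₂ w₂ : ℝ) : Prop where
  ω_gt : 25 < ω
  z_pos : 0 < z₂
  z_gt : 3 < 2 * z₂ ^ 2
  z_lt : 2 * z₂ ^ 2 - 2 * z₂ - 1 < 0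
  root : rootPoly ω z₂ = 0
  w_eq : w₂ = (2 * z₂ ^ 2 - 1) / (2 * z₂)

lemma omegaCrit_gt : 25 < omegaCrit := by
  have h : (1.7 : ℝ) < Real.sqrt 3 := by
    rw [Real.lt_sqrt (by norm_num)]; norm_num
  unfold omegaCrit; linarith

lemma sqrt_twentySeven : Real.sqrt 27 = 3 * Real.sqrt 3 := by
  rw [show (27 : ℝ) = 3 ^ 2 * 3 by norm_num, Real.sqrt_mul (by norm_num),
    Real.sqrt_sq (by norm_num)]

/-- The value w₂ = 1 is reached at z_c = (1 + √3) / 2, the positive root of 2 z² - 2 z - 1, and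
there `rootPoly` equals (√3 - 1)(ω - ω_crit) > 0. At √(3/2) it is negative. The intermediate value
theorem gives a root between them. The bound z < z_c is equivalent to w₂ < 1 and also to (5 + √27)
z³ < ω for such a root. -/
lemma exists_saddle {ω : ℝ} (hω : omegaCrit < ω) : ∃ z₂ w₂, IsSaddle ω z₂ w₂ ∧
    (5 + Real.sqrt 27) * z₂ ^ 3 < ω ∧ 4 * z₂ ^ 5 / (2 * z₂ ^ 2 - 3) = ω := by
  have h3 : Real.sqrt 3 ^ 2 = 3 := Real.sq_sqrt (by norm_num)
  have hl : (1.7 : ℝ) < Real.sqrt 3 := by rw [Real.lt_sqrt (by norm_num)]; norm_num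
  have hu : Real.sqrt 3 < 1.8 := by rw [Real.sqrt_lt' (by norm_num)]; norm_num
  set s := Real.sqrt 3 with hs
  have hω25 := omegaCrit_gt.trans hω
  set zc := (1 + s) / 2 with hzc
  set zl := Real.sqrt (3 / 2) with hzl
  have hzl2 : zl ^ 2 = 3 / 2 := Real.sq_sqrt (by norm_num)
  have hzl0 : 0 < zl := Real.sqrt_pos.2 (by norm_num)
  have hzc2 : zc ^ 2 = (2 + s) / 2 := by rw [hzc]; nlinarith
  have hzc0 : 0 < zc := by rw [hzc]; linarith
  have hlt : zl < zc := lt_of_pow_lt_pow_left₀ 2 hzc0.le (by rw [hzl2, hzc2]; linarith)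
  have hneg : rootPoly ω zl < 0 := by
    unfold rootPoly; rw [hzl2]
    have : 0 < zl ^ 5 := by positivity
    linarith
  have hpos : 0 < rootPoly ω zc := by
    have h5 : 4 * zc ^ 5 = (19 + 11 * s) / 2 := by
      have : zc ^ 5 = zc ^ 2 * zc ^ 2 * zc := by ring
      rw [this, hzc2, hzc]; nlinarith
    have : rootPoly ω zc = (s - 1) * (ω - omegaCrit) := by
      unfold rootPoly omegaCrit; rw [hzc2, h5, ← hs]; nlinarith
    rw [this]
    exact mul_pos (by linarith) (by linarith)
  have hcont : ContinuousOn (rootPoly ω) (Icc zl zc) := by unfold rootPoly; fun_prop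
  obtain ⟨z, ⟨hz1, hz2⟩, hz0⟩ := intermediate_value_Ioo hlt.le hcont ⟨hneg, hpos⟩
  have hz : 0 < z := hzl0.trans hz1
  have hzsq1 : 3 / 2 < z ^ 2 := by rw [← hzl2]; exact pow_lt_pow_left₀ hz1 hzl0.le (by norm_num)
  have hzsq2 : z ^ 2 < (2 + s) / 2 := by
    rw [← hzc2]; exact pow_lt_pow_left₀ hz2 hz.le (by norm_num)
  have hfr : 4 * z ^ 5 / (2 * z ^ 2 - 3) = ω := by
    rw [div_eq_iff (by linarith)]; unfold rootPoly at hz0; linarith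
  refine ⟨z, _, ⟨hω25, hz, by linarith, ?_, hz0, rfl⟩, ?_, hfr⟩
  · rw [hzc] at hz2; nlinarith
  · rw [← hfr, lt_div_iff₀ (by linarith), sqrt_twentySeven, ← hs]
    have h1 : (5 + 3 * s) * (2 * z ^ 2 - 3) < 4 * z ^ 2 := by nlinarith
    have h2 : 0 < z ^ 3 := by positivity
    nlinarith [mul_pos h2 (sub_pos.2 h1)]

namespace IsSaddle

variable {ω z₂ w₂ : ℝ} (h : IsSaddle ω z₂ w₂)
include h

lemma z_gt' : 6 / 5 < z₂ := by nlinarith [h.z_gt, h.z_pos]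

lemma z_lt' : z₂ < 7 / 5 := by nlinarith [h.z_lt, h.z_pos]

lemma w_mul : w₂ * (2 * z₂) = 2 * z₂ ^ 2 - 1 := by
  rw [h.w_eq]; field_simp [h.z_pos.ne']

lemma w_gt : 3 / 5 < w₂ := by nlinarith [h.w_mul, h.z_gt', h.z_lt', h.z_gt]

lemma w_lt : w₂ < 1 := by nlinarith [h.w_mul, h.z_pos, h.z_lt]

lemma driftW_eq : driftW ω z₂ w₂ = 0 := by
  have h1 := h.root
  have h2 := h.w_mul
  have hz := h.z_pos
  unfold rootPoly at h1; unfold driftW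
  have : (2 * z₂ * (ω + z₂ ^ 3) - 3 * ω * w₂) * (2 * z₂) = 0 := by
    linear_combination (-3 * ω) * h2 - h1
  rcases mul_eq_zero.1 this with h | h
  · exact h
  · linarith

lemma driftZ_eq : driftZ ω z₂ w₂ = 0 := by
  have h1 := h.root
  have h2 := h.w_mul
  have hz := h.z_pos
  unfold rootPoly at h1; unfold driftZ
  linear_combination (1 / 2) * (ω - 2 * z₂ ^ 3) * h2 + (1 / 2) * h1

/-- Ensures that the coefficient ω z - 2 z⁴ of w in `driftZ` is positive for 0 < z ≤ z₂. -/
lemma cube_lt : 2 * z₂ ^ 3 < ω := by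
  have h1 := h.z_lt'
  have h2 := h.z_pos
  have : z₂ ^ 3 < (7 / 5) ^ 3 := pow_lt_pow_left₀ h1 h2.le (by norm_num)
  have := h.ω_gt
  linarith

/-- This is the z-derivative of `driftZ` at the saddle. Eliminating ω by the root equation leaves a
positive multiple of 2 - 2q - q² with q = 2 z₂² - 3, which factors as (2z₂)² - (2z₂² - 1)²; its
positivity is again w₂ < 1. -/
lemma slope_pos : 0 < w₂ * (ω - 8 * z₂ ^ 3) - 3 * z₂ ^ 2 := by
  have h1 := h.root
  have h2 := h.w_mul
  have hz := h.z_pos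
  have hq : 0 < 2 * z₂ ^ 2 - 3 := by linarith [h.z_gt]
  have hq2 : 2 * z₂ ^ 2 < 2 + 2 * z₂ - 1 := by linarith [h.z_lt]
  unfold rootPoly at h1
  have hid : (w₂ * (ω - 8 * z₂ ^ 3) - 3 * z₂ ^ 2) * (2 * z₂) * (2 * z₂ ^ 2 - 3)
      = 2 * z₂ ^ 3 * 3 * (2 - 2 * (2 * z₂ ^ 2 - 3) - (2 * z₂ ^ 2 - 3) ^ 2) := by
    linear_combination (2 * z₂ ^ 2 - 3) * (ω - 8 * z₂ ^ 3) * h2 + (2 * z₂ ^ 2 - 1) * h1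
  have hq3 : 0 < 2 - 2 * (2 * z₂ ^ 2 - 3) - (2 * z₂ ^ 2 - 3) ^ 2 := by
    have : 0 < (2 * z₂ + 2 * z₂ ^ 2 - 1) * (2 * z₂ - 2 * z₂ ^ 2 + 1) :=
      mul_pos (by nlinarith) (by linarith)
    nlinarith
  have hp : 0 < (w₂ * (ω - 8 * z₂ ^ 3) - 3 * z₂ ^ 2) * (2 * z₂) * (2 * z₂ ^ 2 - 3) := by
    rw [hid]; positivity
  have := pos_of_mul_pos_left hp hq.le
  exact pos_of_mul_pos_left this (by linarith)

/-- The derivative is 4 z (ω - 5 z³), and ω > 25 exceeds 5 (3/2)³. Combined with `driftZ_nullcline`,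
this gives `driftZ` the sign of z - z₂ along the nullcline of `driftW` for 0 < z ≤ 3/2. -/
lemma rootPoly_strictMono {a b : ℝ} (ha : 0 ≤ a) (hab : a < b) (hb : b ≤ 3 / 2) :
    rootPoly ω a < rootPoly ω b := by
  have hω := h.ω_gt
  have hb0 : 0 < b := ha.trans_lt hab
  have hb3 : b ^ 3 ≤ 27 / 8 := by
    calc b ^ 3 ≤ (3 / 2) ^ 3 := pow_le_pow_left₀ hb0.le hb 3
      _ = 27 / 8 := by norm_num
  have h1 : b ^ 4 ≤ 27 / 8 * b := by nlinarith
  have h2 : b ^ 3 * a ≤ 27 / 8 * a := by nlinarith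
  have h3 : b ^ 2 * a ^ 2 ≤ b ^ 3 * a := by
    have : 0 ≤ b ^ 2 * a * (b - a) := by have := hab.le; exact mul_nonneg (by positivity) (by linarith)
    nlinarith
  have h4 : b * a ^ 3 ≤ b ^ 2 * a ^ 2 := by
    have : 0 ≤ b * a ^ 2 * (b - a) := mul_nonneg (by positivity) (by linarith)
    nlinarith
  have h5 : a ^ 4 ≤ b * a ^ 3 := by
    have : 0 ≤ a ^ 3 * (b - a) := mul_nonneg (by positivity) (by linarith)
    nlinarith
  have hid : rootPoly ω b - rootPoly ω a =
      (b - a) * (2 * ω * (a + b) - 4 * (b ^ 4 + b ^ 3 * a + b ^ 2 * a ^ 2 + b * a ^ 3 + a ^ 4)) := by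
    unfold rootPoly; ring
  have : 0 < 2 * ω * (a + b) - 4 * (b ^ 4 + b ^ 3 * a + b ^ 2 * a ^ 2 + b * a ^ 3 + a ^ 4) := by
    nlinarith
  have := mul_pos (sub_pos.2 hab) this
  linarith

/-- The value of `driftZ` on the nullcline of `driftW`. -/
lemma driftZ_nullcline (z : ℝ) : driftZ ω z (2 * z * (ω + z ^ 3) / (3 * ω))
    = (ω + z ^ 3) / (3 * ω) * rootPoly ω z := by
  have : ω ≠ 0 := by linarith [h.ω_gt]
  unfold driftZ rootPoly; field_simp; ring

/-- The four corner lemmas realize the four sign patterns of (`driftZ`, `driftW`) near the saddle.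
For I and III only w is moved first: `driftZ` grows and `driftW` falls with w. The strict signs then
survive a small shift of z into the required quadrant. -/
lemma exists_corner_I {δ : ℝ} (hδ : 0 < δ) : ∃ z₁ w₁, z₂ < z₁ ∧ z₁ < z₂ + δ ∧ w₂ < w₁ ∧
    w₁ < w₂ + δ ∧ 0 < driftZ ω z₁ w₁ ∧ driftW ω z₁ w₁ < 0 := by
  have hP : 0 < driftZ ω z₂ (w₂ + δ / 2) := by
    have h1 := h.driftZ_eq
    have : 0 < δ / 2 * (z₂ * (ω - 2 * z₂ ^ 3)) :=
      mul_pos (by linarith) (mul_pos h.z_pos (by linarith [h.cube_lt]))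
    unfold driftZ at h1 ⊢; nlinarith
  have hQ : driftW ω z₂ (w₂ + δ / 2) < 0 := by
    have h1 := h.driftW_eq
    have := h.ω_gt
    unfold driftW at h1 ⊢; nlinarith
  have c1 : Continuous fun z => driftZ ω z (w₂ + δ / 2) := by unfold driftZ; fun_prop
  have c2 : Continuous fun z => driftW ω z (w₂ + δ / 2) := by unfold driftW; fun_prop
  have e1 : ∀ᶠ z in 𝓝[>] z₂, 0 < driftZ ω z (w₂ + δ / 2) :=
    (c1.continuousAt.eventually (lt_mem_nhds hP)).filter_mono nhdsWithin_le_nhds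
  have e2 : ∀ᶠ z in 𝓝[>] z₂, driftW ω z (w₂ + δ / 2) < 0 :=
    (c2.continuousAt.eventually (gt_mem_nhds hQ)).filter_mono nhdsWithin_le_nhds
  have e3 : Ioo z₂ (z₂ + δ) ∈ 𝓝[>] z₂ := Ioo_mem_nhdsGT (by linarith)
  obtain ⟨z, hz1, hz2, hz3⟩ := (e1.and (e2.and e3)).exists
  exact ⟨z, _, hz3.1, hz3.2, by linarith, by linarith, hz1, hz2⟩

lemma exists_corner_III {δ : ℝ} (hδ : 0 < δ) : ∃ z₁ w₁, z₁ < z₂ ∧ z₂ - δ < z₁ ∧ w₁ < w₂ ∧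
    w₂ - δ < w₁ ∧ driftZ ω z₁ w₁ < 0 ∧ 0 < driftW ω z₁ w₁ := by
  have hP : driftZ ω z₂ (w₂ - δ / 2) < 0 := by
    have h1 := h.driftZ_eq
    have : 0 < δ / 2 * (z₂ * (ω - 2 * z₂ ^ 3)) :=
      mul_pos (by linarith) (mul_pos h.z_pos (by linarith [h.cube_lt]))
    unfold driftZ at h1 ⊢; nlinarith
  have hQ : 0 < driftW ω z₂ (w₂ - δ / 2) := by
    have h1 := h.driftW_eq
    have := h.ω_gt
    unfold driftW at h1 ⊢; nlinarith
  have c1 : Continuous fun z => driftZ ω z (w₂ - δ / 2) := by unfold driftZ; fun_prop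
  have c2 : Continuous fun z => driftW ω z (w₂ - δ / 2) := by unfold driftW; fun_prop
  have e1 : ∀ᶠ z in 𝓝[<] z₂, driftZ ω z (w₂ - δ / 2) < 0 :=
    (c1.continuousAt.eventually (gt_mem_nhds hP)).filter_mono nhdsWithin_le_nhds
  have e2 : ∀ᶠ z in 𝓝[<] z₂, 0 < driftW ω z (w₂ - δ / 2) :=
    (c2.continuousAt.eventually (lt_mem_nhds hQ)).filter_mono nhdsWithin_le_nhds
  have e3 : Ioo (z₂ - δ) z₂ ∈ 𝓝[<] z₂ := Ioo_mem_nhdsLT (by linarith)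
  obtain ⟨z, hz1, hz2, hz3⟩ := (e1.and (e2.and e3)).exists
  exact ⟨z, _, hz3.2, hz3.1, by linarith, by linarith, hz1, hz2⟩

/-- The second factor takes the value of `slope_pos` at z = z₂, so on the line w = w₂ near the
saddle `driftZ` has the sign of z - z₂. -/
lemma driftZ_factor (z : ℝ) : driftZ ω z w₂ = (z - z₂) *
    (w₂ * (ω - 2 * (z ^ 3 + z ^ 2 * z₂ + z * z₂ ^ 2 + z₂ ^ 3)) - (z ^ 2 + z * z₂ + z₂ ^ 2)) := by
  have h1 := h.driftZ_eq
  unfold driftZ at h1 ⊢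
  linear_combination h1

lemma slope_eventually : ∀ᶠ z in 𝓝 z₂, 0 <
    w₂ * (ω - 2 * (z ^ 3 + z ^ 2 * z₂ + z * z₂ ^ 2 + z₂ ^ 3)) - (z ^ 2 + z * z₂ + z₂ ^ 2) := by
  have c : Continuous fun z => w₂ * (ω - 2 * (z ^ 3 + z ^ 2 * z₂ + z * z₂ ^ 2 + z₂ ^ 3))
      - (z ^ 2 + z * z₂ + z₂ ^ 2) := by fun_prop
  refine c.continuousAt.eventually (lt_mem_nhds ?_)
  have := h.slope_pos
  nlinarith

/-- Here z is moved first, along w = w₂, where both drifts take the sign of z - z₂; then w is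
shifted slightly. The corner IV is obtained in the same way on the other side. -/
lemma exists_corner_II {δ : ℝ} (hδ : 0 < δ) : ∃ z₁ w₁, z₂ < z₁ ∧ z₁ < z₂ + δ ∧ w₁ < w₂ ∧
    w₂ - δ < w₁ ∧ 0 < driftZ ω z₁ w₁ ∧ 0 < driftW ω z₁ w₁ := by
  have e3 : Ioo z₂ (z₂ + δ) ∈ 𝓝[>] z₂ := Ioo_mem_nhdsGT (by linarith)
  obtain ⟨z, hz1, hz3⟩ := ((h.slope_eventually.filter_mono nhdsWithin_le_nhds).and e3).exists
  have hP : 0 < driftZ ω z w₂ := by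
    rw [h.driftZ_factor]; exact mul_pos (by linarith [hz3.1]) hz1
  have hQ : 0 < driftW ω z w₂ := by
    have h1 := h.driftW_eq
    have h2 : z₂ ^ 3 < z ^ 3 := pow_lt_pow_left₀ hz3.1 h.z_pos.le (by norm_num)
    have h3 := h.ω_gt
    have h4 := h.z_pos
    have h5 : z₂ * (ω + z₂ ^ 3) < z * (ω + z ^ 3) :=
      mul_lt_mul'' hz3.1 (by linarith) h4.le (by positivity)
    unfold driftW at h1 ⊢; nlinarith
  have c1 : Continuous fun w => driftZ ω z w := by unfold driftZ; fun_prop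
  have c2 : Continuous fun w => driftW ω z w := by unfold driftW; fun_prop
  have e1 := (c1.continuousAt.eventually (lt_mem_nhds hP)).filter_mono
    (nhdsWithin_le_nhds (s := Iio w₂))
  have e2 := (c2.continuousAt.eventually (lt_mem_nhds hQ)).filter_mono
    (nhdsWithin_le_nhds (s := Iio w₂))
  have e4 : Ioo (w₂ - δ) w₂ ∈ 𝓝[<] w₂ := Ioo_mem_nhdsLT (by linarith)
  obtain ⟨w, hw1, hw2, hw3⟩ := (e1.and (e2.and e4)).exists
  exact ⟨z, w, hz3.1, hz3.2, hw3.2, hw3.1, hw1, hw2⟩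

lemma exists_corner_IV {δ : ℝ} (hδ : 0 < δ) : ∃ z₁ w₁, z₁ < z₂ ∧ z₂ - δ < z₁ ∧ w₂ < w₁ ∧
    w₁ < w₂ + δ ∧ w₁ < 1 ∧ driftZ ω z₁ w₁ < 0 ∧ driftW ω z₁ w₁ < 0 := by
  have e3 : Ioo (max (z₂ - δ) 0) z₂ ∈ 𝓝[<] z₂ := Ioo_mem_nhdsLT (by simp [hδ, h.z_pos])
  obtain ⟨z, hz1, hz3⟩ := ((h.slope_eventually.filter_mono nhdsWithin_le_nhds).and e3).exists
  have hz0 : 0 < z := (le_max_right _ _).trans_lt hz3.1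
  have hP : driftZ ω z w₂ < 0 := by
    rw [h.driftZ_factor]; exact mul_neg_of_neg_of_pos (by linarith [hz3.2]) hz1
  have hQ : driftW ω z w₂ < 0 := by
    have h1 := h.driftW_eq
    have h2 : z ^ 3 < z₂ ^ 3 := pow_lt_pow_left₀ hz3.2 hz0.le (by norm_num)
    have h3 := h.ω_gt
    have h5 : z * (ω + z ^ 3) < z₂ * (ω + z₂ ^ 3) :=
      mul_lt_mul'' hz3.2 (by linarith) hz0.le (by positivity)
    unfold driftW at h1 ⊢; nlinarith
  have c1 : Continuous fun w => driftZ ω z w := by unfold driftZ; fun_prop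
  have c2 : Continuous fun w => driftW ω z w := by unfold driftW; fun_prop
  have e1 := (c1.continuousAt.eventually (gt_mem_nhds hP)).filter_mono
    (nhdsWithin_le_nhds (s := Ioi w₂))
  have e2 := (c2.continuousAt.eventually (gt_mem_nhds hQ)).filter_mono
    (nhdsWithin_le_nhds (s := Ioi w₂))
  have e4 : Ioo w₂ (min (w₂ + δ) 1) ∈ 𝓝[>] w₂ := Ioo_mem_nhdsGT (by simp [hδ, h.w_lt])
  obtain ⟨w, hw1, hw2, hw3⟩ := (e1.and (e2.and e4)).exists
  exact ⟨z, w, hz3.2, (le_max_left _ _).trans_lt hz3.1, hw3.1, hw3.2.trans_le (min_le_left _ _),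
    hw3.2.trans_le (min_le_right _ _), hw1, hw2⟩

end IsSaddle

/-! ### Trajectories of perturbations of the limiting system -/

/-- The rates `a` of `z` and `(1 - w²) b` of `w` are those of the limiting system up to `η`. -/
def RatesClose (ω η z w a b : ℝ) : Prop :=
  |2 * z ^ 3 * w * a - driftZ ω z w| ≤ η ∧ |2 * z ^ 4 * w * b - driftW ω z w| ≤ η

lemma RatesClose.mono {ω η η' z w a b : ℝ} (h : RatesClose ω η z w a b) (hη : η ≤ η') :
    RatesClose ω η' z w a b := ⟨h.1.trans hη, h.2.trans hη⟩

/-- A trajectory on `[T, ∞)` in the box `1/2 ≤ z ≤ Z`, `0 < w < 1` of a perturbation of the limiting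
system, where time runs towards the singularity. -/
structure IsTrajectory (Z T : ℝ) (z w a b : ℝ → ℝ) : Prop where
  deriv_z : ∀ t ∈ Ici T, HasDerivWithinAt z (-a t) (Ici T) t
  deriv_w : ∀ t ∈ Ici T, HasDerivWithinAt w (-((1 - w t ^ 2) * b t)) (Ici T) t
  z_ge : ∀ t ∈ Ici T, 1 / 2 ≤ z t
  z_le : ∀ t ∈ Ici T, z t ≤ Z
  w_pos : ∀ t ∈ Ici T, 0 < w t
  w_lt : ∀ t ∈ Ici T, w t < 1

lemma driftZ_mono_w {ω z w w' : ℝ} (hz : 0 ≤ ω * z - 2 * z ^ 4) (hw : w ≤ w') :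
    driftZ ω z w ≤ driftZ ω z w' := by
  unfold driftZ; nlinarith [mul_le_mul_of_nonneg_right hw hz]

lemma driftW_anti_w {ω z w w' : ℝ} (hω : 0 ≤ ω) (hw : w ≤ w') :
    driftW ω z w' ≤ driftW ω z w := by
  unfold driftW; nlinarith

lemma driftW_mono_z {ω z z' w : ℝ} (hω : 0 ≤ ω) (hz0 : 0 ≤ z) (hz : z ≤ z') :
    driftW ω z w ≤ driftW ω z' w := by
  have h1 : z ^ 3 ≤ z' ^ 3 := pow_le_pow_left₀ hz0 hz 3
  have h2 : z * (ω + z ^ 3) ≤ z' * (ω + z' ^ 3) :=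
    mul_le_mul hz (by linarith) (by positivity) (by linarith)
  unfold driftW; nlinarith

/-! ### Signs and sizes of the rates, deduced from those of the drifts -/

section rates

variable {ω η Z z w a b d : ℝ}

lemma RatesClose.a_pos (h : RatesClose ω η z w a b) (hz : 0 < z) (hw : 0 < w)
    (hd : η < driftZ ω z w) : 0 < a := by
  have h1 := (abs_le.1 h.1).1
  have : 0 < 2 * z ^ 3 * w * a := by linarith
  exact pos_of_mul_pos_right this (by positivity)

lemma RatesClose.a_neg (h : RatesClose ω η z w a b) (hz : 0 < z) (hw : 0 < w)
    (hd : driftZ ω z w < -η) : a < 0 := by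
  have h1 := (abs_le.1 h.1).2
  by_contra hc
  have : 0 ≤ 2 * z ^ 3 * w * a := mul_nonneg (by positivity) (not_lt.1 hc)
  linarith

lemma RatesClose.b_pos (h : RatesClose ω η z w a b) (hz : 0 < z) (hw : 0 < w)
    (hd : η < driftW ω z w) : 0 < b := by
  have h1 := (abs_le.1 h.2).1
  have : 0 < 2 * z ^ 4 * w * b := by linarith
  exact pos_of_mul_pos_right this (by positivity)

lemma RatesClose.b_neg (h : RatesClose ω η z w a b) (hz : 0 < z) (hw : 0 < w)
    (hd : driftW ω z w < -η) : b < 0 := by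
  have h1 := (abs_le.1 h.2).2
  by_contra hc
  have : 0 ≤ 2 * z ^ 4 * w * b := mul_nonneg (by positivity) (not_lt.1 hc)
  linarith

/-- The prefactor 2 z^k w is at most 2 Z^k in the box. This converts a positive lower bound on a
drift into a definite rate, uniform in time. -/
lemma rate_ge_aux {m x d : ℝ} {k : ℕ} (hz : 0 < z) (hzZ : z ≤ Z) (hw : 0 < w) (hw1 : w ≤ 1)
    (hx : d ≤ m) (hd : 0 < d) (hm : m = 2 * z ^ k * w * x) : d / (2 * Z ^ k) ≤ x := by
  have hZ : 0 < Z := hz.trans_le hzZ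
  have hx0 : 0 < x := by
    have : 0 < 2 * z ^ k * w * x := by linarith
    exact pos_of_mul_pos_right this (by positivity)
  rw [div_le_iff₀ (by positivity)]
  have h1 : z ^ k ≤ Z ^ k := pow_le_pow_left₀ hz.le hzZ k
  have h2 : z ^ k * w ≤ Z ^ k := by
    calc z ^ k * w ≤ z ^ k * 1 := by gcongr
      _ ≤ Z ^ k := by linarith
  nlinarith [mul_le_mul_of_nonneg_right h2 hx0.le]

lemma RatesClose.le_a (h : RatesClose ω η z w a b) (hz : 0 < z) (hzZ : z ≤ Z) (hw : 0 < w)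
    (hw1 : w ≤ 1) (hd : 0 < d) (hη : d + η ≤ driftZ ω z w) : d / (2 * Z ^ 3) ≤ a :=
  rate_ge_aux hz hzZ hw hw1 (by have := (abs_le.1 h.1).1; linarith) hd rfl

lemma RatesClose.a_le (h : RatesClose ω η z w a b) (hz : 0 < z) (hzZ : z ≤ Z) (hw : 0 < w)
    (hw1 : w ≤ 1) (hd : 0 < d) (hη : driftZ ω z w ≤ -(d + η)) : a ≤ -(d / (2 * Z ^ 3)) := by
  have : d / (2 * Z ^ 3) ≤ -a := rate_ge_aux (m := -(2 * z ^ 3 * w * a)) hz hzZ hw hw1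
    (by have := (abs_le.1 h.1).2; linarith) hd (by ring)
  linarith

lemma RatesClose.le_b (h : RatesClose ω η z w a b) (hz : 0 < z) (hzZ : z ≤ Z) (hw : 0 < w)
    (hw1 : w ≤ 1) (hd : 0 < d) (hη : d + η ≤ driftW ω z w) : d / (2 * Z ^ 4) ≤ b :=
  rate_ge_aux hz hzZ hw hw1 (by have := (abs_le.1 h.2).1; linarith) hd rfl

lemma RatesClose.b_le (h : RatesClose ω η z w a b) (hz : 0 < z) (hzZ : z ≤ Z) (hw : 0 < w)
    (hw1 : w ≤ 1) (hd : 0 < d) (hη : driftW ω z w ≤ -(d + η)) : b ≤ -(d / (2 * Z ^ 4)) := by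
  have : d / (2 * Z ^ 4) ≤ -b := rate_ge_aux (m := -(2 * z ^ 4 * w * b)) hz hzZ hw hw1
    (by have := (abs_le.1 h.2).2; linarith) hd (by ring)
  linarith

end rates

namespace IsTrajectory

variable {ω Z T : ℝ} {z w a b : ℝ → ℝ}

lemma mono (h : IsTrajectory Z T z w a b) {T' : ℝ} (hT : T ≤ T') : IsTrajectory Z T' z w a b := by
  have hs : Ici T' ⊆ Ici T := Ici_subset_Ici.2 hT
  exact ⟨fun t ht => (h.deriv_z t (hs ht)).mono hs, fun t ht => (h.deriv_w t (hs ht)).mono hs,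
    fun t ht => h.z_ge t (hs ht), fun t ht => h.z_le t (hs ht), fun t ht => h.w_pos t (hs ht),
    fun t ht => h.w_lt t (hs ht)⟩

lemma z_pos (h : IsTrajectory Z T z w a b) {t : ℝ} (ht : t ∈ Ici T) : 0 < z t := by
  linarith [h.z_ge t ht]

lemma one_sub_sq_pos (h : IsTrajectory Z T z w a b) {t : ℝ} (ht : t ∈ Ici T) :
    0 < 1 - w t ^ 2 := by
  nlinarith [h.w_pos t ht, h.w_lt t ht]

lemma deriv_z_Icc (h : IsTrajectory Z T z w a b) {c d : ℝ} (hc : T ≤ c) :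
    ∀ t ∈ Icc c d, HasDerivWithinAt z (-a t) (Icc c d) t := fun t ht =>
  (h.deriv_z t (hc.trans ht.1)).mono fun _ hs => hc.trans hs.1

lemma deriv_w_Icc (h : IsTrajectory Z T z w a b) {c d : ℝ} (hc : T ≤ c) :
    ∀ t ∈ Icc c d, HasDerivWithinAt w (-((1 - w t ^ 2) * b t)) (Icc c d) t := fun t ht =>
  (h.deriv_w t (hc.trans ht.1)).mono fun _ hs => hc.trans hs.1

end IsTrajectory

/-! ### Invariant quadrants and the dichotomy for trajectories -/

variable {ω Z : ℝ}

/-- A quadrant `{z ≤ z₁, w₁ ≤ w}` whose corner lies where `z` increases and `w` decreases away from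
the singularity traps all trajectories. -/
lemma trap_corner_I (hω : 0 < ω) (hZ : 0 < Z) {z₁ w₁ : ℝ} (hw₁ : 0 < w₁)
    (hP : 0 < driftZ ω z₁ w₁) (hQ : driftW ω z₁ w₁ < 0) :
    ∃ η > 0, ∃ c > 0, ∀ (T : ℝ) (z w a b : ℝ → ℝ), IsTrajectory Z T z w a b →
      (∀ t ∈ Ici T, RatesClose ω η (z t) (w t) (a t) (b t)) → z T ≤ z₁ → w₁ ≤ w T →
      ∀ t ∈ Ici T, z t ≤ z₁ ∧ w₁ ≤ w t ∧ b t ≤ -c := by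
  set p := driftZ ω z₁ w₁ with hp
  set q := -driftW ω z₁ w₁ with hq
  have hq0 : 0 < q := by linarith
  have hη : 0 < min p q / 2 := by positivity
  refine ⟨min p q / 2, hη, q / 2 / (2 * Z ^ 4), by positivity, fun T z w a b h hc hz hw => ?_⟩
  have hηp : min p q / 2 < p := by linarith [min_le_left p q, lt_min hP hq0]
  have hηq : min p q / 2 ≤ q / 2 := by linarith [min_le_right p q]
  have hin : ∀ t ∈ Ici T, z t ≤ z₁ ∧ w₁ ≤ w t := by
    intro t ht
    have hz₁ : 1 / 2 ≤ z₁ := (h.z_ge T self_mem_Ici).trans hz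
    -- Positivity of `driftZ` at the corner forces a positive coefficient of w, so `driftZ` stays
    -- positive along the whole edge z = z₁, w ≥ w₁.
    have hcoef : 0 ≤ ω * z₁ - 2 * z₁ ^ 4 := by
      have : 0 < w₁ * (ω * z₁ - 2 * z₁ ^ 4) := by
        have : 0 < z₁ ^ 3 := by positivity
        rw [hp] at hP; unfold driftZ at hP; linarith
      exact (pos_of_mul_pos_right this hw₁.le).le
    have := quadrant_invariant (f := fun s => z₁ - z s) (g := fun s => w s - w₁)
      (a := T) (b := t)
      (fun s hs => (h.deriv_z_Icc le_rfl s hs).const_sub z₁)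
      (fun s hs => (h.deriv_w_Icc le_rfl s hs).sub_const w₁)
      (by linarith) (by linarith)
      (fun s hs h1 h2 => by
        have hzs : z s = z₁ := by linarith
        have := (hc s hs.1).a_pos (h.z_pos hs.1) (h.w_pos s hs.1) (by
          rw [hzs]; exact hηp.trans_le (driftZ_mono_w hcoef (by linarith)))
        linarith)
      (fun s hs h1 h2 => by
        have hws : w s = w₁ := by linarith
        have := (hc s hs.1).b_neg (h.z_pos hs.1) (h.w_pos s hs.1) (by
          have := driftW_mono_z (w := w₁) hω.le (h.z_pos hs.1).le (show z s ≤ z₁ by linarith)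
          rw [hws]; linarith)
        have h3 := h.one_sub_sq_pos hs.1
        nlinarith) t ⟨ht, le_rfl⟩
    exact ⟨by linarith [this.1], by linarith [this.2]⟩
  intro t ht
  obtain ⟨h1, h2⟩ := hin t ht
  refine ⟨h1, h2, (hc t ht).b_le (h.z_pos ht) (h.z_le t ht) (h.w_pos t ht) (h.w_lt t ht).le
    (by positivity) ?_⟩
  have h3 := driftW_mono_z (w := w t) hω.le (h.z_pos ht).le h1
  have h4 := driftW_anti_w (z := z₁) hω.le h2
  linarith

/-- In a quadrant `{z₁ ≤ z, w ≤ w₁}` whose corner lies where `z` decreases and `w` increases away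
from the singularity, `w` reaches zero before the singularity is reached. -/
lemma not_corner_III (hω : 0 < ω) (hZ : 0 < Z) {z₁ w₁ : ℝ} (hz₁ : 0 < z₁) (hw₁ : 0 < w₁)
    (hw₁1 : w₁ < 1) (hcoef : 0 ≤ ω * z₁ - 2 * z₁ ^ 4)
    (hP : driftZ ω z₁ w₁ < 0) (hQ : 0 < driftW ω z₁ w₁) :
    ∃ η > 0, ∀ (T : ℝ) (z w a b : ℝ → ℝ), IsTrajectory Z T z w a b →
      (∀ t ∈ Ici T, RatesClose ω η (z t) (w t) (a t) (b t)) → ¬ (z₁ ≤ z T ∧ w T ≤ w₁) := by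
  set p := -driftZ ω z₁ w₁ with hp
  set q := driftW ω z₁ w₁ with hq
  have hp0 : 0 < p := by linarith
  refine ⟨min p q / 2, by positivity, fun T z w a b h hc ⟨hz, hw⟩ => ?_⟩
  have hηp : min p q / 2 < p := by linarith [min_le_left p q, lt_min hp0 hQ]
  have hηq : min p q / 2 ≤ q / 2 := by linarith [min_le_right p q]
  have hin : ∀ t ∈ Ici T, z₁ ≤ z t ∧ w t ≤ w₁ := by
    intro t ht
    have := quadrant_invariant (f := fun s => z s - z₁) (g := fun s => w₁ - w s)
      (a := T) (b := t)
      (fun s hs => (h.deriv_z_Icc le_rfl s hs).sub_const z₁)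
      (fun s hs => (h.deriv_w_Icc le_rfl s hs).const_sub w₁)
      (by linarith) (by linarith)
      (fun s hs h1 h2 => by
        have hzs : z s = z₁ := by linarith
        have := (hc s hs.1).a_neg (h.z_pos hs.1) (h.w_pos s hs.1) (by
          have := driftZ_mono_w hcoef (show w s ≤ w₁ by linarith)
          rw [hzs]; linarith)
        linarith)
      (fun s hs h1 h2 => by
        have hws : w s = w₁ := by linarith
        have := (hc s hs.1).b_pos (h.z_pos hs.1) (h.w_pos s hs.1) (by
          have := driftW_mono_z (w := w₁) hω.le hz₁.le (show z₁ ≤ z s by linarith)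
          rw [hws]; linarith)
        have h3 := h.one_sub_sq_pos hs.1
        have := mul_pos h3 this
        linarith) t ⟨ht, le_rfl⟩
    exact ⟨by linarith [this.1], by linarith [this.2]⟩
  -- In the quadrant w ≤ w₁ < 1 keeps the factor 1 - w² away from zero, so w would fall for ever at
  -- a definite rate, against w > 0.
  refine not_decreasing_of_bddBelow (f := w) (c := (1 - w₁ ^ 2) * (q / 2 / (2 * Z ^ 4))) (m := 0)
    (mul_pos (by nlinarith) (by positivity)) h.deriv_w (fun t ht => ?_)
    (fun t ht => (h.w_pos t ht).le)
  obtain ⟨h1, h2⟩ := hin t ht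
  have hb := (hc t ht).le_b (d := q / 2) (h.z_pos ht) (h.z_le t ht) (h.w_pos t ht)
    (h.w_lt t ht).le (by positivity) (by
      have h3 := driftW_mono_z (w := w t) hω.le hz₁.le h1
      have h4 := driftW_anti_w (z := z₁) hω.le h2
      linarith)
  have h5 : 1 - w₁ ^ 2 ≤ 1 - w t ^ 2 := by nlinarith [h.w_pos t ht]
  have h6 : 0 < q / 2 / (2 * Z ^ 4) := by positivity
  have := mul_le_mul h5 hb h6.le (h.one_sub_sq_pos ht).le
  linarith

/-- `w` stays away from zero. -/
lemma w_gt_sixth (hω : 0 < ω) (hZ : 0 < Z) : ∀ (T : ℝ) (z w a b : ℝ → ℝ),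
    IsTrajectory Z T z w a b →
    (∀ t ∈ Ici T, RatesClose ω (ω / 4) (z t) (w t) (a t) (b t)) → 1 / 6 < w T := by
  intro T z w a b h hc
  by_contra hw
  -- For z ≥ 1/2 and w ≤ 1/6 one has `driftW` ≥ ω - ω/2. The admitted error ω/4 leaves ω/4.
  refine trapped_decreasing_false (f := w) (a := 1 / 6) (m := 0)
    (c := (1 / 2) * (ω / 4 / (2 * Z ^ 4))) (by positivity) h.deriv_w (not_lt.1 hw)
    (fun t ht hwt => ?_) (fun t ht => (h.w_pos t ht).le)
  have hb := (hc t ht).le_b (d := ω / 4) (h.z_pos ht) (h.z_le t ht) (h.w_pos t ht)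
    (h.w_lt t ht).le (by positivity) (by
      have := h.z_ge t ht
      have : 0 ≤ z t * z t ^ 3 := by have := h.z_pos ht; positivity
      unfold driftW; nlinarith)
  have h5 : 1 / 2 ≤ 1 - w t ^ 2 := by nlinarith [h.w_pos t ht]
  have := mul_le_mul h5 hb (by positivity) (by linarith)
  linarith

/-- The trajectory becomes close to one of the limiting system. -/
def IsAsymptotic (ω : ℝ) (z w a b : ℝ → ℝ) : Prop :=
  ∀ η > 0, ∀ᶠ t in atTop, RatesClose ω η (z t) (w t) (a t) (b t)

lemma IsAsymptotic.exists_ge {z w a b : ℝ → ℝ} (h : IsAsymptotic ω z w a b) {η : ℝ} (hη : 0 < η)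
    (T : ℝ) : ∃ T' ≥ T, ∀ t ∈ Ici T', RatesClose ω η (z t) (w t) (a t) (b t) := by
  obtain ⟨T', hT'⟩ := eventually_atTop.1 (h η hη)
  exact ⟨max T T', le_max_left _ _, fun t ht => hT' t ((le_max_right _ _).trans ht)⟩

/-- The quadrant is invariant backward in time, so frequent visits mean that the trajectory stays in
it from some time on. Let ζ ≥ z₁ > z₂ be the lower limit of z. If `driftW` is positive at (ζ, 1),
then w falls at a definite rate, against w > 0. Otherwise ζ ≤ 3/2 and the nullcline of `driftW` has
a point (ζ, v) with v ≤ 1, where `driftZ` > 0. For v' slightly below v, w must eventually exceed v',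
since below v' it would fall to zero. Then `driftZ` is bounded below by a positive number whenever z
is near ζ, and z would fall without end. -/
lemma not_corner_II {z₂ w₂ : ℝ} (hs : IsSaddle ω z₂ w₂) (hZ : 0 < Z) {T : ℝ} {z w a b : ℝ → ℝ}
    (h : IsTrajectory Z T z w a b) (hc : IsAsymptotic ω z w a b) {z₁ w₁ : ℝ}
    (hz₁ : z₂ < z₁) (hw₁ : 0 < w₁) (hP : 0 < driftZ ω z₁ w₁) (hQ : 0 < driftW ω z₁ w₁) :
    ∀ᶠ t in atTop, ¬ (z₁ ≤ z t ∧ w₁ ≤ w t) := by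
  have hω : 0 < ω := by linarith [hs.ω_gt]
  have hz₁0 : 0 < z₁ := hs.z_pos.trans hz₁
  by_contra hcon
  have hfreq : ∃ᶠ t in atTop, z₁ ≤ z t ∧ w₁ ≤ w t := by
    simpa [Filter.Frequently] using hcon
  obtain ⟨T₁, hT₁, hcl⟩ := hc.exists_ge (η := min (driftZ ω z₁ w₁) (driftW ω z₁ w₁) / 2)
    (by positivity) T
  set η := min (driftZ ω z₁ w₁) (driftW ω z₁ w₁) / 2 with hη
  have hηp : η < driftZ ω z₁ w₁ := by
    have := min_le_left (driftZ ω z₁ w₁) (driftW ω z₁ w₁); have := lt_min hP hQ; linarith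
  have hηq : η < driftW ω z₁ w₁ := by
    have := min_le_right (driftZ ω z₁ w₁) (driftW ω z₁ w₁); have := lt_min hP hQ; linarith
  have h1 := h.mono hT₁
  have hcoef : 0 ≤ ω * z₁ - 2 * z₁ ^ 4 := by
    have : 0 < w₁ * (ω * z₁ - 2 * z₁ ^ 4) := by
      have : 0 < z₁ ^ 3 := by positivity
      unfold driftZ at hP; linarith
    exact (pos_of_mul_pos_right this hw₁.le).le
  have hin : ∀ t ∈ Ici T₁, z₁ ≤ z t ∧ w₁ ≤ w t := by
    intro t ht
    obtain ⟨t₁, ht₁, hq⟩ := (frequently_atTop.1 hfreq) t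
    have := quadrant_invariant_backward (f := fun s => z s - z₁) (g := fun s => w s - w₁)
      (a := T₁) (b := t₁)
      (fun s hs => (h1.deriv_z_Icc le_rfl s hs).sub_const z₁)
      (fun s hs => (h1.deriv_w_Icc le_rfl s hs).sub_const w₁)
      (by linarith [hq.1]) (by linarith [hq.2])
      (fun s hs e1 e2 => by
        have hzs : z s = z₁ := by linarith
        have := (hcl s hs.1).a_pos (h1.z_pos hs.1) (h1.w_pos s hs.1) (by
          rw [hzs]; exact hηp.trans_le (driftZ_mono_w hcoef (by linarith)))
        linarith)
      (fun s hs e1 e2 => by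
        have hws : w s = w₁ := by linarith
        have := (hcl s hs.1).b_pos (h1.z_pos hs.1) (h1.w_pos s hs.1) (by
          have := driftW_mono_z (w := w₁) hω.le hz₁0.le (show z₁ ≤ z s by linarith)
          rw [hws]; linarith)
        have := mul_pos (h1.one_sub_sq_pos hs.1) this
        linarith) t ⟨ht, ht₁⟩
    exact ⟨by linarith [this.1], by linarith [this.2]⟩
  -- the lower limit of `z`
  have hbdd : IsBoundedUnder (· ≥ ·) atTop z :=
    isBoundedUnder_of_eventually_ge (eventually_atTop.2 ⟨T₁, fun t ht => (hin t ht).1⟩)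
  have hcob : IsCoboundedUnder (· ≥ ·) atTop z :=
    (isBoundedUnder_of_eventually_le
      (eventually_atTop.2 ⟨T₁, fun t ht => h1.z_le t ht⟩)).isCoboundedUnder_ge
  set ζ := liminf z atTop with hζ
  have hζ1 : z₁ ≤ ζ := le_liminf_of_le hcob (eventually_atTop.2 ⟨T₁, fun t ht => (hin t ht).1⟩)
  have hev : ∀ δ > 0, ∀ᶠ t in atTop, ζ - δ < z t := fun δ hδ =>
    eventually_lt_of_lt_liminf (by rw [← hζ]; linarith) hbdd
  have hfr : ∀ δ > 0, ∃ᶠ t in atTop, z t < ζ + δ := fun δ hδ =>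
    frequently_lt_of_liminf_lt hcob (by rw [← hζ]; linarith)
  have hζ0 : 0 < ζ := hz₁0.trans_le hζ1
  rcases lt_or_ge 0 (driftW ω ζ 1) with hcase | hcase
  · -- `w` cannot stay below `1`
    have c2 : Continuous fun z => driftW ω z 1 := by unfold driftW; fun_prop
    obtain ⟨δ, hδ, hδ'⟩ := Metric.eventually_nhds_iff.1
      (c2.continuousAt.eventually (lt_mem_nhds hcase))
    set d := min (δ / 2) (ζ / 2) with hd
    have hd0 : 0 < d := by positivity
    have hq0 : 0 < driftW ω (ζ - d) 1 := hδ' (by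
      rw [Real.dist_eq, sub_sub_cancel_left, abs_neg, abs_of_pos hd0]
      linarith [min_le_left (δ / 2) (ζ / 2)])
    have hζd : 0 < ζ - d := by linarith [min_le_right (δ / 2) (ζ / 2)]
    obtain ⟨T₂, hT₂⟩ := eventually_atTop.1 (hev d hd0)
    obtain ⟨T₃, hT₃, hcl₃⟩ := hc.exists_ge (η := driftW ω (ζ - d) 1 / 2) (by positivity) (max T₁ T₂)
    have h3 := h1.mono ((le_max_left _ _).trans hT₃)
    have hbt : ∀ t ∈ Ici T₃, driftW ω (ζ - d) 1 / 2 / (2 * Z ^ 4) ≤ b t := fun t ht =>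
      (hcl₃ t ht).le_b (h3.z_pos ht) (h3.z_le t ht) (h3.w_pos t ht) (h3.w_lt t ht).le
        (by positivity) (by
          have e1 := driftW_mono_z (w := w t) hω.le hζd.le
            (hT₂ t ((le_max_right _ _).trans (hT₃.le.trans ht))).le
          have e2 := driftW_anti_w (z := ζ - d) hω.le (h3.w_lt t ht).le
          linarith)
    have hβ : 0 < driftW ω (ζ - d) 1 / 2 / (2 * Z ^ 4) := by positivity
    refine trapped_decreasing_false (f := w) (a := w T₃) (m := 0)
      (c := (1 - w T₃ ^ 2) * (driftW ω (ζ - d) 1 / 2 / (2 * Z ^ 4)))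
      (mul_pos (h3.one_sub_sq_pos self_mem_Ici) hβ) h3.deriv_w le_rfl
      (fun t ht hwt => ?_) (fun t ht => (h3.w_pos t ht).le)
    have h5 : 1 - w T₃ ^ 2 ≤ 1 - w t ^ 2 := by nlinarith [h3.w_pos t ht]
    have := mul_le_mul h5 (hbt t ht) hβ.le (h3.one_sub_sq_pos ht).le
    linarith
  · -- `w` has to be above the nullcline, so that `z` cannot stay near its lower limit
    have hζ32 : ζ ≤ 3 / 2 := by
      by_contra hgt
      have : 0 < ζ * ζ ^ 3 := by positivity
      unfold driftW at hcase; nlinarith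
    have hK : 0 < rootPoly ω ζ := by
      rw [← hs.root]; exact hs.rootPoly_strictMono hs.z_pos.le (hz₁.trans_le hζ1) hζ32
    set v := 2 * ζ * (ω + ζ ^ 3) / (3 * ω) with hv
    have hv0 : 0 < v := by positivity
    have hv1 : v ≤ 1 := by
      rw [hv, div_le_one (by positivity)]; unfold driftW at hcase; linarith
    have hPv : 0 < driftZ ω ζ v := by
      rw [hv, hs.driftZ_nullcline]; exact mul_pos (by positivity) hK
    have c1 : Continuous fun v => driftZ ω ζ v := by unfold driftZ; fun_prop
    obtain ⟨v', hv'P, hv'⟩ := (((c1.continuousAt.eventually (lt_mem_nhds hPv)).filter_mono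
      (nhdsWithin_le_nhds (s := Iio v))).and (Ioo_mem_nhdsLT hv0)).exists
    have hQv : 0 < driftW ω ζ v' := by
      have : driftW ω ζ v = 0 := by unfold driftW; rw [hv]; field_simp; ring
      have h2 := hv'.2
      unfold driftW at this ⊢; nlinarith
    have c3 : Continuous fun z => driftZ ω z v' := by unfold driftZ; fun_prop
    have c4 : Continuous fun z => driftW ω z v' := by unfold driftW; fun_prop
    have c5 : Continuous fun z : ℝ => ω * z - 2 * z ^ 4 := by fun_prop
    have hco : 0 < ω * ζ - 2 * ζ ^ 4 := by
      have : 0 < v' * (ω * ζ - 2 * ζ ^ 4) := by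
        have : 0 < ζ ^ 3 := by positivity
        unfold driftZ at hv'P; linarith
      exact pos_of_mul_pos_right this hv'.1.le
    obtain ⟨δ, hδ, hδ'⟩ := Metric.eventually_nhds_iff.1
      ((c3.continuousAt.eventually (lt_mem_nhds (half_lt_self hv'P))).and
        ((c4.continuousAt.eventually (lt_mem_nhds (half_lt_self hQv))).and
          (c5.continuousAt.eventually (lt_mem_nhds hco))))
    set d := min (δ / 2) (ζ / 2) with hd
    have hd0 : 0 < d := by positivity
    have hdδ : d < δ := by linarith [min_le_left (δ / 2) (ζ / 2)]
    have hζd : 0 < ζ - d := by linarith [min_le_right (δ / 2) (ζ / 2)]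
    obtain ⟨T₂, hT₂⟩ := eventually_atTop.1 (hev d hd0)
    set η' := min (driftZ ω ζ v') (driftW ω ζ v') / 4 with hη'
    have hη'0 : 0 < η' := by positivity
    have hη'1 : η' ≤ driftZ ω ζ v' / 4 := by
      have := min_le_left (driftZ ω ζ v') (driftW ω ζ v'); linarith
    have hη'2 : η' ≤ driftW ω ζ v' / 4 := by
      have := min_le_right (driftZ ω ζ v') (driftW ω ζ v'); linarith
    obtain ⟨T₃, hT₃, hcl₃⟩ := hc.exists_ge hη'0 (max T₁ T₂)
    have hq1 : driftW ω ζ v' / 2 < driftW ω (ζ - d) v' := (hδ' (by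
      rw [Real.dist_eq, sub_sub_cancel_left, abs_neg, abs_of_pos hd0]; exact hdδ)).2.1
    have hwv : ∀ t ∈ Ici T₃, v' < w t := by
      intro t ht
      by_contra hwt
      have h3 := h1.mono ((le_max_left _ _).trans (hT₃.le.trans ht))
      have hv'1 : v' < 1 := hv'.2.trans_le hv1
      refine trapped_decreasing_false (f := w) (a := v') (m := 0) (T := t)
        (c := (1 - v' ^ 2) * (driftW ω ζ v' / 4 / (2 * Z ^ 4)))
        (mul_pos (by nlinarith [hv'.1]) (by positivity)) h3.deriv_w (not_lt.1 hwt)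
        (fun s hs hws => ?_) (fun s hs => (h3.w_pos s hs).le)
      have hb := (hcl₃ s (mem_Ici.2 (le_trans (mem_Ici.1 ht) (mem_Ici.1 hs)))).le_b (d := driftW ω ζ v' / 4) (h3.z_pos hs) (h3.z_le s hs)
        (h3.w_pos s hs) (h3.w_lt s hs).le (by positivity) (by
          have e1 := driftW_mono_z (w := w s) hω.le hζd.le
            (hT₂ s ((le_max_right _ _).trans (hT₃.le.trans (ht.trans hs)))).le
          have e2 := driftW_anti_w (z := ζ - d) hω.le hws
          linarith)
      have h5 : 1 - v' ^ 2 ≤ 1 - w s ^ 2 := by nlinarith [h3.w_pos s hs, hv'.1]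
      have := mul_le_mul h5 hb (by positivity) (h3.one_sub_sq_pos hs).le
      linarith
    obtain ⟨T₄, hT₄, hz₄⟩ := (frequently_atTop.1 (hfr d hd0)) T₃
    have h4 := h1.mono ((le_max_left _ _).trans (hT₃.le.trans hT₄))
    refine trapped_decreasing_false (f := z) (a := ζ + d) (m := 0) (T := T₄)
      (c := driftZ ω ζ v' / 4 / (2 * Z ^ 3)) (by positivity) h4.deriv_z hz₄.le
      (fun s hs hzs => ?_) (fun s hs => (h4.z_pos hs).le)
    have hn := hδ' (show dist (z s) ζ < δ by
      have := hT₂ s ((le_max_right _ _).trans (hT₃.le.trans (hT₄.trans hs)))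
      rw [Real.dist_eq, abs_lt]; constructor <;> linarith)
    have ha := (hcl₃ s (le_trans hT₄ hs)).le_a (d := driftZ ω ζ v' / 4) (h4.z_pos hs) (h4.z_le s hs)
      (h4.w_pos s hs) (h4.w_lt s hs).le (by positivity) (by
        have := driftZ_mono_w hn.2.2.le (hwv s (le_trans hT₄ hs)).le
        linarith [hn.1])
    linarith

/-- The mirror image of `not_corner_II`, with the upper limit ζ < z₂ of z and a value v' slightly
above the nullcline: w must eventually be below v', as it would otherwise grow past w₁, and then z
would grow past Z. No case distinction is needed, because w ≤ w₁ < 1 bounds 1 - w² from below. -/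
lemma not_corner_IV {z₂ w₂ : ℝ} (hs : IsSaddle ω z₂ w₂) (hZ : 0 < Z) {T : ℝ} {z w a b : ℝ → ℝ}
    (h : IsTrajectory Z T z w a b) (hc : IsAsymptotic ω z w a b) {z₁ w₁ : ℝ}
    (hz₁ : z₁ < z₂) (hw₁ : w₁ < 1) (hP : driftZ ω z₁ w₁ < 0) (hQ : driftW ω z₁ w₁ < 0) :
    ∀ᶠ t in atTop, ¬ (z t ≤ z₁ ∧ w t ≤ w₁) := by
  have hω : 0 < ω := by linarith [hs.ω_gt]
  by_contra hcon
  have hfreq : ∃ᶠ t in atTop, z t ≤ z₁ ∧ w t ≤ w₁ := by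
    simpa [Filter.Frequently] using hcon
  have hz₁0 : 0 < z₁ := by
    obtain ⟨t, ht, hq⟩ := (frequently_atTop.1 hfreq) T
    exact (h.z_pos ht).trans_le hq.1
  have hcoefz : ∀ y, 0 < y → y < z₂ → 0 < ω * y - 2 * y ^ 4 := by
    intro y hy hyz
    have h1 : y ^ 3 < z₂ ^ 3 := pow_lt_pow_left₀ hyz hy.le (by norm_num)
    have h2 := hs.cube_lt
    have : 0 < y * (ω - 2 * y ^ 3) := mul_pos hy (by linarith)
    nlinarith
  obtain ⟨T₁, hT₁, hcl⟩ := hc.exists_ge (η := min (-driftZ ω z₁ w₁) (-driftW ω z₁ w₁) / 2)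
    (by have : 0 < min (-driftZ ω z₁ w₁) (-driftW ω z₁ w₁) := lt_min (by linarith) (by linarith)
        positivity) T
  set η := min (-driftZ ω z₁ w₁) (-driftW ω z₁ w₁) / 2 with hη
  have hpos : 0 < min (-driftZ ω z₁ w₁) (-driftW ω z₁ w₁) := lt_min (by linarith) (by linarith)
  have hηp : η < -driftZ ω z₁ w₁ := by
    have := min_le_left (-driftZ ω z₁ w₁) (-driftW ω z₁ w₁); linarith
  have hηq : η < -driftW ω z₁ w₁ := by
    have := min_le_right (-driftZ ω z₁ w₁) (-driftW ω z₁ w₁); linarith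
  have h1 := h.mono hT₁
  have hin : ∀ t ∈ Ici T₁, z t ≤ z₁ ∧ w t ≤ w₁ := by
    intro t ht
    obtain ⟨t₁, ht₁, hq⟩ := (frequently_atTop.1 hfreq) t
    have := quadrant_invariant_backward (f := fun s => z₁ - z s) (g := fun s => w₁ - w s)
      (a := T₁) (b := t₁)
      (fun s hs => (h1.deriv_z_Icc le_rfl s hs).const_sub z₁)
      (fun s hs => (h1.deriv_w_Icc le_rfl s hs).const_sub w₁)
      (by linarith [hq.1]) (by linarith [hq.2])
      (fun s hs e1 e2 => by
        have hzs : z s = z₁ := by linarith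
        have := (hcl s hs.1).a_neg (h1.z_pos hs.1) (h1.w_pos s hs.1) (by
          have := driftZ_mono_w (hcoefz z₁ hz₁0 hz₁).le (show w s ≤ w₁ by linarith)
          rw [hzs]; linarith)
        linarith)
      (fun s hs e1 e2 => by
        have hws : w s = w₁ := by linarith
        have := (hcl s hs.1).b_neg (h1.z_pos hs.1) (h1.w_pos s hs.1) (by
          have := driftW_mono_z (w := w₁) hω.le (h1.z_pos hs.1).le (show z s ≤ z₁ by linarith)
          rw [hws]; linarith)
        have := mul_neg_of_pos_of_neg (h1.one_sub_sq_pos hs.1) this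
        linarith) t ⟨ht, ht₁⟩
    exact ⟨by linarith [this.1], by linarith [this.2]⟩
  have hbdd : IsBoundedUnder (· ≤ ·) atTop z :=
    isBoundedUnder_of_eventually_le (eventually_atTop.2 ⟨T₁, fun t ht => (hin t ht).1⟩)
  have hcob : IsCoboundedUnder (· ≤ ·) atTop z :=
    (isBoundedUnder_of_eventually_ge
      (eventually_atTop.2 ⟨T₁, fun t ht => h1.z_ge t ht⟩)).isCoboundedUnder_le
  set ζ := limsup z atTop with hζ
  have hζ1 : ζ ≤ z₁ := limsup_le_of_le hcob (eventually_atTop.2 ⟨T₁, fun t ht => (hin t ht).1⟩)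
  have hζ0 : 0 < ζ := by
    have : 1 / 2 ≤ ζ := le_limsup_of_le hbdd fun y hy => by
      obtain ⟨t, ht⟩ := (hy.and (eventually_ge_atTop T₁)).exists
      exact (h1.z_ge t ht.2).trans ht.1
    linarith
  have hev : ∀ δ > 0, ∀ᶠ t in atTop, z t < ζ + δ := fun δ hδ =>
    eventually_lt_of_limsup_lt (by rw [← hζ]; linarith) hbdd
  have hfr : ∀ δ > 0, ∃ᶠ t in atTop, ζ - δ < z t := fun δ hδ =>
    frequently_lt_of_lt_limsup hcob (by rw [← hζ]; linarith)
  have hζ2 : ζ < z₂ := hζ1.trans_lt hz₁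
  have hK : rootPoly ω ζ < 0 := by
    rw [← hs.root]; exact hs.rootPoly_strictMono hζ0.le hζ2 (by linarith [hs.z_lt'])
  set v := 2 * ζ * (ω + ζ ^ 3) / (3 * ω) with hv
  have hQv0 : driftW ω ζ v = 0 := by unfold driftW; rw [hv]; field_simp; ring
  have hPv : driftZ ω ζ v < 0 := by
    rw [hv, hs.driftZ_nullcline]; exact mul_neg_of_pos_of_neg (by positivity) hK
  have c1 : Continuous fun v => driftZ ω ζ v := by unfold driftZ; fun_prop
  obtain ⟨v', hv'P, hv'⟩ := (((c1.continuousAt.eventually (gt_mem_nhds hPv)).filter_mono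
    (nhdsWithin_le_nhds (s := Ioi v))).and (Ioo_mem_nhdsGT (lt_add_one v))).exists
  have hQv : driftW ω ζ v' < 0 := by
    have h2 := hv'.1
    unfold driftW at hQv0 ⊢; nlinarith
  have c3 : Continuous fun z => driftZ ω z v' := by unfold driftZ; fun_prop
  have c4 : Continuous fun z => driftW ω z v' := by unfold driftW; fun_prop
  have c5 : Continuous fun z : ℝ => ω * z - 2 * z ^ 4 := by fun_prop
  set p := -driftZ ω ζ v' with hp
  set q := -driftW ω ζ v' with hq
  have hp0 : 0 < p := by linarith
  have hq0 : 0 < q := by linarith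
  obtain ⟨δ, hδ, hδ'⟩ := Metric.eventually_nhds_iff.1
    ((c3.continuousAt.eventually (gt_mem_nhds (show driftZ ω ζ v' < -(p / 2) by linarith))).and
      ((c4.continuousAt.eventually (gt_mem_nhds (show driftW ω ζ v' < -(q / 2) by linarith))).and
        (c5.continuousAt.eventually (lt_mem_nhds (hcoefz ζ hζ0 hζ2)))))
  set d := δ / 2 with hd
  have hd0 : 0 < d := by positivity
  have hdδ : d < δ := by linarith
  obtain ⟨T₂, hT₂⟩ := eventually_atTop.1 (hev d hd0)
  set η' := min p q / 4 with hη'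
  have hη'0 : 0 < η' := by positivity
  have hη'1 : η' ≤ p / 4 := by have := min_le_left p q; linarith
  have hη'2 : η' ≤ q / 4 := by have := min_le_right p q; linarith
  obtain ⟨T₃, hT₃, hcl₃⟩ := hc.exists_ge hη'0 (max T₁ T₂)
  have hq1 : driftW ω (ζ + d) v' < -(q / 2) := (hδ' (by
    rw [Real.dist_eq, add_sub_cancel_left, abs_of_pos hd0]; exact hdδ)).2.1
  have hwv : ∀ t ∈ Ici T₃, w t < v' := by
    intro t ht
    by_contra hwt
    have hT₁t : T₁ ≤ t := (le_max_left _ _).trans (hT₃.le.trans ht)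
    have h3 := h1.mono hT₁t
    refine trapped_increasing_false (f := w) (a := v') (m := w₁) (T := t)
      (c := (1 - w₁ ^ 2) * (q / 4 / (2 * Z ^ 4)))
      (mul_pos (by nlinarith [(h1.w_pos t hT₁t).trans_le (hin t hT₁t).2]) (by positivity))
      h3.deriv_w (not_lt.1 hwt)
      (fun s hs hws => ?_) (fun s hs => (hin s (hT₁t.trans hs)).2)
    have hb := (hcl₃ s (mem_Ici.2 (le_trans (mem_Ici.1 ht) (mem_Ici.1 hs)))).b_le (d := q / 4) (h3.z_pos hs) (h3.z_le s hs)
      (h3.w_pos s hs) (h3.w_lt s hs).le (by positivity) (by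
        have e1 := driftW_mono_z (w := w s) hω.le (h3.z_pos hs).le
          (hT₂ s ((le_max_right _ _).trans (hT₃.le.trans (ht.trans hs)))).le
        have e2 := driftW_anti_w (z := ζ + d) hω.le hws
        linarith)
    have h5 : 1 - w₁ ^ 2 ≤ 1 - w s ^ 2 := by nlinarith [h3.w_pos s hs, (hin s (hT₁t.trans hs)).2]
    have := mul_le_mul h5 (show q / 4 / (2 * Z ^ 4) ≤ -b s by linarith) (by positivity)
      (h3.one_sub_sq_pos hs).le
    linarith
  obtain ⟨T₄, hT₄, hz₄⟩ := (frequently_atTop.1 (hfr d hd0)) T₃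
  have h4 := h1.mono ((le_max_left _ _).trans (hT₃.le.trans hT₄))
  refine trapped_increasing_false (f := z) (a := ζ - d) (m := Z) (T := T₄)
    (c := p / 4 / (2 * Z ^ 3)) (by positivity) h4.deriv_z hz₄.le
    (fun s hs hzs => ?_) (fun s hs => h4.z_le s hs)
  have hn := hδ' (show dist (z s) ζ < δ by
    have := hT₂ s ((le_max_right _ _).trans (hT₃.le.trans (hT₄.trans hs)))
    rw [Real.dist_eq, abs_lt]; constructor <;> linarith)
  have ha := (hcl₃ s (le_trans hT₄ hs)).a_le (d := p / 4) (h4.z_pos hs) (h4.z_le s hs)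
    (h4.w_pos s hs) (h4.w_lt s hs).le (by positivity) (by
      have := driftZ_mono_w hn.2.2.le (hwv s (le_trans hT₄ hs)).le
      linarith [hn.1])
  linarith

lemma monotoneOn_Ici_of_deriv_nonneg {f f' : ℝ → ℝ} {T : ℝ}
    (hf : ∀ t ∈ Ici T, HasDerivWithinAt f (f' t) (Ici T) t) (h : ∀ t ∈ Ici T, 0 ≤ f' t) :
    MonotoneOn f (Ici T) := by
  have := antitoneOn_Ici_of_deriv_nonpos (f := fun t => -f t) (f' := fun t => -f' t)
    (fun t ht => (hf t ht).neg) (fun t ht => by linarith [h t ht])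
  intro x hx y hy hxy
  have := this hx hy hxy
  simpa using this

lemma tendsto_atBot_of_deriv_le {f f' : ℝ → ℝ} {T c : ℝ} (hc : 0 < c)
    (hf : ∀ t ∈ Ici T, HasDerivWithinAt f (f' t) (Ici T) t) (h : ∀ t ∈ Ici T, f' t ≤ -c) :
    Tendsto f atTop atBot := by
  have hanti : AntitoneOn (fun t => f t + c * t) (Ici T) :=
    antitoneOn_Ici_of_deriv_nonpos (f' := fun t => f' t + c * 1)
      (fun t ht => (hf t ht).add ((hasDerivWithinAt_id t _).const_mul c))
      (fun t ht => by linarith [h t ht])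
  have h1 : Tendsto (fun t => (f T + c * T) - c * t) atTop atBot := by
    refine tendsto_atBot_add_const_left _ (f T + c * T) ?_ |>.congr fun t => (sub_eq_add_neg _ _).symm
    exact tendsto_neg_atTop_atBot.comp (tendsto_id.const_mul_atTop hc)
  refine tendsto_atBot_mono' _ ?_ h1
  filter_upwards [eventually_ge_atTop T] with t ht
  have := hanti self_mem_Ici ht ht
  simp only at this
  linarith

/-- In the trap w increases, at a rate of at least (1 - v²) c as long as w ≤ v. So w comes
arbitrarily close to 1. -/
lemma w_eventually_gt_of_trap {T c : ℝ} {z w a b : ℝ → ℝ} (h : IsTrajectory Z T z w a b)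
    (hc : 0 < c) (hb : ∀ t ∈ Ici T, b t ≤ -c) {v : ℝ} (hv : v < 1) : ∀ᶠ t in atTop, v < w t := by
  have hmono : MonotoneOn w (Ici T) := monotoneOn_Ici_of_deriv_nonneg h.deriv_w fun t ht => by
    have := mul_nonneg (h.one_sub_sq_pos ht).le (show 0 ≤ -b t by linarith [hb t ht])
    linarith
  have hex : ∃ t ∈ Ici T, v < w t := by
    by_contra hcon
    push Not at hcon
    have hv0 : 0 < v := (h.w_pos T self_mem_Ici).trans_le (hcon T self_mem_Ici)
    refine trapped_increasing_false (f := w) (a := w T) (m := v) (c := (1 - v ^ 2) * c)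
      (mul_pos (by nlinarith) hc) h.deriv_w le_rfl (fun t ht _ => ?_) hcon
    have h5 : 1 - v ^ 2 ≤ 1 - w t ^ 2 := by nlinarith [h.w_pos t ht, hcon t ht]
    have := mul_le_mul h5 (show c ≤ -b t by linarith [hb t ht]) hc.le (h.one_sub_sq_pos ht).le
    linarith
  obtain ⟨t, ht, hvt⟩ := hex
  filter_upwards [eventually_ge_atTop t] with s hs
  exact hvt.trans_le (hmono ht (show T ≤ s from le_trans ht hs) hs)

/-- Every trajectory either ends in the quadrant `{z < z₁, w₁ < w}` or converges to the saddle. -/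
theorem trajectory_dichotomy {z₂ w₂ : ℝ} (hs : IsSaddle ω z₂ w₂) (hZ : 0 < Z) {T : ℝ}
    {z w a b : ℝ → ℝ} (h : IsTrajectory Z T z w a b) (hc : IsAsymptotic ω z w a b) {z₁ w₁ : ℝ}
    (hz₁ : z₂ < z₁) (hw₁1 : w₁ < 1) :
    (∃ᶠ t in atTop, z t < z₁ ∧ w₁ < w t) ∨
      (Tendsto z atTop (𝓝 z₂) ∧ Tendsto w atTop (𝓝 w₂)) := by
  have hω : 0 < ω := by linarith [hs.ω_gt]
  have hw₂ : 0 < w₂ := by linarith [hs.w_gt]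
  refine or_iff_not_imp_left.2 fun hno => ?_
  -- A visit to a quadrant of type I would trap the trajectory with w → 1, and would thus lead into
  -- {z < z₁, w₁ < w}, which is excluded by `hno`.
  have hI : ∀ zc wc, z₂ < zc → zc < z₁ → w₂ < wc → 0 < driftZ ω zc wc → driftW ω zc wc < 0 →
      ∀ᶠ t in atTop, ¬ (z t ≤ zc ∧ wc ≤ w t) := by
    intro zc wc _ hz2 hw hP hQ
    obtain ⟨η, hη, c, hc0, htrap⟩ := trap_corner_I hω hZ (hw₂.trans hw) hP hQ
    obtain ⟨T', hT', hcl⟩ := hc.exists_ge hη T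
    filter_upwards [eventually_ge_atTop T'] with t ht hq
    have ht' := htrap t z w a b (h.mono (hT'.le.trans ht)) (fun s hs => hcl s (le_trans ht hs))
      hq.1 hq.2
    refine hno (Eventually.frequently ?_)
    filter_upwards [w_eventually_gt_of_trap (h.mono (hT'.le.trans ht)) hc0
      (fun s hs => (ht' s hs).2.2) hw₁1, eventually_ge_atTop t] with s hs1 hs2
    exact ⟨(ht' s hs2).1.trans_lt hz2, hs1⟩
  have hIII : ∀ zc wc, 0 < zc → zc < z₂ → 0 < wc → wc < w₂ → driftZ ω zc wc < 0 →
      0 < driftW ω zc wc → ∀ᶠ t in atTop, ¬ (zc ≤ z t ∧ w t ≤ wc) := by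
    intro zc wc hz0 hz2 hw0 hw hP hQ
    have hcoef : 0 ≤ ω * zc - 2 * zc ^ 4 := by
      have h1 : zc ^ 3 < z₂ ^ 3 := pow_lt_pow_left₀ hz2 hz0.le (by norm_num)
      have h2 := hs.cube_lt
      have : 0 < zc * (ω - 2 * zc ^ 3) := mul_pos hz0 (by linarith)
      nlinarith
    obtain ⟨η, hη, htrap⟩ := not_corner_III hω hZ hz0 hw0 (hw.trans hs.w_lt) hcoef hP hQ
    obtain ⟨T', hT', hcl⟩ := hc.exists_ge hη T
    filter_upwards [eventually_ge_atTop T'] with t ht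
    exact htrap t z w a b (h.mono (hT'.le.trans ht)) (fun s hs => hcl s (le_trans ht hs))
  have key : ∀ δ > 0, ∀ᶠ t in atTop, |z t - z₂| < δ ∧ |w t - w₂| < δ := by
    intro δ' hδ'
    obtain ⟨δ, hδ, hδδ', hδz, hδw, hδ1⟩ : ∃ δ > 0, δ ≤ δ' ∧ δ ≤ z₂ ∧ δ ≤ w₂ ∧ δ ≤ z₁ - z₂ :=
      ⟨min (min δ' z₂) (min w₂ (z₁ - z₂)), by
        have := hs.z_pos; have : 0 < z₁ - z₂ := by linarith
        positivity, by simp, by simp, by simp, by simp⟩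
    -- The corners are nested. With e closer to the saddle than c, the quadrants of c (type I) and e
    -- (type II) cover {w ≥ wc}; likewise d (III) and f (IV) cover {w ≤ wd}. Since wa < wd and wc <
    -- wb, the strip wd < w < wc reduces the quadrants of a and b to the conditions z ≥ za and z ≤
    -- zb.
    obtain ⟨za, wa, a1, a2, a3, a4, a5, a6⟩ := hs.exists_corner_II hδ
    obtain ⟨zb, wb, b1, b2, b3, b4, b5, b6, b7⟩ := hs.exists_corner_IV hδ
    obtain ⟨zc, wc, c1, c2, c3, c4, c5, c6⟩ := hs.exists_corner_I
      (show 0 < min δ (wb - w₂) by have : 0 < wb - w₂ := by linarith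
                                   positivity)
    obtain ⟨zd, wd, d1, d2, d3, d4, d5, d6⟩ := hs.exists_corner_III
      (show 0 < min δ (w₂ - wa) by have : 0 < w₂ - wa := by linarith
                                   positivity)
    obtain ⟨ze, we, e1, e2, e3, e4, e5, e6⟩ := hs.exists_corner_II
      (show 0 < min δ (zc - z₂) by have : 0 < zc - z₂ := by linarith
                                   positivity)
    obtain ⟨zf, wf, f1, f2, f3, f4, f5, f6, f7⟩ := hs.exists_corner_IV
      (show 0 < min δ (z₂ - zd) by have : 0 < z₂ - zd := by linarith
                                   positivity)
    have := min_le_left δ (wb - w₂); have := min_le_right δ (wb - w₂)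
    have := min_le_left δ (w₂ - wa); have := min_le_right δ (w₂ - wa)
    have := min_le_left δ (zc - z₂); have := min_le_right δ (zc - z₂)
    have := min_le_left δ (z₂ - zd); have := min_le_right δ (z₂ - zd)
    filter_upwards [not_corner_II hs hZ h hc a1 (by linarith) a5 a6,
      not_corner_IV hs hZ h hc b1 b5 b6 b7,
      hI zc wc c1 (by linarith) c3 c5 c6,
      hIII zd wd (by linarith) d1 (by linarith) d3 d5 d6,
      not_corner_II hs hZ h hc e1 (by linarith) e5 e6,
      not_corner_IV hs hZ h hc f1 f5 f6 f7] with t ha hb hc' hd he hf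
    have hw1 : w t < wc := by
      by_contra hw
      rw [not_lt] at hw
      rcases le_total (z t) zc with hz | hz
      · exact hc' ⟨hz, hw⟩
      · exact he ⟨by linarith, by linarith⟩
    have hw2 : wd < w t := by
      by_contra hw
      rw [not_lt] at hw
      rcases le_total zd (z t) with hz | hz
      · exact hd ⟨hz, hw⟩
      · exact hf ⟨by linarith, by linarith⟩
    have hz1 : z t < za := by
      by_contra hz
      exact ha ⟨not_lt.1 hz, by linarith⟩
    have hz2 : zb < z t := by
      by_contra hz
      exact hb ⟨not_lt.1 hz, by linarith⟩
    constructor <;> rw [abs_lt] <;> constructor <;> linarith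
  constructor
  · exact Metric.tendsto_nhds.2 fun δ hδ => (key δ hδ).mono fun t ht => ht.1
  · exact Metric.tendsto_nhds.2 fun δ hδ => (key δ hδ).mono fun t ht => ht.2

/-- In the trap w → 1, and `driftZ` at (z₂, 1) is positive because it increases with w from its zero
at the saddle. So z could not remain near z₂. -/
lemma not_tendsto_saddle_of_trap {z₂ w₂ : ℝ} (hs : IsSaddle ω z₂ w₂) (hZ : 0 < Z) {T c : ℝ}
    {z w a b : ℝ → ℝ} (h : IsTrajectory Z T z w a b) (hcl : IsAsymptotic ω z w a b)
    (hc : 0 < c) (hb : ∀ t ∈ Ici T, b t ≤ -c) : ¬ Tendsto z atTop (𝓝 z₂) := by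
  intro hz
  have hw : Tendsto w atTop (𝓝 1) := by
    refine tendsto_order.2 ⟨fun v hv => w_eventually_gt_of_trap h hc hb hv, fun v hv => ?_⟩
    filter_upwards [eventually_ge_atTop T] with t ht
    exact (h.w_lt t ht).trans hv
  have hd : 0 < driftZ ω z₂ 1 := by
    have h1 := hs.driftZ_eq
    have : 0 < (1 - w₂) * (z₂ * (ω - 2 * z₂ ^ 3)) :=
      mul_pos (by linarith [hs.w_lt]) (mul_pos hs.z_pos (by linarith [hs.cube_lt]))
    unfold driftZ at h1 ⊢; nlinarith
  have hcont : Continuous fun p : ℝ × ℝ => driftZ ω p.1 p.2 := by unfold driftZ; fun_prop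
  have hlim : Tendsto (fun t => driftZ ω (z t) (w t)) atTop (𝓝 (driftZ ω z₂ 1)) :=
    (hcont.tendsto (z₂, 1)).comp (hz.prodMk_nhds hw)
  obtain ⟨T₁, hT₁⟩ := eventually_atTop.1 ((hlim.eventually (lt_mem_nhds (half_lt_self hd))).and
    (hcl (driftZ ω z₂ 1 / 4) (by positivity)))
  have h1 := h.mono (le_max_left T T₁)
  refine not_decreasing_of_bddBelow (f := z) (c := driftZ ω z₂ 1 / 4 / (2 * Z ^ 3)) (m := 0)
    (by positivity) h1.deriv_z (fun t ht => ?_) (fun t ht => (h1.z_pos ht).le)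
  have h2 := hT₁ t ((le_max_right _ _).trans ht)
  have := h2.2.le_a (d := driftZ ω z₂ 1 / 4) (h1.z_pos ht) (h1.z_le t ht) (h1.w_pos t ht)
    (h1.w_lt t ht).le (by positivity) (by linarith [h2.1])
  linarith

/-- The angle stays bounded along trapped trajectories. -/
lemma angle_bounded_of_trap {T c C : ℝ} {z w a b f f' : ℝ → ℝ} (h : IsTrajectory Z T z w a b)
    (hc : 0 < c) (hC : 0 ≤ C) (hb : ∀ t ∈ Ici T, b t ≤ -c)
    (hf : ∀ t ∈ Ici T, HasDerivWithinAt f (f' t) (Ici T) t)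
    (hf' : ∀ t ∈ Ici T, -(C * Real.sqrt (1 - w t ^ 2)) ≤ f' t) : ¬ Tendsto f atTop atBot := by
  have hmono : MonotoneOn w (Ici T) := monotoneOn_Ici_of_deriv_nonneg h.deriv_w fun t ht => by
    have := mul_nonneg (h.one_sub_sq_pos ht).le (show 0 ≤ -b t by linarith [hb t ht])
    linarith
  have hw0 := h.w_pos T self_mem_Ici
  -- Along the trajectory √(1 - w²) has derivative w b √(1 - w²) ≤ -c w(T) √(1 - w²). With K c w(T)
  -- = C the combination f - K √(1 - w²) is nondecreasing, which bounds `f` from below.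
  set K := C / (c * w T) with hK
  have hK0 : 0 ≤ K := by positivity
  have hD : ∀ t ∈ Ici T, HasDerivWithinAt (fun s => Real.sqrt (1 - w s ^ 2))
      (w t * b t * Real.sqrt (1 - w t ^ 2)) (Ici T) t := by
    intro t ht
    have hp := h.one_sub_sq_pos ht
    refine HasDerivWithinAt.congr_deriv
      (((h.deriv_w t ht).pow 2).const_sub 1 |>.sqrt hp.ne') ?_
    rw [Pi.pow_apply]
    have h2 := Real.mul_self_sqrt hp.le
    have h3 := Real.sqrt_pos.2 hp
    rw [div_eq_iff (by positivity)]
    push_cast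
    linear_combination (-2 * w t * b t) * h2
  have hm : MonotoneOn (fun t => f t - K * Real.sqrt (1 - w t ^ 2)) (Ici T) :=
    monotoneOn_Ici_of_deriv_nonneg (fun t ht => (hf t ht).sub ((hD t ht).const_mul K))
      fun t ht => by
        have hp := Real.sqrt_nonneg (1 - w t ^ 2)
        have h1 := hf' t ht
        have h2 : w T * c ≤ w t * (-b t) :=
          mul_le_mul (hmono self_mem_Ici ht ht) (by linarith [hb t ht]) hc.le (h.w_pos t ht).le
        have h3 : K * (w T * c) = C := by rw [hK]; field_simp
        have h4 := mul_le_mul_of_nonneg_left h2 hK0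
        have h5 := mul_le_mul_of_nonneg_right h4 hp
        rw [h3] at h5
        nlinarith
  intro hbot
  obtain ⟨t, ht, hT⟩ := ((hbot.eventually_lt_atBot (f T - K * Real.sqrt (1 - w T ^ 2))).and
    (eventually_ge_atTop T)).exists
  have h1 := hm self_mem_Ici hT hT
  have := mul_nonneg hK0 (Real.sqrt_nonneg (1 - w t ^ 2))
  simp only at h1
  linarith

/-! ### Global solutions of bounded Lipschitz differential equations -/

section ode

variable {E : Type*} [NormedAddCommGroup E] [NormedSpace ℝ E] [CompleteSpace E]

/-- A time dependent vector field on `[T, ∞)` that is, locally uniformly in time, bounded and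
Lipschitz on the whole space. -/
structure IsTameField (F : ℝ → E → E) (T : ℝ) : Prop where
  lipschitz : ∀ T', ∃ K, ∀ t ∈ Icc T T', LipschitzWith K (F t)
  bounded : ∀ T', ∃ C : NNReal, ∀ t ∈ Icc T T', ∀ x, ‖F t x‖ ≤ C
  continuous : ∀ x, ContinuousOn (fun t => F t x) (Ici T)

def IsSolution (F : ℝ → E → E) (T : ℝ) (α : ℝ → E) : Prop :=
  ∀ t ∈ Ici T, HasDerivWithinAt α (F t (α t)) (Ici T) t

omit [CompleteSpace E] in
lemma IsTameField.dist_le {F : ℝ → E → E} {T : ℝ} (hF : IsTameField F T) (T' : ℝ) :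
    ∃ K : NNReal, ∀ α β : ℝ → E,
      (∀ t ∈ Icc T T', HasDerivWithinAt α (F t (α t)) (Icc T T') t) →
      (∀ t ∈ Icc T T', HasDerivWithinAt β (F t (β t)) (Icc T T') t) →
      ∀ t ∈ Icc T T', dist (α t) (β t) ≤ dist (α T) (β T) * Real.exp (K * (t - T)) := by
  obtain ⟨K, hK⟩ := hF.lipschitz T'
  refine ⟨K, fun α β hα hβ => ?_⟩
  have hr : ∀ γ : ℝ → E, (∀ t ∈ Icc T T', HasDerivWithinAt γ (F t (γ t)) (Icc T T') t) →
      ∀ t ∈ Ico T T', HasDerivWithinAt γ (F t (γ t)) (Ici t) t := fun γ hγ t ht =>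
    (hγ t ⟨ht.1, ht.2.le⟩).mono_of_mem_nhdsWithin
      (mem_of_superset (Ico_mem_nhdsGE ht.2) fun y hy => ⟨ht.1.trans hy.1, hy.2.le⟩)
  exact dist_le_of_trajectories_ODE_of_mem (s := fun _ => univ)
    (fun t ht => (hK t ⟨ht.1, ht.2.le⟩).lipschitzOnWith)
    (fun t ht => (hα t ht).continuousWithinAt) (hr α hα) (fun _ _ => mem_univ _)
    (fun t ht => (hβ t ht).continuousWithinAt) (hr β hβ) (fun _ _ => mem_univ _) le_rfl

omit [CompleteSpace E] in
lemma IsTameField.unique {F : ℝ → E → E} {T T' : ℝ} (hF : IsTameField F T) {α β : ℝ → E}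
    (hα : ∀ t ∈ Icc T T', HasDerivWithinAt α (F t (α t)) (Icc T T') t)
    (hβ : ∀ t ∈ Icc T T', HasDerivWithinAt β (F t (β t)) (Icc T T') t) (h0 : α T = β T) :
    ∀ t ∈ Icc T T', α t = β t := by
  obtain ⟨K, hK⟩ := hF.dist_le T'
  intro t ht
  have := hK α β hα hβ t ht
  rw [h0, dist_self, zero_mul] at this
  exact dist_le_zero.1 this

lemma IsTameField.exists_solution_Icc {F : ℝ → E → E} {T : ℝ} (hF : IsTameField F T) (x₀ : E)
    {T' : ℝ} (hT : T ≤ T') :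
    ∃ α : ℝ → E, α T = x₀ ∧ ∀ t ∈ Icc T T', HasDerivWithinAt α (F t (α t)) (Icc T T') t := by
  obtain ⟨K, hK⟩ := hF.lipschitz T'
  obtain ⟨C, hC⟩ := hF.bounded T'
  -- The field is bounded by `C` everywhere, so the radius C (T' - T) imposes no restriction on the
  -- length of the interval.
  have hP : IsPicardLindelof F (⟨T, left_mem_Icc.2 hT⟩ : Icc T T') x₀
      (C * (T' - T).toNNReal) 0 C K :=
    { lipschitzOnWith := fun t ht => (hK t ht).lipschitzOnWith
      continuousOn := fun x _ => (hF.continuous x).mono Icc_subset_Ici_self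
      norm_le := fun t ht x _ => hC t ht x
      mul_max_le := by
        simp only [sub_self, NNReal.coe_mul, NNReal.coe_zero, sub_zero]
        rw [max_eq_left (by linarith), Real.coe_toNNReal _ (by linarith)] }
  exact hP.exists_eq_forall_mem_Icc_hasDerivWithinAt₀

/-- The solutions on [T, T + n] agree by uniqueness and are glued by choosing, at time t, the index
⌈t - T⌉. -/
lemma IsTameField.exists_solution {F : ℝ → E → E} {T : ℝ} (hF : IsTameField F T) (x₀ : E) :
    ∃ α : ℝ → E, α T = x₀ ∧ IsSolution F T α := by
  have hex : ∀ n : ℕ, ∃ α : ℝ → E, α T = x₀ ∧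
      ∀ t ∈ Icc T (T + n), HasDerivWithinAt α (F t (α t)) (Icc T (T + n)) t := fun n =>
    hF.exists_solution_Icc x₀ (by simp)
  choose α hα0 hα using hex
  have hagree : ∀ m n : ℕ, m ≤ n → ∀ t ∈ Icc T (T + m), α m t = α n t := by
    intro m n hmn
    have hsub : Icc T (T + (m : ℝ)) ⊆ Icc T (T + n) :=
      Icc_subset_Icc_right (by have : (m : ℝ) ≤ n := by exact_mod_cast hmn
                               linarith)
    exact hF.unique (hα m) (fun t ht => (hα n t (hsub ht)).mono hsub) (by rw [hα0, hα0])
  set N : ℝ → ℕ := fun t => ⌈t - T⌉₊ with hN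
  have hNt : ∀ t, t ≤ T + N t := fun t => by have := Nat.le_ceil (t - T); linarith
  have hglob : ∀ (n : ℕ), ∀ t ∈ Icc T (T + n), α (N t) t = α n t := by
    intro n t ht
    have hle : N t ≤ n := Nat.ceil_le.2 (by linarith [ht.2])
    exact hagree _ _ hle t ⟨ht.1, hNt t⟩
  refine ⟨fun t => α (N t) t, hα0 _, fun t ht => ?_⟩
  -- One more than ⌈t - T⌉, so that T + n lies strictly beyond t and the derivative within [T, T +
  -- n] is one within the half-line.
  set n := N t + 1 with hn
  have htn : t < T + (n : ℝ) := by
    have := hNt t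
    rw [hn]; push_cast; linarith
  have hmem : t ∈ Icc T (T + n) := ⟨ht, htn.le⟩
  have h1 : HasDerivWithinAt (α n) (F t (α n t)) (Ici T) t :=
    (hα n t hmem).mono_of_mem_nhdsWithin
      (inter_mem_nhdsWithin _ (Iic_mem_nhds htn))
  have h2 : (fun s => α (N s) s) =ᶠ[𝓝[Ici T] t] α n := by
    filter_upwards [inter_mem_nhdsWithin (Ici T) (Iic_mem_nhds htn)] with s hs
    exact hglob n s hs
  have h3 : α (N t) t = α n t := hglob n t hmem
  simp only [h3]
  exact h1.congr_of_eventuallyEq h2 h3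

end ode

/-! ### Shooting for the saddle -/

section shooting

variable {ω Z T₀ : ℝ}

/-- The box in which the perturbed system is considered. -/
def ratesBox (Z : ℝ) : Set (ℝ × ℝ) := Icc (1 / 2) (Z + 1) ×ˢ Icc (1 / 12) 1

/-- Rates `A`, `B` on `[T₀, ∞) × [1/2, Z + 1] × [1/12, 1]` that are asymptotic to those of the
limiting system and `η`-close to them. -/
structure IsRates (ω Z T₀ η : ℝ) (A B : ℝ × ℝ × ℝ → ℝ) : Prop where
  contDiff_A : ContDiffOn ℝ 1 A (Ici T₀ ×ˢ ratesBox Z)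
  contDiff_B : ContDiffOn ℝ 1 B (Ici T₀ ×ˢ ratesBox Z)
  close : ∀ t ∈ Ici T₀, ∀ x ∈ ratesBox Z, RatesClose ω η x.1 x.2 (A (t, x)) (B (t, x))
  asymptotic : ∀ ε > 0, ∀ᶠ t in atTop, ∀ x ∈ ratesBox Z,
    RatesClose ω ε x.1 x.2 (A (t, x)) (B (t, x))

/-- The projection onto the box. -/
noncomputable def clampBox (Z : ℝ) (x : ℝ × ℝ) : ℝ × ℝ :=
  (max (1 / 2) (min (Z + 1) x.1), max (1 / 12) (min 1 x.2))

lemma clampBox_mem (hZ : 0 < Z) (x : ℝ × ℝ) : clampBox Z x ∈ ratesBox Z :=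
  ⟨⟨le_max_left _ _, max_le (by linarith) (min_le_left _ _)⟩,
    ⟨le_max_left _ _, max_le (by norm_num) (min_le_left _ _)⟩⟩

lemma clampBox_of_mem {x : ℝ × ℝ} (hx : x ∈ ratesBox Z) : clampBox Z x = x := by
  obtain ⟨⟨h1, h2⟩, h3, h4⟩ := hx
  unfold clampBox
  rw [min_eq_right h2, max_eq_right h1, min_eq_right h4, max_eq_right h3]

lemma lipschitzWith_clampBox : LipschitzWith 1 (clampBox Z) := by
  have h1 : LipschitzWith 1 fun x : ℝ × ℝ => max (1 / 2) (min (Z + 1) x.1) :=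
    (LipschitzWith.prod_fst.const_min _).const_max _
  have h2 : LipschitzWith 1 fun x : ℝ × ℝ => max (1 / 12) (min 1 x.2) :=
    (LipschitzWith.prod_snd.const_min _).const_max _
  exact (h1.prodMk h2).weaken (by rw [max_self])

/-- The field of the perturbed system, extended from the box to the plane. -/
noncomputable def clampedField (Z : ℝ) (A B : ℝ × ℝ × ℝ → ℝ) (t : ℝ) (x : ℝ × ℝ) : ℝ × ℝ :=
  (-A (t, clampBox Z x), -((1 - (clampBox Z x).2 ^ 2) * B (t, clampBox Z x)))

/-- C¹ rates are Lipschitz and bounded on the compact convex sets [T₀, T'] × box. Composition with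
the projection onto the box extends both properties to the plane. -/
lemma IsRates.isTameField {η : ℝ} {A B : ℝ × ℝ × ℝ → ℝ} (h : IsRates ω Z T₀ η A B) (hZ : 0 < Z) :
    IsTameField (clampedField Z A B) T₀ := by
  set X : ℝ × ℝ × ℝ → ℝ × ℝ := fun p => (-A p, -((1 - p.2.2 ^ 2) * B p)) with hX
  have hXd : ContDiffOn ℝ 1 X (Ici T₀ ×ˢ ratesBox Z) := by
    refine h.contDiff_A.neg.prodMk (ContDiffOn.neg (ContDiffOn.mul ?_ h.contDiff_B))
    exact (contDiff_const.sub (contDiff_snd.snd.pow 2)).contDiffOn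
  have hFX : ∀ t x, clampedField Z A B t x = X (t, clampBox Z x) := fun _ _ => rfl
  have hbc : IsCompact (ratesBox Z) := isCompact_Icc.prod isCompact_Icc
  have hbv : Convex ℝ (ratesBox Z) := (convex_Icc _ _).prod (convex_Icc _ _)
  have hsub : ∀ T', Icc T₀ T' ×ˢ ratesBox Z ⊆ Ici T₀ ×ˢ ratesBox Z := fun T' =>
    prod_mono Icc_subset_Ici_self subset_rfl
  refine ⟨fun T' => ?_, fun T' => ?_, fun x => ?_⟩
  · obtain ⟨K, hK⟩ := (hXd.mono (hsub T')).exists_lipschitzOnWith one_ne_zero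
      ((convex_Icc _ _).prod hbv) (isCompact_Icc.prod hbc)
    refine ⟨K, fun t ht => LipschitzWith.of_dist_le_mul fun x y => ?_⟩
    have h1 := hK.dist_le_mul (t, clampBox Z x) ⟨ht, clampBox_mem hZ x⟩
      (t, clampBox Z y) ⟨ht, clampBox_mem hZ y⟩
    have h2 : dist ((t, clampBox Z x) : ℝ × ℝ × ℝ) (t, clampBox Z y)
        = dist (clampBox Z x) (clampBox Z y) := by
      rw [Prod.dist_eq]; simp
    have h3 := lipschitzWith_clampBox (Z := Z) |>.dist_le_mul x y
    rw [hFX, hFX]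
    rw [h2] at h1
    refine h1.trans ?_
    gcongr
    simpa using h3
  · obtain ⟨C, hC⟩ := (isCompact_Icc.prod hbc).exists_bound_of_continuousOn
      (hXd.mono (hsub T')).continuousOn
    refine ⟨C.toNNReal, fun t ht x => ?_⟩
    rw [hFX]
    exact (hC _ ⟨ht, clampBox_mem hZ x⟩).trans (Real.le_coe_toNNReal C)
  · have h1 : ContinuousOn (fun t : ℝ => (t, clampBox Z x)) (Ici T₀) := by fun_prop
    exact hXd.continuousOn.comp h1 fun t ht => ⟨ht, clampBox_mem hZ x⟩

/-- A solution of the perturbed system inside the box. -/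
structure IsBoxSolution (Z T₀ : ℝ) (A B : ℝ × ℝ × ℝ → ℝ) (z w : ℝ → ℝ) : Prop where
  deriv_z : ∀ t ∈ Ici T₀, HasDerivWithinAt z (-A (t, z t, w t)) (Ici T₀) t
  deriv_w : ∀ t ∈ Ici T₀, HasDerivWithinAt w (-((1 - w t ^ 2) * B (t, z t, w t))) (Ici T₀) t
  z_ge : ∀ t ∈ Ici T₀, 1 / 2 ≤ z t
  z_le : ∀ t ∈ Ici T₀, z t ≤ Z
  w_ge : ∀ t ∈ Ici T₀, 1 / 6 ≤ w t
  w_lt : ∀ t ∈ Ici T₀, w t < 1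

lemma IsBoxSolution.mem {A B : ℝ × ℝ × ℝ → ℝ} {z w : ℝ → ℝ} (h : IsBoxSolution Z T₀ A B z w)
    {t : ℝ} (ht : t ∈ Ici T₀) : (z t, w t) ∈ ratesBox Z :=
  ⟨⟨h.z_ge t ht, by linarith [h.z_le t ht]⟩, by linarith [h.w_ge t ht], (h.w_lt t ht).le⟩

lemma IsBoxSolution.isTrajectory {A B : ℝ × ℝ × ℝ → ℝ} {z w : ℝ → ℝ}
    (h : IsBoxSolution Z T₀ A B z w) :
    IsTrajectory Z T₀ z w (fun t => A (t, z t, w t)) (fun t => B (t, z t, w t)) :=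
  ⟨h.deriv_z, h.deriv_w, h.z_ge, h.z_le, fun t ht => by linarith [h.w_ge t ht], h.w_lt⟩

lemma IsBoxSolution.isAsymptotic {η : ℝ} {A B : ℝ × ℝ × ℝ → ℝ} {z w : ℝ → ℝ}
    (h : IsBoxSolution Z T₀ A B z w) (hr : IsRates ω Z T₀ η A B) :
    IsAsymptotic ω z w (fun t => A (t, z t, w t)) (fun t => B (t, z t, w t)) := by
  intro ε hε
  filter_upwards [hr.asymptotic ε hε, eventually_ge_atTop T₀] with t ht ht0
  exact ht (z t, w t) (h.mem ht0)

lemma IsBoxSolution.isSolution {A B : ℝ × ℝ × ℝ → ℝ} {z w : ℝ → ℝ}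
    (h : IsBoxSolution Z T₀ A B z w) :
    IsSolution (clampedField Z A B) T₀ (fun t => (z t, w t)) := by
  intro t ht
  have h1 := (h.deriv_z t ht).prodMk (h.deriv_w t ht)
  unfold clampedField
  rw [clampBox_of_mem (h.mem ht)]
  exact h1

set_option maxHeartbeats 1600000 in
/-- The shooting argument: a curve of initial values that starts in the basin of the quadrant
`{z < z₁, w₁ < w}` and ends outside of the box contains an initial value of a solution that converges
to the saddle. -/
theorem exists_boxSolution_tendsto_saddle {z₂ w₂ : ℝ} (hs : IsSaddle ω z₂ w₂)
    (hZ : ω ≤ 2 * Z ^ 3) (hZ0 : 0 < Z) {z₁ w₁ η : ℝ} (hz₁ : z₂ < z₁) (hz₁Z : z₁ < Z)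
    (hw₁ : w₂ < w₁) (hw₁1 : w₁ < 1)
    (hP : η < driftZ ω z₁ w₁) (hQ : driftW ω z₁ w₁ < -η) (hη : η < ω / 4)
    {A B : ℝ × ℝ × ℝ → ℝ} (hr : IsRates ω Z T₀ η A B)
    {p q : ℝ} (hpq : p ≤ q) {z₀ w₀ : ℝ → ℝ} (hz₀ : ContinuousOn z₀ (Icc p q))
    (hw₀ : ContinuousOn w₀ (Icc p q)) (hz₀ge : ∀ s ∈ Icc p q, 1 / 2 ≤ z₀ s)
    (hw₀lt : ∀ s ∈ Icc p q, w₀ s < 1)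
    (hstart : (z₀ p < z₁ ∧ w₁ < w₀ p) ∨ ∃ z w, IsBoxSolution Z T₀ A B z w ∧ z T₀ = z₀ p ∧
      w T₀ = w₀ p ∧ ∃ t ∈ Ici T₀, z t < z₁ ∧ w₁ < w t)
    (hend : Z < z₀ q) :
    ∃ s ∈ Icc p q, s ≠ p ∧ ∃ z w, IsBoxSolution Z T₀ A B z w ∧ z T₀ = z₀ s ∧ w T₀ = w₀ s ∧
      Tendsto z atTop (𝓝 z₂) ∧ Tendsto w atTop (𝓝 w₂) := by
  have hω : 25 < ω := hs.ω_gt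
  have hZz : 1 / 2 ≤ Z := by linarith [hs.z_gt']
  have hF := hr.isTameField hZ0
  set F := clampedField Z A B with hFdef
  choose Φ hΦ0 hΦ using fun x => hF.exists_solution x
  have hΦsub : ∀ x {c d : ℝ}, T₀ ≤ c → ∀ t ∈ Icc c d,
      HasDerivWithinAt (Φ x) (F t (Φ x t)) (Icc c d) t := fun x c d hc t ht =>
    (hΦ x t (hc.trans ht.1)).mono fun y hy => hc.trans hy.1
  have hΦ1 : ∀ x {c d : ℝ}, T₀ ≤ c → ∀ t ∈ Icc c d,
      HasDerivWithinAt (fun s => (Φ x s).1) (-A (t, clampBox Z (Φ x t))) (Icc c d) t :=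
    fun x c d hc t ht => (hΦsub x hc t ht).fst
  have hΦ2 : ∀ x {c d : ℝ}, T₀ ≤ c → ∀ t ∈ Icc c d,
      HasDerivWithinAt (fun s => (Φ x s).2)
        (-((1 - (clampBox Z (Φ x t)).2 ^ 2) * B (t, clampBox Z (Φ x t)))) (Icc c d) t :=
    fun x c d hc t ht => (hΦsub x hc t ht).snd
  -- the flow depends continuously on the initial value
  have hcont : ∀ t ∈ Ici T₀, Continuous fun x => Φ x t := by
    intro t ht
    obtain ⟨K, hK⟩ := hF.dist_le t
    have hL : LipschitzWith (Real.exp (K * (t - T₀))).toNNReal fun x => Φ x t :=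
      LipschitzWith.of_dist_le_mul fun x y => by
        have := hK (Φ x) (Φ y) (hΦsub x le_rfl) (hΦsub y le_rfl) t ⟨ht, le_rfl⟩
        rw [hΦ0, hΦ0] at this
        rw [Real.coe_toNNReal _ (Real.exp_pos _).le, mul_comm]
        exact this
    exact hL.continuous
  -- invariance properties of the clamped flow
  have hzge : ∀ x : ℝ × ℝ, 1 / 2 ≤ x.1 → ∀ t ∈ Ici T₀, 1 / 2 ≤ (Φ x t).1 := by
    intro x hx t ht
    have := halfline_invariant (f := fun s => (Φ x s).1 - 1 / 2) (a := T₀) (b := t)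
      (fun s hs => (hΦ1 x le_rfl s hs).sub_const _) (by simp [hΦ0]; linarith)
      (fun s hs h0 => by
        have hm := clampBox_mem hZ0 (Φ x s)
        have h1 : (clampBox Z (Φ x s)).1 = 1 / 2 := by
          show max (1 / 2) (min (Z + 1) (Φ x s).1) = _
          rw [show (Φ x s).1 = 1 / 2 by linarith, min_eq_right (by linarith), max_self]
        -- At z = 1/2 and w ≤ 1 one has `driftZ` ≤ -ω/2 - 1/4 < -η, so z increases there.
        have h2 := (hr.close s hs.1 _ hm).a_neg (by rw [h1]; norm_num)
          (by linarith [hm.2.1]) (by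
            have h3 := hm.2.2
            have h4 := hm.2.1
            rw [h1]; unfold driftZ; nlinarith)
        linarith) t ⟨ht, le_rfl⟩
    linarith
  -- The factor 1 - w² is at most 2 (1 - w), so the positive barrier ε exp(-K (t - T₀)) stays below
  -- 1 - w: the line w = 1 is not reached in finite time.
  have hwlt : ∀ x : ℝ × ℝ, x.2 < 1 → ∀ t ∈ Ici T₀, (Φ x t).2 < 1 := by
    intro x hx t ht
    obtain ⟨C, hC⟩ := hF.bounded t
    have hBC : ∀ s ∈ Icc T₀ t, ∀ y, -((1 - (clampBox Z y).2 ^ 2) * B (s, clampBox Z y)) ≤ C :=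
      fun s hs y => (le_abs_self _).trans ((norm_snd_le _).trans (hC s hs y))
    have hbox : IsCompact (Icc T₀ t ×ˢ ratesBox Z) :=
      isCompact_Icc.prod (isCompact_Icc.prod isCompact_Icc)
    obtain ⟨D, hD⟩ := hbox.exists_bound_of_continuousOn
      (hr.contDiff_B.continuousOn.mono (prod_mono Icc_subset_Ici_self subset_rfl))
    set K := 2 * |D| + 1 with hK
    set ε := 1 - x.2 with hε
    have hε0 : 0 < ε := by linarith
    have := halfline_invariant
      (f := fun s => 1 - (Φ x s).2 - ε * Real.exp (-K * (s - T₀))) (a := T₀) (b := t)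
      (f' := fun s => -(-((1 - (clampBox Z (Φ x s)).2 ^ 2) * B (s, clampBox Z (Φ x s)))) -
        ε * (Real.exp (-K * (s - T₀)) * (-K * 1)))
      (fun s hs => ((hΦ2 x le_rfl s hs).const_sub 1).sub
        ((((((hasDerivAt_id s).sub_const T₀).const_mul (-K)).exp).const_mul ε).hasDerivWithinAt))
      (by simp [hΦ0, hε])
      (fun s hs h0 => by
        have he := mul_pos hε0 (Real.exp_pos (-K * (s - T₀)))
        have hm := clampBox_mem hZ0 (Φ x s)
        have hb : |B (s, clampBox Z (Φ x s))| ≤ |D| := (hD _ ⟨hs, hm⟩).trans (le_abs_self _)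
        have h1 : 0 ≤ 1 - (clampBox Z (Φ x s)).2 ^ 2 := by nlinarith [hm.2.1, hm.2.2]
        have h2 : 1 - (clampBox Z (Φ x s)).2 ^ 2 ≤ 2 * (1 - (Φ x s).2) := by
          have h3 : (Φ x s).2 ≤ (clampBox Z (Φ x s)).2 := by
            show _ ≤ max (1 / 12) (min 1 (Φ x s).2)
            exact le_max_of_le_right (le_min (by linarith) le_rfl)
          nlinarith [hm.2.1, hm.2.2]
        have h4 : -((1 - (clampBox Z (Φ x s)).2 ^ 2) * |D|) ≤
            (1 - (clampBox Z (Φ x s)).2 ^ 2) * B (s, clampBox Z (Φ x s)) := by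
          have := mul_le_mul_of_nonneg_left (abs_le.1 hb).1 h1
          linarith
        have h5 := mul_le_mul_of_nonneg_right h2 (abs_nonneg D)
        have h6 : 1 - (Φ x s).2 = ε * Real.exp (-K * (s - T₀)) := by linarith
        rw [h6] at h5
        rw [hK] at *
        nlinarith) t ⟨ht, le_rfl⟩
    have := mul_pos hε0 (Real.exp_pos (-K * (t - T₀)))
    linarith
  -- At z = Z the bound ω ≤ 2 Z³ makes the coefficient of w in `driftZ` nonpositive, so `driftZ` ≤
  -- -ω - Z³ and z increases: leaving through z = Z is irreversible.
  have hzZ : ∀ (x : ℝ × ℝ) (t₁ : ℝ), T₀ ≤ t₁ → Z ≤ (Φ x t₁).1 → ∀ t ≥ t₁, Z ≤ (Φ x t).1 := by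
    intro x t₁ ht₁ hx t ht
    have := halfline_invariant (f := fun s => (Φ x s).1 - Z) (a := t₁) (b := t)
      (fun s hs => (hΦ1 x ht₁ s hs).sub_const _) (by linarith)
      (fun s hs h0 => by
        have hm := clampBox_mem hZ0 (Φ x s)
        have h1 : (clampBox Z (Φ x s)).1 = Z := by
          show max (1 / 2) (min (Z + 1) (Φ x s).1) = _
          rw [show (Φ x s).1 = Z by linarith, min_eq_right (by linarith), max_eq_right hZz]
        have h2 := (hr.close s (ht₁.trans hs.1) _ hm).a_neg (by rw [h1]; exact hZ0)
          (by linarith [hm.2.1]) (by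
            have h4 := hm.2.1
            have h5 : 0 < Z ^ 3 := by positivity
            have h6 : 0 ≤ (clampBox Z (Φ x s)).2 * (Z * (2 * Z ^ 3 - ω)) :=
              mul_nonneg (by linarith) (mul_nonneg hZ0.le (by linarith))
            rw [h1]; unfold driftZ; nlinarith)
        linarith) t ⟨ht, le_rfl⟩
    linarith
  -- At w = 1/6 and z ≥ 1/2 one has `driftW` ≥ ω/2 > η, so w decreases and leaving through w = 1/6
  -- is irreversible as well.
  have hw6 : ∀ (x : ℝ × ℝ) (t₁ : ℝ), T₀ ≤ t₁ → (Φ x t₁).2 ≤ 1 / 6 →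
      ∀ t ≥ t₁, (Φ x t).2 ≤ 1 / 6 := by
    intro x t₁ ht₁ hx t ht
    have := halfline_invariant (f := fun s => 1 / 6 - (Φ x s).2) (a := t₁) (b := t)
      (fun s hs => (hΦ2 x ht₁ s hs).const_sub _) (by linarith)
      (fun s hs h0 => by
        have hm := clampBox_mem hZ0 (Φ x s)
        have h1 : (clampBox Z (Φ x s)).2 = 1 / 6 := by
          show max (1 / 12) (min 1 (Φ x s).2) = _
          rw [show (Φ x s).2 = 1 / 6 by linarith, min_eq_right (by norm_num),
            max_eq_right (by norm_num)]
        have h2 := (hr.close s (ht₁.trans hs.1) _ hm).b_pos (by linarith [hm.1.1])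
          (by rw [h1]; norm_num) (by
            have h4 := hm.1.1
            have h5 : 0 ≤ (clampBox Z (Φ x s)).1 * (clampBox Z (Φ x s)).1 ^ 3 := by positivity
            rw [h1]; unfold driftW; nlinarith)
        rw [h1]
        have : 0 < (1 - (1 / 6 : ℝ) ^ 2) * B (s, clampBox Z (Φ x s)) := mul_pos (by norm_num) h2
        linarith) t ⟨ht, le_rfl⟩
    linarith
  have hw₂ := hs.w_gt
  have hquad : ∀ (x : ℝ × ℝ) (t₁ : ℝ), T₀ ≤ t₁ → 1 / 2 ≤ x.1 → x.2 < 1 → (Φ x t₁).1 ≤ z₁ →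
      w₁ ≤ (Φ x t₁).2 → ∀ t ≥ t₁, (Φ x t).1 ≤ z₁ ∧ w₁ ≤ (Φ x t).2 := by
    intro x t₁ ht₁ hx1 hx2 hx3 hx4 t ht
    have hbox : ∀ s ≥ t₁, (Φ x s).1 ≤ z₁ → w₁ ≤ (Φ x s).2 → Φ x s ∈ ratesBox Z := by
      intro s hs h1 h2
      exact ⟨⟨hzge x hx1 s (ht₁.trans hs), by linarith⟩, by linarith,
        (hwlt x hx2 s (ht₁.trans hs)).le⟩
    have hcoef : 0 ≤ ω * z₁ - 2 * z₁ ^ 4 := by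
      by_contra hneg
      have h1 : w₁ * (ω * z₁ - 2 * z₁ ^ 4) ≤ 0 :=
        mul_nonpos_of_nonneg_of_nonpos (by linarith) (by linarith)
      have h2 : 0 < z₁ ^ 3 := by have := hs.z_pos.trans hz₁; positivity
      have h3 := (abs_nonneg _).trans (hr.close T₀ self_mem_Ici _ (clampBox_mem hZ0 x)).1
      unfold driftZ at hP
      linarith
    have := quadrant_invariant (f := fun s => z₁ - (Φ x s).1) (g := fun s => (Φ x s).2 - w₁)
      (a := t₁) (b := t)
      (fun s hs => (hΦ1 x ht₁ s hs).const_sub _) (fun s hs => (hΦ2 x ht₁ s hs).sub_const _)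
      (by linarith) (by linarith)
      (fun s hs h1 h2 => by
        have hm := hbox s hs.1 (by linarith) (by linarith)
        rw [clampBox_of_mem hm]
        have hzs : (Φ x s).1 = z₁ := by linarith
        have := (hr.close s (ht₁.trans hs.1) _ hm).a_pos (by linarith [hm.1.1])
          (by linarith [hm.2.1])
          (by rw [hzs]; exact hP.trans_le (driftZ_mono_w hcoef (by linarith)))
        linarith)
      (fun s hs h1 h2 => by
        have hm := hbox s hs.1 (by linarith) (by linarith)
        rw [clampBox_of_mem hm]
        have hws : (Φ x s).2 = w₁ := by linarith
        have := (hr.close s (ht₁.trans hs.1) _ hm).b_neg (by linarith [hm.1.1])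
          (by linarith [hm.2.1]) (by
            have := driftW_mono_z (ω := ω) (w := w₁) (by linarith)
              (show (0 : ℝ) ≤ (Φ x s).1 by linarith [hm.1.1]) (show (Φ x s).1 ≤ z₁ by linarith)
            rw [hws]; linarith)
        have h3 : 0 < 1 - (Φ x s).2 ^ 2 := by nlinarith [hwlt x hx2 s (ht₁.trans hs.1)]
        have := mul_neg_of_pos_of_neg h3 this
        linarith) t ⟨ht, le_rfl⟩
    exact ⟨by linarith [this.1], by linarith [this.2]⟩
  -- the curve of initial values
  set x₀ : ℝ → ℝ × ℝ := fun s => (z₀ (max p (min q s)), w₀ (max p (min q s))) with hx₀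
  have hclm : ∀ s, max p (min q s) ∈ Icc p q := fun s =>
    ⟨le_max_left _ _, max_le hpq (min_le_left _ _)⟩
  have hcl : ∀ s ∈ Icc p q, max p (min q s) = s := fun s hs => by
    rw [min_eq_right hs.2, max_eq_right hs.1]
  have hx₀c : Continuous x₀ := by
    have hc : Continuous fun s => max p (min q s) := by fun_prop
    exact (hz₀.comp_continuous hc hclm).prodMk (hw₀.comp_continuous hc hclm)
  have hx₀1 : ∀ s, 1 / 2 ≤ (x₀ s).1 := fun s => hz₀ge _ (hclm s)
  have hx₀2 : ∀ s, (x₀ s).2 < 1 := fun s => hw₀lt _ (hclm s)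
  -- `U` collects the parameters whose solution enters the trap, `W` those whose solution escapes.
  -- Both are open, being strict conditions at one time on a flow that depends continuously on its
  -- initial value, and they are disjoint since either event is final. As `p` lies in `U` and `q` in
  -- `W`, connectedness yields a parameter in neither.
  set U : Set ℝ := {s | ∃ t ∈ Ici T₀, (Φ (x₀ s) t).1 < z₁ ∧ w₁ < (Φ (x₀ s) t).2} with hU
  set W : Set ℝ := {s | ∃ t ∈ Ici T₀, Z < (Φ (x₀ s) t).1 ∨ (Φ (x₀ s) t).2 < 1 / 6} with hW
  have hΦc : ∀ t ∈ Ici T₀, Continuous fun s => Φ (x₀ s) t := fun t ht => (hcont t ht).comp hx₀c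
  have hUo : IsOpen U := by
    have : U = ⋃ t ∈ Ici T₀, {s | (Φ (x₀ s) t).1 < z₁ ∧ w₁ < (Φ (x₀ s) t).2} := by
      ext s; simp only [hU, mem_ofPred_eq, mem_iUnion, exists_prop]
    rw [this]
    exact isOpen_biUnion fun t ht =>
      (isOpen_lt (hΦc t ht).fst continuous_const).inter (isOpen_lt continuous_const (hΦc t ht).snd)
  have hWo : IsOpen W := by
    have : W = ⋃ t ∈ Ici T₀, {s | Z < (Φ (x₀ s) t).1 ∨ (Φ (x₀ s) t).2 < 1 / 6} := by
      ext s; simp only [hW, mem_ofPred_eq, mem_iUnion, exists_prop]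
    rw [this]
    exact isOpen_biUnion fun t ht =>
      (isOpen_lt continuous_const (hΦc t ht).fst).union (isOpen_lt (hΦc t ht).snd continuous_const)
  have hdisj : ∀ s, s ∈ U → s ∉ W := by
    rintro s ⟨t, ht, h1, h2⟩ ⟨t', ht', h3⟩
    rcases le_total t t' with h | h
    · have := hquad (x₀ s) t ht (hx₀1 s) (hx₀2 s) h1.le h2.le t' h
      rcases h3 with h3 | h3 <;> linarith [this.1, this.2]
    · rcases h3 with h3 | h3
      · linarith [hzZ (x₀ s) t' ht' h3.le t h]
      · linarith [hw6 (x₀ s) t' ht' h3.le t h]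
  have hpU : p ∈ U := by
    have hxp : x₀ p = (z₀ p, w₀ p) := by
      show (z₀ (max p (min q p)), w₀ (max p (min q p))) = _
      rw [hcl p ⟨le_rfl, hpq⟩]
    rcases hstart with h | ⟨z, w, hsol, e1, e2, t, ht, h⟩
    · exact ⟨T₀, self_mem_Ici, by rw [hΦ0, hxp]; exact h⟩
    · refine ⟨t, ht, ?_⟩
      have hsol' := hsol.isSolution
      have := hF.unique (T' := t) (α := Φ (x₀ p)) (β := fun s => (z s, w s)) (hΦsub _ le_rfl)
        (fun s hs => (hsol' s hs.1).mono Icc_subset_Ici_self) (by rw [hΦ0, hxp, e1, e2]) t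
        ⟨ht, le_rfl⟩
      rw [this]
      exact h
  have hqW : q ∈ W := by
    refine ⟨T₀, self_mem_Ici, Or.inl ?_⟩
    rw [hΦ0]
    show Z < z₀ (max p (min q q))
    rw [hcl q ⟨hpq, le_rfl⟩]
    exact hend
  obtain ⟨s, hs0, hsU, hsW⟩ : ∃ s ∈ Icc p q, s ∉ U ∧ s ∉ W := by
    by_contra hcon
    push Not at hcon
    obtain ⟨s, -, h1, h2⟩ := (isPreconnected_Icc : IsPreconnected (Icc p q)) U W hUo hWo
      (fun s hs => by
        by_cases h : s ∈ U
        · exact Or.inl h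
        · exact Or.inr (hcon s hs h))
      ⟨p, ⟨le_rfl, hpq⟩, hpU⟩ ⟨q, ⟨hpq, le_rfl⟩, hqW⟩
    exact hdisj s h1 h2
  have hxs : x₀ s = (z₀ s, w₀ s) := by
    show (z₀ (max p (min q s)), w₀ (max p (min q s))) = _
    rw [hcl s hs0]
  have hbd : ∀ t ∈ Ici T₀, (Φ (x₀ s) t).1 ≤ Z ∧ 1 / 6 ≤ (Φ (x₀ s) t).2 := by
    intro t ht
    by_contra hcon
    refine hsW ⟨t, ht, ?_⟩
    by_contra h'
    push Not at h'
    exact hcon h'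
  have hmem : ∀ t ∈ Ici T₀, Φ (x₀ s) t ∈ ratesBox Z := fun t ht =>
    ⟨⟨hzge _ (hx₀1 s) t ht, by linarith [(hbd t ht).1]⟩, by linarith [(hbd t ht).2],
      (hwlt _ (hx₀2 s) t ht).le⟩
  -- Inside the box the projection does nothing, so the clamped solution solves the original system.
  have hsol : IsBoxSolution Z T₀ A B (fun t => (Φ (x₀ s) t).1) (fun t => (Φ (x₀ s) t).2) := by
    refine ⟨fun t ht => ?_, fun t ht => ?_, fun t ht => hzge _ (hx₀1 s) t ht,
      fun t ht => (hbd t ht).1, fun t ht => (hbd t ht).2, fun t ht => hwlt _ (hx₀2 s) t ht⟩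
    · have := (hΦ (x₀ s) t ht).fst
      rw [hFdef] at this
      unfold clampedField at this
      rw [clampBox_of_mem (hmem t ht)] at this
      exact this
    · have := (hΦ (x₀ s) t ht).snd
      rw [hFdef] at this
      unfold clampedField at this
      rw [clampBox_of_mem (hmem t ht)] at this
      exact this
  refine ⟨s, hs0, fun h => hsU (h ▸ hpU), _, _, hsol, by rw [hΦ0, hxs], by rw [hΦ0, hxs], ?_⟩
  rcases trajectory_dichotomy hs hZ0 hsol.isTrajectory (hsol.isAsymptotic hr) hz₁ hw₁1 with h | h
  · obtain ⟨t, ht, h1⟩ := (frequently_atTop.1 h) T₀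
    exact absurd ⟨t, ht, h1⟩ hsU
  · exact h

end shooting

/-! ### Taylor expansions -/

section taylor

lemma contDiffAt_deriv {f : ℝ → ℝ} {x : ℝ} {n : ℕ} (hf : ContDiffAt ℝ (n + 1 : ℕ) f x) :
    ContDiffAt ℝ n (deriv f) x := by
  have h1 : ContDiffAt ℝ n (fderiv ℝ f) x := hf.fderiv_right (by norm_cast)
  exact h1.clm_apply contDiffAt_const

lemma eventually_hasDerivAt {f : ℝ → ℝ} {x : ℝ} {n : ℕ} (hf : ContDiffAt ℝ (n + 1 : ℕ) f x) :
    ∀ᶠ y in 𝓝 x, HasDerivAt f (deriv f y) y := by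
  filter_upwards [hf.eventually (by simp)] with y hy
  exact (hy.differentiableAt (by simp)).hasDerivAt

lemma isLittleO_pow_succ_of_deriv {g g' : ℝ → ℝ} {n : ℕ}
    (hg : ∀ᶠ r in 𝓝 (0 : ℝ), HasDerivAt g (g' r) r) (h0 : g 0 = 0)
    (hg' : g' =o[𝓝 0] fun r => r ^ n) : g =o[𝓝 0] fun r => r ^ (n + 1) := by
  refine IsLittleO.of_bound fun c hc => ?_
  obtain ⟨ε, hε, h⟩ := Metric.eventually_nhds_iff_ball.1 (hg.and (hg'.bound hc))
  filter_upwards [Metric.ball_mem_nhds (0 : ℝ) hε] with r hr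
  have hsub : Metric.closedBall (0 : ℝ) |r| ⊆ Metric.ball 0 ε := by
    refine Metric.closedBall_subset_ball ?_
    simpa using hr
  have := (convex_closedBall (0 : ℝ) |r|).norm_image_sub_le_of_norm_hasDerivWithin_le
    (f := g) (f' := g') (C := c * |r| ^ n) (x := 0) (y := r)
    (fun x hx => (h x (hsub hx)).1.hasDerivWithinAt)
    (fun x hx => by
      refine ((h x (hsub hx)).2).trans ?_
      rw [norm_pow, Real.norm_eq_abs]
      have : |x| ≤ |r| := by simpa using hx
      gcongr)
    (by simp) (by simp)
  rw [h0, sub_zero, sub_zero] at this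
  rw [norm_pow, pow_succ, ← mul_assoc]
  exact this

lemma isLittleO_zero_of_tendsto {a : ℝ} {k : ℝ → ℝ} (hk : ContinuousAt k 0) {n : ℕ}
    (h : (fun r => a * r ^ n + r ^ (n + 1) * k r) =o[𝓝[>] 0] fun r => r ^ n) : a = 0 := by
  have h1 : Tendsto (fun r : ℝ => a + r * k r) (𝓝[>] 0) (𝓝 (a + 0 * k 0)) :=
    ((continuousAt_id.mul hk).tendsto.mono_left nhdsWithin_le_nhds).const_add a
  have h2 := h.tendsto_div_nhds_zero
  have h3 : Tendsto (fun r : ℝ => a + r * k r) (𝓝[>] 0) (𝓝 0) := by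
    refine h2.congr' ?_
    filter_upwards [self_mem_nhdsWithin] with r hr
    have : (r : ℝ) ≠ 0 := ne_of_gt hr
    rw [pow_succ]
    field_simp
  have := tendsto_nhds_unique h1 h3
  simpa using this

/-- Taylor's formula of order three is compared with the one-sided hypothesis, coefficient by
coefficient from the lowest order. The conclusion on f' is two-sided, because it comes from the
Taylor formula for f' itself. -/
lemma taylor_of_isLittleO_cube {f : ℝ → ℝ} (hf : ContDiffAt ℝ 3 f 0) {c : ℝ}
    (h : (fun r => f r - c * r ^ 3) =o[𝓝[>] 0] fun r => r ^ 3) :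
    f 0 = 0 ∧ deriv f 0 = 0 ∧ deriv (deriv f) 0 = 0 ∧
      (fun r => deriv f r - 3 * c * r ^ 2) =o[𝓝 0] fun r => r ^ 2 := by
  have c1 : ContDiffAt ℝ 2 (deriv f) 0 := contDiffAt_deriv (n := 2) hf
  have c2 : ContDiffAt ℝ 1 (deriv (deriv f)) 0 := contDiffAt_deriv (n := 1) c1
  have c3 : ContDiffAt ℝ 0 (deriv (deriv (deriv f))) 0 := contDiffAt_deriv (n := 0) c2
  set a₀ := f 0
  set a₁ := deriv f 0
  set a₂ := deriv (deriv f) 0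
  set a₃ := deriv (deriv (deriv f)) 0
  have o0 : (fun r => deriv (deriv (deriv f)) r - a₃) =o[𝓝 0] fun r : ℝ => r ^ 0 := by
    simp only [pow_zero]
    rw [isLittleO_one_iff]
    exact tendsto_sub_nhds_zero_iff.2 c3.continuousAt.tendsto
  have o1 : (fun r => deriv (deriv f) r - a₂ - a₃ * r) =o[𝓝 0] fun r : ℝ => r ^ 1 := by
    refine isLittleO_pow_succ_of_deriv ?_ (by simp [a₂]) o0
    filter_upwards [eventually_hasDerivAt (n := 0) c2] with r hr
    simpa using (hr.sub_const a₂).fun_sub ((hasDerivAt_id r).const_mul a₃)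
  have o2 : (fun r => deriv f r - a₁ - a₂ * r - a₃ * r ^ 2 / 2) =o[𝓝 0] fun r : ℝ => r ^ 2 := by
    refine isLittleO_pow_succ_of_deriv ?_ (by simp [a₁]) o1
    filter_upwards [eventually_hasDerivAt (n := 1) c1] with r hr
    exact (((hr.sub_const a₁).fun_sub ((hasDerivAt_id r).const_mul a₂)).fun_sub
      (((hasDerivAt_pow 2 r).const_mul a₃).div_const 2)).congr_deriv (by push_cast; ring)
  have o3 : (fun r => f r - a₀ - a₁ * r - a₂ * r ^ 2 / 2 - a₃ * r ^ 3 / 6)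
      =o[𝓝 0] fun r : ℝ => r ^ 3 := by
    refine isLittleO_pow_succ_of_deriv ?_ (by simp [a₀]) o2
    filter_upwards [eventually_hasDerivAt (n := 2) hf] with r hr
    exact ((((hr.sub_const a₀).fun_sub ((hasDerivAt_id r).const_mul a₁)).fun_sub
      (((hasDerivAt_pow 2 r).const_mul a₂).div_const 2)).fun_sub
      (((hasDerivAt_pow 3 r).const_mul a₃).div_const 6)).congr_deriv (by push_cast; ring)
  have o4 : (fun r => a₀ + a₁ * r + a₂ / 2 * r ^ 2 + (a₃ / 6 - c) * r ^ 3)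
      =o[𝓝[>] 0] fun r : ℝ => r ^ 3 := by
    refine (h.sub (o3.mono nhdsWithin_le_nhds)).congr_left fun r => ?_
    ring
  have p3 : ∀ n ≤ 3, (fun r : ℝ => r ^ 3) =O[𝓝[>] 0] fun r : ℝ => r ^ n := fun n hn =>
    IsBigO.of_bound 1 (by
      filter_upwards [mem_nhdsWithin_of_mem_nhds (Icc_mem_nhds (show (-1 : ℝ) < 0 by norm_num)
        (show (0 : ℝ) < 1 by norm_num))] with r hr
      rw [one_mul, norm_pow, norm_pow]
      exact pow_le_pow_of_le_one (norm_nonneg _) (abs_le.2 hr) hn)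
  have e0 : a₀ = 0 := by
    refine isLittleO_zero_of_tendsto (n := 0)
      (k := fun r => a₁ + a₂ / 2 * r + (a₃ / 6 - c) * r ^ 2) (by fun_prop) ?_
    refine (o4.trans_isBigO (p3 0 (by norm_num))).congr_left fun r => ?_
    ring
  have e1 : a₁ = 0 := by
    refine isLittleO_zero_of_tendsto (n := 1)
      (k := fun r => a₂ / 2 + (a₃ / 6 - c) * r) (by fun_prop) ?_
    refine (o4.trans_isBigO (p3 1 (by norm_num))).congr_left fun r => ?_
    rw [e0]; ring
  have e2 : a₂ / 2 = 0 := by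
    refine isLittleO_zero_of_tendsto (n := 2)
      (k := fun r => (a₃ / 6 - c)) (by fun_prop) ?_
    refine (o4.trans_isBigO (p3 2 (by norm_num))).congr_left fun r => ?_
    rw [e0, e1]; ring
  have e3 : a₃ / 6 - c = 0 := by
    refine isLittleO_zero_of_tendsto (n := 3) (k := fun r => 0) (by fun_prop) ?_
    refine o4.congr_left fun r => ?_
    rw [e0, e1, e2]; ring
  have e2' : a₂ = 0 := by linarith
  refine ⟨e0, e1, e2', o2.congr_left fun r => ?_⟩
  rw [e1, e2', show a₃ = 6 * c by linarith]; ring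

end taylor

/-! ### A function of two variables with a cubic expansion -/

section cubic

lemma hasDerivAt_ray {V : ℝ × ℝ → ℝ} {e : ℝ × ℝ} {r : ℝ} (h : DifferentiableAt ℝ V (r • e)) :
    HasDerivAt (fun r : ℝ => V (r • e)) (fderiv ℝ V (r • e) e) r := by
  have h1 : HasDerivAt (fun r : ℝ => r • e) e r := by
    simpa using (hasDerivAt_id r).smul_const e
  exact h.hasFDerivAt.comp_hasDerivAt r h1

/-- If `V` agrees with a cubic form up to `o(r³)` along `e`, its first two derivatives at the origin
vanish in this direction. -/
lemma derivs_ray_of_isLittleO {V : ℝ × ℝ → ℝ} (hV : ContDiffAt ℝ 3 V 0) {e : ℝ × ℝ} {c : ℝ}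
    (h : (fun r : ℝ => V (r • e) - c * r ^ 3) =o[𝓝[>] 0] fun r => r ^ 3) :
    fderiv ℝ V 0 e = 0 ∧ fderiv ℝ (fderiv ℝ V) 0 e e = 0 ∧
      (fun r : ℝ => fderiv ℝ V (r • e) e - 3 * c * r ^ 2) =o[𝓝 0] fun r => r ^ 2 := by
  have hc : ContinuousAt (fun r : ℝ => r • e) 0 := by fun_prop
  have hV0 : ContDiffAt ℝ 3 V ((0 : ℝ) • e) := by simpa using hV
  have hf : ContDiffAt ℝ 3 (fun r : ℝ => V (r • e)) 0 :=
    hV0.comp 0 (contDiffAt_id.smul contDiffAt_const)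
  obtain ⟨-, h1, h2, h3⟩ := taylor_of_isLittleO_cube hf h
  have hd : deriv (fun r : ℝ => V (r • e)) =ᶠ[𝓝 0] fun r => fderiv ℝ V (r • e) e := by
    have hev : ∀ᶠ p in 𝓝 ((0 : ℝ) • e), ContDiffAt ℝ 3 V p := hV0.eventually (by simp)
    filter_upwards [hc.eventually hev] with r hr
    exact (hasDerivAt_ray (hr.differentiableAt (by simp))).deriv
  refine ⟨?_, ?_, ?_⟩
  · rw [hd.eq_of_nhds] at h1
    simpa using h1
  · rw [hd.deriv_eq] at h2
    have hD : DifferentiableAt ℝ (fderiv ℝ V) ((0 : ℝ) • e) :=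
      (hV0.fderiv_right (m := 2) (by norm_num)).differentiableAt (by simp)
    have h4 : HasDerivAt (fun r : ℝ => r • e) e 0 := by
      simpa using (hasDerivAt_id (0 : ℝ)).smul_const e
    have h5 : HasDerivAt (fun r : ℝ => fderiv ℝ V (r • e))
        (fderiv ℝ (fderiv ℝ V) ((0 : ℝ) • e) e) 0 := hD.hasFDerivAt.comp_hasDerivAt (0 : ℝ) h4
    have h6 : HasDerivAt (fun r : ℝ => fderiv ℝ V (r • e) e)
        (fderiv ℝ (fderiv ℝ V) ((0 : ℝ) • e) e e) 0 :=
      ((ContinuousLinearMap.apply ℝ ℝ e).hasFDerivAt.comp_hasDerivAt (0 : ℝ) h5)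
    rw [h6.deriv] at h2
    simpa using h2
  · refine h3.congr' ?_ EventuallyEq.rfl
    filter_upwards [hd] with r hr
    rw [hr]

end cubic

/-! ### The interior near the centre -/

section interior

/-- The partial derivative with respect to the first coordinate. -/
noncomputable def dFst (f : ℝ × ℝ → ℝ) (p : ℝ × ℝ) : ℝ := fderiv ℝ f p (1, 0)

/-- The partial derivative with respect to the second coordinate. -/
noncomputable def dSnd (f : ℝ × ℝ → ℝ) (p : ℝ × ℝ) : ℝ := fderiv ℝ f p (0, 1)

lemma hasDerivAt_dFst {f : ℝ × ℝ → ℝ} {a b : ℝ} (h : DifferentiableAt ℝ f (a, b)) :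
    HasDerivAt (fun x => f (x, b)) (dFst f (a, b)) a :=
  h.hasFDerivAt.comp_hasDerivAt a ((hasDerivAt_id a).prodMk (hasDerivAt_const a b))

lemma hasDerivAt_dSnd {f : ℝ × ℝ → ℝ} {a b : ℝ} (h : DifferentiableAt ℝ f (a, b)) :
    HasDerivAt (fun x => f (a, x)) (dSnd f (a, b)) b :=
  h.hasFDerivAt.comp_hasDerivAt b ((hasDerivAt_const b a).prodMk (hasDerivAt_id b))

lemma fderiv_apply_eq (f : ℝ × ℝ → ℝ) (p v : ℝ × ℝ) :
    fderiv ℝ f p v = v.1 * dFst f p + v.2 * dSnd f p := by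
  have : v = v.1 • (1, 0) + v.2 • ((0, 1) : ℝ × ℝ) := by
    ext <;> simp
  conv_lhs => rw [this]
  rw [map_add, map_smul, map_smul]
  rfl

/-- The function `R u² = R (Y² - 1) + 2 Ψ`. -/
def massV (Ψ Y : ℝ → ℝ → ℝ) (p : ℝ × ℝ) : ℝ := p.2 * (Y p.1 p.2 ^ 2 - 1) + 2 * Ψ p.1 p.2

/-- The integrand in the definition of `G`. -/
noncomputable def kernelG (Ψ Y : ℝ → ℝ → ℝ) (p : ℝ × ℝ) : ℝ :=
  -(Real.sqrt p.2 * dFst (massV Ψ Y) p) /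
    (2 * Y p.1 p.2 * (massV Ψ Y p * Real.sqrt (massV Ψ Y p)))

variable {α ξ β γ δ rmax : ℝ} {Ψ Y : ℝ → ℝ → ℝ}

lemma uSq_eq {r R : ℝ} (hR : R ≠ 0) : uSq Ψ Y r R = massV Ψ Y (r, R) / R := by
  unfold uSq massV
  field_simp
  ring

lemma mul_uSq {r R : ℝ} (hR : R ≠ 0) : R * uSq Ψ Y r R = massV Ψ Y (r, R) := by
  rw [uSq_eq hR]; field_simp

namespace IsInterior

lemma contDiffAt_massV (h : IsInterior α ξ β γ δ rmax Ψ Y) {r R : ℝ} (h0 : 0 ≤ R) (h1 : R ≤ r)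
    (h2 : r ≤ rmax) : ContDiffAt ℝ 3 (massV Ψ Y) (r, R) := by
  have hY : ContDiffAt ℝ 3 (fun p : ℝ × ℝ => Y p.1 p.2) (r, R) := h.contDiff_Y r R h0 h1 h2
  have hΨ : ContDiffAt ℝ 3 (fun p : ℝ × ℝ => Ψ p.1 p.2) (r, R) := h.contDiff_Ψ r R h0 h1 h2
  exact (contDiffAt_snd.mul ((hY.pow 2).sub contDiffAt_const)).add (contDiffAt_const.mul hΨ)

lemma massV_pos (h : IsInterior α ξ β γ δ rmax Ψ Y) {r R : ℝ} (h0 : 0 ≤ R) (h1 : R ≤ r)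
    (h2 : r ≤ rmax) (hr : 0 < r) : 0 < massV Ψ Y (r, R) := by
  rcases h0.eq_or_lt with rfl | hR
  · simp only [massV, zero_mul, zero_add]
    have := h.Ψ_pos r 0 h0 h1 h2 hr
    linarith
  · rw [← mul_uSq hR.ne']
    exact mul_pos hR (h.uSq_pos r R hR h1 h2)

/-- For 0 < R ≤ r the error scale (r² + R²)^{3/2} is at most 8 r³. The axis R = 0, which is outside
the hypothesis, is reached by continuity of `massV`. -/
lemma taylor_bound (h : IsInterior α ξ β γ δ rmax Ψ Y) {c : ℝ} (hc : 0 < c) :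
    ∃ ε > 0, ε ≤ rmax ∧ ∀ r R : ℝ, 0 < r → r < ε → 0 ≤ R → R ≤ r →
      |massV Ψ Y (r, R) - (α * r ^ 3 + β * r ^ 2 * R + γ * r * R ^ 2 + δ * R ^ 3)| ≤ c * r ^ 3 := by
  have h1 := h.taylor.bound (show 0 < c / 8 by positivity)
  rw [eventually_nhdsWithin_iff, Metric.eventually_nhds_iff_ball] at h1
  obtain ⟨ε, hε, h1⟩ := h1
  refine ⟨min ε rmax, lt_min hε h.rmax_pos, min_le_right _ _, fun r R hr hrε hR hRr => ?_⟩
  have hrm : r ≤ rmax := hrε.le.trans (min_le_right _ _)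
  have key : ∀ x ∈ Ioc 0 r, |massV Ψ Y (r, x) -
      (α * r ^ 3 + β * r ^ 2 * x + γ * r * x ^ 2 + δ * x ^ 3)| ≤ c * r ^ 3 := by
    intro x hx
    have h2 := h1 (r, x) (by
      change (r, x) ∈ Metric.ball (0 : ℝ × ℝ) ε
      rw [mem_ball_zero_iff, Prod.norm_def, max_lt_iff, Real.norm_eq_abs, Real.norm_eq_abs,
        abs_of_pos hr, abs_of_pos hx.1]
      exact ⟨hrε.trans_le (min_le_left _ _), hx.2.trans_lt (hrε.trans_le (min_le_left _ _))⟩)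
      ⟨hx.1, hx.2⟩
    simp only at h2
    rw [mul_uSq hx.1.ne', Real.norm_eq_abs, Real.norm_eq_abs] at h2
    refine h2.trans ?_
    have h3 : (r ^ 2 + x ^ 2) ^ (3 / 2 : ℝ) ≤ ((2 * r) ^ 2) ^ (3 / 2 : ℝ) := by
      refine Real.rpow_le_rpow (by positivity) ?_ (by norm_num)
      nlinarith [hx.1, hx.2]
    have h4 : ((2 * r) ^ 2) ^ (3 / 2 : ℝ) = 8 * r ^ 3 := by
      rw [← Real.rpow_natCast, ← Real.rpow_mul (by positivity)]
      norm_num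
      ring
    rw [abs_of_nonneg (by positivity)]
    rw [h4] at h3
    nlinarith
  rcases hR.eq_or_lt with rfl | hR0
  · have hcont : ContinuousWithinAt (fun x => |massV Ψ Y (r, x) -
        (α * r ^ 3 + β * r ^ 2 * x + γ * r * x ^ 2 + δ * x ^ 3)|) (Ioc 0 r) 0 := by
      have h2 : ContinuousAt (fun x => massV Ψ Y (r, x)) 0 :=
        (h.contDiffAt_massV le_rfl hr.le hrm).continuousAt.comp (by fun_prop)
      exact ((h2.sub (by fun_prop)).abs).continuousWithinAt
    have hne : (0 : ℝ) ∈ closure (Ioc 0 r) := by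
      rw [closure_Ioc hr.ne]; exact ⟨le_rfl, hr.le⟩
    have := mem_closure_iff_nhdsWithin_neBot.1 hne
    exact le_of_tendsto hcont.tendsto (eventually_mem_nhdsWithin.mono fun x hx => key x hx)
  · exact key R ⟨hR0, hRr⟩

lemma isLittleO_ray (h : IsInterior α ξ β γ δ rmax Ψ Y) {y : ℝ} (hy : 0 ≤ y) (hy1 : y ≤ 1) :
    (fun r : ℝ => massV Ψ Y (r • ((1 : ℝ), y)) - (α + β * y + γ * y ^ 2 + δ * y ^ 3) * r ^ 3)
      =o[𝓝[>] 0] fun r => r ^ 3 := by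
  refine IsLittleO.of_bound fun c hc => ?_
  obtain ⟨ε, hε, -, hb⟩ := h.taylor_bound hc
  filter_upwards [Ioo_mem_nhdsGT hε] with r hr
  have h1 := hb r (r * y) hr.1 hr.2 (mul_nonneg hr.1.le hy) (by nlinarith [hr.1])
  rw [Real.norm_eq_abs, Real.norm_eq_abs, abs_of_pos (show 0 < r ^ 3 by have := hr.1; positivity)]
  refine le_trans (le_of_eq ?_) h1
  congr 1
  simp only [Prod.smul_mk, smul_eq_mul, mul_one]
  ring

lemma contDiffAt_massV_zero (h : IsInterior α ξ β γ δ rmax Ψ Y) :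
    ContDiffAt ℝ 3 (massV Ψ Y) 0 := h.contDiffAt_massV le_rfl le_rfl h.rmax_pos.le

lemma fderiv_massV_zero (h : IsInterior α ξ β γ δ rmax Ψ Y) : fderiv ℝ (massV Ψ Y) 0 = 0 := by
  have h0 := (derivs_ray_of_isLittleO h.contDiffAt_massV_zero
    (h.isLittleO_ray le_rfl zero_le_one)).1
  have h1 := (derivs_ray_of_isLittleO h.contDiffAt_massV_zero
    (h.isLittleO_ray zero_le_one le_rfl)).1
  rw [fderiv_apply_eq] at h0 h1
  ext
  · rw [ContinuousLinearMap.comp_apply, fderiv_apply_eq]; simp; linarith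
  · rw [ContinuousLinearMap.comp_apply, fderiv_apply_eq]; simp; linarith

/-- The second derivative is a symmetric bilinear form on the plane whose quadratic form vanishes on
(1, 0), (1, 1) and (1, 1/2). Three pairwise independent directions force it to be zero. -/
lemma fderiv_fderiv_massV_zero (h : IsInterior α ξ β γ δ rmax Ψ Y) :
    fderiv ℝ (fderiv ℝ (massV Ψ Y)) 0 = 0 := by
  have hs : IsSymmSndFDerivAt ℝ (massV Ψ Y) 0 :=
    h.contDiffAt_massV_zero.isSymmSndFDerivAt (by simp; norm_num)
  set L := fderiv ℝ (fderiv ℝ (massV Ψ Y)) 0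
  have hexp : ∀ v w : ℝ × ℝ, L v w = v.1 * w.1 * L (1, 0) (1, 0) +
      (v.1 * w.2 + v.2 * w.1) * L (1, 0) (0, 1) + v.2 * w.2 * L (0, 1) (0, 1) := by
    intro v w
    have hv : v = v.1 • (1, 0) + v.2 • ((0, 1) : ℝ × ℝ) := by ext <;> simp
    have hw : w = w.1 • (1, 0) + w.2 • ((0, 1) : ℝ × ℝ) := by ext <;> simp
    have hs' : L (0, 1) (1, 0) = L (1, 0) (0, 1) := hs _ _
    conv_lhs => rw [hv, hw]
    simp only [map_add, map_smul, _root_.add_apply, _root_.smul_apply,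
      smul_eq_mul, hs']
    ring
  have h0 := (derivs_ray_of_isLittleO h.contDiffAt_massV_zero
    (h.isLittleO_ray le_rfl zero_le_one)).2.1
  have h1 := (derivs_ray_of_isLittleO h.contDiffAt_massV_zero
    (h.isLittleO_ray zero_le_one le_rfl)).2.1
  have h2 := (derivs_ray_of_isLittleO h.contDiffAt_massV_zero
    (h.isLittleO_ray (y := 1 / 2) (by norm_num) (by norm_num))).2.1
  change L _ _ = 0 at h0 h1 h2
  rw [hexp] at h0 h1 h2
  simp only at h0 h1 h2
  have e0 : L (1, 0) (1, 0) = 0 := by linarith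
  have e1 : L (1, 0) (0, 1) = 0 := by linarith
  have e2 : L (0, 1) (0, 1) = 0 := by linarith
  refine ContinuousLinearMap.ext fun v => ContinuousLinearMap.ext fun w => ?_
  rw [hexp, e0, e1, e2]
  simp

/-- Near the centre the gradient of `R u²` is `O(r²)` and its oscillation over a ball of radius `r`
is `O(r)` times the distance. -/
lemma fderiv_massV_bound (h : IsInterior α ξ β γ δ rmax Ψ Y) :
    ∃ C > 0, ∃ ε > 0, ∀ r < ε, ∀ p ∈ Metric.closedBall (0 : ℝ × ℝ) r,
      ∀ q ∈ Metric.closedBall (0 : ℝ × ℝ) r,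
      ‖fderiv ℝ (massV Ψ Y) p - fderiv ℝ (massV Ψ Y) q‖ ≤ C * r * ‖p - q‖ := by
  have hL : ContDiffAt ℝ 2 (fderiv ℝ (massV Ψ Y)) 0 :=
    h.contDiffAt_massV_zero.fderiv_right (by norm_num)
  have hL' : ContDiffAt ℝ 1 (fderiv ℝ (fderiv ℝ (massV Ψ Y))) 0 := hL.fderiv_right (by norm_num)
  obtain ⟨C, hC⟩ := (hL'.differentiableAt (by simp)).isBigO_sub.bound
  obtain ⟨ε, hε, hb⟩ := Metric.eventually_nhds_iff_ball.1 ((hL.eventually (by simp)).and hC)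
  refine ⟨|C| + 1, by positivity, ε, hε, fun r hr p hp q hq => ?_⟩
  have hsub : ∀ x ∈ Metric.closedBall (0 : ℝ × ℝ) r, x ∈ Metric.ball (0 : ℝ × ℝ) ε :=
    fun x hx => Metric.closedBall_subset_ball hr hx
  refine (convex_closedBall (0 : ℝ × ℝ) r).norm_image_sub_le_of_norm_fderiv_le (𝕜 := ℝ)
    (fun x hx => ((hb x (hsub x hx)).1.differentiableAt (by simp))) (fun x hx => ?_) hq hp
  have h1 : ‖fderiv ℝ (fderiv ℝ (massV Ψ Y)) x‖ ≤ C * ‖x‖ := by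
    have h2 := (hb x (hsub x hx)).2
    rw [h.fderiv_fderiv_massV_zero, sub_zero x] at h2
    exact (congrArg norm (sub_zero (fderiv ℝ (fderiv ℝ (massV Ψ Y)) x))).symm.le.trans h2
  have h2 : ‖x‖ ≤ r := by simpa using hx
  have h3 : C * ‖x‖ ≤ |C| * ‖x‖ := mul_le_mul_of_nonneg_right (le_abs_self C) (norm_nonneg x)
  nlinarith [norm_nonneg x, abs_nonneg C]

/-- In a thin wedge R ≤ ε r the terms with a factor R are negligible. For the derivatives, ∂_r(R u²)
= 3 α r² + o(r²) is known on the axis by `derivs_ray_of_isLittleO`, and `fderiv_massV_bound` carries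
it to the point (r, R) at the cost of C r R. The same bound makes ∂_R(R u²) of order r², which
suffices because it is multiplied by R / r³. -/
lemma wedge_bounds (h : IsInterior α ξ β γ δ rmax Ψ Y) (hα : 0 < α) {η : ℝ} (hη : 0 < η) :
    ∃ ε > 0, ε ≤ 1 ∧ ∃ r₀ > 0, r₀ ≤ rmax ∧ ∀ r R : ℝ, 0 < r → r < r₀ → 0 ≤ R → R ≤ ε * r →
      |massV Ψ Y (r, R) / (α * r ^ 3) - 1| ≤ η ∧
      |dFst (massV Ψ Y) (r, R) / (3 * α * r ^ 2) - 1| ≤ η ∧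
      |Y r R - 1| ≤ η ∧ |R * dSnd (Function.uncurry Y) (r, R)| ≤ η ∧
      |dSnd (massV Ψ Y) (r, R) * (R / (α * r ^ 3))| ≤ η := by
  obtain ⟨C, hC, ε₁, hε₁, hb⟩ := h.fderiv_massV_bound
  obtain ⟨ε₂, hε₂, hε₂m, hT⟩ := h.taylor_bound (show 0 < α * η / 2 by positivity)
  have hV0 := (derivs_ray_of_isLittleO h.contDiffAt_massV_zero
    (h.isLittleO_ray le_rfl zero_le_one)).2.2.bound (show 0 < α * η by positivity)
  obtain ⟨ε₃, hε₃, hV0⟩ := Metric.eventually_nhds_iff_ball.1 hV0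
  have hYc := h.contDiff_Y 0 0 le_rfl le_rfl h.rmax_pos.le
  have hY1 : ∀ᶠ p in 𝓝 ((0 : ℝ), (0 : ℝ)), |Y p.1 p.2 - 1| < η := by
    have : Tendsto (fun p : ℝ × ℝ => |Y p.1 p.2 - 1|) (𝓝 (0, 0)) (𝓝 |Y 0 0 - 1|) :=
      (hYc.continuousAt.tendsto.sub_const 1).abs
    rw [h.Y_center, sub_self, abs_zero] at this
    exact this.eventually_lt_const hη
  have hY2 : ∀ᶠ p in 𝓝 ((0 : ℝ), (0 : ℝ)), |p.2 * dSnd (Function.uncurry Y) p| < η := by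
    have h1 : ContinuousAt (fun p => dSnd (Function.uncurry Y) p) ((0 : ℝ), (0 : ℝ)) :=
      ((hYc.fderiv_right (m := 2) (by norm_num)).continuousAt.clm_apply continuousAt_const)
    have : Tendsto (fun p : ℝ × ℝ => |p.2 * dSnd (Function.uncurry Y) p|) (𝓝 (0, 0))
        (𝓝 |0 * dSnd (Function.uncurry Y) (0, 0)|) :=
      ((continuousAt_snd.mul h1).abs).tendsto
    rw [zero_mul, abs_zero] at this
    exact this.eventually_lt_const hη
  obtain ⟨ε₄, hε₄, hY⟩ := Metric.eventually_nhds_iff_ball.1 (hY1.and hY2)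
  -- Collects the coefficients of all terms that carry a factor R; `ε` is chosen so that ε K ≤ α η /
  -- 2.
  set K := |β| + |γ| + |δ| + C + 1 with hK
  have hK0 : 0 < K := by positivity
  set ε := min 1 (α * η / (2 * K)) with hε
  have hε0 : 0 < ε := lt_min one_pos (by positivity)
  have hεK : ε * K ≤ α * η / 2 := by
    have : ε ≤ α * η / (2 * K) := min_le_right _ _
    calc ε * K ≤ α * η / (2 * K) * K := by gcongr
      _ = α * η / 2 := by field_simp
  refine ⟨ε, hε0, min_le_left _ _, min (min ε₁ ε₂) (min ε₃ ε₄), by positivity,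
    ((min_le_left _ _).trans (min_le_right _ _)).trans hε₂m, fun r R hr hrr hR hRr => ?_⟩
  have hr1 : r < ε₁ := hrr.trans_le ((min_le_left _ _).trans (min_le_left _ _))
  have hr2 : r < ε₂ := hrr.trans_le ((min_le_left _ _).trans (min_le_right _ _))
  have hr3 : r < ε₃ := hrr.trans_le ((min_le_right _ _).trans (min_le_left _ _))
  have hr4 : r < ε₄ := hrr.trans_le ((min_le_right _ _).trans (min_le_right _ _))
  have hε1 : ε ≤ 1 := min_le_left _ _
  have hRr' : R ≤ r := hRr.trans (by nlinarith)
  have hnorm : ‖((r, R) : ℝ × ℝ)‖ = r := by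
    rw [Prod.norm_def, Real.norm_eq_abs, Real.norm_eq_abs, abs_of_pos hr, abs_of_nonneg hR,
      max_eq_left hRr']
  have hball : (r, R) ∈ Metric.closedBall (0 : ℝ × ℝ) r := by simp [hnorm]
  have hball4 : (r, R) ∈ Metric.ball ((0 : ℝ), (0 : ℝ)) ε₄ := by
    change (r, R) ∈ Metric.ball (0 : ℝ × ℝ) ε₄
    rw [mem_ball_zero_iff, hnorm]
    exact hr4
  have hball0 : (r, (0 : ℝ)) ∈ Metric.closedBall (0 : ℝ × ℝ) r := by
    simp [Prod.norm_def, abs_of_pos hr, hr.le]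
  have hα3 : 0 < α * r ^ 3 := by positivity
  have hα2 : 0 < 3 * α * r ^ 2 := by positivity
  refine ⟨?_, ?_, ?_, ?_, ?_⟩
  · have h1 := hT r R hr hr2 hR hRr'
    have h2 : |β * r ^ 2 * R + γ * r * R ^ 2 + δ * R ^ 3| ≤ ε * K * r ^ 3 := by
      have hb1 : |β * r ^ 2 * R| ≤ |β| * (ε * r ^ 3) := by
        rw [abs_mul, abs_mul, abs_of_nonneg hR, abs_of_nonneg (sq_nonneg r), mul_assoc]
        refine mul_le_mul_of_nonneg_left ?_ (abs_nonneg _)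
        calc r ^ 2 * R ≤ r ^ 2 * (ε * r) := by gcongr
          _ = _ := by ring
      have hb2 : |γ * r * R ^ 2| ≤ |γ| * (ε * r ^ 3) := by
        rw [abs_mul, abs_mul, abs_of_pos hr, abs_of_nonneg (sq_nonneg R), mul_assoc]
        refine mul_le_mul_of_nonneg_left ?_ (abs_nonneg _)
        calc r * R ^ 2 = r * (R * R) := by ring
          _ ≤ r * (ε * r * r) := by gcongr
          _ = _ := by ring
      have hb3 : |δ * R ^ 3| ≤ |δ| * (ε * r ^ 3) := by
        rw [abs_mul, abs_of_nonneg (pow_nonneg hR 3)]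
        refine mul_le_mul_of_nonneg_left ?_ (abs_nonneg _)
        calc R ^ 3 = R * R * R := by ring
          _ ≤ ε * r * r * r := by gcongr
          _ = _ := by ring
      have h3 := abs_add_three (β * r ^ 2 * R) (γ * r * R ^ 2) (δ * R ^ 3)
      have h4 : 0 ≤ ε * r ^ 3 := by positivity
      have h5 : ε * K * r ^ 3 = |β| * (ε * r ^ 3) + |γ| * (ε * r ^ 3) + |δ| * (ε * r ^ 3) +
        (C + 1) * (ε * r ^ 3) := by rw [hK]; ring
      have h6 : 0 ≤ (C + 1) * (ε * r ^ 3) := by positivity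
      linarith
    have h3 : |massV Ψ Y (r, R) - α * r ^ 3| ≤ η * (α * r ^ 3) := by
      have h4 := abs_add_le (massV Ψ Y (r, R) -
        (α * r ^ 3 + β * r ^ 2 * R + γ * r * R ^ 2 + δ * R ^ 3))
        (β * r ^ 2 * R + γ * r * R ^ 2 + δ * R ^ 3)
      have h5 : ε * K * r ^ 3 ≤ α * η / 2 * r ^ 3 := by gcongr
      rw [show massV Ψ Y (r, R) - (α * r ^ 3 + β * r ^ 2 * R + γ * r * R ^ 2 + δ * R ^ 3) +
        (β * r ^ 2 * R + γ * r * R ^ 2 + δ * R ^ 3) = massV Ψ Y (r, R) - α * r ^ 3 by ring] at h4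
      linarith
    rw [div_sub_one hα3.ne', abs_div, abs_of_pos hα3, div_le_iff₀ hα3]
    exact h3
  · have h1 := hV0 r (by simpa [abs_of_pos hr] using hr3)
    simp only [Prod.smul_mk, smul_eq_mul, mul_one, mul_zero, Real.norm_eq_abs, add_zero, ne_eq,
      OfNat.ofNat_ne_zero, not_false_eq_true, zero_pow] at h1
    rw [abs_of_nonneg (sq_nonneg r)] at h1
    have h2 := hb r hr1 _ hball _ hball0
    have h3 : |dFst (massV Ψ Y) (r, R) - dFst (massV Ψ Y) (r, 0)| ≤ C * r * R := by
      have h4 := (fderiv ℝ (massV Ψ Y) (r, R) - fderiv ℝ (massV Ψ Y) (r, 0)).le_opNorm (1, 0)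
      have h5 : ‖((1, 0) : ℝ × ℝ)‖ = 1 := by simp [Prod.norm_def]
      have h6 : ‖((r, R) - (r, 0) : ℝ × ℝ)‖ = R := by simp [Prod.norm_def, abs_of_nonneg hR, hR]
      rw [h5, mul_one] at h4
      rw [h6] at h2
      exact h4.trans h2
    have h4 : C * r * R ≤ α * η / 2 * r ^ 2 := by
      calc C * r * R ≤ C * r * (ε * r) := by gcongr
        _ = ε * C * r ^ 2 := by ring
        _ ≤ ε * K * r ^ 2 := by
          gcongr
          rw [hK]; linarith [abs_nonneg β, abs_nonneg γ, abs_nonneg δ]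
        _ ≤ _ := by gcongr
    rw [div_sub_one hα2.ne', abs_div, abs_of_pos hα2, div_le_iff₀ hα2]
    have h5 := abs_add_le (dFst (massV Ψ Y) (r, R) - dFst (massV Ψ Y) (r, 0))
      (dFst (massV Ψ Y) (r, 0) - 3 * α * r ^ 2)
    rw [sub_add_sub_cancel] at h5
    have h6 : |dFst (massV Ψ Y) (r, 0) - 3 * α * r ^ 2| ≤ α * η * r ^ 2 := h1
    have h7 : 0 ≤ α * η * r ^ 2 := by positivity
    linarith
  · exact (hY (r, R) hball4).1.le
  · exact (hY (r, R) hball4).2.le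
  · have h2 := hb r hr1 _ hball 0 (by simp [hr.le])
    rw [h.fderiv_massV_zero, sub_zero, sub_zero, hnorm] at h2
    have h4 := (fderiv ℝ (massV Ψ Y) (r, R)).le_opNorm (0, 1)
    have h5 : ‖((0, 1) : ℝ × ℝ)‖ = 1 := by simp [Prod.norm_def]
    rw [h5, mul_one] at h4
    have h6 : |dSnd (massV Ψ Y) (r, R)| ≤ C * r * r := h4.trans h2
    rw [abs_mul, abs_of_nonneg (show 0 ≤ R / (α * r ^ 3) by positivity), ← mul_div_assoc,
      div_le_iff₀ hα3]
    calc |dSnd (massV Ψ Y) (r, R)| * R ≤ C * r * r * (ε * r) := by gcongr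
      _ = ε * C * r ^ 3 := by ring
      _ ≤ ε * K * r ^ 3 := by
          gcongr
          rw [hK]; linarith [abs_nonneg β, abs_nonneg γ, abs_nonneg δ]
      _ ≤ α * η / 2 * r ^ 3 := by gcongr
      _ ≤ _ := by
        have : 0 ≤ α * η * r ^ 3 := by positivity
        linarith

end IsInterior

end interior

/-! ### The function `G` and the rates near the centre -/

section rates

variable {α ξ β γ δ rmax : ℝ} {Ψ Y : ℝ → ℝ → ℝ}

lemma integral_sqrt_zero {R : ℝ} (hR : 0 ≤ R) :
    ∫ x in (0 : ℝ)..R, Real.sqrt x = 2 / 3 * (R * Real.sqrt R) := by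
  simp_rw [Real.sqrt_eq_rpow]
  rw [integral_rpow (Or.inl (by norm_num)), Real.zero_rpow (by norm_num),
    Real.rpow_add_one' hR (by norm_num)]
  ring

lemma u_eq {r R : ℝ} (hR : R ≠ 0) : u Ψ Y r R = Real.sqrt (massV Ψ Y (r, R) / R) := by
  unfold u
  rw [uSq_eq hR]

namespace IsInterior

lemma differentiableAt_massV (h : IsInterior α ξ β γ δ rmax Ψ Y) {r R : ℝ} (h0 : 0 ≤ R)
    (h1 : R ≤ r) (h2 : r ≤ rmax) : DifferentiableAt ℝ (massV Ψ Y) (r, R) :=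
  (h.contDiffAt_massV h0 h1 h2).differentiableAt (by simp)

lemma contDiffAt_dFst_massV (h : IsInterior α ξ β γ δ rmax Ψ Y) {r R : ℝ} (h0 : 0 ≤ R)
    (h1 : R ≤ r) (h2 : r ≤ rmax) : ContDiffAt ℝ 2 (dFst (massV Ψ Y)) (r, R) :=
  ((h.contDiffAt_massV h0 h1 h2).fderiv_right (m := 2) (by norm_num)).clm_apply contDiffAt_const

lemma contDiffAt_dSnd_massV (h : IsInterior α ξ β γ δ rmax Ψ Y) {r R : ℝ} (h0 : 0 ≤ R)
    (h1 : R ≤ r) (h2 : r ≤ rmax) : ContDiffAt ℝ 2 (dSnd (massV Ψ Y)) (r, R) :=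
  ((h.contDiffAt_massV h0 h1 h2).fderiv_right (m := 2) (by norm_num)).clm_apply contDiffAt_const

lemma u_pos (h : IsInterior α ξ β γ δ rmax Ψ Y) {r R : ℝ} (h0 : 0 < R) (h1 : R ≤ r)
    (h2 : r ≤ rmax) : 0 < u Ψ Y r R := Real.sqrt_pos.2 (h.uSq_pos r R h0 h1 h2)

lemma hasDerivAt_u_fst (h : IsInterior α ξ β γ δ rmax Ψ Y) {r R : ℝ} (h0 : 0 < R) (h1 : R ≤ r)
    (h2 : r ≤ rmax) :
    HasDerivAt (fun ρ => u Ψ Y ρ R) (dFst (massV Ψ Y) (r, R) / R / (2 * u Ψ Y r R)) r := by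
  have hV := (hasDerivAt_dFst (h.differentiableAt_massV h0.le h1 h2)).div_const R
  have hp : massV Ψ Y (r, R) / R ≠ 0 :=
    (div_pos (h.massV_pos h0.le h1 h2 (h0.trans_le h1)) h0).ne'
  simp_rw [u_eq h0.ne']
  exact hV.sqrt hp

/-- With V = σ u² one has 1/u = √σ V^{-1/2}. In this form the integrand is continuous down to σ = 0,
where u itself is singular, so that G(r, R) can be compared with G(r, 0). -/
lemma kernelG_eq (h : IsInterior α ξ β γ δ rmax Ψ Y) {r σ : ℝ} (h0 : 0 < σ) (h1 : σ ≤ r)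
    (h2 : r ≤ rmax) :
    1 / Y r σ * deriv (fun ρ => 1 / u Ψ Y ρ σ) r = kernelG Ψ Y (r, σ) := by
  have hu := h.u_pos h0 h1 h2
  have hd : deriv (fun ρ => 1 / u Ψ Y ρ σ) r =
      -(dFst (massV Ψ Y) (r, σ) / σ / (2 * u Ψ Y r σ)) / u Ψ Y r σ ^ 2 := by
    simp_rw [one_div]
    exact ((h.hasDerivAt_u_fst h0 h1 h2).inv hu.ne').deriv
  have hV := h.massV_pos h0.le h1 h2 (h0.trans_le h1)
  have hY := h.Y_pos r σ h0.le h1 h2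
  rw [hd, u_eq h0.ne', Real.sqrt_div hV.le]
  unfold kernelG
  have h3 : 0 < Real.sqrt σ := Real.sqrt_pos.2 h0
  have h4 : 0 < Real.sqrt (massV Ψ Y (r, σ)) := Real.sqrt_pos.2 hV
  have h5 : Real.sqrt σ ^ 2 = σ := Real.sq_sqrt h0.le
  have h6 : Real.sqrt (massV Ψ Y (r, σ)) ^ 2 = massV Ψ Y (r, σ) := Real.sq_sqrt hV.le
  generalize Real.sqrt σ = s at *
  generalize Real.sqrt (massV Ψ Y (r, σ)) = v at *
  rw [← h6]
  have h7 : σ ≠ 0 := h0.ne'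
  field_simp
  rw [← h5]

lemma continuousAt_kernelG (h : IsInterior α ξ β γ δ rmax Ψ Y) {r R : ℝ} (h0 : 0 ≤ R)
    (h1 : R ≤ r) (h2 : r ≤ rmax) (hr : 0 < r) : ContinuousAt (kernelG Ψ Y) (r, R) := by
  have hV := h.massV_pos h0 h1 h2 hr
  have hY := h.Y_pos r R h0 h1 h2
  have hYc : ContinuousAt (fun p : ℝ × ℝ => Y p.1 p.2) (r, R) :=
    (h.contDiff_Y r R h0 h1 h2).continuousAt
  have hVc := (h.contDiffAt_massV h0 h1 h2).continuousAt
  have hFc := (h.contDiffAt_dFst_massV h0 h1 h2).continuousAt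
  refine ContinuousAt.div ?_ ?_ ?_
  · exact ((Real.continuous_sqrt.continuousAt.comp continuousAt_snd).mul hFc).neg
  · exact (continuousAt_const.mul hYc).mul (hVc.mul (Real.continuous_sqrt.continuousAt.comp hVc))
  · have := Real.sqrt_pos.2 hV
    positivity

lemma continuousOn_kernelG (h : IsInterior α ξ β γ δ rmax Ψ Y) {r : ℝ} (h2 : r ≤ rmax)
    (hr : 0 < r) : ContinuousOn (fun σ => kernelG Ψ Y (r, σ)) (Icc 0 r) := fun σ hσ =>
  ((h.continuousAt_kernelG hσ.1 hσ.2 h2 hr).comp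
    (f := fun σ => (r, σ)) (by fun_prop)).continuousWithinAt

lemma intervalIntegrable_kernelG (h : IsInterior α ξ β γ δ rmax Ψ Y) {r a b : ℝ} (h2 : r ≤ rmax)
    (hr : 0 < r) (ha : a ∈ Icc 0 r) (hb : b ∈ Icc 0 r) :
    IntervalIntegrable (fun σ => kernelG Ψ Y (r, σ)) MeasureTheory.volume a b :=
  ((h.continuousOn_kernelG h2 hr).mono (ordConnected_Icc.uIcc_subset ha hb)).intervalIntegrable

lemma G_eq (h : IsInterior α ξ β γ δ rmax Ψ Y) {r R : ℝ} (h0 : 0 ≤ R) (h1 : R ≤ r)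
    (h2 : r ≤ rmax) :
    G Ψ Y r R = (∫ σ in R..r, kernelG Ψ Y (r, σ)) + 1 / (Y r r * u Ψ Y r r) := by
  unfold G
  congr 1
  refine intervalIntegral.integral_congr_Ioo_of_le h1 fun σ hσ => ?_
  exact h.kernelG_eq (h0.trans_lt hσ.1) hσ.2.le h2

lemma G_sub (h : IsInterior α ξ β γ δ rmax Ψ Y) {r R : ℝ} (h0 : 0 ≤ R) (h1 : R ≤ r)
    (h2 : r ≤ rmax) (hr : 0 < r) :
    G Ψ Y r R = G Ψ Y r 0 - ∫ σ in (0 : ℝ)..R, kernelG Ψ Y (r, σ) := by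
  rw [h.G_eq h0 h1 h2, h.G_eq le_rfl hr.le h2, ← intervalIntegral.integral_add_adjacent_intervals
    (h.intervalIntegrable_kernelG h2 hr ⟨le_rfl, hr.le⟩ ⟨h0, h1⟩)
    (h.intervalIntegrable_kernelG h2 hr ⟨h0, h1⟩ ⟨hr.le, le_rfl⟩)]
  ring

/-- The quotient of the kernel by its leading term is a continuous function of V / (α r³), ∂_r V /
(3 α r²) and Y, all of which are close to 1 in the wedge. -/
lemma wedge_kernelG (h : IsInterior α ξ β γ δ rmax Ψ Y) (hα : 0 < α) {η : ℝ} (hη : 0 < η) :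
    ∃ ε > 0, ε ≤ 1 ∧ ∃ r₀ > 0, r₀ ≤ rmax ∧ ∀ r R : ℝ, 0 < r → r < r₀ → 0 ≤ R → R ≤ ε * r →
      |-kernelG Ψ Y (r, R) - 3 / 2 * (α * r ^ 2 / (α * r ^ 3 * Real.sqrt (α * r ^ 3))) * Real.sqrt R|
        ≤ η * (3 / 2 * (α * r ^ 2 / (α * r ^ 3 * Real.sqrt (α * r ^ 3))) * Real.sqrt R) := by
  have hc : ContinuousAt (fun p : ℝ × ℝ × ℝ => |p.2.1 / (p.2.2 * (p.1 * Real.sqrt p.1)) - 1|)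
      (1, 1, 1) := by
    have : ContinuousAt (fun p : ℝ × ℝ × ℝ => p.2.1 / (p.2.2 * (p.1 * Real.sqrt p.1))) (1, 1, 1) := by
      refine ContinuousAt.div (by fun_prop) (by fun_prop) (by simp)
    fun_prop
  have hev : ∀ᶠ p : ℝ × ℝ × ℝ in 𝓝 (1, 1, 1),
      |p.2.1 / (p.2.2 * (p.1 * Real.sqrt p.1)) - 1| < η := by
    refine hc.eventually_lt_const ?_
    simpa using hη
  obtain ⟨κ, hκ, hb⟩ := Metric.eventually_nhds_iff.1 hev
  obtain ⟨ε, hε, hε1, r₀, hr₀, hr₀m, hw⟩ := h.wedge_bounds hα (show 0 < κ / 2 by positivity)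
  refine ⟨ε, hε, hε1, r₀, hr₀, hr₀m, fun r R hr hrr hR hRr => ?_⟩
  obtain ⟨h1, h2, h3, -, -⟩ := hw r R hr hrr hR hRr
  have hα3 : 0 < α * r ^ 3 := by positivity
  have h4 := hb (y := (massV Ψ Y (r, R) / (α * r ^ 3), dFst (massV Ψ Y) (r, R) / (3 * α * r ^ 2),
    Y r R)) (by
      simp only [Prod.dist_eq, Real.dist_eq, max_lt_iff]
      exact ⟨by linarith, by linarith, by linarith⟩)
  simp only at h4
  set D := α * r ^ 3 with hD
  have hRr' : R ≤ r := hRr.trans (by nlinarith)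
  have hV := h.massV_pos hR hRr' (hrr.le.trans hr₀m) hr
  have hY := h.Y_pos r R hR hRr' (hrr.le.trans hr₀m)
  have hsD := Real.sqrt_pos.2 hα3
  have hsV := Real.sqrt_pos.2 hV
  have hsp : 0 ≤ 3 / 2 * (α * r ^ 2 / (D * Real.sqrt D)) * Real.sqrt R := by positivity
  have e : -kernelG Ψ Y (r, R) = 3 / 2 * (α * r ^ 2 / (D * Real.sqrt D)) * Real.sqrt R *
      (dFst (massV Ψ Y) (r, R) / (3 * α * r ^ 2) /
        (Y r R * (massV Ψ Y (r, R) / D * Real.sqrt (massV Ψ Y (r, R) / D)))) := by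
    rw [Real.sqrt_div hV.le]
    unfold kernelG
    field_simp
  rw [e, ← mul_sub_one, abs_mul, abs_of_nonneg hsp, mul_comm]
  exact mul_le_mul_of_nonneg_right h4.le hsp

/-- The term ξ / α is the value on the axis. The term z³ is the integral of the leading part of the
kernel: the integral of √σ over [0, R] is (2/3) R^{3/2}, and R = z² (α r³). -/
lemma wedge_G (h : IsInterior α ξ β γ δ rmax Ψ Y) (hα : 0 < α) {η : ℝ} (hη : 0 < η) :
    ∃ ε > 0, ε ≤ 1 ∧ ∃ r₀ > 0, r₀ ≤ rmax ∧ ∀ r z : ℝ, 0 < r → r < r₀ → 0 ≤ z →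
      α * z ^ 2 * r ^ 3 ≤ ε * r →
      |G Ψ Y r (α * z ^ 2 * r ^ 3) / (α * r ^ 2) - (ξ / α + z ^ 3)| ≤ η * (1 + z ^ 3) := by
  obtain ⟨ε, hε, hε1, r₁, hr₁, hr₁m, hk⟩ := h.wedge_kernelG hα hη
  have h0 := h.taylor_G.bound (show 0 < η * α by positivity)
  obtain ⟨r₂, hr₂, h0⟩ := mem_nhdsGT_iff_exists_Ioo_subset.1 h0
  refine ⟨ε, hε, hε1, min r₁ r₂, lt_min hr₁ hr₂, (min_le_left _ _).trans hr₁m,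
    fun r z hr hrr hz hR => ?_⟩
  have hrr₁ := hrr.trans_le (min_le_left _ _)
  have h1 : ‖G Ψ Y r 0 - ξ * r ^ 2‖ ≤ η * α * ‖r ^ 2‖ := h0 ⟨hr, hrr.trans_le (min_le_right _ _)⟩
  rw [Real.norm_eq_abs, Real.norm_eq_abs, abs_of_nonneg (sq_nonneg r)] at h1
  set R := α * z ^ 2 * r ^ 3 with hRdef
  have hR0 : 0 ≤ R := by positivity
  have hRr : R ≤ r := hR.trans (by nlinarith)
  have hrm : r ≤ rmax := hrr₁.le.trans hr₁m
  set D := α * r ^ 3 with hD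
  have hD0 : 0 < D := by positivity
  have hsD := Real.sqrt_pos.2 hD0
  set K := 3 / 2 * (α * r ^ 2 / (D * Real.sqrt D)) with hK
  have hK0 : 0 < K := by positivity
  have hRz : Real.sqrt R = z * Real.sqrt D := by
    rw [show R = z ^ 2 * D by rw [hRdef, hD]; ring, Real.sqrt_mul (sq_nonneg z), Real.sqrt_sq hz]
  have hint : ∫ σ in (0 : ℝ)..R, K * Real.sqrt σ = α * r ^ 2 * z ^ 3 := by
    rw [intervalIntegral.integral_const_mul, integral_sqrt_zero hR0, hRz, hK,
      show R = z ^ 2 * D by rw [hRdef, hD]; ring]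
    field_simp
  have hi1 : IntervalIntegrable (fun σ => -kernelG Ψ Y (r, σ)) MeasureTheory.volume 0 R :=
    (h.intervalIntegrable_kernelG hrm hr ⟨le_rfl, hr.le⟩ ⟨hR0, hRr⟩).neg
  have hi2 : IntervalIntegrable (fun σ => K * Real.sqrt σ) MeasureTheory.volume 0 R :=
    (continuous_const.mul Real.continuous_sqrt).intervalIntegrable _ _
  have hdiff : |(∫ σ in (0 : ℝ)..R, -kernelG Ψ Y (r, σ)) - α * r ^ 2 * z ^ 3| ≤
      η * (α * r ^ 2 * z ^ 3) := by
    rw [← hint, ← intervalIntegral.integral_sub hi1 hi2, ← intervalIntegral.integral_const_mul,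
      ← Real.norm_eq_abs]
    refine intervalIntegral.norm_integral_le_of_norm_le hR0 ?_ (hi2.const_mul η)
    refine Filter.Eventually.of_forall fun σ hσ => ?_
    exact hk r σ hr hrr₁ hσ.1.le (hσ.2.trans hR)
  have hG := h.G_sub hR0 hRr hrm hr
  rw [intervalIntegral.integral_neg] at hdiff
  have hα2 : 0 < α * r ^ 2 := by positivity
  have e : G Ψ Y r R / (α * r ^ 2) - (ξ / α + z ^ 3) =
      ((G Ψ Y r 0 - ξ * r ^ 2) + (-(∫ σ in (0 : ℝ)..R, kernelG Ψ Y (r, σ)) - α * r ^ 2 * z ^ 3)) /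
        (α * r ^ 2) := by
    rw [hG]
    field_simp
    ring
  rw [e, abs_div, abs_of_pos hα2, div_le_iff₀ hα2]
  refine (abs_add_le _ _).trans ?_
  calc _ ≤ η * α * r ^ 2 + η * (α * r ^ 2 * z ^ 3) := add_le_add h1 hdiff
    _ = _ := by ring

end IsInterior

/-- The rate of decrease of `z = (R / (α r³))^{1/2}` in the time `-log r`. -/
noncomputable def rateA (α : ℝ) (Ψ Y : ℝ → ℝ → ℝ) (r z w : ℝ) : ℝ :=
  let R := α * z ^ 2 * r ^ 3
  let q := Real.sqrt (massV Ψ Y (r, R) / (α * r ^ 3))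
  let g := G Ψ Y r R / (α * r ^ 2)
  (z * w * (q * Y r R * g) - q ^ 2 * g - 3 * z ^ 4 * w) / (2 * z ^ 3 * w)

/-- The rate of decrease of `artanh w` in the time `-log r`. -/
noncomputable def rateB (α : ℝ) (Ψ Y : ℝ → ℝ → ℝ) (r z w : ℝ) : ℝ :=
  let R := α * z ^ 2 * r ^ 3
  let q := Real.sqrt (massV Ψ Y (r, R) / (α * r ^ 3))
  let g := G Ψ Y r R / (α * r ^ 2)
  (2 * z * (q * (Y r R - R * dSnd (Function.uncurry Y) (r, R)) * g) +
    w * (g * (dSnd (massV Ψ Y) (r, R) * z ^ 2) - 3 * (q ^ 2 * g) +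
      3 * z ^ 3 * (dFst (massV Ψ Y) (r, R) / (3 * α * r ^ 2) / (Y r R * q)))) / (2 * z ^ 4 * w)

lemma abs_mul_sub_le {ω κ z m g : ℝ} (hω : 0 ≤ ω) (hz : 0 ≤ z) (hκ1 : κ ≤ 1) (hm : |m - 1| ≤ κ)
    (hg : |g - (ω + z ^ 3)| ≤ κ * (1 + z ^ 3)) :
    |m * g - (ω + z ^ 3)| ≤ (ω + 3) * κ * (1 + z ^ 3) := by
  have hz3 : 0 ≤ z ^ 3 := by positivity
  have hκ : 0 ≤ κ := (abs_nonneg _).trans hm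
  have hm2 : |m| ≤ 2 := by
    have := abs_add_le (m - 1) 1
    rw [sub_add_cancel, abs_one] at this
    linarith
  have e : m * g - (ω + z ^ 3) = m * (g - (ω + z ^ 3)) + (m - 1) * (ω + z ^ 3) := by ring
  have h1 : |m * (g - (ω + z ^ 3))| ≤ 2 * (κ * (1 + z ^ 3)) := by
    rw [abs_mul]
    exact mul_le_mul hm2 hg (abs_nonneg _) (by norm_num)
  have h2 : |(m - 1) * (ω + z ^ 3)| ≤ κ * ((ω + 1) * (1 + z ^ 3)) := by
    rw [abs_mul, abs_of_nonneg (by positivity : 0 ≤ ω + z ^ 3)]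
    refine mul_le_mul hm ?_ (by positivity) hκ
    nlinarith [mul_nonneg hω hz3]
  rw [e]
  calc _ ≤ _ := abs_add_le _ _
    _ ≤ 2 * (κ * (1 + z ^ 3)) + κ * ((ω + 1) * (1 + z ^ 3)) := add_le_add h1 h2
    _ = _ := by ring

/-- With every mᵢ = 1, g = ω + z³ and v = 0 the two numerators are exactly `driftZ` and `driftW`.
The deviations are bounded by multiples of (1 + z)(1 + z³), hence of 1 + z⁴. -/
lemma ratesClose_of_close {ω κ z w m₁ m₂ m₃ m₄ g v : ℝ} (hω : 0 ≤ ω) (hz : 0 < z) (hw : 0 < w)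
    (hw1 : w ≤ 1) (hκ1 : κ ≤ 1) (h1 : |m₁ - 1| ≤ κ) (h2 : |m₂ - 1| ≤ κ) (h3 : |m₃ - 1| ≤ κ)
    (h4 : |m₄ - 1| ≤ κ) (hv : |v| ≤ κ) (hg : |g - (ω + z ^ 3)| ≤ κ * (1 + z ^ 3)) :
    RatesClose ω (14 * ((ω + 3) * κ) * (1 + z ^ 4)) z w
      ((z * w * (m₁ * g) - m₂ * g - 3 * z ^ 4 * w) / (2 * z ^ 3 * w))
      ((2 * z * (m₃ * g) + w * (g * v - 3 * (m₂ * g) + 3 * z ^ 3 * m₄)) / (2 * z ^ 4 * w)) := by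
  have hκ : 0 ≤ κ := (abs_nonneg _).trans h1
  have hz3 : 0 < z ^ 3 := by positivity
  have e1 := abs_mul_sub_le hω hz.le hκ1 h1 hg
  have e2 := abs_mul_sub_le hω hz.le hκ1 h2 hg
  have e3 := abs_mul_sub_le hω hz.le hκ1 h3 hg
  set H := (ω + 3) * κ with hH
  have hH0 : 0 ≤ H := by positivity
  have hHκ : 3 * κ ≤ H := by nlinarith
  have hzz : z + z ^ 3 ≤ 1 + z ^ 4 := by
    nlinarith [mul_nonneg (sq_nonneg (1 - z)) (by positivity : 0 ≤ 1 + z + z ^ 2)]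
  have hP : (1 + z) * (H * (1 + z ^ 3)) ≤ 2 * H * (1 + z ^ 4) := by
    nlinarith [mul_nonneg hH0 (sub_nonneg.2 hzz)]
  have hHz : 0 ≤ H * (1 + z ^ 3) := by positivity
  have hgv : |g * v| ≤ H * (1 + z ^ 3) := by
    have hg' : |g| ≤ (ω + 2) * (1 + z ^ 3) := by
      have h5 := abs_add_le (g - (ω + z ^ 3)) (ω + z ^ 3)
      rw [sub_add_cancel, abs_of_nonneg (by positivity : 0 ≤ ω + z ^ 3)] at h5
      nlinarith [mul_nonneg hω hz3.le]
    rw [abs_mul]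
    calc |g| * |v| ≤ (ω + 2) * (1 + z ^ 3) * κ :=
          mul_le_mul hg' hv (abs_nonneg _) (by positivity)
      _ ≤ _ := by rw [hH]; nlinarith [mul_nonneg hκ (by positivity : 0 ≤ 1 + z ^ 3)]
  have h4' : |3 * z ^ 3 * (m₄ - 1)| ≤ H * (1 + z ^ 3) := by
    rw [abs_mul, abs_of_nonneg (by positivity : 0 ≤ 3 * z ^ 3)]
    calc 3 * z ^ 3 * |m₄ - 1| ≤ 3 * z ^ 3 * κ := by gcongr
      _ ≤ _ := by nlinarith
  constructor
  · have e : 2 * z ^ 3 * w * ((z * w * (m₁ * g) - m₂ * g - 3 * z ^ 4 * w) / (2 * z ^ 3 * w)) -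
        driftZ ω z w = z * w * (m₁ * g - (ω + z ^ 3)) + -(m₂ * g - (ω + z ^ 3)) := by
      rw [mul_div_cancel₀ _ (by positivity)]
      unfold driftZ
      ring
    rw [e]
    have h5 : |z * w * (m₁ * g - (ω + z ^ 3))| ≤ z * (H * (1 + z ^ 3)) := by
      rw [abs_mul, abs_of_nonneg (by positivity : 0 ≤ z * w)]
      refine mul_le_mul ?_ e1 (abs_nonneg _) hz.le
      nlinarith
    have h6 := abs_add_le (z * w * (m₁ * g - (ω + z ^ 3))) (-(m₂ * g - (ω + z ^ 3)))
    rw [abs_neg] at h6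
    have h7 : 0 ≤ H * (1 + z ^ 4) := by positivity
    nlinarith
  · have e : 2 * z ^ 4 * w * ((2 * z * (m₃ * g) + w * (g * v - 3 * (m₂ * g) + 3 * z ^ 3 * m₄)) /
        (2 * z ^ 4 * w)) - driftW ω z w = 2 * z * (m₃ * g - (ω + z ^ 3)) +
        w * (g * v + -(3 * (m₂ * g - (ω + z ^ 3))) + 3 * z ^ 3 * (m₄ - 1)) := by
      rw [mul_div_cancel₀ _ (by positivity)]
      unfold driftW
      ring
    rw [e]
    have h5 : |2 * z * (m₃ * g - (ω + z ^ 3))| ≤ 2 * z * (H * (1 + z ^ 3)) := by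
      rw [abs_mul, abs_of_nonneg (by positivity : 0 ≤ 2 * z)]
      exact mul_le_mul_of_nonneg_left e3 (by positivity)
    have h6 : |w * (g * v + -(3 * (m₂ * g - (ω + z ^ 3))) + 3 * z ^ 3 * (m₄ - 1))| ≤
        5 * (H * (1 + z ^ 3)) := by
      rw [abs_mul, abs_of_pos hw]
      have h7 := abs_add_three (g * v) (-(3 * (m₂ * g - (ω + z ^ 3)))) (3 * z ^ 3 * (m₄ - 1))
      rw [abs_neg, abs_mul 3, abs_of_pos (by norm_num : (0 : ℝ) < 3)] at h7
      calc _ ≤ 1 * |g * v + -(3 * (m₂ * g - (ω + z ^ 3))) + 3 * z ^ 3 * (m₄ - 1)| :=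
            mul_le_mul_of_nonneg_right hw1 (abs_nonneg _)
        _ ≤ _ := by linarith
    have h8 := abs_add_le (2 * z * (m₃ * g - (ω + z ^ 3)))
      (w * (g * v + -(3 * (m₂ * g - (ω + z ^ 3))) + 3 * z ^ 3 * (m₄ - 1)))
    have h9 : 0 ≤ z * (H * (1 + z ^ 3)) := by positivity
    nlinarith

/-- Bounds for the metric functions at the point `(r, α z² r³)`. -/
structure WedgeBounds (α ω : ℝ) (Ψ Y : ℝ → ℝ → ℝ) (r z : ℝ) : Prop where
  Y_gt : 15 / 16 < Y r (α * z ^ 2 * r ^ 3)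
  Y_lt : Y r (α * z ^ 2 * r ^ 3) < 17 / 16
  G_ge : 1 / 2 * (α * r ^ 2) ≤ G Ψ Y r (α * z ^ 2 * r ^ 3)
  G_le : G Ψ Y r (α * z ^ 2 * r ^ 3) ≤ (ω + 1 + 2 * z ^ 3) * (α * r ^ 2)
  V_gt : 15 / 16 * (α * r ^ 3) < massV Ψ Y (r, α * z ^ 2 * r ^ 3)
  V_lt : massV Ψ Y (r, α * z ^ 2 * r ^ 3) < 17 / 16 * (α * r ^ 3)
  Vr_gt : 2 * (α * r ^ 2) < dFst (massV Ψ Y) (r, α * z ^ 2 * r ^ 3)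
  VR_lt : |dSnd (massV Ψ Y) (r, α * z ^ 2 * r ^ 3) * z ^ 2| < 1 / 16
  YR_lt : |α * z ^ 2 * r ^ 3 * dSnd (Function.uncurry Y) (r, α * z ^ 2 * r ^ 3)| < 1 / 16

/-- The estimate is uniform over all z with R ≤ ε r, however large, with an error relative to 1 +
z⁴. It is needed before a ray is known to have bounded z; `box_rates` is the version for bounded z.
-/
lemma IsInterior.wedge_rates (h : IsInterior α ξ β γ δ rmax Ψ Y) (hα : 0 < α) (hξ : α ≤ ξ)
    {η : ℝ} (hη : 0 < η) :
    ∃ ε > 0, ε ≤ 1 ∧ ∃ r₀ > 0, r₀ ≤ rmax ∧ ∀ r z w : ℝ, 0 < r → r < r₀ → 0 < z → 0 < w → w ≤ 1 →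
      α * z ^ 2 * r ^ 3 ≤ ε * r →
      RatesClose (ξ / α) (η * (1 + z ^ 4)) z w (rateA α Ψ Y r z w) (rateB α Ψ Y r z w) ∧
      WedgeBounds α (ξ / α) Ψ Y r z := by
  have hω1 : 1 ≤ ξ / α := (one_le_div hα).2 hξ
  have hω : 0 ≤ ξ / α := by linarith
  set ω := ξ / α with hωdef
  set κ := min (1 / 16) (η / (14 * (ω + 3))) with hκdef
  have hκ0 : 0 < κ := by positivity
  have hκη : 14 * ((ω + 3) * κ) ≤ η := by
    have : κ ≤ η / (14 * (ω + 3)) := min_le_right _ _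
    rw [le_div_iff₀ (by positivity)] at this
    linarith
  have hκ1 : κ ≤ 1 / 16 := min_le_left _ _
  have hev : ∀ᶠ p : ℝ × ℝ × ℝ × ℝ in 𝓝 (1, 1, 1, 0),
      |Real.sqrt p.1 * p.2.1 - 1| < κ ∧ |Real.sqrt p.1 * (p.2.1 - p.2.2.2) - 1| < κ ∧
        |p.2.2.1 / (p.2.1 * Real.sqrt p.1) - 1| < κ := by
    have c1 : ContinuousAt (fun p : ℝ × ℝ × ℝ × ℝ => |Real.sqrt p.1 * p.2.1 - 1|) (1, 1, 1, 0) := by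
      fun_prop
    have c2 : ContinuousAt (fun p : ℝ × ℝ × ℝ × ℝ => |Real.sqrt p.1 * (p.2.1 - p.2.2.2) - 1|)
      (1, 1, 1, 0) := by fun_prop
    have c3 : ContinuousAt (fun p : ℝ × ℝ × ℝ × ℝ => p.2.2.1 / (p.2.1 * Real.sqrt p.1))
      (1, 1, 1, 0) := ContinuousAt.div (by fun_prop) (by fun_prop) (by simp)
    have c4 : ContinuousAt (fun p : ℝ × ℝ × ℝ × ℝ => |p.2.2.1 / (p.2.1 * Real.sqrt p.1) - 1|)
      (1, 1, 1, 0) := by fun_prop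
    refine (c1.eventually_lt_const (by simpa using hκ0)).and
      ((c2.eventually_lt_const (by simpa using hκ0)).and
        (c4.eventually_lt_const (by simpa using hκ0)))
  obtain ⟨κ', hκ', hb⟩ := Metric.eventually_nhds_iff.1 hev
  obtain ⟨ε₁, hε₁, hε₁1, r₁, hr₁, hr₁m, hw₁⟩ := h.wedge_bounds hα
    (show 0 < min (κ / 2) (κ' / 2) by positivity)
  obtain ⟨ε₂, hε₂, hε₂1, r₂, hr₂, hr₂m, hw₂⟩ := h.wedge_G hα hκ0
  refine ⟨min ε₁ ε₂, lt_min hε₁ hε₂, (min_le_left _ _).trans hε₁1, min r₁ r₂, lt_min hr₁ hr₂,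
    (min_le_left _ _).trans hr₁m, fun r z w hr hrr hz hw hw1 hR => ?_⟩
  have hg := hw₂ r z hr (hrr.trans_le (min_le_right _ _)) hz.le
    (hR.trans (mul_le_mul_of_nonneg_right (min_le_right _ _) hr.le))
  obtain ⟨b1, b2, b3, b4, b5⟩ := hw₁ r (α * z ^ 2 * r ^ 3) hr (hrr.trans_le (min_le_left _ _))
    (by positivity) (hR.trans (mul_le_mul_of_nonneg_right (min_le_left _ _) hr.le))
  have hm1 : min (κ / 2) (κ' / 2) ≤ κ / 2 := min_le_left _ _
  have hm2 : min (κ / 2) (κ' / 2) ≤ κ' / 2 := min_le_right _ _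
  have h4 := hb (y := (massV Ψ Y (r, α * z ^ 2 * r ^ 3) / (α * r ^ 3), Y r (α * z ^ 2 * r ^ 3),
    dFst (massV Ψ Y) (r, α * z ^ 2 * r ^ 3) / (3 * α * r ^ 2),
    α * z ^ 2 * r ^ 3 * dSnd (Function.uncurry Y) (r, α * z ^ 2 * r ^ 3))) (by
      simp only [Prod.dist_eq, Real.dist_eq, max_lt_iff, sub_zero]
      exact ⟨by linarith, by linarith, by linarith, by linarith⟩)
  simp only at h4
  obtain ⟨h5, h6, h7⟩ := h4
  have hα3 : 0 < α * r ^ 3 := by positivity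
  have hα2 : 0 < α * r ^ 2 := by positivity
  have hz3 : 0 < z ^ 3 := by positivity
  obtain ⟨b1l, b1u⟩ := abs_le.1 b1
  obtain ⟨b2l, b2u⟩ := abs_le.1 b2
  obtain ⟨b3l, b3u⟩ := abs_le.1 b3
  obtain ⟨gl, gu⟩ := abs_le.1 hg
  have hκz : κ * (1 + z ^ 3) ≤ 1 / 16 * (1 + z ^ 3) := by gcongr
  have hVp : 15 / 16 < massV Ψ Y (r, α * z ^ 2 * r ^ 3) / (α * r ^ 3) := by linarith
  have hVu : massV Ψ Y (r, α * z ^ 2 * r ^ 3) / (α * r ^ 3) < 17 / 16 := by linarith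
  have hz2 : α * z ^ 2 * r ^ 3 / (α * r ^ 3) = z ^ 2 := by field_simp
  rw [hz2] at b5
  refine ⟨?_, by linarith, by linarith, ?_, ?_, ?_, ?_, ?_, by linarith, by linarith⟩
  rotate_left
  · rw [← le_div_iff₀ hα2]; linarith
  · rw [← div_le_iff₀ hα2]; linarith
  · rwa [lt_div_iff₀ hα3] at hVp
  · rwa [div_lt_iff₀ hα3] at hVu
  · have : 2 / 3 < dFst (massV Ψ Y) (r, α * z ^ 2 * r ^ 3) / (3 * α * r ^ 2) := by linarith
    rw [lt_div_iff₀ (by positivity)] at this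
    linarith
  · have hsq : Real.sqrt (massV Ψ Y (r, α * z ^ 2 * r ^ 3) / (α * r ^ 3)) ^ 2 =
        massV Ψ Y (r, α * z ^ 2 * r ^ 3) / (α * r ^ 3) := Real.sq_sqrt (by linarith)
    have := ratesClose_of_close (m₂ := Real.sqrt (massV Ψ Y (r, α * z ^ 2 * r ^ 3) /
        (α * r ^ 3)) ^ 2) (v := dSnd (massV Ψ Y) (r, α * z ^ 2 * r ^ 3) * z ^ 2)
      hω hz hw hw1 (by linarith) h5.le (by rw [hsq]; linarith) h6.le h7.le
      (by linarith) hg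
    refine this.mono ?_
    gcongr

end rates

/-! ### Smoothness of `G` -/

section smooth

/-- Differentiation under the integral sign, dominated by the maximum of the partial derivative over
a compact neighbourhood times [0, 1]. -/
lemma contDiffAt_intervalIntegral {E : Type*} [NormedAddCommGroup E] [NormedSpace ℝ E]
    [ProperSpace E] {K : E × ℝ → ℝ} {U : Set E} (hU : IsOpen U)
    (hK : ∀ p ∈ U, ∀ t ∈ Icc (0 : ℝ) 1, ContDiffAt ℝ 1 K (p, t)) {p₀ : E} (hp₀ : p₀ ∈ U) :
    ContDiffAt ℝ 1 (fun p => ∫ t in (0 : ℝ)..1, K (p, t)) p₀ := by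
  set D : E → ℝ → E →L[ℝ] ℝ := fun p t => (fderiv ℝ K (p, t)).comp (ContinuousLinearMap.inl ℝ E ℝ)
    with hD
  have hDc : ∀ p ∈ U, ∀ t ∈ Icc (0 : ℝ) 1, ContinuousAt (fun q : E × ℝ => D q.1 q.2) (p, t) := by
    intro p hp t ht
    have : ContinuousAt (fderiv ℝ K) (p, t) :=
      ((hK p hp t ht).fderiv_right (m := 0) (by norm_num)).continuousAt
    exact this.clm_comp continuousAt_const
  have hKd : ∀ p ∈ U, ∀ t ∈ Icc (0 : ℝ) 1, HasFDerivAt (fun p => K (p, t)) (D p t) p := by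
    intro p hp t ht
    exact ((hK p hp t ht).differentiableAt one_ne_zero).hasFDerivAt.comp p
      (hasFDerivAt_prodMk_left p t)
  obtain ⟨ρ, hρ, hball⟩ := Metric.nhds_basis_closedBall.mem_iff.1 (hU.mem_nhds hp₀)
  have hcomp : IsCompact (Metric.closedBall p₀ ρ ×ˢ Icc (0 : ℝ) 1) :=
    (isCompact_closedBall _ _).prod isCompact_Icc
  obtain ⟨C, hC⟩ := hcomp.exists_bound_of_continuousOn
    (f := fun q : E × ℝ => D q.1 q.2)
    (fun q hq => (hDc q.1 (hball hq.1) q.2 hq.2).continuousWithinAt)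
  have hIoc : uIoc (0 : ℝ) 1 ⊆ Icc 0 1 := by
    rw [uIoc_of_le zero_le_one]; exact Ioc_subset_Icc_self
  have hmeas : ∀ p ∈ U, MeasureTheory.AEStronglyMeasurable (fun t => K (p, t))
      (MeasureTheory.volume.restrict (uIoc (0 : ℝ) 1)) := fun p hp =>
    (ContinuousOn.mono (fun t ht => ((hK p hp t ht).continuousAt.comp
      (f := fun t => (p, t)) (by fun_prop)).continuousWithinAt) hIoc).aestronglyMeasurable
      measurableSet_uIoc
  have hmeasD : ∀ p ∈ U, MeasureTheory.AEStronglyMeasurable (fun t => D p t)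
      (MeasureTheory.volume.restrict (uIoc (0 : ℝ) 1)) := fun p hp =>
    (ContinuousOn.mono (fun t ht => ((hDc p hp t ht).comp
      (f := fun t => (p, t)) (by fun_prop)).continuousWithinAt) hIoc).aestronglyMeasurable
      measurableSet_uIoc
  have hint : ∀ p ∈ U, IntervalIntegrable (fun t => K (p, t)) MeasureTheory.volume 0 1 := fun p hp =>
    ContinuousOn.intervalIntegrable (by
      rw [uIcc_of_le zero_le_one]
      exact fun t ht => ((hK p hp t ht).continuousAt.comp
        (f := fun t => (p, t)) (by fun_prop)).continuousWithinAt)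
  rw [contDiffAt_one_iff]
  refine ⟨fun p => ∫ t in (0 : ℝ)..1, D p t, Metric.ball p₀ ρ, Metric.ball_mem_nhds _ hρ, ?_, ?_⟩
  · intro p hp
    refine (intervalIntegral.continuousAt_of_dominated_interval (bound := fun _ => C) ?_ ?_
      intervalIntegrable_const ?_).continuousWithinAt
    · filter_upwards [Metric.isOpen_ball.mem_nhds hp] with x hx
      exact hmeasD x (hball (Metric.ball_subset_closedBall hx))
    · filter_upwards [Metric.isOpen_ball.mem_nhds hp] with x hx
      exact Eventually.of_forall fun t ht =>
        hC (x, t) ⟨Metric.ball_subset_closedBall hx, hIoc ht⟩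
    · exact Eventually.of_forall fun t ht =>
        (hDc p (hball (Metric.ball_subset_closedBall hp)) t (hIoc ht)).comp
          (f := fun x => (x, t)) (by fun_prop)
  · intro p hp
    refine intervalIntegral.hasFDerivAt_integral_of_dominated_of_fderiv_le
      (F := fun p t => K (p, t)) (F' := D) (bound := fun _ => C) (Metric.isOpen_ball.mem_nhds hp)
      ?_ (hint p (hball (Metric.ball_subset_closedBall hp)))
      (hmeasD p (hball (Metric.ball_subset_closedBall hp))) ?_ intervalIntegrable_const ?_
    · filter_upwards [Metric.isOpen_ball.mem_nhds hp] with x hx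
      exact hmeas x (hball (Metric.ball_subset_closedBall hx))
    · exact Eventually.of_forall fun t ht x hx =>
        hC (x, t) ⟨Metric.ball_subset_closedBall hx, hIoc ht⟩
    · exact Eventually.of_forall fun t ht x hx =>
        hKd x (hball (Metric.ball_subset_closedBall hx)) t (hIoc ht)

variable {α ξ β γ δ rmax : ℝ} {Ψ Y : ℝ → ℝ → ℝ}

namespace IsInterior

lemma contDiffAt_kernelG (h : IsInterior α ξ β γ δ rmax Ψ Y) {r R : ℝ} (h0 : 0 < R)
    (h1 : R ≤ r) (h2 : r ≤ rmax) : ContDiffAt ℝ 2 (kernelG Ψ Y) (r, R) := by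
  have hV := h.massV_pos h0.le h1 h2 (h0.trans_le h1)
  have hY := h.Y_pos r R h0.le h1 h2
  have hYc : ContDiffAt ℝ 2 (fun p : ℝ × ℝ => Y p.1 p.2) (r, R) :=
    (h.contDiff_Y r R h0.le h1 h2).of_le (by norm_num)
  have hVc : ContDiffAt ℝ 2 (massV Ψ Y) (r, R) :=
    (h.contDiffAt_massV h0.le h1 h2).of_le (by norm_num)
  have hFc := h.contDiffAt_dFst_massV h0.le h1 h2
  refine ContDiffAt.div ?_ ?_ ?_
  · exact ((contDiffAt_snd.sqrt h0.ne').mul hFc).neg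
  · exact (contDiffAt_const.mul hYc).mul (hVc.mul (hVc.sqrt hV.ne'))
  · have := Real.sqrt_pos.2 hV
    positivity

/-- The substitution σ = (r - R) t + R carries the moving limits of integration to the fixed
interval [0, 1]. For R > 0 the factor √σ in the kernel is smooth on the range of integration. -/
lemma contDiffAt_G (h : IsInterior α ξ β γ δ rmax Ψ Y) {r R : ℝ} (h0 : 0 < R) (h1 : R < r)
    (h2 : r < rmax) : ContDiffAt ℝ 1 (Function.uncurry (G Ψ Y)) (r, R) := by
  set U : Set (ℝ × ℝ) := {p | 0 < p.2 ∧ p.2 < p.1 ∧ p.1 < rmax} with hUdef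
  have hU : IsOpen U := (isOpen_lt continuous_const continuous_snd).inter
    ((isOpen_lt continuous_snd continuous_fst).inter (isOpen_lt continuous_fst continuous_const))
  have hp : (r, R) ∈ U := ⟨h0, h1, h2⟩
  have hK : ∀ p ∈ U, ∀ t ∈ Icc (0 : ℝ) 1, ContDiffAt ℝ 1
      (fun q : (ℝ × ℝ) × ℝ => kernelG Ψ Y (q.1.1, (q.1.1 - q.1.2) * q.2 + q.1.2)) (p, t) := by
    intro p hp t ht
    have h3 : 0 ≤ (p.1 - p.2) * t := mul_nonneg (by linarith [hp.2.1]) ht.1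
    have h4 : ContDiffAt ℝ 1 (kernelG Ψ Y) (p.1, (p.1 - p.2) * t + p.2) :=
      (h.contDiffAt_kernelG (by linarith [hp.1])
        (by nlinarith [mul_le_mul_of_nonneg_left ht.2 (sub_nonneg.2 hp.2.1.le)])
        hp.2.2.le).of_le (by norm_num)
    have h5 : ContDiffAt ℝ 1
        (fun q : (ℝ × ℝ) × ℝ => (q.1.1, (q.1.1 - q.1.2) * q.2 + q.1.2)) (p, t) := by fun_prop
    exact h4.comp (p, t) h5
  have hI := contDiffAt_intervalIntegral hU hK hp
  have hbd : ContDiffAt ℝ 1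
      (fun p : ℝ × ℝ => 1 / (Y p.1 p.1 * Real.sqrt (massV Ψ Y (p.1, p.1) / p.1))) (r, R) := by
    have hr : 0 < r := h0.trans h1
    have hdiag : ContDiffAt ℝ 1 (fun p : ℝ × ℝ => (p.1, p.1)) (r, R) := by fun_prop
    have hY : ContDiffAt ℝ 1 (Function.uncurry Y) (r, r) :=
      (h.contDiff_Y r r hr.le le_rfl h2.le).of_le (by norm_num)
    have hV : ContDiffAt ℝ 1 (massV Ψ Y) (r, r) :=
      (h.contDiffAt_massV hr.le le_rfl h2.le).of_le (by norm_num)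
    have hVp := div_pos (h.massV_pos hr.le le_rfl h2.le hr) hr
    have hYp := h.Y_pos r r hr.le le_rfl h2.le
    have hV' : ContDiffAt ℝ 1 (fun p : ℝ × ℝ => massV Ψ Y (p.1, p.1)) (r, R) :=
      ContDiffAt.comp (g := massV Ψ Y) (f := fun p : ℝ × ℝ => (p.1, p.1)) (r, R) hV hdiag
    have hY' : ContDiffAt ℝ 1 (fun p : ℝ × ℝ => Y p.1 p.1) (r, R) :=
      ContDiffAt.comp (g := Function.uncurry Y) (f := fun p : ℝ × ℝ => (p.1, p.1)) (r, R) hY hdiag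
    have h6 : ContDiffAt ℝ 1 (fun p : ℝ × ℝ => massV Ψ Y (p.1, p.1) / p.1) (r, R) :=
      hV'.fun_div contDiffAt_fst hr.ne'
    refine contDiffAt_const.fun_div (hY'.mul (h6.sqrt hVp.ne')) ?_
    exact (mul_pos hYp (Real.sqrt_pos.2 hVp)).ne'
  have hmain := ((contDiffAt_fst.sub contDiffAt_snd).mul hI).add hbd
  refine hmain.congr_of_eventuallyEq ?_
  filter_upwards [hU.mem_nhds hp] with p hp
  simp only [Function.uncurry]
  rw [h.G_eq hp.1.le hp.2.1.le hp.2.2.le, u_eq (hp.1.trans hp.2.1).ne']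
  refine congrArg₂ (· + ·) ?_ rfl
  show _ = (p.1 - p.2) * ∫ t in (0 : ℝ)..1, kernelG Ψ Y (p.1, (p.1 - p.2) * t + p.2)
  rw [intervalIntegral.mul_integral_comp_mul_add (f := fun σ => kernelG Ψ Y (p.1, σ))]
  congr 1 <;> ring

lemma hasDerivAt_G_snd (h : IsInterior α ξ β γ δ rmax Ψ Y) {r R : ℝ} (h0 : 0 < R) (h1 : R < r)
    (h2 : r ≤ rmax) : HasDerivAt (fun x => G Ψ Y r x) (-kernelG Ψ Y (r, R)) R := by
  have hr : 0 < r := h0.trans h1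
  have hd : HasDerivAt (fun x => (∫ σ in x..r, kernelG Ψ Y (r, σ)) + 1 / (Y r r * u Ψ Y r r))
      (-kernelG Ψ Y (r, R)) R := by
    refine HasDerivAt.add_const _ ?_
    refine intervalIntegral.integral_hasDerivAt_left
      (h.intervalIntegrable_kernelG h2 hr ⟨h0.le, h1.le⟩ ⟨hr.le, le_rfl⟩) ?_ ?_
    · refine ContinuousOn.stronglyMeasurableAtFilter_nhdsWithin (s := Ioo 0 r) ?_ measurableSet_Ioo R
        |>.filter_mono ?_
      · exact (h.continuousOn_kernelG h2 hr).mono Ioo_subset_Icc_self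
      · rw [isOpen_Ioo.nhdsWithin_eq ⟨h0, h1⟩]
    · exact (h.continuousOn_kernelG h2 hr).continuousAt (Icc_mem_nhds h0 h1)
  refine hd.congr_of_eventuallyEq ?_
  filter_upwards [Ioo_mem_nhds h0 h1] with x hx
  exact h.G_eq hx.1.le hx.2.le h2

lemma contDiffAt_rates (h : IsInterior α ξ β γ δ rmax Ψ Y) (hα : 0 < α) {t z w : ℝ} (hz : 0 < z)
    (hw : 0 < w) (hR : α * z ^ 2 * Real.exp (-t) ^ 3 < Real.exp (-t)) (hr : Real.exp (-t) < rmax) :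
    ContDiffAt ℝ 1 (fun p : ℝ × ℝ × ℝ => rateA α Ψ Y (Real.exp (-p.1)) p.2.1 p.2.2) (t, z, w) ∧
    ContDiffAt ℝ 1 (fun p : ℝ × ℝ × ℝ => rateB α Ψ Y (Real.exp (-p.1)) p.2.1 p.2.2) (t, z, w) := by
  have hr0 : 0 < Real.exp (-t) := Real.exp_pos _
  have hcr : ContDiff ℝ 1 fun p : ℝ × ℝ × ℝ => Real.exp (-p.1) := by fun_prop
  have hcR : ContDiff ℝ 1 fun p : ℝ × ℝ × ℝ => α * p.2.1 ^ 2 * Real.exp (-p.1) ^ 3 := by fun_prop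
  have hpt : ContDiffAt ℝ 1 (fun p : ℝ × ℝ × ℝ =>
      (Real.exp (-p.1), α * p.2.1 ^ 2 * Real.exp (-p.1) ^ 3)) (t, z, w) :=
    hcr.contDiffAt.prodMk hcR.contDiffAt
  have hR0 : 0 < α * z ^ 2 * Real.exp (-t) ^ 3 := by positivity
  have hG := (h.contDiffAt_G hR0 hR hr).comp (t, z, w) hpt
  have hY := (((h.contDiff_Y _ _ hR0.le hR.le hr.le)).of_le
    (show (1 : WithTop ℕ∞) ≤ 3 by norm_num)).comp (t, z, w) hpt
  have hY' := (((h.contDiff_Y _ _ hR0.le hR.le hr.le).fderiv_right (m := 1)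
    (by norm_num)).clm_apply (contDiffAt_const (c := ((0 : ℝ), (1 : ℝ))))).comp (t, z, w) hpt
  have hV := (((h.contDiffAt_massV hR0.le hR.le hr.le)).of_le
    (show (1 : WithTop ℕ∞) ≤ 3 by norm_num)).comp (t, z, w) hpt
  have hVr := ((h.contDiffAt_dFst_massV hR0.le hR.le hr.le).of_le
    (show (1 : WithTop ℕ∞) ≤ 2 by norm_num)).comp (t, z, w) hpt
  have hVR := ((h.contDiffAt_dSnd_massV hR0.le hR.le hr.le).of_le
    (show (1 : WithTop ℕ∞) ≤ 2 by norm_num)).comp (t, z, w) hpt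
  have hVp := h.massV_pos hR0.le hR.le hr.le hr0
  have hYp := h.Y_pos _ _ hR0.le hR.le hr.le
  have hα3 : α * Real.exp (-t) ^ 3 ≠ 0 := by positivity
  have hq := (hV.div (contDiffAt_const.mul (hcr.contDiffAt.pow 3)) hα3).sqrt (by
    exact (div_pos hVp (by positivity)).ne')
  have hqp : 0 < Real.sqrt (massV Ψ Y (Real.exp (-t), α * z ^ 2 * Real.exp (-t) ^ 3) /
    (α * Real.exp (-t) ^ 3)) := Real.sqrt_pos.2 (div_pos hVp (by positivity))
  have hg := hG.div (contDiffAt_const.mul (hcr.contDiffAt.pow 2)) (by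
    show α * Real.exp (-t) ^ 2 ≠ 0
    positivity)
  have cz : ContDiffAt ℝ 1 (fun p : ℝ × ℝ × ℝ => p.2.1) (t, z, w) := contDiffAt_snd.fst
  have cw : ContDiffAt ℝ 1 (fun p : ℝ × ℝ × ℝ => p.2.2) (t, z, w) := contDiffAt_snd.snd
  have cR : ContDiffAt ℝ 1 (fun p : ℝ × ℝ × ℝ => α * p.2.1 ^ 2 * Real.exp (-p.1) ^ 3) (t, z, w) :=
    hcR.contDiffAt
  constructor
  · refine ContDiffAt.div (((((cz.mul cw).mul ((hq.mul hY).mul hg)).sub ((hq.pow 2).mul hg)).sub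
      ((contDiffAt_const.mul (cz.pow 4)).mul cw))) ((contDiffAt_const.mul (cz.pow 3)).mul cw) ?_
    show 2 * z ^ 3 * w ≠ 0
    positivity
  · refine ContDiffAt.div (((contDiffAt_const.mul cz).mul ((hq.mul (hY.sub (cR.mul hY'))).mul
      hg)).add (cw.mul (((hg.mul (hVR.mul (cz.pow 2))).sub
        (contDiffAt_const.mul ((hq.pow 2).mul hg))).add ((contDiffAt_const.mul (cz.pow 3)).mul
        ((hVr.div (contDiffAt_const.mul (hcr.contDiffAt.pow 2)) ?_).div (hY.mul hq) ?_)))))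
        ((contDiffAt_const.mul (cz.pow 4)).mul cw) ?_
    · show 3 * α * Real.exp (-t) ^ 2 ≠ 0
      positivity
    · exact (mul_pos hYp hqp).ne'
    · show 2 * z ^ 4 * w ≠ 0
      positivity

lemma box_rates (h : IsInterior α ξ β γ δ rmax Ψ Y) (hα : 0 < α) (hξ : α ≤ ξ) {Z : ℝ} (hZ : 0 < Z)
    {η : ℝ} (hη : 0 < η) :
    ∃ r₀ > 0, r₀ ≤ rmax ∧ ∀ r z w : ℝ, 0 < r → r < r₀ → 0 < z → z ≤ Z + 1 → 0 < w → w ≤ 1 →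
      RatesClose (ξ / α) η z w (rateA α Ψ Y r z w) (rateB α Ψ Y r z w) ∧
      α * z ^ 2 * r ^ 3 < r ∧ WedgeBounds α (ξ / α) Ψ Y r z ∧
      |dFst (Function.uncurry Y) (r, α * z ^ 2 * r ^ 3)| * z ^ 2 * r < 1 / 16 := by
  obtain ⟨ε, hε, hε1, r₀, hr₀, hr₀m, hw⟩ := h.wedge_rates hα hξ
    (show 0 < η / (1 + (Z + 1) ^ 4) by positivity)
  have hYc : ContinuousAt (fun p => |dFst (Function.uncurry Y) p|) ((0 : ℝ), (0 : ℝ)) :=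
    (((h.contDiff_Y 0 0 le_rfl le_rfl h.rmax_pos.le).fderiv_right (m := 2)
      (by norm_num)).continuousAt.clm_apply continuousAt_const).abs
  set C := |dFst (Function.uncurry Y) ((0 : ℝ), (0 : ℝ))| + 1 with hC
  have hC0 : 0 < C := by positivity
  obtain ⟨r₂, hr₂, hY⟩ := Metric.eventually_nhds_iff_ball.1
    (hYc.eventually_lt_const (show _ < C from lt_add_one _))
  -- For r < r₁ and z ≤ Z + 1 one has R / r = α z² r² ≤ ε / 2, so the point lies in the wedge. The
  -- radius `r₃` makes the last product at most 1/32.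
  set r₁ := Real.sqrt (ε / (2 * (α * (Z + 1) ^ 2))) with hr₁
  have hr₁0 : 0 < r₁ := Real.sqrt_pos.2 (by positivity)
  set r₃ := 1 / (32 * (C * (Z + 1) ^ 2)) with hr₃
  have hr₃0 : 0 < r₃ := by positivity
  refine ⟨min (min r₀ r₁) (min r₂ r₃), by positivity,
    ((min_le_left _ _).trans (min_le_left _ _)).trans hr₀m,
    fun r z w hr hrr' hz hzZ hw0 hw1 => ?_⟩
  have hrr : r < min r₀ r₁ := hrr'.trans_le (min_le_left _ _)
  have hrr₂ : r < r₂ := hrr'.trans_le ((min_le_right _ _).trans (min_le_left _ _))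
  have hrr₃ : r < r₃ := hrr'.trans_le ((min_le_right _ _).trans (min_le_right _ _))
  have hrr₁ : r < r₁ := hrr.trans_le (min_le_right _ _)
  have h1 : α * (Z + 1) ^ 2 * r ^ 2 ≤ ε / 2 := by
    have h2 : r ^ 2 ≤ ε / (2 * (α * (Z + 1) ^ 2)) := by
      rw [← Real.sq_sqrt (show 0 ≤ ε / (2 * (α * (Z + 1) ^ 2)) by positivity), ← hr₁]
      gcongr
    rw [le_div_iff₀ (by positivity)] at h2
    linarith
  have h2 : α * z ^ 2 * r ^ 3 ≤ ε / 2 * r := by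
    calc α * z ^ 2 * r ^ 3 ≤ α * (Z + 1) ^ 2 * r ^ 3 := by gcongr
      _ = α * (Z + 1) ^ 2 * r ^ 2 * r := by ring
      _ ≤ _ := by gcongr
  obtain ⟨h3, h4⟩ := hw r z w hr (hrr.trans_le (min_le_left _ _)) hz hw0 hw1
    (by nlinarith)
  have hRr : α * z ^ 2 * r ^ 3 < r := by nlinarith
  have h7 : |dFst (Function.uncurry Y) (r, α * z ^ 2 * r ^ 3)| < C := by
    refine hY _ ?_
    change (r, α * z ^ 2 * r ^ 3) ∈ Metric.ball (0 : ℝ × ℝ) r₂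
    rw [mem_ball_zero_iff, Prod.norm_def, max_lt_iff, Real.norm_eq_abs, Real.norm_eq_abs,
      abs_of_pos hr, abs_of_pos (by positivity)]
    exact ⟨hrr₂, hRr.trans hrr₂⟩
  refine ⟨h3.mono ?_, hRr, h4, ?_⟩
  rotate_left
  · calc |dFst (Function.uncurry Y) (r, α * z ^ 2 * r ^ 3)| * z ^ 2 * r
        ≤ C * (Z + 1) ^ 2 * r₃ := by gcongr
      _ = 1 / 32 := by rw [hr₃]; field_simp
      _ < 1 / 16 := by norm_num
  have h6 : z ^ 4 ≤ (Z + 1) ^ 4 := by gcongr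
  calc η / (1 + (Z + 1) ^ 4) * (1 + z ^ 4) ≤ η / (1 + (Z + 1) ^ 4) * (1 + (Z + 1) ^ 4) := by gcongr
    _ = η := by field_simp

lemma exists_isRates (h : IsInterior α ξ β γ δ rmax Ψ Y) (hα : 0 < α) (hξ : α ≤ ξ) {Z : ℝ}
    (hZ : 0 < Z) {η : ℝ} (hη : 0 < η) :
    ∃ r₀ > 0, r₀ ≤ rmax ∧
      (∀ r z w : ℝ, 0 < r → r < r₀ → 0 < z → z ≤ Z + 1 → 0 < w → w ≤ 1 →
        RatesClose (ξ / α) η z w (rateA α Ψ Y r z w) (rateB α Ψ Y r z w) ∧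
        α * z ^ 2 * r ^ 3 < r ∧ WedgeBounds α (ξ / α) Ψ Y r z ∧
        |dFst (Function.uncurry Y) (r, α * z ^ 2 * r ^ 3)| * z ^ 2 * r < 1 / 16) ∧
      ∀ T₀, Real.exp (-T₀) < r₀ → IsRates (ξ / α) Z T₀ η
        (fun p => rateA α Ψ Y (Real.exp (-p.1)) p.2.1 p.2.2)
        (fun p => rateB α Ψ Y (Real.exp (-p.1)) p.2.1 p.2.2) := by
  obtain ⟨r₀, hr₀, hr₀m, hb⟩ := h.box_rates hα hξ hZ hη
  refine ⟨r₀, hr₀, hr₀m, hb, fun T₀ hT₀ => ?_⟩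
  have hexp : ∀ t ∈ Ici T₀, Real.exp (-t) < r₀ := fun t ht =>
    (Real.exp_le_exp.2 (neg_le_neg ht)).trans_lt hT₀
  have hbox : ∀ x ∈ ratesBox Z, 0 < x.1 ∧ x.1 ≤ Z + 1 ∧ 0 < x.2 ∧ x.2 ≤ 1 := fun x hx =>
    ⟨by linarith [hx.1.1], hx.1.2, by linarith [hx.2.1], hx.2.2⟩
  have hC : ∀ p ∈ Ici T₀ ×ˢ ratesBox Z, _ := fun p hp =>
    let b := hbox p.2 hp.2
    h.contDiffAt_rates hα b.1 b.2.2.1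
      (hb _ p.2.1 p.2.2 (Real.exp_pos _) (hexp p.1 hp.1) b.1 b.2.1 b.2.2.1 b.2.2.2).2.1
      ((hexp p.1 hp.1).trans_le hr₀m)
  refine ⟨fun p hp => (hC p hp).1.contDiffWithinAt, fun p hp => (hC p hp).2.contDiffWithinAt,
    fun t ht x hx => ?_, fun ε hε => ?_⟩
  · obtain ⟨b1, b2, b3, b4⟩ := hbox x hx
    exact (hb _ x.1 x.2 (Real.exp_pos _) (hexp t ht) b1 b2 b3 b4).1
  · obtain ⟨r₁, hr₁, -, hb'⟩ := h.box_rates hα hξ hZ hε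
    have : Tendsto (fun t : ℝ => Real.exp (-t)) atTop (𝓝 0) := Real.tendsto_exp_neg_atTop_nhds_zero
    filter_upwards [this.eventually_lt_const hr₁] with t ht x hx
    obtain ⟨b1, b2, b3, b4⟩ := hbox x hx
    exact (hb' _ x.1 x.2 (Real.exp_pos _) ht b1 b2 b3 b4).1

end IsInterior

end smooth

/-! ### Pointwise geometry of the interior -/

section geometry

variable {α ξ β γ δ rmax : ℝ} {Ψ Y : ℝ → ℝ → ℝ}

lemma hasDerivWithinAt_comp_pair {F : ℝ × ℝ → ℝ} {a b : ℝ → ℝ} {a' b' s : ℝ} {I : Set ℝ}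
    (hF : DifferentiableAt ℝ F (a s, b s)) (ha : HasDerivWithinAt a a' I s)
    (hb : HasDerivWithinAt b b' I s) :
    HasDerivWithinAt (fun t => F (a t, b t)) (a' * dFst F (a s, b s) + b' * dSnd F (a s, b s)) I s := by
  have := hF.hasFDerivAt.comp_hasDerivWithinAt s (ha.prodMk hb)
  rwa [fderiv_apply_eq] at this

namespace IsInterior

lemma u_sq (h : IsInterior α ξ β γ δ rmax Ψ Y) {r R : ℝ} (h0 : 0 < R) (h1 : R ≤ r)
    (h2 : r ≤ rmax) : u Ψ Y r R ^ 2 = massV Ψ Y (r, R) / R := by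
  rw [u_eq h0.ne', Real.sq_sqrt (div_pos (h.massV_pos h0.le h1 h2 (h0.trans_le h1)) h0).le]

lemma contDiffAt_u (h : IsInterior α ξ β γ δ rmax Ψ Y) {r R : ℝ} (h0 : 0 < R) (h1 : R ≤ r)
    (h2 : r ≤ rmax) : ContDiffAt ℝ 1 (Function.uncurry (u Ψ Y)) (r, R) := by
  have hV : ContDiffAt ℝ 1 (massV Ψ Y) (r, R) :=
    (h.contDiffAt_massV h0.le h1 h2).of_le (by norm_num)
  have hp := div_pos (h.massV_pos h0.le h1 h2 (h0.trans_le h1)) h0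
  have h3 : ContDiffAt ℝ 1 (fun p : ℝ × ℝ => Real.sqrt (massV Ψ Y p / p.2)) (r, R) :=
    (hV.fun_div contDiffAt_snd h0.ne').sqrt hp.ne'
  refine h3.congr_of_eventuallyEq ?_
  filter_upwards [(isOpen_lt continuous_const continuous_snd).mem_nhds h0] with p hp
  exact u_eq (ne_of_gt hp)

lemma hasDerivAt_u_snd (h : IsInterior α ξ β γ δ rmax Ψ Y) {r R : ℝ} (h0 : 0 < R) (h1 : R ≤ r)
    (h2 : r ≤ rmax) : HasDerivAt (fun x => u Ψ Y r x)
      ((dSnd (massV Ψ Y) (r, R) / R - massV Ψ Y (r, R) / R ^ 2) / (2 * u Ψ Y r R)) R := by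
  have hV := (hasDerivAt_dSnd (h.differentiableAt_massV h0.le h1 h2)).fun_div (hasDerivAt_id R)
    h0.ne'
  have hp : massV Ψ Y (r, R) / R ≠ 0 :=
    (div_pos (h.massV_pos h0.le h1 h2 (h0.trans_le h1)) h0).ne'
  have h3 := (hV.sqrt hp).congr_of_eventuallyEq (f₁ := fun x => u Ψ Y r x) (by
    filter_upwards [lt_mem_nhds h0] with x hx
    exact u_eq (ne_of_gt hx))
  refine h3.congr_deriv ?_
  rw [u_eq h0.ne']
  simp only [id]
  congr 1
  field_simp

lemma dFst_u (h : IsInterior α ξ β γ δ rmax Ψ Y) {r R : ℝ} (h0 : 0 < R) (h1 : R ≤ r)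
    (h2 : r ≤ rmax) : dFst (Function.uncurry (u Ψ Y)) (r, R) =
      dFst (massV Ψ Y) (r, R) / R / (2 * u Ψ Y r R) :=
  (hasDerivAt_dFst ((h.contDiffAt_u h0 h1 h2).differentiableAt one_ne_zero)).unique
    (h.hasDerivAt_u_fst h0 h1 h2)

lemma dSnd_u (h : IsInterior α ξ β γ δ rmax Ψ Y) {r R : ℝ} (h0 : 0 < R) (h1 : R ≤ r)
    (h2 : r ≤ rmax) : dSnd (Function.uncurry (u Ψ Y)) (r, R) =
      (dSnd (massV Ψ Y) (r, R) / R - massV Ψ Y (r, R) / R ^ 2) / (2 * u Ψ Y r R) :=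
  (hasDerivAt_dSnd ((h.contDiffAt_u h0 h1 h2).differentiableAt one_ne_zero)).unique
    (h.hasDerivAt_u_snd h0 h1 h2)

/-- The fundamental theorem of calculus applied to the definition of G. This relation removes ∂_r u
from the evolution of the frame energy. -/
lemma dSnd_G (h : IsInterior α ξ β γ δ rmax Ψ Y) {r R : ℝ} (h0 : 0 < R) (h1 : R < r)
    (h2 : r < rmax) : dSnd (Function.uncurry (G Ψ Y)) (r, R) =
      dFst (Function.uncurry (u Ψ Y)) (r, R) / (Y r R * u Ψ Y r R ^ 2) := by
  have e : dSnd (Function.uncurry (G Ψ Y)) (r, R) = -kernelG Ψ Y (r, R) :=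
    (hasDerivAt_dSnd ((h.contDiffAt_G h0 h1 h2).differentiableAt one_ne_zero)).unique
      (h.hasDerivAt_G_snd h0 h1 h2.le)
  have hu := h.u_pos h0 h1.le h2.le
  have hd : deriv (fun ρ => 1 / u Ψ Y ρ R) r =
      -(dFst (massV Ψ Y) (r, R) / R / (2 * u Ψ Y r R)) / u Ψ Y r R ^ 2 := by
    simp_rw [one_div]
    exact ((h.hasDerivAt_u_fst h0 h1.le h2.le).inv hu.ne').deriv
  have hY := h.Y_pos r R h0.le h1.le h2.le
  rw [e, ← h.kernelG_eq h0 h1.le h2.le, hd, h.dFst_u h0 h1.le h2.le]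
  field_simp

lemma coeffA_eq (h : IsInterior α ξ β γ δ rmax Ψ Y) {r R : ℝ} (h0 : 0 < R) (h1 : R ≤ r)
    (h2 : r ≤ rmax) :
    coeffA Ψ Y r R = (Y r R ^ 2 - u Ψ Y r R ^ 2) * G Ψ Y r R ^ 2 := by
  have : u Ψ Y r R ^ 2 = uSq Ψ Y r R := Real.sq_sqrt (h.uSq_pos r R h0 h1 h2).le
  rw [this]
  unfold coeffA uSq
  ring

lemma sqrt_massV_eq {r z : ℝ} (hα : 0 < α) (hr : 0 < r) (hz : 0 < z) :
    Real.sqrt (massV Ψ Y (r, α * z ^ 2 * r ^ 3) / (α * r ^ 3)) =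
      z * u Ψ Y r (α * z ^ 2 * r ^ 3) := by
  have hR0 : 0 < α * z ^ 2 * r ^ 3 := by positivity
  rw [u_eq hR0.ne', show massV Ψ Y (r, α * z ^ 2 * r ^ 3) / (α * r ^ 3) =
    z ^ 2 * (massV Ψ Y (r, α * z ^ 2 * r ^ 3) / (α * z ^ 2 * r ^ 3)) by field_simp,
    Real.sqrt_mul (sq_nonneg z), Real.sqrt_sq hz.le]

/-- Since z² is proportional to R / r³, the rate is z / 2 times d log R / d log r - 3, and the slope
dR/dr of a ray is u G (Y - u / w). -/
lemma rateA_eq (hα : 0 < α) {r z w R : ℝ} (hr : 0 < r) (hz : 0 < z)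
    (hw : 0 < w) (hR : R = α * z ^ 2 * r ^ 3) : rateA α Ψ Y r z w =
      z / 2 * (r * u Ψ Y r R * G Ψ Y r R * (Y r R - u Ψ Y r R / w) / R - 3) := by
  unfold rateA
  simp only [sqrt_massV_eq hα hr hz]
  rw [← hR]
  generalize u Ψ Y r R = U
  generalize G Ψ Y r R = g
  generalize Y r R = y
  rw [hR]
  field_simp

/-- Links the normalized expression, suited to the limit r → 0, to the geometric one that appears
when R times the frame energy is differentiated along a ray. -/
lemma rateB_eq (h : IsInterior α ξ β γ δ rmax Ψ Y) (hα : 0 < α) {r z w R : ℝ} (hr : 0 < r)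
    (hz : 0 < z) (hw : 0 < w) (hR : R = α * z ^ 2 * r ^ 3) (h1 : R < r) (h2 : r < rmax)
    (hG : 0 < G Ψ Y r R) : rateB α Ψ Y r z w =
      r * u Ψ Y r R * G Ψ Y r R / w * (Y r R / R - dSnd (Function.uncurry Y) (r, R) +
        w * ((dSnd (Function.uncurry (u Ψ Y)) (r, R) * G Ψ Y r R +
          u Ψ Y r R * dSnd (Function.uncurry (G Ψ Y)) (r, R)) / G Ψ Y r R - u Ψ Y r R / R)) := by
  have h0 : 0 < R := by rw [hR]; positivity
  have hU := h.u_pos h0 h1.le h2.le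
  have hY := h.Y_pos r R h0.le h1.le h2.le
  have hV : massV Ψ Y (r, R) = u Ψ Y r R ^ 2 * R := by
    rw [h.u_sq h0 h1.le h2.le]; field_simp
  rw [h.dSnd_G h0 h1 h2, h.dFst_u h0 h1.le h2.le, h.dSnd_u h0 h1.le h2.le, hV]
  unfold rateB
  simp only [sqrt_massV_eq hα hr hz]
  rw [← hR]
  generalize u Ψ Y r R = U at *
  generalize G Ψ Y r R = g at *
  generalize Y r R = y at *
  generalize dFst (massV Ψ Y) (r, R) = Vr
  generalize dSnd (massV Ψ Y) (r, R) = VR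
  generalize dSnd (Function.uncurry Y) (r, R) = YR
  rw [hR]
  field_simp
  ring

end IsInterior

/-! ### The geodesic equation in components -/

/-- The energy in the comoving frame. -/
noncomputable def frameEnergy (Ψ Y : ℝ → ℝ → ℝ) (x v : Fin 4 → ℝ) : ℝ :=
  G Ψ Y (x 0) (x 1) * Y (x 0) (x 1) * v 0 - v 1 / u Ψ Y (x 0) (x 1)

/-- The radial momentum in the comoving frame. -/
noncomputable def frameMomentum (Ψ Y : ℝ → ℝ → ℝ) (x v : Fin 4 → ℝ) : ℝ :=
  u Ψ Y (x 0) (x 1) * G Ψ Y (x 0) (x 1) * v 0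

lemma interior_momentum_zero (x v : Fin 4 → ℝ) : ∑ ν, interiorMetric Ψ Y x 0 ν * v ν =
    -coeffA Ψ Y (x 0) (x 1) * v 0 - coeffB Ψ Y (x 0) (x 1) * v 1 := by
  simp [Fin.sum_univ_four, interiorMetric]; ring

lemma interior_momentum_one (x v : Fin 4 → ℝ) : ∑ ν, interiorMetric Ψ Y x 1 ν * v ν =
    -coeffB Ψ Y (x 0) (x 1) * v 0 - coeffC Ψ Y (x 0) (x 1) * v 1 := by
  simp [Fin.sum_univ_four, interiorMetric]; ring

lemma interior_momentum_two (x v : Fin 4 → ℝ) : ∑ ν, interiorMetric Ψ Y x 2 ν * v ν =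
    x 1 ^ 2 * v 2 := by
  simp [Fin.sum_univ_four, interiorMetric]

lemma interior_momentum_three (x v : Fin 4 → ℝ) : ∑ ν, interiorMetric Ψ Y x 3 ν * v ν =
    x 1 ^ 2 * Real.sin (x 2) ^ 2 * v 3 := by
  simp [Fin.sum_univ_four, interiorMetric]

lemma interior_norm (x v : Fin 4 → ℝ) :
    ∑ μ, ∑ ν, interiorMetric Ψ Y x μ ν * v μ * v ν =
      -coeffA Ψ Y (x 0) (x 1) * v 0 ^ 2 - 2 * coeffB Ψ Y (x 0) (x 1) * v 0 * v 1 -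
        coeffC Ψ Y (x 0) (x 1) * v 1 ^ 2 + x 1 ^ 2 * v 2 ^ 2 +
        x 1 ^ 2 * Real.sin (x 2) ^ 2 * v 3 ^ 2 := by
  simp [Fin.sum_univ_four, interiorMetric]; ring

lemma interior_force_three (x v : Fin 4 → ℝ) :
    (1 / 2 : ℝ) * ∑ ν, ∑ σ, partialMetric (interiorMetric Ψ Y) 3 ν σ x * v ν * v σ = 0 := by
  simp [interiorMetric, partialMetric]

lemma interior_force_two (x v : Fin 4 → ℝ) (hx : x 2 = Real.pi / 2) :
    (1 / 2 : ℝ) * ∑ ν, ∑ σ, partialMetric (interiorMetric Ψ Y) 2 ν σ x * v ν * v σ = 0 := by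
  have : deriv (fun t : ℝ => x 1 ^ 2 * Real.sin t ^ 2) (Real.pi / 2) = 0 := by
    have := (((Real.hasDerivAt_sin (Real.pi / 2)).pow 2).const_mul (x 1 ^ 2)).deriv
    simp only [Real.cos_pi_div_two, mul_zero] at this
    exact this
  simp [Fin.sum_univ_four, interiorMetric, partialMetric, hx]

lemma interior_force_of_deriv {a b c : ℝ} (x v : Fin 4 → ℝ) (hx : x 2 = Real.pi / 2)
    (hA : HasDerivAt (fun t => coeffA Ψ Y (x 0) t) a (x 1))
    (hB : HasDerivAt (fun t => coeffB Ψ Y (x 0) t) b (x 1))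
    (hC : HasDerivAt (fun t => coeffC Ψ Y (x 0) t) c (x 1)) :
    (1 / 2 : ℝ) * ∑ ν, ∑ σ, partialMetric (interiorMetric Ψ Y) 1 ν σ x * v ν * v σ =
      (-a * v 0 ^ 2 - 2 * b * v 0 * v 1 - c * v 1 ^ 2) / 2 + x 1 * (v 2 ^ 2 + v 3 ^ 2) := by
  have h1 : deriv (fun t : ℝ => t ^ 2) (x 1) = 2 * x 1 := by simp
  simp [Fin.sum_univ_four, interiorMetric, partialMetric, hx, hA.deriv, hB.deriv, hC.deriv]
  ring

lemma interior_force_zero_of_deriv {a b c : ℝ} (x v : Fin 4 → ℝ)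
    (hA : HasDerivAt (fun t => coeffA Ψ Y t (x 1)) a (x 0))
    (hB : HasDerivAt (fun t => coeffB Ψ Y t (x 1)) b (x 0))
    (hC : HasDerivAt (fun t => coeffC Ψ Y t (x 1)) c (x 0)) :
    (1 / 2 : ℝ) * ∑ ν, ∑ σ, partialMetric (interiorMetric Ψ Y) 0 ν σ x * v ν * v σ =
      (-a * v 0 ^ 2 - 2 * b * v 0 * v 1 - c * v 1 ^ 2) / 2 := by
  simp [Fin.sum_univ_four, interiorMetric, partialMetric, hA.deriv, hB.deriv, hC.deriv]
  ring

end geometry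

/-! ### The geodesic equation in terms of frame energy and momentum -/

section frame

variable {α ξ β γ δ rmax : ℝ} {Ψ Y : ℝ → ℝ → ℝ}

/-- The (r, R) part of the metric is -e² + p² with e = G Y v⁰ - v¹ / u and p = u G v⁰. Half of its
derivative at frozen velocity is -e ∂e + p ∂p. The variable is left abstract so that the identity
serves for ∂_r and for ∂_R. -/
lemma coeff_force {y U g : ℝ → ℝ} {y' U' g' t a b c v0 v1 : ℝ} (hy : HasDerivAt y y' t)
    (hU : HasDerivAt U U' t) (hg : HasDerivAt g g' t) (hU0 : U t ≠ 0)
    (ha : HasDerivAt (fun t => (y t ^ 2 - U t ^ 2) * g t ^ 2) a t)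
    (hb : HasDerivAt (fun t => -(g t * (y t / U t))) b t)
    (hc : HasDerivAt (fun t => 1 / U t ^ 2) c t) :
    (-a * v0 ^ 2 - 2 * b * v0 * v1 - c * v1 ^ 2) / 2 =
      -(g t * y t * v0 - v1 / U t) * ((g' * y t + g t * y') * v0 + v1 * U' / U t ^ 2) +
        U t * g t * v0 * ((U' * g t + U t * g') * v0) := by
  have ea := ha.unique (((hy.pow 2).sub (hU.pow 2)).mul (hg.pow 2))
  have eb := hb.unique (hg.mul (hy.div hU hU0)).neg
  have ec := hc.unique ((hasDerivAt_const t (1 : ℝ)).div (hU.pow 2) (pow_ne_zero 2 hU0))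
  simp only [Nat.cast_ofNat, Pi.pow_apply, Pi.sub_apply, Pi.div_apply] at ea eb ec
  rw [ea, eb, ec]
  field_simp
  ring

namespace IsInterior

lemma differentiableAt_G (h : IsInterior α ξ β γ δ rmax Ψ Y) {r R : ℝ} (h0 : 0 < R) (h1 : R < r)
    (h2 : r < rmax) : DifferentiableAt ℝ (Function.uncurry (G Ψ Y)) (r, R) :=
  (h.contDiffAt_G h0 h1 h2).differentiableAt one_ne_zero

lemma differentiableAt_u (h : IsInterior α ξ β γ δ rmax Ψ Y) {r R : ℝ} (h0 : 0 < R) (h1 : R ≤ r)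
    (h2 : r ≤ rmax) : DifferentiableAt ℝ (Function.uncurry (u Ψ Y)) (r, R) :=
  (h.contDiffAt_u h0 h1 h2).differentiableAt one_ne_zero

lemma differentiableAt_Y (h : IsInterior α ξ β γ δ rmax Ψ Y) {r R : ℝ} (h0 : 0 ≤ R) (h1 : R ≤ r)
    (h2 : r ≤ rmax) : DifferentiableAt ℝ (Function.uncurry Y) (r, R) :=
  (h.contDiff_Y r R h0 h1 h2).differentiableAt (by simp)

lemma force_one (h : IsInterior α ξ β γ δ rmax Ψ Y) {x v : Fin 4 → ℝ} (h0 : 0 < x 1)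
    (h1 : x 1 < x 0) (h2 : x 0 < rmax) (hx : x 2 = Real.pi / 2) :
    (1 / 2 : ℝ) * ∑ ν, ∑ σ, partialMetric (interiorMetric Ψ Y) 1 ν σ x * v ν * v σ =
      -frameEnergy Ψ Y x v *
        ((dSnd (Function.uncurry (G Ψ Y)) (x 0, x 1) * Y (x 0) (x 1) +
          G Ψ Y (x 0) (x 1) * dSnd (Function.uncurry Y) (x 0, x 1)) * v 0 +
          v 1 * dSnd (Function.uncurry (u Ψ Y)) (x 0, x 1) / u Ψ Y (x 0) (x 1) ^ 2) +
      frameMomentum Ψ Y x v *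
        ((dSnd (Function.uncurry (u Ψ Y)) (x 0, x 1) * G Ψ Y (x 0) (x 1) +
          u Ψ Y (x 0) (x 1) * dSnd (Function.uncurry (G Ψ Y)) (x 0, x 1)) * v 0) +
      x 1 * (v 2 ^ 2 + v 3 ^ 2) := by
  have hy := hasDerivAt_dSnd (h.differentiableAt_Y h0.le h1.le h2.le)
  have hU := hasDerivAt_dSnd (h.differentiableAt_u h0 h1.le h2.le)
  have hg := hasDerivAt_dSnd (h.differentiableAt_G h0 h1 h2)
  simp only [Function.uncurry_apply_pair] at hy hU hg
  have hU0 := (h.u_pos h0 h1.le h2.le).ne'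
  have ha := ((hy.fun_pow 2).fun_sub (hU.fun_pow 2)).fun_mul (hg.fun_pow 2)
  have hb := (hg.fun_mul (hy.fun_div hU hU0)).fun_neg
  have hc := (hasDerivAt_const (x 1) (1 : ℝ)).fun_div (hU.fun_pow 2) (pow_ne_zero 2 hU0)
  have hA := ha.congr_of_eventuallyEq (f₁ := fun t => coeffA Ψ Y (x 0) t) (by
    filter_upwards [Ioo_mem_nhds h0 h1] with t ht
    exact h.coeffA_eq ht.1 ht.2.le h2.le)
  have hB : HasDerivAt (fun t => coeffB Ψ Y (x 0) t) _ (x 1) := hb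
  have hC : HasDerivAt (fun t => coeffC Ψ Y (x 0) t) _ (x 1) := hc
  rw [interior_force_of_deriv x v hx hA hB hC, coeff_force hy hU hg hU0 ha hb hc]
  rfl

lemma force_zero (h : IsInterior α ξ β γ δ rmax Ψ Y) {x v : Fin 4 → ℝ} (h0 : 0 < x 1)
    (h1 : x 1 < x 0) (h2 : x 0 < rmax) :
    (1 / 2 : ℝ) * ∑ ν, ∑ σ, partialMetric (interiorMetric Ψ Y) 0 ν σ x * v ν * v σ =
      -frameEnergy Ψ Y x v *
        ((dFst (Function.uncurry (G Ψ Y)) (x 0, x 1) * Y (x 0) (x 1) +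
          G Ψ Y (x 0) (x 1) * dFst (Function.uncurry Y) (x 0, x 1)) * v 0 +
          v 1 * dFst (Function.uncurry (u Ψ Y)) (x 0, x 1) / u Ψ Y (x 0) (x 1) ^ 2) +
      frameMomentum Ψ Y x v *
        ((dFst (Function.uncurry (u Ψ Y)) (x 0, x 1) * G Ψ Y (x 0) (x 1) +
          u Ψ Y (x 0) (x 1) * dFst (Function.uncurry (G Ψ Y)) (x 0, x 1)) * v 0) := by
  have hy := hasDerivAt_dFst (h.differentiableAt_Y h0.le h1.le h2.le)
  have hU := hasDerivAt_dFst (h.differentiableAt_u h0 h1.le h2.le)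
  have hg := hasDerivAt_dFst (h.differentiableAt_G h0 h1 h2)
  simp only [Function.uncurry_apply_pair] at hy hU hg
  have hU0 := (h.u_pos h0 h1.le h2.le).ne'
  have ha := ((hy.fun_pow 2).fun_sub (hU.fun_pow 2)).fun_mul (hg.fun_pow 2)
  have hb := (hg.fun_mul (hy.fun_div hU hU0)).fun_neg
  have hc := (hasDerivAt_const (x 0) (1 : ℝ)).fun_div (hU.fun_pow 2) (pow_ne_zero 2 hU0)
  have hA := ha.congr_of_eventuallyEq (f₁ := fun t => coeffA Ψ Y t (x 1)) (by
    filter_upwards [Ioo_mem_nhds h1 h2] with t ht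
    exact h.coeffA_eq h0 ht.1.le ht.2.le)
  have hB : HasDerivAt (fun t => coeffB Ψ Y t (x 1)) _ (x 0) := hb
  have hC : HasDerivAt (fun t => coeffC Ψ Y t (x 1)) _ (x 0) := hc
  rw [interior_force_zero_of_deriv x v hA hB hC, coeff_force hy hU hg hU0 ha hb hc]
  rfl

lemma momentum_one (h : IsInterior α ξ β γ δ rmax Ψ Y) {x v : Fin 4 → ℝ} (h0 : 0 < x 1)
    (h1 : x 1 < x 0) (h2 : x 0 < rmax) :
    ∑ ν, interiorMetric Ψ Y x 1 ν * v ν = frameEnergy Ψ Y x v / u Ψ Y (x 0) (x 1) := by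
  have hU0 := (h.u_pos h0 h1.le h2.le).ne'
  rw [interior_momentum_one]
  unfold frameEnergy coeffB coeffC
  field_simp

lemma momentum_zero (h : IsInterior α ξ β γ δ rmax Ψ Y) {x v : Fin 4 → ℝ} (h0 : 0 < x 1)
    (h1 : x 1 < x 0) (h2 : x 0 < rmax) :
    ∑ ν, interiorMetric Ψ Y x 0 ν * v ν = -G Ψ Y (x 0) (x 1) *
      (Y (x 0) (x 1) * frameEnergy Ψ Y x v - u Ψ Y (x 0) (x 1) * frameMomentum Ψ Y x v) := by
  have hU0 := (h.u_pos h0 h1.le h2.le).ne'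
  rw [interior_momentum_zero, h.coeffA_eq h0 h1.le h2.le]
  unfold frameEnergy frameMomentum coeffB
  field_simp
  ring

lemma norm_eq (h : IsInterior α ξ β γ δ rmax Ψ Y) {x v : Fin 4 → ℝ} (h0 : 0 < x 1)
    (h1 : x 1 < x 0) (h2 : x 0 < rmax) (hx : x 2 = Real.pi / 2) :
    ∑ μ, ∑ ν, interiorMetric Ψ Y x μ ν * v μ * v ν =
      -frameEnergy Ψ Y x v ^ 2 + frameMomentum Ψ Y x v ^ 2 + x 1 ^ 2 * (v 2 ^ 2 + v 3 ^ 2) := by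
  have hU0 := (h.u_pos h0 h1.le h2.le).ne'
  rw [interior_norm, h.coeffA_eq h0 h1.le h2.le, hx, Real.sin_pi_div_two]
  unfold frameEnergy frameMomentum coeffB coeffC
  field_simp
  ring

end IsInterior

/-- The evolution of the frame energy along a geodesic. -/
noncomputable def energyRate (Ψ Y : ℝ → ℝ → ℝ) (x v : Fin 4 → ℝ) : ℝ :=
  -frameEnergy Ψ Y x v * frameMomentum Ψ Y x v * dSnd (Function.uncurry Y) (x 0, x 1) +
    frameMomentum Ψ Y x v ^ 2 * (dSnd (Function.uncurry (u Ψ Y)) (x 0, x 1) * G Ψ Y (x 0) (x 1) +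
      u Ψ Y (x 0) (x 1) * dSnd (Function.uncurry (G Ψ Y)) (x 0, x 1)) / G Ψ Y (x 0) (x 1) +
    u Ψ Y (x 0) (x 1) * (x 1 * v 3 ^ 2)

/-- The radial component of the geodesic equation is the evolution law of the frame energy. -/
lemma IsInterior.radial_iff (h : IsInterior α ξ β γ δ rmax Ψ Y) {x v : ℝ → Fin 4 → ℝ} {I : Set ℝ}
    {s : ℝ} (hs : s ∈ I) (hreg : ∀ t ∈ I, 0 < x t 1 ∧ x t 1 < x t 0 ∧ x t 0 < rmax)
    (hx2 : x s 2 = Real.pi / 2) (hv2 : v s 2 = 0) (hG : G Ψ Y (x s 0) (x s 1) ≠ 0)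
    (h0 : HasDerivWithinAt (fun t => x t 0) (v s 0) I s)
    (h1 : HasDerivWithinAt (fun t => x t 1) (v s 1) I s) :
    HasDerivWithinAt (fun t => ∑ ν, interiorMetric Ψ Y (x t) 1 ν * v t ν)
      ((1 / 2) * ∑ ν, ∑ σ, partialMetric (interiorMetric Ψ Y) 1 ν σ (x s) * v s ν * v s σ) I s ↔
    HasDerivWithinAt (fun t => frameEnergy Ψ Y (x t) (v t)) (energyRate Ψ Y (x s) (v s)) I s := by
  obtain ⟨r1, r2, r3⟩ := hreg s hs
  have hUpos := h.u_pos r1 r2.le r3.le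
  have hYpos := h.Y_pos _ _ r1.le r2.le r3.le
  have hU := hasDerivWithinAt_comp_pair (h.differentiableAt_u r1 r2.le r3.le) h0 h1
  simp only [Function.uncurry_apply_pair] at hU
  -- The radial momentum is e / u. With `dSnd_G` the term e ∂_R G Y v⁰ of the force cancels the ∂_r
  -- u term that arises from differentiating 1 / u.
  rw [h.force_one r1 r2 r3 hx2, hv2, h.dSnd_G r1 r2 r3]
  have hGv := h.dSnd_G r1 r2 r3
  set e := frameEnergy Ψ Y (x s) (v s) with he
  have hev : e = G Ψ Y (x s 0) (x s 1) * Y (x s 0) (x s 1) * v s 0 - v s 1 / u Ψ Y (x s 0) (x s 1) :=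
    rfl
  have hp : frameMomentum Ψ Y (x s) (v s) =
    u Ψ Y (x s 0) (x s 1) * G Ψ Y (x s 0) (x s 1) * v s 0 := rfl
  have hrate : energyRate Ψ Y (x s) (v s) = -e * frameMomentum Ψ Y (x s) (v s) *
      dSnd (Function.uncurry Y) (x s 0, x s 1) + frameMomentum Ψ Y (x s) (v s) ^ 2 *
      (dSnd (Function.uncurry (u Ψ Y)) (x s 0, x s 1) * G Ψ Y (x s 0) (x s 1) +
        u Ψ Y (x s 0) (x s 1) * dSnd (Function.uncurry (G Ψ Y)) (x s 0, x s 1)) /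
        G Ψ Y (x s 0) (x s 1) + u Ψ Y (x s 0) (x s 1) * (x s 1 * v s 3 ^ 2) := rfl
  rw [hGv] at hrate
  rw [hrate, hp]
  have hv1 : v s 1 = u Ψ Y (x s 0) (x s 1) *
      (G Ψ Y (x s 0) (x s 1) * Y (x s 0) (x s 1) * v s 0 - e) := by
    rw [hev]; field_simp; ring
  have hmom : ∀ t ∈ I, ∑ ν, interiorMetric Ψ Y (x t) 1 ν * v t ν =
      frameEnergy Ψ Y (x t) (v t) / u Ψ Y (x t 0) (x t 1) := fun t ht =>
    h.momentum_one (hreg t ht).1 (hreg t ht).2.1 (hreg t ht).2.2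
  constructor
  · intro hP
    have h3 := hU.fun_mul hP
    rw [hmom s hs, ← he] at h3
    refine (h3.congr (f₁ := fun t => frameEnergy Ψ Y (x t) (v t)) (fun t ht => ?_) ?_).congr_deriv ?_
    · rw [hmom t ht]
      have := (h.u_pos (hreg t ht).1 (hreg t ht).2.1.le (hreg t ht).2.2.le).ne'
      field_simp
    · rw [hmom s hs]; field_simp
    · rw [hv1]
      generalize u Ψ Y (x s 0) (x s 1) = U at *
      generalize G Ψ Y (x s 0) (x s 1) = g at *
      generalize Y (x s 0) (x s 1) = y at *
      field_simp
      ring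
  · intro hE
    have h3 := hE.fun_div hU hUpos.ne'
    refine (h3.congr (fun t ht => hmom t ht) (hmom s hs)).congr_deriv ?_
    rw [← he, hv1]
    generalize u Ψ Y (x s 0) (x s 1) = U at *
    generalize G Ψ Y (x s 0) (x s 1) = g at *
    generalize Y (x s 0) (x s 1) = y at *
    field_simp
    ring

end frame

/-! ### Inverse functions on intervals -/

section inverse

/-- Serves to exchange affine parameter and log r, on intervals that may be closed at either end,
with one-sided derivatives there. The inverse is continuous as an order isomorphism between
intervals, and the local inverse rule gives its derivative. -/
lemma exists_inverse {f f' : ℝ → ℝ} {I : Set ℝ} (hI : I.OrdConnected)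
    (hf : ∀ x ∈ I, HasDerivWithinAt f (f' x) I x) (hpos : ∀ x ∈ I, 0 < f' x) :
    StrictMonoOn f I ∧ (f '' I).OrdConnected ∧ ∃ g : ℝ → ℝ, (∀ x ∈ I, g (f x) = x) ∧
      (∀ y ∈ f '' I, HasDerivWithinAt g (f' (g y))⁻¹ (f '' I) y) := by
  have hc : ContinuousOn f I := fun x hx => (hf x hx).continuousWithinAt
  have hmono : StrictMonoOn f I := strictMonoOn_of_hasDerivWithinAt_pos hI.convex hc
    (fun x hx => (hf x (interior_subset hx)).mono interior_subset)
    (fun x hx => hpos x (interior_subset hx))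
  have hJ : (f '' I).OrdConnected := (hI.isPreconnected.image f hc).ordConnected
  refine ⟨hmono, hJ, Function.invFunOn f I, fun x hx =>
    hmono.injOn.leftInvOn_invFunOn hx, ?_⟩
  set g := Function.invFunOn f I with hg
  have hgf : ∀ x ∈ I, g (f x) = x := fun x hx => hmono.injOn.leftInvOn_invFunOn hx
  have hgI : ∀ y ∈ f '' I, g y ∈ I := fun y hy => Function.invFunOn_mem hy
  have hfg : ∀ y ∈ f '' I, f (g y) = y := fun y hy => Function.invFunOn_eq hy
  have hgc : ContinuousOn g (f '' I) := by
    have h1 : Continuous (hmono.orderIso f I).symm := OrderIso.continuous _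
    rw [continuousOn_iff_continuous_domRestrict]
    refine (continuous_subtype_val.comp h1).congr fun y => ?_
    obtain ⟨x, hx, hxy⟩ := y.2
    have : (hmono.orderIso f I).symm y = ⟨x, hx⟩ := by
      rw [OrderIso.symm_apply_eq]
      exact Subtype.ext hxy.symm
    simp only [Function.comp, this, Set.domRestrict_apply]
    rw [← hxy, hgf x hx]
  intro y hy
  have ht : Tendsto g (𝓝[f '' I] y) (𝓝[I] (g y)) :=
    tendsto_nhdsWithin_iff.2 ⟨hgc y hy, eventually_mem_nhdsWithin.mono fun z hz => hgI z hz⟩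
  have hne := (hpos _ (hgI y hy)).ne'
  have h1 : HasFDerivWithinAt f
      ((ContinuousLinearEquiv.unitsEquivAut ℝ (Units.mk0 _ hne) : ℝ ≃L[ℝ] ℝ) : ℝ →L[ℝ] ℝ) I
      (g y) := by
    refine (hf (g y) (hgI y hy)).hasFDerivWithinAt.congr_fderiv ?_
    ext
    simp
  have h2 := (HasFDerivWithinAt.of_local_left_inverse ht h1 hy
    (eventually_mem_nhdsWithin.mono fun z hz => hfg z hz)).hasDerivWithinAt
  refine h2.congr_deriv ?_
  simp

end inverse

/-! ### Conserved quantities and the time -log r along a ray -/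

section interiorRay

lemma eq_of_hasDerivWithinAt_zero {f : ℝ → ℝ} {I : Set ℝ} (hI : I.OrdConnected)
    (hf : ∀ x ∈ I, HasDerivWithinAt f 0 I x) {x y : ℝ} (hx : x ∈ I) (hy : y ∈ I) : f x = f y := by
  have := hI.convex.norm_image_sub_le_of_norm_hasDerivWithin_le (C := 0) hf (by simp) hx hy
  simp only [zero_mul, norm_le_zero_iff] at this
  linarith

variable {α ξ β γ δ rmax rb R₀ : ℝ} {Ψ Y : ℝ → ℝ → ℝ} {M : ℝ → ℝ} {c : Ray}

namespace IsDetectedSingularRay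

lemma exit_mem (hc : IsDetectedSingularRay Ψ Y rb M R₀ c) : c.exit ∈ Ioc c.start c.exit :=
  ⟨hc.start_lt, le_rfl⟩

lemma hasDerivWithinAt_pos (hc : IsDetectedSingularRay Ψ Y rb M R₀ c) (i : Fin 4) {s : ℝ}
    (hs : s ∈ Ioc c.start c.exit) :
    HasDerivWithinAt (fun t => c.pos t i) (c.vel s i) (Ioc c.start c.exit) s :=
  hasDerivWithinAt_pi.1 (hc.geodesic s hs).1 i

lemma strictMonoOn_r (hc : IsDetectedSingularRay Ψ Y rb M R₀ c) :
    StrictMonoOn (fun s => c.pos s 0) (Ioc c.start c.exit) :=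
  (exists_inverse ordConnected_Ioc (fun _ hs => hc.hasDerivWithinAt_pos 0 hs) hc.vel_r).1

lemma region' (hc : IsDetectedSingularRay Ψ Y rb M R₀ c) (hrb : rb < rmax) :
    ∀ s ∈ Ioc c.start c.exit, 0 < c.pos s 1 ∧ c.pos s 1 < c.pos s 0 ∧ c.pos s 0 < rmax := by
  intro s hs
  obtain ⟨-, h1, h2, -⟩ := hc.region s hs
  refine ⟨h1, h2, lt_of_le_of_lt ?_ hrb⟩
  rw [← hc.exit_r]
  exact hc.strictMonoOn_r.monotoneOn hs hc.exit_mem hs.2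

lemma vel_two (hc : IsDetectedSingularRay Ψ Y rb M R₀ c) {s : ℝ} (hs : s ∈ Ioc c.start c.exit) :
    c.vel s 2 = 0 := by
  have h1 : HasDerivWithinAt (fun t => c.pos t 2) 0 (Ioc c.start c.exit) s :=
    (hasDerivWithinAt_const s _ (Real.pi / 2)).congr hc.equatorial (hc.equatorial s hs)
  exact (uniqueDiffOn_Ioc c.start c.exit s hs).eq_deriv _ (hc.hasDerivWithinAt_pos 2 hs) h1

lemma angularMomentum_eq (hc : IsDetectedSingularRay Ψ Y rb M R₀ c) {s : ℝ}
    (hs : s ∈ Ioc c.start c.exit) : c.pos s 1 ^ 2 * c.vel s 3 = c.angularMomentum := by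
  have h1 : ∀ t ∈ Ioc c.start c.exit, c.pos t 1 ^ 2 * c.vel t 3 =
      ∑ ν, interiorMetric Ψ Y (c.pos t) 3 ν * c.vel t ν := fun t ht => by
    rw [interior_momentum_three, hc.equatorial t ht, Real.sin_pi_div_two]; ring
  have h2 := eq_of_hasDerivWithinAt_zero ordConnected_Ioc (f := fun t =>
    ∑ ν, interiorMetric Ψ Y (c.pos t) 3 ν * c.vel t ν) (fun t ht => by
      have := (hc.geodesic t ht).2.2 3
      rwa [interior_force_three] at this) hs hc.exit_mem
  rw [h1 s hs, h2, ← h1 _ hc.exit_mem, Ray.angularMomentum, hc.join_pos 1 (by decide),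
    hc.join_vel 3 (by decide)]

lemma energy_pos (hc : IsDetectedSingularRay Ψ Y rb M R₀ c)
    (h : IsInterior α ξ β γ δ rmax Ψ Y) (hrb : rb < rmax) {s : ℝ} (hs : s ∈ Ioc c.start c.exit) :
    0 < frameEnergy Ψ Y (c.pos s) (c.vel s) := by
  obtain ⟨r1, r2, r3⟩ := hc.region' hrb s hs
  have hu := h.u_pos r1 r2.le r3.le
  have h1 := h.momentum_one (v := c.vel s) r1 r2 r3
  rw [interior_momentum_one] at h1
  have h2 := hc.future s hs
  have h3 : 0 < frameEnergy Ψ Y (c.pos s) (c.vel s) / u Ψ Y (c.pos s 0) (c.pos s 1) := by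
    rw [← h1]; linarith
  exact (div_pos_iff_of_pos_right hu).1 h3

/-- The null condition multiplied by R², with R² dφ/dκ = ℓ. -/
lemma energy_sq (hc : IsDetectedSingularRay Ψ Y rb M R₀ c)
    (h : IsInterior α ξ β γ δ rmax Ψ Y) (hrb : rb < rmax) {s : ℝ} (hs : s ∈ Ioc c.start c.exit) :
    (c.pos s 1 * frameEnergy Ψ Y (c.pos s) (c.vel s)) ^ 2 =
      (c.pos s 1 * frameMomentum Ψ Y (c.pos s) (c.vel s)) ^ 2 + c.angularMomentum ^ 2 := by
  obtain ⟨r1, r2, r3⟩ := hc.region' hrb s hs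
  have h1 := (hc.geodesic s hs).2.1
  rw [h.norm_eq r1 r2 r3 (hc.equatorial s hs), hc.vel_two hs] at h1
  rw [← hc.angularMomentum_eq hs]
  linear_combination (-c.pos s 1 ^ 2) * h1

lemma vel_one (h : IsInterior α ξ β γ δ rmax Ψ Y) (hc : IsDetectedSingularRay Ψ Y rb M R₀ c)
    (hrb : rb < rmax) {s : ℝ} (hs : s ∈ Ioc c.start c.exit) :
    c.vel s 1 = Y (c.pos s 0) (c.pos s 1) * frameMomentum Ψ Y (c.pos s) (c.vel s) -
      u Ψ Y (c.pos s 0) (c.pos s 1) * frameEnergy Ψ Y (c.pos s) (c.vel s) := by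
  obtain ⟨r1, r2, r3⟩ := hc.region' hrb s hs
  have hu := (h.u_pos r1 r2.le r3.le).ne'
  unfold frameMomentum frameEnergy
  field_simp
  ring

/-- By the definition of u², Y² - u² = 1 - 2Ψ/R, which is positive outside the trapped region. -/
lemma u_lt_Y (hc : IsDetectedSingularRay Ψ Y rb M R₀ c)
    (h : IsInterior α ξ β γ δ rmax Ψ Y) (hrb : rb < rmax) {s : ℝ} (hs : s ∈ Ioc c.start c.exit) :
    u Ψ Y (c.pos s 0) (c.pos s 1) < Y (c.pos s 0) (c.pos s 1) := by
  obtain ⟨r1, r2, r3⟩ := hc.region' hrb s hs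
  have hY := h.Y_pos _ _ r1.le r2.le r3.le
  obtain ⟨-, -, -, h2⟩ := hc.region s hs
  refine Real.sqrt_lt' hY |>.2 ?_
  unfold uSq
  have : 2 * Ψ (c.pos s 0) (c.pos s 1) / c.pos s 1 < 1 := (div_lt_one r1).2 h2
  linarith

lemma energy_deriv (hc : IsDetectedSingularRay Ψ Y rb M R₀ c)
    (h : IsInterior α ξ β γ δ rmax Ψ Y) (hrb : rb < rmax) {s : ℝ} (hs : s ∈ Ioc c.start c.exit)
    (hG : 0 < G Ψ Y (c.pos s 0) (c.pos s 1)) :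
    HasDerivWithinAt (fun t => frameEnergy Ψ Y (c.pos t) (c.vel t))
      (energyRate Ψ Y (c.pos s) (c.vel s)) (Ioc c.start c.exit) s :=
  (h.radial_iff hs (hc.region' hrb) (hc.equatorial s hs) (hc.vel_two hs) hG.ne'
    (hc.hasDerivWithinAt_pos 0 hs) (hc.hasDerivWithinAt_pos 1 hs)).1 ((hc.geodesic s hs).2.2 1)

/-- The time `-log r` as a parameter. -/
lemma exists_time (hc : IsDetectedSingularRay Ψ Y rb M R₀ c) :
    ∃ S : ℝ → ℝ, (∀ t ∈ Ici (-Real.log rb), S t ∈ Ioc c.start c.exit ∧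
        c.pos (S t) 0 = Real.exp (-t)) ∧
      (∀ t ∈ Ici (-Real.log rb), HasDerivWithinAt S (-(Real.exp (-t) / c.vel (S t) 0))
        (Ici (-Real.log rb)) t) ∧
      (∀ s ∈ Ioc c.start c.exit, -Real.log (c.pos s 0) ∈ Ici (-Real.log rb) ∧
        S (-Real.log (c.pos s 0)) = s) ∧
      Tendsto S atTop (𝓝[>] c.start) ∧
      Tendsto (fun s => -Real.log (c.pos s 0)) (𝓝[>] c.start) atTop := by
  set I := Ioc c.start c.exit with hI
  set f : ℝ → ℝ := fun s => Real.log (c.pos s 0) with hf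
  have hr0 : ∀ s ∈ I, 0 < c.pos s 0 := fun s hs => (hc.region s hs).1
  obtain ⟨hmono, hoc, g, hgf, hg⟩ := exists_inverse (f := f)
    (f' := fun s => c.vel s 0 / c.pos s 0) (I := I) ordConnected_Ioc
    (fun s hs => (hc.hasDerivWithinAt_pos 0 hs).log (hr0 s hs).ne')
    (fun s hs => div_pos (hc.vel_r s hs) (hr0 s hs))
  have hlim : Tendsto f (𝓝[>] c.start) atBot := by
    refine Real.tendsto_log_nhdsGT_zero.comp ?_
    refine tendsto_nhdsWithin_iff.2 ⟨hc.start_r, ?_⟩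
    filter_upwards [Ioc_mem_nhdsGT hc.start_lt] with s hs
    exact hr0 s hs
  have hfe : f c.exit = Real.log rb := by simp only [hf]; rw [hc.exit_r]
  -- log r tends to -∞ at the singularity and equals log r_b at the exit, so the time -log r fills a
  -- whole half-line.
  have himg : f '' I = Iic (Real.log rb) := by
    apply Subset.antisymm
    · rintro _ ⟨s, hs, rfl⟩
      rw [mem_Iic, ← hfe]
      exact hmono.monotoneOn hs hc.exit_mem hs.2
    · intro y hy
      obtain ⟨s, hs1, hs2⟩ := ((hlim.eventually_le_atBot y).and
        (Ioc_mem_nhdsGT hc.start_lt)).exists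
      exact hoc.out ⟨s, hs2, rfl⟩ ⟨c.exit, hc.exit_mem, rfl⟩ ⟨hs1, by rw [hfe]; exact hy⟩
  rw [himg] at hg
  have hmem : ∀ t ∈ Ici (-Real.log rb), -t ∈ Iic (Real.log rb) := fun t ht => by
    have : -Real.log rb ≤ t := ht
    show -t ≤ Real.log rb
    linarith
  have hgI : ∀ y ∈ Iic (Real.log rb), g y ∈ I ∧ f (g y) = y := fun y hy => by
    rw [← himg] at hy
    obtain ⟨s, hs, rfl⟩ := hy
    rw [hgf s hs]; exact ⟨hs, rfl⟩
  have hexp : ∀ t ∈ Ici (-Real.log rb), c.pos (g (-t)) 0 = Real.exp (-t) := fun t ht => by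
    obtain ⟨h1, h2⟩ := hgI (-t) (hmem t ht)
    rw [← Real.exp_log (hr0 _ h1)]
    exact congrArg Real.exp h2
  have hneg : ∀ s ∈ I, -Real.log (c.pos s 0) ∈ Ici (-Real.log rb) := fun s hs => by
    have : f s ≤ Real.log rb := by
      have := mem_image_of_mem f hs
      rwa [himg] at this
    exact neg_le_neg this
  refine ⟨fun t => g (-t), fun t ht => ⟨(hgI _ (hmem t ht)).1, hexp t ht⟩, fun t ht => ?_,
    fun s hs => ⟨hneg s hs, ?_⟩, ?_, ?_⟩
  · have h1 := (hg (-t) (hmem t ht)).comp t (hasDerivWithinAt_neg t (Ici (-Real.log rb))) hmem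
    refine h1.congr_deriv ?_
    rw [hexp t ht, inv_div]
    ring
  · simp only [neg_neg]
    exact hgf s hs
  · rw [(nhdsGT_basis c.start).tendsto_right_iff]
    intro a ha
    obtain ⟨s, hs1, hs2⟩ := exists_between (lt_min ha hc.start_lt)
    have hsI : s ∈ I := ⟨hs1, (hs2.trans_le (min_le_right _ _)).le⟩
    filter_upwards [eventually_ge_atTop (-Real.log rb), eventually_ge_atTop (-f s)] with t ht1 ht2
    obtain ⟨h1, h2⟩ := hgI (-t) (hmem t ht1)
    refine ⟨h1.1, lt_of_le_of_lt ?_ (hs2.trans_le (min_le_left _ _))⟩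
    refine (hmono.le_iff_le h1 hsI).1 ?_
    rw [h2]; linarith
  · exact tendsto_neg_atBot_atTop.comp hlim

end IsDetectedSingularRay

end interiorRay

/-! ### The variables z and w along a ray and their equations -/

section rayVariables

variable {α ξ β γ δ rmax rb R₀ : ℝ} {Ψ Y : ℝ → ℝ → ℝ} {M : ℝ → ℝ} {c : Ray}

namespace Ray

/-- The scaled area radius `z = (R / (α r³))^{1/2}` along a ray. -/
noncomputable def zVar (α : ℝ) (c : Ray) (s : ℝ) : ℝ := Real.sqrt (c.pos s 1 / (α * c.pos s 0 ^ 3))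

/-- The cosine of the angle to the radial direction in the comoving frame, along a ray. -/
noncomputable def wVar (Ψ Y : ℝ → ℝ → ℝ) (c : Ray) (s : ℝ) : ℝ :=
  Real.sqrt (1 - (c.angularMomentum / (c.pos s 1 * frameEnergy Ψ Y (c.pos s) (c.vel s))) ^ 2)

end Ray

namespace IsDetectedSingularRay

lemma zVar_pos (hc : IsDetectedSingularRay Ψ Y rb M R₀ c) (hα : 0 < α) {s : ℝ}
    (hs : s ∈ Ioc c.start c.exit) : 0 < c.zVar α s := by
  obtain ⟨h1, h2, -, -⟩ := hc.region s hs
  exact Real.sqrt_pos.2 (by positivity)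

lemma zVar_sq (hc : IsDetectedSingularRay Ψ Y rb M R₀ c) (hα : 0 < α) {s : ℝ}
    (hs : s ∈ Ioc c.start c.exit) : c.pos s 1 = α * c.zVar α s ^ 2 * c.pos s 0 ^ 3 := by
  obtain ⟨h1, h2, -, -⟩ := hc.region s hs
  rw [Ray.zVar, Real.sq_sqrt (by positivity)]
  field_simp

/-- Geometrically w = p / e; G > 0 gives p > 0 and selects the positive root, and ℓ ≠ 0 gives w < 1.
The definition through ℓ / (R e) is the convenient one to differentiate, since ℓ is constant. -/
lemma wVar_eq (hc : IsDetectedSingularRay Ψ Y rb M R₀ c) (h : IsInterior α ξ β γ δ rmax Ψ Y)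
    (hrb : rb < rmax) {s : ℝ} (hs : s ∈ Ioc c.start c.exit)
    (hG : 0 < G Ψ Y (c.pos s 0) (c.pos s 1)) :
    0 < c.wVar Ψ Y s ∧ c.wVar Ψ Y s < 1 ∧
    frameMomentum Ψ Y (c.pos s) (c.vel s) = c.wVar Ψ Y s * frameEnergy Ψ Y (c.pos s) (c.vel s) ∧
    (1 - c.wVar Ψ Y s ^ 2) * (c.pos s 1 * frameEnergy Ψ Y (c.pos s) (c.vel s)) ^ 2 =
      c.angularMomentum ^ 2 := by
  obtain ⟨r1, r2, r3⟩ := hc.region' hrb s hs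
  have hu := h.u_pos r1 r2.le r3.le
  have he := hc.energy_pos h hrb hs
  have hsq := hc.energy_sq h hrb hs
  have hp : 0 < frameMomentum Ψ Y (c.pos s) (c.vel s) := mul_pos (mul_pos hu hG) (hc.vel_r s hs)
  have hℓ : 0 < c.angularMomentum ^ 2 := by have := hc.nonradial; positivity
  set e := frameEnergy Ψ Y (c.pos s) (c.vel s) with hedef
  set p := frameMomentum Ψ Y (c.pos s) (c.vel s) with hpdef
  have hw : c.wVar Ψ Y s = p / e := by
    have e1 : 1 - (c.angularMomentum / (c.pos s 1 * e)) ^ 2 = (p / e) ^ 2 := by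
      rw [div_pow, div_pow]
      field_simp
      linarith
    rw [Ray.wVar, e1, Real.sqrt_sq (div_pos hp he).le]
  have hpe : p < e := by
    have h3 : (c.pos s 1 * p) ^ 2 < (c.pos s 1 * e) ^ 2 := by rw [hsq]; linarith
    have := lt_of_pow_lt_pow_left₀ 2 (by positivity) h3
    exact lt_of_mul_lt_mul_left this r1.le
  refine ⟨by rw [hw]; exact div_pos hp he, by rw [hw]; exact (div_lt_one he).2 hpe, ?_, ?_⟩
  · rw [hw]; field_simp
  · rw [hw]; field_simp; linarith

lemma vel_ratio (hc : IsDetectedSingularRay Ψ Y rb M R₀ c) (h : IsInterior α ξ β γ δ rmax Ψ Y)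
    (hrb : rb < rmax) {s : ℝ} (hs : s ∈ Ioc c.start c.exit)
    (hG : 0 < G Ψ Y (c.pos s 0) (c.pos s 1)) :
    c.vel s 1 = u Ψ Y (c.pos s 0) (c.pos s 1) * G Ψ Y (c.pos s 0) (c.pos s 1) *
      (Y (c.pos s 0) (c.pos s 1) - u Ψ Y (c.pos s 0) (c.pos s 1) / c.wVar Ψ Y s) * c.vel s 0 := by
  obtain ⟨w1, w2, w3, w4⟩ := hc.wVar_eq h hrb hs hG
  rw [vel_one h hc hrb hs]
  have he : frameEnergy Ψ Y (c.pos s) (c.vel s) =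
      frameMomentum Ψ Y (c.pos s) (c.vel s) / c.wVar Ψ Y s := by
    rw [w3]; field_simp
  rw [he]
  unfold frameMomentum
  field_simp

lemma zVar_deriv (hc : IsDetectedSingularRay Ψ Y rb M R₀ c) (hα : 0 < α) {s : ℝ}
    (hs : s ∈ Ioc c.start c.exit) :
    HasDerivWithinAt (c.zVar α) (c.zVar α s / 2 * (c.vel s 1 / c.pos s 1 -
      3 * c.vel s 0 / c.pos s 0)) (Ioc c.start c.exit) s := by
  obtain ⟨h1, h2, -, -⟩ := hc.region s hs
  have h3 := ((hc.hasDerivWithinAt_pos 1 hs).fun_div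
    (((hc.hasDerivWithinAt_pos 0 hs).fun_pow 3).const_mul α) (by positivity)).sqrt (by positivity)
  refine HasDerivWithinAt.congr_deriv h3 ?_
  have h4 : Real.sqrt (c.pos s 1 / (α * c.pos s 0 ^ 3)) = c.zVar α s := rfl
  have h5 := hc.zVar_sq hα hs
  have hz := hc.zVar_pos hα hs
  rw [h4]
  generalize c.zVar α s = z at *
  rw [h5]
  field_simp
  ring

lemma zVar_deriv_rateA (hc : IsDetectedSingularRay Ψ Y rb M R₀ c)
    (h : IsInterior α ξ β γ δ rmax Ψ Y) (hα : 0 < α)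
    (hrb : rb < rmax) {s : ℝ} (hs : s ∈ Ioc c.start c.exit)
    (hG : 0 < G Ψ Y (c.pos s 0) (c.pos s 1)) :
    HasDerivWithinAt (c.zVar α) (rateA α Ψ Y (c.pos s 0) (c.zVar α s) (c.wVar Ψ Y s) *
      (c.vel s 0 / c.pos s 0)) (Ioc c.start c.exit) s := by
  refine (hc.zVar_deriv hα hs).congr_deriv ?_
  obtain ⟨w1, -, -, -⟩ := hc.wVar_eq h hrb hs hG
  obtain ⟨h1, h2, -, -⟩ := hc.region s hs
  rw [IsInterior.rateA_eq hα h1 (hc.zVar_pos hα hs) w1 (hc.zVar_sq hα hs),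
    hc.vel_ratio h hrb hs hG]
  field_simp

/-- Differentiates 1 - w² = (ℓ / (R e))² with the known derivatives of R and of the frame energy.
The factor 1 - w² comes out because ℓ² = (1 - w²) (R e)². -/
lemma wVar_deriv_rateB (hc : IsDetectedSingularRay Ψ Y rb M R₀ c)
    (h : IsInterior α ξ β γ δ rmax Ψ Y) (hα : 0 < α)
    (hrb : rb < rmax) {s : ℝ} (hs : s ∈ Ioc c.start c.exit)
    (hG : 0 < G Ψ Y (c.pos s 0) (c.pos s 1)) :
    HasDerivWithinAt (c.wVar Ψ Y) ((1 - c.wVar Ψ Y s ^ 2) *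
      rateB α Ψ Y (c.pos s 0) (c.zVar α s) (c.wVar Ψ Y s) * (c.vel s 0 / c.pos s 0))
      (Ioc c.start c.exit) s := by
  obtain ⟨w1, w2, w3, w4⟩ := hc.wVar_eq h hrb hs hG
  obtain ⟨h0, -⟩ := hc.region s hs
  obtain ⟨r1, r2, r3⟩ := hc.region' hrb s hs
  have hu := h.u_pos r1 r2.le r3.le
  have he := hc.energy_pos h hrb hs
  have hE := hc.energy_deriv h hrb hs hG
  have hRe : c.pos s 1 * frameEnergy Ψ Y (c.pos s) (c.vel s) ≠ 0 := (mul_pos r1 he).ne'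
  have hin : 1 - (c.angularMomentum / (c.pos s 1 * frameEnergy Ψ Y (c.pos s) (c.vel s))) ^ 2 =
      c.wVar Ψ Y s ^ 2 := by
    rw [div_pow, ← w4]
    field_simp
    ring
  have h3 := ((((hasDerivWithinAt_const s (Ioc c.start c.exit) c.angularMomentum).fun_div
    ((hc.hasDerivWithinAt_pos 1 hs).fun_mul hE) hRe).fun_pow 2).const_sub 1).sqrt
      (by rw [hin]; positivity)
  refine HasDerivWithinAt.congr_deriv h3 ?_
  rw [hin, Real.sqrt_sq w1.le, h.rateB_eq hα h0 (hc.zVar_pos hα hs) w1 (hc.zVar_sq hα hs) r2 r3 hG]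
  have hv1 := vel_one h hc hrb hs
  have hv0 : c.vel s 0 = frameMomentum Ψ Y (c.pos s) (c.vel s) /
      (u Ψ Y (c.pos s 0) (c.pos s 1) * G Ψ Y (c.pos s 0) (c.pos s 1)) := by
    unfold frameMomentum; field_simp
  have hv3 : c.vel s 3 = c.angularMomentum / c.pos s 1 ^ 2 := by
    rw [← hc.angularMomentum_eq hs]; field_simp
  unfold energyRate
  rw [hv1, hv3, hv0, w3]
  set e := frameEnergy Ψ Y (c.pos s) (c.vel s)
  set w := c.wVar Ψ Y s
  set ℓ := c.angularMomentum
  set R := c.pos s 1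
  set r := c.pos s 0
  generalize dSnd (Function.uncurry (u Ψ Y)) (r, R) = UR
  generalize dSnd (Function.uncurry (G Ψ Y)) (r, R) = GR
  generalize dSnd (Function.uncurry Y) (r, R) = YR
  generalize u Ψ Y r R = U at *
  generalize G Ψ Y r R = g at *
  generalize Y r R = y at *
  have h5 : ℓ ^ 2 = (1 - w ^ 2) * (R * e) ^ 2 := w4.symm
  field_simp
  simp only [Nat.cast_ofNat, Nat.add_one_sub_one, pow_one, mul_zero, zero_mul, zero_sub]
  field_simp
  linear_combination (R ^ 2 * e ^ 2 * (y * w - U) * g +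
    (R ^ 3 * e ^ 2 * w * (-(YR * g) + w * (UR * g + U * GR)) + ℓ ^ 2 * U * g) +
    (1 - w ^ 2) * (R * e) ^ 2 * U * g) * h5

end IsDetectedSingularRay

end rayVariables

/-! ### Every ray is a solution in the box; direction versus angle -/

section boxRadius

variable {α ξ β γ δ rmax rb R₀ Z η r₀ : ℝ} {Ψ Y : ℝ → ℝ → ℝ} {M : ℝ → ℝ} {c : Ray}

/-- For `r < r₀` the rates are `η`-close to those of the limiting system in the box. -/
structure IsBoxRadius (α ω rmax Z η : ℝ) (Ψ Y : ℝ → ℝ → ℝ) (r₀ : ℝ) : Prop where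
  pos : 0 < r₀
  le_rmax : r₀ ≤ rmax
  box : ∀ r z w : ℝ, 0 < r → r < r₀ → 0 < z → z ≤ Z + 1 → 0 < w → w ≤ 1 →
    RatesClose ω η z w (rateA α Ψ Y r z w) (rateB α Ψ Y r z w) ∧
    α * z ^ 2 * r ^ 3 < r ∧ WedgeBounds α ω Ψ Y r z ∧
    |dFst (Function.uncurry Y) (r, α * z ^ 2 * r ^ 3)| * z ^ 2 * r < 1 / 16
  rates : ∀ T₀, Real.exp (-T₀) < r₀ → IsRates ω Z T₀ η
    (fun p => rateA α Ψ Y (Real.exp (-p.1)) p.2.1 p.2.2)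
    (fun p => rateB α Ψ Y (Real.exp (-p.1)) p.2.1 p.2.2)

lemma IsInterior.exists_isBoxRadius (h : IsInterior α ξ β γ δ rmax Ψ Y) (hα : 0 < α) (hξ : α ≤ ξ)
    (hZ : 0 < Z) (hη : 0 < η) : ∃ r₀, IsBoxRadius α (ξ / α) rmax Z η Ψ Y r₀ := by
  obtain ⟨r₀, h1, h2, h3, h4⟩ := h.exists_isRates hα hξ hZ hη
  exact ⟨r₀, h1, h2, h3, h4⟩

/-- The rate of change of the angle in the time `-log r`, up to a factor that depends on `w`. -/
noncomputable def angleFactor (α : ℝ) (Ψ Y : ℝ → ℝ → ℝ) (r z : ℝ) : ℝ :=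
  r * u Ψ Y r (α * z ^ 2 * r ^ 3) * G Ψ Y r (α * z ^ 2 * r ^ 3) / (α * z ^ 2 * r ^ 3)

lemma WedgeBounds.u_mul_z_bounds {ω r z : ℝ} (hα : 0 < α) (hr : 0 < r) (hz : 0 < z)
    (h : WedgeBounds α ω Ψ Y r z) :
    15 / 16 < u Ψ Y r (α * z ^ 2 * r ^ 3) * z ∧ u Ψ Y r (α * z ^ 2 * r ^ 3) * z < 17 / 16 := by
  have hR : 0 < α * z ^ 2 * r ^ 3 := by positivity
  have e : u Ψ Y r (α * z ^ 2 * r ^ 3) * z =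
      Real.sqrt (massV Ψ Y (r, α * z ^ 2 * r ^ 3) / (α * r ^ 3)) := by
    rw [u_eq hR.ne', show massV Ψ Y (r, α * z ^ 2 * r ^ 3) / (α * r ^ 3) =
      massV Ψ Y (r, α * z ^ 2 * r ^ 3) / (α * z ^ 2 * r ^ 3) * z ^ 2 by field_simp,
      Real.sqrt_mul' _ (by positivity), Real.sqrt_sq hz.le]
  have h1 := h.V_gt
  have h2 := h.V_lt
  have hα3 : 0 < α * r ^ 3 := by positivity
  rw [← lt_div_iff₀ hα3] at h1
  rw [← div_lt_iff₀ hα3] at h2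
  rw [e]
  constructor
  · rw [Real.lt_sqrt (by norm_num)]; linarith
  · rw [Real.sqrt_lt' (by norm_num)]; linarith

/-- The factor equals (u z) · (G / (α r²)) / z³, and each of its parts is controlled in the box. -/
lemma WedgeBounds.angleFactor_bounds {ω r z : ℝ} (hα : 0 < α) (hω : 0 ≤ ω) (hr : 0 < r)
    (hz : 1 / 2 ≤ z) (hzZ : z ≤ Z) (h : WedgeBounds α ω Ψ Y r z) :
    1 / (4 * Z ^ 3) ≤ angleFactor α Ψ Y r z ∧
      angleFactor α Ψ Y r z ≤ 17 / 2 * (ω + 1 + 2 * Z ^ 3) := by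
  have hz0 : 0 < z := by linarith
  obtain ⟨u1, u2⟩ := h.u_mul_z_bounds hα hr hz0
  have g1 := h.G_ge
  have g2 := h.G_le
  have hα2 : 0 < α * r ^ 2 := by positivity
  rw [← le_div_iff₀ hα2] at g1
  rw [← div_le_iff₀ hα2] at g2
  have e : angleFactor α Ψ Y r z = u Ψ Y r (α * z ^ 2 * r ^ 3) * z *
      (G Ψ Y r (α * z ^ 2 * r ^ 3) / (α * r ^ 2)) / z ^ 3 := by
    unfold angleFactor
    field_simp
  rw [e]
  have hz3 : z ^ 3 ≤ Z ^ 3 := by gcongr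
  have hz8 : (1 / 8 : ℝ) ≤ z ^ 3 := by
    calc (1 / 8 : ℝ) = (1 / 2) ^ 3 := by norm_num
      _ ≤ _ := by gcongr
  have hZ3 : 0 < Z ^ 3 := by linarith
  constructor
  · rw [div_le_div_iff₀ (by positivity) (by positivity)]
    have : (1 / 4 : ℝ) ≤ u Ψ Y r (α * z ^ 2 * r ^ 3) * z *
        (G Ψ Y r (α * z ^ 2 * r ^ 3) / (α * r ^ 2)) := by nlinarith
    nlinarith
  · rw [div_le_iff₀ (by positivity)]
    have h1 : u Ψ Y r (α * z ^ 2 * r ^ 3) * z * (G Ψ Y r (α * z ^ 2 * r ^ 3) / (α * r ^ 2)) ≤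
        17 / 16 * (ω + 1 + 2 * Z ^ 3) :=
      mul_le_mul u2.le (g2.trans (by linarith)) (by linarith) (by norm_num)
    have h2 : 0 ≤ ω + 1 + 2 * Z ^ 3 := by linarith
    nlinarith [mul_le_mul_of_nonneg_left hz8 h2]

namespace IsDetectedSingularRay

lemma zVar_rate_eq (hc : IsDetectedSingularRay Ψ Y rb M R₀ c)
    (h : IsInterior α ξ β γ δ rmax Ψ Y) (hα : 0 < α)
    (hrb : rb < rmax) {s : ℝ} (hs : s ∈ Ioc c.start c.exit)
    (hG : 0 < G Ψ Y (c.pos s 0) (c.pos s 1)) :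
    c.zVar α s / 2 * (c.vel s 1 / c.pos s 1 - 3 * c.vel s 0 / c.pos s 0) =
      rateA α Ψ Y (c.pos s 0) (c.zVar α s) (c.wVar Ψ Y s) * (c.vel s 0 / c.pos s 0) :=
  (uniqueDiffOn_Ioc c.start c.exit s hs).eq_deriv _ (hc.zVar_deriv hα hs)
    (hc.zVar_deriv_rateA h hα hrb hs hG)

lemma vel_three (hc : IsDetectedSingularRay Ψ Y rb M R₀ c)
    (h : IsInterior α ξ β γ δ rmax Ψ Y)
    (hrb : rb < rmax) {s : ℝ} (hs : s ∈ Ioc c.start c.exit)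
    (hG : 0 < G Ψ Y (c.pos s 0) (c.pos s 1)) (hℓ : 0 < c.angularMomentum) :
    c.vel s 3 = u Ψ Y (c.pos s 0) (c.pos s 1) * G Ψ Y (c.pos s 0) (c.pos s 1) / c.pos s 1 *
      (Real.sqrt (1 - c.wVar Ψ Y s ^ 2) / c.wVar Ψ Y s) * c.vel s 0 := by
  obtain ⟨w1, w2, w3, w4⟩ := hc.wVar_eq h hrb hs hG
  obtain ⟨r1, r2, r3⟩ := hc.region' hrb s hs
  have he := hc.energy_pos h hrb hs
  have hsq : 0 < 1 - c.wVar Ψ Y s ^ 2 := by nlinarith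
  have hℓe : c.angularMomentum = Real.sqrt (1 - c.wVar Ψ Y s ^ 2) *
      (c.pos s 1 * frameEnergy Ψ Y (c.pos s) (c.vel s)) := by
    rw [← Real.sqrt_sq hℓ.le, ← w4, Real.sqrt_mul hsq.le, Real.sqrt_sq (by positivity)]
  have h3 : c.vel s 3 = c.angularMomentum / c.pos s 1 ^ 2 := by
    rw [← hc.angularMomentum_eq hs]; field_simp
  have hp : u Ψ Y (c.pos s 0) (c.pos s 1) * G Ψ Y (c.pos s 0) (c.pos s 1) * c.vel s 0 =
    c.wVar Ψ Y s * frameEnergy Ψ Y (c.pos s) (c.vel s) := w3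
  rw [h3, hℓe]
  have e2 : u Ψ Y (c.pos s 0) (c.pos s 1) * G Ψ Y (c.pos s 0) (c.pos s 1) / c.pos s 1 *
      (Real.sqrt (1 - c.wVar Ψ Y s ^ 2) / c.wVar Ψ Y s) * c.vel s 0 =
      u Ψ Y (c.pos s 0) (c.pos s 1) * G Ψ Y (c.pos s 0) (c.pos s 1) * c.vel s 0 / c.pos s 1 *
      (Real.sqrt (1 - c.wVar Ψ Y s ^ 2) / c.wVar Ψ Y s) := by ring
  rw [e2, hp]
  field_simp

set_option maxHeartbeats 800000 in
/-- Every ray gives rise to a solution in the box. -/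
theorem exists_boxSolution (hc : IsDetectedSingularRay Ψ Y rb M R₀ c)
    (h : IsInterior α ξ β γ δ rmax Ψ Y) (hα : 0 < α) (hω : 25 < ξ / α)
    (hZ : ξ / α ≤ 2 * Z ^ 3) (hZ1 : 3 / 2 ≤ Z) (hη : η < ξ / α / 4)
    (hr : IsBoxRadius α (ξ / α) rmax Z η Ψ Y r₀) (hrb : rb < r₀) :
    ∃ z w, IsBoxSolution Z (-Real.log rb) (fun p => rateA α Ψ Y (Real.exp (-p.1)) p.2.1 p.2.2)
      (fun p => rateB α Ψ Y (Real.exp (-p.1)) p.2.1 p.2.2) z w ∧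
      z (-Real.log rb) = c.zVar α c.exit ∧ w (-Real.log rb) = c.wVar Ψ Y c.exit ∧
      0 < G Ψ Y (c.pos c.exit 0) (c.pos c.exit 1) ∧
      (∀ z₂, 0 ≤ z₂ → (c.HasDirection (α * z₂ ^ 2) ↔ Tendsto z atTop (𝓝 z₂))) ∧
      (0 < c.angularMomentum → ∃ f, (∀ t ∈ Ici (-Real.log rb), HasDerivWithinAt f
        (-(angleFactor α Ψ Y (Real.exp (-t)) (z t) * (Real.sqrt (1 - w t ^ 2) / w t)))
          (Ici (-Real.log rb)) t) ∧ (c.AngleToNegInfinity ↔ Tendsto f atTop atBot)) := by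
  have hrbm := hrb.trans_le hr.le_rmax
  obtain ⟨S, hS, hSd, hSi, hSlim, hTlim⟩ := hc.exists_time
  have hrbe : rb = c.pos c.exit 0 := hc.exit_r.symm
  have hrb0 : 0 < rb := by rw [hrbe]; exact (hc.region _ hc.exit_mem).1
  set T₀ := -Real.log rb with hT₀
  set ω := ξ / α with hωdef
  have hexp : ∀ t ∈ Ici T₀, Real.exp (-t) < r₀ := fun t ht => by
    refine lt_of_le_of_lt ?_ hrb
    rw [← Real.exp_log hrb0, Real.exp_le_exp]
    have : T₀ ≤ t := ht
    linarith
  set z : ℝ → ℝ := fun t => c.zVar α (S t) with hz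
  set w : ℝ → ℝ := fun t => c.wVar Ψ Y (S t) with hw
  have hz0 : ∀ t ∈ Ici T₀, 0 < z t := fun t ht => hc.zVar_pos hα (hS t ht).1
  have hR : ∀ t ∈ Ici T₀, c.pos (S t) 1 = α * z t ^ 2 * Real.exp (-t) ^ 3 := fun t ht => by
    rw [← (hS t ht).2]; exact hc.zVar_sq hα (hS t ht).1
  have hmaps : MapsTo S (Ici T₀) (Ioc c.start c.exit) := fun t ht => (hS t ht).1
  have hv : ∀ t ∈ Ici T₀, 0 < c.vel (S t) 0 := fun t ht => hc.vel_r _ (hS t ht).1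
  -- derivatives in the time `t`
  set a : ℝ → ℝ := fun t => c.zVar α (S t) / 2 * (c.vel (S t) 1 / c.pos (S t) 1 -
    3 * c.vel (S t) 0 / c.pos (S t) 0) * (Real.exp (-t) / c.vel (S t) 0) with ha
  have hdz : ∀ t ∈ Ici T₀, HasDerivWithinAt z (-a t) (Ici T₀) t := fun t ht => by
    refine ((hc.zVar_deriv hα (hS t ht).1).comp t (hSd t ht) hmaps).congr_deriv ?_
    simp only [ha]; ring
  -- The rate `a` is defined kinematically. Its identification with `rateA` requires G > 0, which is
  -- not yet known before z is bounded.
  have haA : ∀ t ∈ Ici T₀, 0 < G Ψ Y (c.pos (S t) 0) (c.pos (S t) 1) →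
      a t = rateA α Ψ Y (Real.exp (-t)) (z t) (w t) := fun t ht hG => by
    simp only [ha]
    rw [hc.zVar_rate_eq h hα hrbm (hS t ht).1 hG, (hS t ht).2]
    have := hv t ht
    field_simp
    rfl
  have hdw : ∀ t ∈ Ici T₀, 0 < G Ψ Y (c.pos (S t) 0) (c.pos (S t) 1) →
      HasDerivWithinAt w (-((1 - w t ^ 2) * rateB α Ψ Y (Real.exp (-t)) (z t) (w t)))
        (Ici T₀) t := fun t ht hG => by
    refine ((hc.wVar_deriv_rateB h hα hrbm (hS t ht).1 hG).comp t (hSd t ht) hmaps).congr_deriv ?_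
    rw [(hS t ht).2]
    have := hv t ht
    simp only [hw, hz]
    field_simp
  have hww : ∀ t ∈ Ici T₀, 0 < G Ψ Y (c.pos (S t) 0) (c.pos (S t) 1) → 0 < w t ∧ w t < 1 :=
    fun t ht hG => by
      obtain ⟨w1, w2, -, -⟩ := hc.wVar_eq h hrbm (hS t ht).1 hG
      exact ⟨w1, w2⟩
  have hGpos : ∀ t ∈ Ici T₀, WedgeBounds α ω Ψ Y (Real.exp (-t)) (z t) →
      0 < G Ψ Y (c.pos (S t) 0) (c.pos (S t) 1) := fun t ht hb => by
    rw [(hS t ht).2, hR t ht]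
    refine lt_of_lt_of_le ?_ hb.G_ge
    positivity
  have hbox : ∀ t ∈ Ici T₀, z t ≤ Z + 1 → WedgeBounds α ω Ψ Y (Real.exp (-t)) (z t) :=
    fun t ht hzt => (hr.box _ (z t) 1 (Real.exp_pos _) (hexp t ht) (hz0 t ht) hzt one_pos
      le_rfl).2.2.1
  -- `z` gets below `Z`
  have hfreq : ∃ᶠ t in atTop, z t < Z := by
    intro hcon
    -- Otherwise z ≥ Z from some time on. As R / r → 0 the ray lies in the wedge, and 2 z ≥ 3 gives
    -- `driftW` ≥ 2 z⁴. After the error (1 + z⁴) / 2 there remains w b ≥ 1/2, so w² would decrease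
    -- for ever at a definite rate.
    obtain ⟨ε, hε, -, r₁, hr₁, -, hwr⟩ := h.wedge_rates hα ((one_le_div hα).1 (by linarith : 1 ≤ ω))
      (show (0 : ℝ) < 1 / 2 by norm_num)
    have h1 : ∀ᶠ t in atTop, Real.exp (-t) < r₁ :=
      (Real.tendsto_exp_neg_atTop_nhds_zero).eventually_lt_const hr₁
    have h2 : ∀ᶠ t in atTop, c.pos (S t) 1 / c.pos (S t) 0 < ε :=
      hSlim.eventually (hc.start_R.eventually_lt_const hε)
    obtain ⟨T₁, hT₁⟩ := eventually_atTop.1 (((h1.and h2).and hcon).and (eventually_ge_atTop T₀))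
    have hk : ∀ t ∈ Ici T₁, t ∈ Ici T₀ ∧ Z ≤ z t ∧ 0 < w t ∧ w t < 1 ∧
        HasDerivWithinAt w (-((1 - w t ^ 2) * rateB α Ψ Y (Real.exp (-t)) (z t) (w t)))
          (Ici T₀) t ∧ 1 / 2 ≤ w t * rateB α Ψ Y (Real.exp (-t)) (z t) (w t) := by
      intro t ht
      obtain ⟨⟨⟨q1, q2⟩, q3⟩, q4⟩ := hT₁ t ht
      have q5 : Z ≤ z t := not_lt.1 q3
      have hzt := hz0 t q4
      have q6 : α * z t ^ 2 * Real.exp (-t) ^ 3 ≤ ε * Real.exp (-t) := by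
        rw [← hR t q4]
        rw [(hS t q4).2, div_lt_iff₀ (Real.exp_pos _)] at q2
        exact q2.le
      have hG := hGpos t q4 (hwr _ (z t) 1 (Real.exp_pos _) q1 hzt one_pos le_rfl q6).2
      obtain ⟨w1, w2⟩ := hww t q4 hG
      refine ⟨q4, q5, w1, w2, hdw t q4 hG, ?_⟩
      have q7 := (abs_le.1 (hwr _ (z t) (w t) (Real.exp_pos _) q1 hzt w1 w2.le q6).1.2).1
      generalize rateB α Ψ Y (Real.exp (-t)) (z t) (w t) = b at *
      have z1 : 1 ≤ z t ^ 4 := one_le_pow₀ (by linarith)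
      have z2 : 0 ≤ ω * (2 * z t - 3 * w t) := mul_nonneg (by linarith) (by linarith)
      unfold driftW at q7
      have z3 : 0 < z t ^ 4 := by linarith
      have : z t ^ 4 * (1 / 2) ≤ z t ^ 4 * (w t * b) := by nlinarith
      exact le_of_mul_le_mul_left this z3
    have hT₁0 : T₀ ≤ T₁ := (hk T₁ self_mem_Ici).1
    have hD : ∀ t ∈ Ici T₁, HasDerivWithinAt (fun t => w t ^ 2)
        (-(2 * (1 - w t ^ 2) * (w t * rateB α Ψ Y (Real.exp (-t)) (z t) (w t)))) (Ici T₁) t := by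
      intro t ht
      refine (((hk t ht).2.2.2.2.1.mono (Ici_subset_Ici.2 hT₁0)).fun_pow 2).congr_deriv ?_
      simp only [Nat.cast_ofNat, Nat.add_one_sub_one, pow_one]
      ring
    have hanti : AntitoneOn (fun t => w t ^ 2) (Ici T₁) :=
      antitoneOn_Ici_of_deriv_nonpos hD fun t ht => by
        obtain ⟨-, -, w1, w2, -, w3⟩ := hk t ht
        have : 0 ≤ 2 * (1 - w t ^ 2) * (w t * rateB α Ψ Y (Real.exp (-t)) (z t) (w t)) :=
          mul_nonneg (by nlinarith) (by linarith)
        linarith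
    obtain ⟨-, -, w1, w2, -, -⟩ := hk T₁ self_mem_Ici
    refine not_decreasing_of_bddBelow (c := 1 - w T₁ ^ 2) (m := 0) (by nlinarith) hD
      (fun t ht => ?_) fun t _ => sq_nonneg _
    obtain ⟨-, -, w1', w2', -, w3⟩ := hk t ht
    have h5 : w t ^ 2 ≤ w T₁ ^ 2 := hanti self_mem_Ici ht ht
    have : (1 - w T₁ ^ 2) * 1 ≤
        2 * (1 - w t ^ 2) * (w t * rateB α Ψ Y (Real.exp (-t)) (z t) (w t)) := by
      nlinarith [mul_le_mul_of_nonneg_left w3 (by nlinarith : 0 ≤ 1 - w t ^ 2)]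
    linarith
  -- hence it is always below `Z`
  have hzle : ∀ t ∈ Ici T₀, z t ≤ Z := by
    intro t ht
    obtain ⟨T, hT1, hT2⟩ := (hfreq.and_eventually (eventually_ge_atTop t)).exists
    have hsub : Icc t T ⊆ Ici T₀ := fun s hs => le_trans ht hs.1
    -- At z = Z, z increases with time, so {z ≤ Z} is invariant backward; it is started from the
    -- later and later times at which z < Z.
    have := halfline_invariant_backward (f := fun s => Z - z s) (f' := a) (a := t) (b := T)
      (fun s hs => (((hdz s (hsub hs)).mono hsub).const_sub Z).congr_deriv (neg_neg _))
      (by linarith) (fun s hs hzs => by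
        have hzZ : z s = Z := by linarith
        have hG := hGpos s (hsub hs) (hbox s (hsub hs) (by linarith))
        obtain ⟨w1, w2⟩ := hww s (hsub hs) hG
        rw [haA s (hsub hs) hG]
        refine (hr.box _ (z s) (w s) (Real.exp_pos _) (hexp s (hsub hs)) (hz0 s (hsub hs))
          (by linarith) w1 w2.le).1.a_neg (hz0 s (hsub hs)) w1 ?_
        rw [hzZ]
        have e1 : 0 ≤ w s * (Z * (2 * Z ^ 3 - ω)) :=
          mul_nonneg w1.le (mul_nonneg (by linarith) (by linarith))
        have e2 : 0 < Z ^ 3 := by linarith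
        unfold driftZ
        nlinarith) t ⟨le_rfl, hT2⟩
    linarith
  have hB : ∀ t ∈ Ici T₀, WedgeBounds α ω Ψ Y (Real.exp (-t)) (z t) := fun t ht =>
    hbox t ht (by linarith [hzle t ht])
  have hG : ∀ t ∈ Ici T₀, 0 < G Ψ Y (c.pos (S t) 0) (c.pos (S t) 1) := fun t ht =>
    hGpos t ht (hB t ht)
  -- Outside the trapped region u < Y < 17/16, while u z > 15/16; hence z > 15/17.
  have hzge : ∀ t ∈ Ici T₀, 1 / 2 ≤ z t := by
    intro t ht
    obtain ⟨u1, -⟩ := (hB t ht).u_mul_z_bounds hα (Real.exp_pos _) (hz0 t ht)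
    have h1 := hc.u_lt_Y h hrbm (hS t ht).1
    rw [(hS t ht).2, hR t ht] at h1
    have h2 := (hB t ht).Y_lt
    have := hz0 t ht
    nlinarith
  have hdz' : ∀ t ∈ Ici T₀, HasDerivWithinAt z (-rateA α Ψ Y (Real.exp (-t)) (z t) (w t))
      (Ici T₀) t := fun t ht => by
    rw [← haA t ht (hG t ht)]; exact hdz t ht
  have htraj : IsTrajectory Z T₀ z w (fun t => rateA α Ψ Y (Real.exp (-t)) (z t) (w t))
      (fun t => rateB α Ψ Y (Real.exp (-t)) (z t) (w t)) :=
    ⟨hdz', fun t ht => hdw t ht (hG t ht), hzge, hzle, fun t ht => (hww t ht (hG t ht)).1,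
      fun t ht => (hww t ht (hG t ht)).2⟩
  have hw6 : ∀ t ∈ Ici T₀, 1 / 6 < w t := fun t ht => by
    refine w_gt_sixth (ω := ω) (Z := Z) (by linarith) (by linarith) t z w _ _ (htraj.mono ht) fun s hs => ?_
    have hs' : s ∈ Ici T₀ := le_trans (mem_Ici.1 ht) hs
    exact (hr.box _ _ _ (Real.exp_pos _) (hexp s hs') (hz0 s hs') (by linarith [hzle s hs'])
      (hww s hs' (hG s hs')).1 (hww s hs' (hG s hs')).2.le).1.mono hη.le
  have hST : S T₀ = c.exit := by
    have := (hSi c.exit hc.exit_mem).2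
    rwa [hc.exit_r] at this
  have hT₀m : T₀ ∈ Ici T₀ := self_mem_Ici
  -- Limits at the past end of the ray correspond to limits t → ∞, in both directions.
  have htrans : ∀ (F : ℝ → ℝ) (l : Filter ℝ), Tendsto F (𝓝[>] c.start) l ↔
      Tendsto (fun t => F (S t)) atTop l := fun F l => by
    refine ⟨fun hF => hF.comp hSlim, fun hF => (hF.comp hTlim).congr' ?_⟩
    filter_upwards [Ioc_mem_nhdsGT hc.start_lt] with s hs
    simp only [Function.comp, (hSi s hs).2]
  refine ⟨z, w, ⟨hdz', fun t ht => hdw t ht (hG t ht), hzge, hzle, fun t ht => (hw6 t ht).le,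
    fun t ht => (hww t ht (hG t ht)).2⟩, by simp only [hz, hST], by simp only [hw, hST],
    by have := hG T₀ hT₀m; rwa [hST] at this, fun z₂ hz₂ => ?_, fun hℓ => ?_⟩
  · rw [Ray.HasDirection, htrans]
    have e : ∀ t ∈ Ici T₀, c.pos (S t) 1 / c.pos (S t) 0 ^ 3 = α * z t ^ 2 := fun t ht => by
      rw [hR t ht, (hS t ht).2]
      have := Real.exp_pos (-t)
      field_simp
    constructor
    · intro hd
      have h1 : Tendsto (fun t => Real.sqrt (c.pos (S t) 1 / c.pos (S t) 0 ^ 3 / α)) atTop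
          (𝓝 (Real.sqrt (α * z₂ ^ 2 / α))) :=
        (Real.continuous_sqrt.tendsto _).comp (hd.div_const α)
      rw [mul_div_cancel_left₀ _ hα.ne', Real.sqrt_sq hz₂] at h1
      refine h1.congr' ?_
      filter_upwards [eventually_ge_atTop T₀] with t ht
      rw [e t ht, mul_div_cancel_left₀ _ hα.ne', Real.sqrt_sq (hz0 t ht).le]
    · intro hd
      refine ((hd.pow 2).const_mul α).congr' ?_
      filter_upwards [eventually_ge_atTop T₀] with t ht
      exact (e t ht).symm
  · refine ⟨fun t => c.pos (S t) 3, fun t ht => ?_, by rw [Ray.AngleToNegInfinity, htrans]⟩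
    refine ((hc.hasDerivWithinAt_pos 3 (hS t ht).1).comp t (hSd t ht) hmaps).congr_deriv ?_
    rw [hc.vel_three h hrbm (hS t ht).1 (hG t ht) hℓ, hR t ht, (hS t ht).2]
    have := hv t ht
    have := hz0 t ht
    have := Real.exp_pos (-t)
    unfold angleFactor
    simp only [hw]
    field_simp

/-- The rays of the second class are characterized by their direction, and by their angle. -/
theorem hasDirection_iff (hc : IsDetectedSingularRay Ψ Y rb M R₀ c)
    (h : IsInterior α ξ β γ δ rmax Ψ Y) (hα : 0 < α) {z₂ w₂ : ℝ} (hs : IsSaddle (ξ / α) z₂ w₂)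
    (hZ : ξ / α ≤ 2 * Z ^ 3) (hZ1 : 3 / 2 ≤ Z) (hη : η < ξ / α / 4)
    (hr : IsBoxRadius α (ξ / α) rmax Z η Ψ Y r₀) (hrb : rb < r₀) (hℓ : 0 < c.angularMomentum) :
    c.HasDirection (α * z₂ ^ 2) ↔ c.AngleToNegInfinity := by
  obtain ⟨z, w, hsol, -, -, -, hdir, hang⟩ := hc.exists_boxSolution h hα hs.ω_gt hZ hZ1 hη hr hrb
  obtain ⟨f, hf, hfa⟩ := hang hℓ
  rw [hdir z₂ hs.z_pos.le, hfa]
  have hrb0 : 0 < rb := by rw [← hc.exit_r]; exact (hc.region _ hc.exit_mem).1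
  have hω : 0 < ξ / α := by linarith [hs.ω_gt]
  have hZ0 : 0 < Z := by linarith
  set T₀ := -Real.log rb with hT₀
  have hexpT : Real.exp (-T₀) < r₀ := by rwa [hT₀, neg_neg, Real.exp_log hrb0]
  have hrates := hr.rates T₀ hexpT
  have hexp : ∀ t ∈ Ici T₀, Real.exp (-t) < r₀ := fun t ht =>
    (Real.exp_le_exp.2 (neg_le_neg ht)).trans_lt hexpT
  have hbd : ∀ t ∈ Ici T₀, 1 / (4 * Z ^ 3) ≤ angleFactor α Ψ Y (Real.exp (-t)) (z t) ∧
      angleFactor α Ψ Y (Real.exp (-t)) (z t) ≤ 17 / 2 * (ξ / α + 1 + 2 * Z ^ 3) := fun t ht => by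
    have z1 := hsol.z_ge t ht
    have z2 := hsol.z_le t ht
    exact (hr.box _ (z t) 1 (Real.exp_pos _) (hexp t ht) (by linarith) (by linarith) one_pos
      le_rfl).2.2.1.angleFactor_bounds hα hω.le (Real.exp_pos _) z1 z2
  have htr := hsol.isTrajectory
  have has := hsol.isAsymptotic hrates
  obtain ⟨z₁, w₁, c1, -, c2, c3, c4, c5⟩ := hs.exists_corner_I (show 0 < 1 - w₂ by linarith [hs.w_lt])
  have hw₁0 : 0 < w₁ := by linarith [hs.w_gt]
  -- In the trapped case both sides of the equivalence fail, and at the saddle both hold.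
  rcases trajectory_dichotomy (w₁ := w₁) hs hZ0 htr has c1 (by linarith) with hfr | ⟨hz, hw⟩
  · obtain ⟨η', hη', k, hk, htrap⟩ := trap_corner_I hω hZ0 hw₁0 c4 c5
    obtain ⟨T', hT', hcl⟩ := has.exists_ge hη' T₀
    obtain ⟨T, ⟨hT1, hT2⟩, hT3⟩ := (hfr.and_eventually (eventually_ge_atTop T')).exists
    have hTT : T₀ ≤ T := hT'.le.trans hT3
    have hb := htrap T z w _ _ (htr.mono hTT) (fun s hs => hcl s (le_trans hT3 hs)) hT1.le hT2.le
    refine iff_of_false (not_tendsto_saddle_of_trap hs hZ0 (htr.mono hTT) has hk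
      fun t ht => (hb t ht).2.2) ?_
    refine angle_bounded_of_trap (C := 6 * (17 / 2 * (ξ / α + 1 + 2 * Z ^ 3))) (htr.mono hTT) hk
      (by positivity) (fun t ht => (hb t ht).2.2)
      (fun t ht => (hf t (le_trans hTT ht)).mono (Ici_subset_Ici.2 hTT)) fun t ht => ?_
    have ht' : t ∈ Ici T₀ := le_trans hTT ht
    obtain ⟨b1, b2⟩ := hbd t ht'
    have hw6 := hsol.w_ge t ht'
    have hsq := Real.sqrt_nonneg (1 - w t ^ 2)
    have hq : Real.sqrt (1 - w t ^ 2) / w t ≤ 6 * Real.sqrt (1 - w t ^ 2) := by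
      rw [div_le_iff₀ (by linarith)]; nlinarith
    have h0 : 0 ≤ Real.sqrt (1 - w t ^ 2) / w t := div_nonneg hsq (by linarith)
    have := mul_le_mul b2 hq h0 (by positivity)
    linarith
  -- Near the saddle w < v for some v < 1, so √(1 - w²) / w is bounded below and the angle falls at
  -- a definite rate in t.
  · refine iff_of_true hz ?_
    obtain ⟨v, hv1, hv2⟩ := exists_between hs.w_lt
    obtain ⟨T, hT⟩ := eventually_atTop.1 ((hw.eventually_lt_const hv1).and (eventually_ge_atTop T₀))
    have hTT : T₀ ≤ T := (hT T le_rfl).2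
    have hv0 : 0 < v := by linarith [hs.w_gt]
    have hsq : 0 < Real.sqrt (1 - v ^ 2) := Real.sqrt_pos.2 (by nlinarith)
    refine tendsto_atBot_of_deriv_le (T := T) (c := 1 / (4 * Z ^ 3) * Real.sqrt (1 - v ^ 2))
      (by positivity) (fun t ht => (hf t (le_trans hTT ht)).mono (Ici_subset_Ici.2 hTT))
      fun t ht => ?_
    have ht' : t ∈ Ici T₀ := le_trans hTT ht
    have hwp : 0 < w t := by linarith [hsol.w_ge t ht']
    have hwv := (hT t ht).1
    have h1 : Real.sqrt (1 - v ^ 2) ≤ Real.sqrt (1 - w t ^ 2) / w t := by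
      rw [le_div_iff₀ hwp]
      have h2 : Real.sqrt (1 - v ^ 2) ≤ Real.sqrt (1 - w t ^ 2) :=
        Real.sqrt_le_sqrt (by nlinarith)
      nlinarith [hsol.w_lt t ht']
    have := mul_le_mul (hbd t ht').1 h1 hsq.le (le_trans (by positivity) (hbd t ht').1)
    linarith

end IsDetectedSingularRay

end boxRadius

/-! ### Geodesics of the exterior -/

section exterior

variable {α ξ β γ δ rmax rb R₀ : ℝ} {Ψ Y : ℝ → ℝ → ℝ} {M : ℝ → ℝ} {c : Ray}

lemma exterior_momentum_zero (x v : Fin 4 → ℝ) :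
    ∑ ν, exteriorMetric M x 0 ν * v ν = -chi M (x 1) * v 0 := by
  simp [Fin.sum_univ_four, exteriorMetric]

lemma exterior_momentum_one (x v : Fin 4 → ℝ) :
    ∑ ν, exteriorMetric M x 1 ν * v ν = (chi M (x 1))⁻¹ * v 1 := by
  simp [Fin.sum_univ_four, exteriorMetric]

lemma exterior_momentum_two (x v : Fin 4 → ℝ) :
    ∑ ν, exteriorMetric M x 2 ν * v ν = x 1 ^ 2 * v 2 := by
  simp [Fin.sum_univ_four, exteriorMetric]

lemma exterior_momentum_three (x v : Fin 4 → ℝ) :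
    ∑ ν, exteriorMetric M x 3 ν * v ν = x 1 ^ 2 * Real.sin (x 2) ^ 2 * v 3 := by
  simp [Fin.sum_univ_four, exteriorMetric]

lemma exterior_norm (x v : Fin 4 → ℝ) :
    ∑ μ, ∑ ν, exteriorMetric M x μ ν * v μ * v ν =
      -chi M (x 1) * v 0 ^ 2 + (chi M (x 1))⁻¹ * v 1 ^ 2 + x 1 ^ 2 * v 2 ^ 2 +
        x 1 ^ 2 * Real.sin (x 2) ^ 2 * v 3 ^ 2 := by
  simp [Fin.sum_univ_four, exteriorMetric]; ring

lemma exterior_force_zero (x v : Fin 4 → ℝ) :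
    (1 / 2 : ℝ) * ∑ ν, ∑ σ, partialMetric (exteriorMetric M) 0 ν σ x * v ν * v σ = 0 := by
  simp [exteriorMetric, partialMetric]

lemma exterior_force_three (x v : Fin 4 → ℝ) :
    (1 / 2 : ℝ) * ∑ ν, ∑ σ, partialMetric (exteriorMetric M) 3 ν σ x * v ν * v σ = 0 := by
  simp [exteriorMetric, partialMetric]

lemma exterior_force_two (x v : Fin 4 → ℝ) (hx : x 2 = Real.pi / 2) :
    (1 / 2 : ℝ) * ∑ ν, ∑ σ, partialMetric (exteriorMetric M) 2 ν σ x * v ν * v σ = 0 := by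
  have : deriv (fun t : ℝ => x 1 ^ 2 * Real.sin t ^ 2) (Real.pi / 2) = 0 := by
    have := (((Real.hasDerivAt_sin (Real.pi / 2)).pow 2).const_mul (x 1 ^ 2)).deriv
    simp only [Real.cos_pi_div_two, mul_zero] at this
    exact this
  simp [Fin.sum_univ_four, exteriorMetric, partialMetric, hx]

lemma exterior_force_one {a : ℝ} (x v : Fin 4 → ℝ) (hx : x 2 = Real.pi / 2)
    (hχ : chi M (x 1) ≠ 0) (ha : HasDerivAt (chi M) a (x 1)) :
    (1 / 2 : ℝ) * ∑ ν, ∑ σ, partialMetric (exteriorMetric M) 1 ν σ x * v ν * v σ =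
      (-a * v 0 ^ 2 - a / chi M (x 1) ^ 2 * v 1 ^ 2) / 2 + x 1 * (v 2 ^ 2 + v 3 ^ 2) := by
  have h1 : deriv (fun t : ℝ => t ^ 2) (x 1) = 2 * x 1 := by simp
  have h2 : deriv (fun t => chi M t) (x 1) = a := ha.deriv
  have h3 : deriv (fun t => (chi M t)⁻¹) (x 1) = -a / chi M (x 1) ^ 2 := (ha.fun_inv hχ).deriv
  simp [Fin.sum_univ_four, exteriorMetric, partialMetric, hx, h2, h3]
  ring

/-- The matching of the masses turns the exterior lapse on the boundary into the frame quantities Y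
and u. -/
lemma IsExteriorMass.chi_eq (hM : IsExteriorMass Ψ rb M) (h : IsInterior α ξ β γ δ rmax Ψ Y)
    (hrb : rb ≤ rmax) {R : ℝ} (h0 : 0 < R) (h1 : R ≤ rb) :
    chi M R = Y rb R ^ 2 - u Ψ Y rb R ^ 2 := by
  rw [chi, hM.matching R ⟨h0.le, h1⟩, u, Real.sq_sqrt (h.uSq_pos rb R h0 h1 hrb).le, uSq]
  ring

namespace IsDetectedSingularRay

lemma exit_mem_ext (hc : IsDetectedSingularRay Ψ Y rb M R₀ c) : c.exit ∈ Icc c.exit c.finish :=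
  ⟨le_rfl, hc.exit_lt.le⟩

lemma hasDerivWithinAt_extPos (hc : IsDetectedSingularRay Ψ Y rb M R₀ c) (i : Fin 4) {s : ℝ}
    (hs : s ∈ Icc c.exit c.finish) :
    HasDerivWithinAt (fun t => c.extPos t i) (c.extVel s i) (Icc c.exit c.finish) s :=
  hasDerivWithinAt_pi.1 (hc.ext_geodesic s hs).1 i

lemma extVel_two (hc : IsDetectedSingularRay Ψ Y rb M R₀ c) {s : ℝ}
    (hs : s ∈ Icc c.exit c.finish) : c.extVel s 2 = 0 := by
  have h1 : HasDerivWithinAt (fun t => c.extPos t 2) 0 (Icc c.exit c.finish) s :=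
    (hasDerivWithinAt_const s _ (Real.pi / 2)).congr hc.ext_equatorial (hc.ext_equatorial s hs)
  exact (uniqueDiffOn_Icc hc.exit_lt s hs).eq_deriv _ (hc.hasDerivWithinAt_extPos 2 hs) h1

lemma ext_angularMomentum (hc : IsDetectedSingularRay Ψ Y rb M R₀ c) {s : ℝ}
    (hs : s ∈ Icc c.exit c.finish) : c.extPos s 1 ^ 2 * c.extVel s 3 = c.angularMomentum := by
  have h1 : ∀ t ∈ Icc c.exit c.finish, c.extPos t 1 ^ 2 * c.extVel t 3 =
      ∑ ν, exteriorMetric M (c.extPos t) 3 ν * c.extVel t ν := fun t ht => by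
    rw [exterior_momentum_three, hc.ext_equatorial t ht, Real.sin_pi_div_two]; ring
  have h2 := eq_of_hasDerivWithinAt_zero ordConnected_Icc (f := fun t =>
    ∑ ν, exteriorMetric M (c.extPos t) 3 ν * c.extVel t ν) (fun t ht => by
      have := (hc.ext_geodesic t ht).2.2 3
      rwa [exterior_force_three] at this) hs hc.exit_mem_ext
  rw [h1 s hs, h2, ← h1 _ hc.exit_mem_ext, Ray.angularMomentum]

lemma ext_frequency (hc : IsDetectedSingularRay Ψ Y rb M R₀ c) {s : ℝ}
    (hs : s ∈ Icc c.exit c.finish) : chi M (c.extPos s 1) * c.extVel s 0 = c.frequency M := by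
  have h2 := eq_of_hasDerivWithinAt_zero ordConnected_Icc (f := fun t =>
    ∑ ν, exteriorMetric M (c.extPos t) 0 ν * c.extVel t ν) (fun t ht => by
      have := (hc.ext_geodesic t ht).2.2 0
      rwa [exterior_force_zero] at this) hs hc.exit_mem_ext
  simp only [exterior_momentum_zero] at h2
  unfold Ray.frequency
  linarith

lemma frequency_pos (hc : IsDetectedSingularRay Ψ Y rb M R₀ c) : 0 < c.frequency M := by
  rw [← hc.ext_frequency hc.exit_mem_ext]
  exact mul_pos (hc.ext_region _ hc.exit_mem_ext) (hc.ext_future _ hc.exit_mem_ext)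

lemma ext_null (hc : IsDetectedSingularRay Ψ Y rb M R₀ c) {s : ℝ}
    (hs : s ∈ Icc c.exit c.finish) (hR : 0 < c.extPos s 1) :
    c.frequency M ^ 2 = c.extVel s 1 ^ 2 +
      chi M (c.extPos s 1) * (c.angularMomentum / c.extPos s 1) ^ 2 := by
  have h1 := (hc.ext_geodesic s hs).2.1
  rw [exterior_norm, hc.extVel_two hs, hc.ext_equatorial s hs, Real.sin_pi_div_two] at h1
  have hχ := hc.ext_region s hs
  rw [← hc.ext_frequency hs, ← hc.ext_angularMomentum hs]
  field_simp at h1 ⊢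
  linarith

lemma extPos_exit_pos (hc : IsDetectedSingularRay Ψ Y rb M R₀ c) :
    0 < c.extPos c.exit 1 ∧ c.extPos c.exit 1 < rb := by
  rw [hc.join_pos 1 (by decide), ← hc.exit_r]
  exact ⟨(hc.region _ hc.exit_mem).2.1, (hc.region _ hc.exit_mem).2.2.1⟩

/-- Between the exit and R₀ the radius takes every intermediate value with positive radial velocity,
and the null condition reads ω² = (dR/dκ)² + χ ℓ² / R². So there is no turning point at any of these
radii. -/
lemma frequency_sq_gt (hc : IsDetectedSingularRay Ψ Y rb M R₀ c) {R : ℝ}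
    (hR : R ∈ Icc (c.pos c.exit 1) R₀) :
    0 < chi M R ∧ chi M R * c.angularMomentum ^ 2 < (c.frequency M * R) ^ 2 := by
  rw [← hc.join_pos 1 (by decide), ← hc.detected] at hR
  have hcont : ContinuousOn (fun s => c.extPos s 1) (Icc c.exit c.finish) := fun s hs =>
    (hc.hasDerivWithinAt_extPos 1 hs).continuousWithinAt
  obtain ⟨s, hs, rfl⟩ := intermediate_value_Icc hc.exit_lt.le hcont hR
  simp only at hR ⊢
  have hR0 := hc.extPos_exit_pos.1.trans_le hR.1
  have h1 := hc.ext_null hs hR0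
  have h2 := pow_pos (hc.ext_outgoing s hs) 2
  refine ⟨hc.ext_region s hs, ?_⟩
  have h3 : chi M (c.extPos s 1) * c.angularMomentum ^ 2 =
    chi M (c.extPos s 1) * (c.angularMomentum / c.extPos s 1) ^ 2 * c.extPos s 1 ^ 2 := by
    field_simp
  rw [h3, mul_pow, h1]
  have := pow_pos hR0 2
  nlinarith

/-- The frequency in terms of the data in the comoving frame. -/
lemma frequency_eq (hc : IsDetectedSingularRay Ψ Y rb M R₀ c) (hM : IsExteriorMass Ψ rb M)
    (h : IsInterior α ξ β γ δ rmax Ψ Y) (hrb : rb < rmax)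
    (hG : 0 < G Ψ Y (c.pos c.exit 0) (c.pos c.exit 1)) :
    c.frequency M = Y rb (c.pos c.exit 1) * frameEnergy Ψ Y (c.pos c.exit) (c.vel c.exit) -
      u Ψ Y rb (c.pos c.exit 1) * frameMomentum Ψ Y (c.pos c.exit) (c.vel c.exit) ∧
    0 < Y rb (c.pos c.exit 1) * frameMomentum Ψ Y (c.pos c.exit) (c.vel c.exit) -
      u Ψ Y rb (c.pos c.exit 1) * frameEnergy Ψ Y (c.pos c.exit) (c.vel c.exit) := by
  have hm := hc.exit_mem
  obtain ⟨r1, r2, r3⟩ := hc.region' hrb _ hm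
  have h1 := hc.ext_null hc.exit_mem_ext hc.extPos_exit_pos.1
  have h2 := vel_one h hc hrb hm
  have h3 := hc.energy_sq h hrb hm
  have h4 := hc.energy_pos h hrb hm
  have h5 := hc.u_lt_Y h hrb hm
  obtain ⟨w1, w2, w3, -⟩ := hc.wVar_eq h hrb hm hG
  have h6 := hc.ext_outgoing _ hc.exit_mem_ext
  have hu := h.u_pos r1 r2.le r3.le
  rw [hc.exit_r] at h2 h5 r2 r3 hu
  rw [hc.join_vel 1 (by decide)] at h1 h6
  rw [hc.join_pos 1 (by decide), hM.chi_eq h hrb.le r1 r2.le, h2] at h1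
  rw [h2] at h6
  refine ⟨?_, h6⟩
  have hf := hc.frequency_pos
  set e := frameEnergy Ψ Y (c.pos c.exit) (c.vel c.exit)
  set p := frameMomentum Ψ Y (c.pos c.exit) (c.vel c.exit)
  set R := c.pos c.exit 1
  have h7 : (c.angularMomentum / R) ^ 2 = e ^ 2 - p ^ 2 := by
    field_simp
    linarith
  rw [h7] at h1
  have hpe : p < e := by rw [w3]; nlinarith
  have hp : 0 < p := by rw [w3]; positivity
  have h8 : 0 < Y rb R * e - u Ψ Y rb R * p := by
    have := mul_lt_mul'' h5 hpe hu.le hp.le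
    linarith
  -- The identity (Y e - u p)² = (Y p - u e)² + (Y² - u²)(e² - p²) is the exterior null condition at
  -- the boundary; both square roots are positive.
  refine (pow_left_inj₀ hf.le h8.le two_ne_zero).1 ?_
  linear_combination h1

end IsDetectedSingularRay

end exterior

/-! ### The direction of emission of a ray with given impact parameter -/

section aim

/-- The cosine of the angle to the radial direction, in the comoving frame, of an outgoing ray with
impact parameter `R / k`. -/
noncomputable def aimCos (y v k : ℝ) : ℝ :=
  (y * v + k * Real.sqrt (k ^ 2 - (y ^ 2 - v ^ 2))) / (v ^ 2 + k ^ 2)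

variable {y v k : ℝ}

lemma aimCos_pos (hv : 0 < v) (hvy : v < y) (hk : 0 < k) : 0 < aimCos y v k := by
  have hy := hv.trans hvy
  unfold aimCos
  positivity

/-- For a ray of energy e one has frequency (y - v w) e and ℓ = s R e, with s the sine of the angle,
so k = R · frequency / ℓ means y - v w = k s. Since (y - v w)² - (y w - v)² = (y² - v²) s², the
outgoing branch satisfies y w - v = √(k² - (y² - v²)) s. These two equations, linear in w and s, are
solved by `aimCos`. -/
lemma aimCos_spec (hv : 0 < v) (hvy : v < y) (hk : 0 < k) (hk2 : y ^ 2 - v ^ 2 ≤ k ^ 2) :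
    ∃ s > 0, aimCos y v k ^ 2 + s ^ 2 = 1 ∧
      y * aimCos y v k - v = Real.sqrt (k ^ 2 - (y ^ 2 - v ^ 2)) * s ∧
      y - v * aimCos y v k = k * s := by
  have hd := Real.sq_sqrt (sub_nonneg.2 hk2)
  have hd0 := Real.sqrt_nonneg (k ^ 2 - (y ^ 2 - v ^ 2))
  unfold aimCos
  set d := Real.sqrt (k ^ 2 - (y ^ 2 - v ^ 2))
  have hy := hv.trans hvy
  have hlt : v * d < y * k := by
    refine lt_of_pow_lt_pow_left₀ 2 (by positivity) ?_
    rw [mul_pow, mul_pow, hd]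
    have : 0 < (y ^ 2 - v ^ 2) * (k ^ 2 + v ^ 2) := mul_pos (by nlinarith) (by positivity)
    nlinarith
  have hn : v ^ 2 + k ^ 2 ≠ 0 := by positivity
  refine ⟨(y * k - v * d) / (v ^ 2 + k ^ 2), div_pos (by linarith) (by positivity), ?_, ?_, ?_⟩
  · field_simp
    linear_combination (v ^ 2 + k ^ 2) * hd
  · field_simp
    linear_combination v * hd
  · field_simp
    ring

lemma aimCos_lt_one (hv : 0 < v) (hvy : v < y) (hk : 0 < k) (hk2 : y ^ 2 - v ^ 2 ≤ k ^ 2) :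
    aimCos y v k < 1 := by
  obtain ⟨s, hs, h1, -, -⟩ := aimCos_spec hv hvy hk hk2
  nlinarith

/-- Uniqueness on the branch y w ≥ v: it allows the shooting curve to start at a given ray. -/
lemma eq_aimCos {w s : ℝ} (hv : 0 < v) (hs : 0 < s) (hws : w ^ 2 + s ^ 2 = 1)
    (h1 : 0 ≤ y * w - v) (h2 : y - v * w = k * s) : w = aimCos y v k := by
  have hd : Real.sqrt (k ^ 2 - (y ^ 2 - v ^ 2)) * s = y * w - v := by
    rw [← Real.sqrt_sq hs.le, ← Real.sqrt_mul' _ (sq_nonneg s), ← Real.sqrt_sq h1]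
    congr 1
    linear_combination (-(y - v * w) - k * s) * h2 - (y ^ 2 - v ^ 2) * hws
  have hn : v ^ 2 + k ^ 2 ≠ 0 := by positivity
  unfold aimCos
  rw [eq_div_iff hn]
  refine mul_right_cancel₀ hs.ne' ?_
  rw [add_mul, mul_assoc k, hd]
  linear_combination (-w * k - v * s) * h2 - v * k * hws

lemma continuousOn_aimCos {I : Set ℝ} {Y V K : ℝ → ℝ} (hY : ContinuousOn Y I)
    (hV : ContinuousOn V I) (hK : ContinuousOn K I) (hV0 : ∀ x ∈ I, 0 < V x) :
    ContinuousOn (fun x => aimCos (Y x) (V x) (K x)) I := by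
  unfold aimCos
  refine ContinuousOn.div (by fun_prop) (by fun_prop) fun x hx => ?_
  have := hV0 x hx
  positivity

end aim

/-! ### Sufficient conditions for a null geodesic of the interior -/

section sufficiency

variable {α ξ β γ δ rmax : ℝ} {Ψ Y : ℝ → ℝ → ℝ}

/-- The time component of the geodesic equation follows from the radial one. -/
lemma IsInterior.time_component (h : IsInterior α ξ β γ δ rmax Ψ Y) {x v : ℝ → Fin 4 → ℝ}
    {I : Set ℝ} {s ℓ : ℝ} (hs : s ∈ I)
    (hreg : ∀ t ∈ I, 0 < x t 1 ∧ x t 1 < x t 0 ∧ x t 0 < rmax)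
    (hG : ∀ t ∈ I, 0 < G Ψ Y (x t 0) (x t 1))
    (h0 : HasDerivWithinAt (fun t => x t 0) (v s 0) I s)
    (h1 : HasDerivWithinAt (fun t => x t 1) (v s 1) I s)
    (hv0 : ∀ t ∈ I, 0 < v t 0) (hℓ : ∀ t ∈ I, x t 1 ^ 2 * v t 3 = ℓ)
    (hnull : ∀ t ∈ I, frameEnergy Ψ Y (x t) (v t) ^ 2 =
      frameMomentum Ψ Y (x t) (v t) ^ 2 + x t 1 ^ 2 * v t 3 ^ 2)
    (hE : HasDerivWithinAt (fun t => frameEnergy Ψ Y (x t) (v t)) (energyRate Ψ Y (x s) (v s)) I s) :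
    HasDerivWithinAt (fun t => ∑ ν, interiorMetric Ψ Y (x t) 0 ν * v t ν)
      ((1 / 2) * ∑ ν, ∑ σ, partialMetric (interiorMetric Ψ Y) 0 ν σ (x s) * v s ν * v s σ) I s := by
  obtain ⟨r1, r2, r3⟩ := hreg s hs
  have hUpos := h.u_pos r1 r2.le r3.le
  have hYpos := h.Y_pos _ _ r1.le r2.le r3.le
  have hGpos := hG s hs
  have hP0 : ∀ t ∈ I, 0 < frameMomentum Ψ Y (x t) (v t) := fun t ht =>
    mul_pos (mul_pos (h.u_pos (hreg t ht).1 (hreg t ht).2.1.le (hreg t ht).2.2.le) (hG t ht))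
      (hv0 t ht)
  have hpp := hP0 s hs
  -- No equation for the frame momentum is assumed: it is a function of the energy, of R and of the
  -- constant ℓ, and is differentiated as such.
  have hPeq : ∀ t ∈ I, frameMomentum Ψ Y (x t) (v t) =
      Real.sqrt (frameEnergy Ψ Y (x t) (v t) ^ 2 - (ℓ / x t 1) ^ 2) := fun t ht => by
    rw [← Real.sqrt_sq (hP0 t ht).le, hnull t ht, ← hℓ t ht]
    congr 1
    have := (hreg t ht).1
    field_simp
    ring
  have hsq : frameEnergy Ψ Y (x s) (v s) ^ 2 - (ℓ / x s 1) ^ 2 =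
      frameMomentum Ψ Y (x s) (v s) ^ 2 := by
    rw [hnull s hs, ← hℓ s hs]
    field_simp
    ring
  have hPd := (((hE.fun_pow 2).fun_sub (((hasDerivWithinAt_const s I ℓ).fun_div h1 r1.ne').fun_pow
    2)).sqrt (by rw [hsq]; positivity)).congr hPeq (hPeq s hs)
  rw [hsq, Real.sqrt_sq hpp.le] at hPd
  have hUd := hasDerivWithinAt_comp_pair (h.differentiableAt_u r1 r2.le r3.le) h0 h1
  have hYd := hasDerivWithinAt_comp_pair (h.differentiableAt_Y r1.le r2.le r3.le) h0 h1
  have hGd := hasDerivWithinAt_comp_pair (h.differentiableAt_G r1 r2 r3) h0 h1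
  simp only [Function.uncurry_apply_pair] at hUd hYd hGd
  have hmom : ∀ t ∈ I, ∑ ν, interiorMetric Ψ Y (x t) 0 ν * v t ν = -G Ψ Y (x t 0) (x t 1) *
      (Y (x t 0) (x t 1) * frameEnergy Ψ Y (x t) (v t) -
        u Ψ Y (x t 0) (x t 1) * frameMomentum Ψ Y (x t) (v t)) := fun t ht =>
    h.momentum_zero (hreg t ht).1 (hreg t ht).2.1 (hreg t ht).2.2
  refine (((hGd.fun_neg).fun_mul ((hYd.fun_mul hE).fun_sub (hUd.fun_mul hPd))).congr hmom
    (hmom s hs)).congr_deriv ?_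
  rw [h.force_zero r1 r2 r3]
  unfold energyRate
  rw [h.dSnd_G r1 r2 r3]
  have hv3 : v s 3 ^ 2 = (frameEnergy Ψ Y (x s) (v s) ^ 2 - frameMomentum Ψ Y (x s) (v s) ^ 2) /
      x s 1 ^ 2 := by
    rw [hnull s hs]; field_simp; ring
  have hℓ2 : ℓ ^ 2 = (frameEnergy Ψ Y (x s) (v s) ^ 2 - frameMomentum Ψ Y (x s) (v s) ^ 2) *
      x s 1 ^ 2 := by
    rw [hnull s hs, ← hℓ s hs]; ring
  have hv0' : v s 0 = frameMomentum Ψ Y (x s) (v s) /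
      (u Ψ Y (x s 0) (x s 1) * G Ψ Y (x s 0) (x s 1)) := by
    unfold frameMomentum; field_simp
  have hv1' : v s 1 = Y (x s 0) (x s 1) * frameMomentum Ψ Y (x s) (v s) -
      u Ψ Y (x s 0) (x s 1) * frameEnergy Ψ Y (x s) (v s) := by
    unfold frameMomentum frameEnergy; field_simp; ring
  rw [hv1', hv0', hv3]
  set e := frameEnergy Ψ Y (x s) (v s)
  set p := frameMomentum Ψ Y (x s) (v s)
  generalize dFst (Function.uncurry (u Ψ Y)) (x s 0, x s 1) = ur
  generalize dSnd (Function.uncurry (u Ψ Y)) (x s 0, x s 1) = uR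
  generalize dFst (Function.uncurry Y) (x s 0, x s 1) = Yr
  generalize dSnd (Function.uncurry Y) (x s 0, x s 1) = YR
  generalize dFst (Function.uncurry (G Ψ Y)) (x s 0, x s 1) = Gr
  generalize u Ψ Y (x s 0) (x s 1) = U at *
  generalize G Ψ Y (x s 0) (x s 1) = g at *
  generalize Y (x s 0) (x s 1) = y at *
  generalize x s 1 = R at *
  simp only [Nat.cast_ofNat, Nat.add_one_sub_one, pow_one, zero_mul, zero_sub]
  have e1 : 2 * (ℓ / R) * (-(ℓ * (y * p - U * e)) / R ^ 2) =
      -2 * ((e ^ 2 - p ^ 2) * (y * p - U * e)) / R := by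
    have : 2 * (ℓ / R) * (-(ℓ * (y * p - U * e)) / R ^ 2) = -2 * ℓ ^ 2 * (y * p - U * e) / R ^ 3 := by
      field_simp
    rw [this, hℓ2]
    field_simp
  rw [e1]
  field_simp
  ring

/-- A sufficient condition for null geodesics in the equatorial plane. -/
theorem IsInterior.isNullGeodesicOn (h : IsInterior α ξ β γ δ rmax Ψ Y) {x v : ℝ → Fin 4 → ℝ}
    {I : Set ℝ} {ℓ : ℝ} (hreg : ∀ t ∈ I, 0 < x t 1 ∧ x t 1 < x t 0 ∧ x t 0 < rmax)
    (hx2 : ∀ t ∈ I, x t 2 = Real.pi / 2) (hv2 : ∀ t ∈ I, v t 2 = 0)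
    (hG : ∀ t ∈ I, 0 < G Ψ Y (x t 0) (x t 1))
    (h0 : ∀ t ∈ I, HasDerivWithinAt (fun t => x t 0) (v t 0) I t)
    (h1 : ∀ t ∈ I, HasDerivWithinAt (fun t => x t 1) (v t 1) I t)
    (h3 : ∀ t ∈ I, HasDerivWithinAt (fun t => x t 3) (v t 3) I t)
    (hv0 : ∀ t ∈ I, 0 < v t 0) (hℓ : ∀ t ∈ I, x t 1 ^ 2 * v t 3 = ℓ)
    (hnull : ∀ t ∈ I, frameEnergy Ψ Y (x t) (v t) ^ 2 =
      frameMomentum Ψ Y (x t) (v t) ^ 2 + x t 1 ^ 2 * v t 3 ^ 2)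
    (hE : ∀ t ∈ I, HasDerivWithinAt (fun t => frameEnergy Ψ Y (x t) (v t))
      (energyRate Ψ Y (x t) (v t)) I t) :
    IsNullGeodesicOn (interiorMetric Ψ Y) x v I := by
  intro s hs
  refine ⟨hasDerivWithinAt_pi.2 fun i => ?_, ?_, fun μ => ?_⟩
  · fin_cases i
    · exact h0 s hs
    · exact h1 s hs
    · refine ((hasDerivWithinAt_const s I (Real.pi / 2)).congr hx2 (hx2 s hs)).congr_deriv ?_
      exact (hv2 s hs).symm
    · exact h3 s hs
  · obtain ⟨r1, r2, r3⟩ := hreg s hs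
    rw [h.norm_eq r1 r2 r3 (hx2 s hs), hv2 s hs, hnull s hs]
    ring
  · fin_cases μ
    · exact h.time_component hs hreg hG (h0 s hs) (h1 s hs) hv0 hℓ hnull (hE s hs)
    · exact (h.radial_iff hs hreg (hx2 s hs) (hv2 s hs) (hG s hs).ne' (h0 s hs) (h1 s hs)).2
        (hE s hs)
    · refine ((hasDerivWithinAt_const s I (0 : ℝ)).congr (f₁ := fun t =>
        ∑ ν, interiorMetric Ψ Y (x t) 2 ν * v t ν) (fun t ht => ?_) ?_).congr_deriv ?_
      · rw [interior_momentum_two, hv2 t ht, mul_zero]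
      · rw [interior_momentum_two, hv2 s hs, mul_zero]
      · exact (interior_force_two _ _ (hx2 s hs)).symm
    · refine ((hasDerivWithinAt_const s I ℓ).congr (f₁ := fun t =>
        ∑ ν, interiorMetric Ψ Y (x t) 3 ν * v t ν) (fun t ht => ?_) ?_).congr_deriv ?_
      · rw [interior_momentum_three, hx2 t ht, Real.sin_pi_div_two, ← hℓ t ht]; ring
      · rw [interior_momentum_three, hx2 s hs, Real.sin_pi_div_two, ← hℓ s hs]; ring
      · exact (interior_force_three _ _).symm

end sufficiency

/-! ### Reparametrizations -/

section reparametrization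

lemma exists_antideriv_Icc {k : ℝ → ℝ} {a b : ℝ} (hab : a ≤ b) (hk : ContinuousOn k (Icc a b)) :
    ∃ K : ℝ → ℝ, ∀ x ∈ Icc a b, HasDerivWithinAt K (k x) (Icc a b) x := by
  have hc : Continuous (IccExtend hab (domRestrict (Icc a b) k)) :=
    (continuousOn_iff_continuous_domRestrict.1 hk).Icc_extend'
  refine ⟨fun x => ∫ t in a..x, IccExtend hab (domRestrict (Icc a b) k) t, fun x hx => ?_⟩
  have h1 := (hc.integral_hasStrictDerivAt a x).hasDerivAt.hasDerivWithinAt (s := Icc a b)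
  refine h1.congr_deriv ?_
  rw [IccExtend_of_mem hab _ hx]
  rfl

/-- The integrand may be unbounded at 0, so the integral is taken in the variable log x. The minimum
with log b keeps the argument inside the interval. -/
lemma exists_antideriv_Ioc {k : ℝ → ℝ} {b : ℝ} (hb : 0 < b) (hk : ContinuousOn k (Ioc 0 b)) :
    ∃ K : ℝ → ℝ, ∀ x ∈ Ioc 0 b, HasDerivWithinAt K (k x) (Ioc 0 b) x := by
  have hm : ∀ t : ℝ, Real.exp (min t (Real.log b)) ∈ Ioc 0 b := fun t =>
    ⟨Real.exp_pos _, by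
      rw [← Real.exp_log hb, Real.exp_le_exp, Real.exp_log hb]; exact min_le_right _ _⟩
  have hc : Continuous fun t : ℝ => k (Real.exp (min t (Real.log b))) *
      Real.exp (min t (Real.log b)) :=
    (hk.comp_continuous (by fun_prop) hm).mul (by fun_prop)
  refine ⟨fun x => ∫ t in (0 : ℝ)..Real.log x, k (Real.exp (min t (Real.log b))) *
      Real.exp (min t (Real.log b)), fun x hx => ?_⟩
  have h1 := ((hc.integral_hasStrictDerivAt 0 (Real.log x)).hasDerivAt.comp x
    (Real.hasDerivAt_log hx.1.ne')).hasDerivWithinAt (s := Ioc 0 b)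
  refine h1.congr_deriv ?_
  have hx0 := hx.1
  rw [min_eq_left (Real.log_le_log hx.1 hx.2), Real.exp_log hx.1]
  field_simp

/-- The autonomous equation g' = 1 / k(g) is solved by inverting an antiderivative of k. -/
lemma exists_reparam_Icc {k : ℝ → ℝ} {a b : ℝ} (hab : a < b) (hk : ContinuousOn k (Icc a b))
    (hpos : ∀ x ∈ Icc a b, 0 < k x) (s₀ : ℝ) : ∃ S > s₀, ∃ g : ℝ → ℝ, g s₀ = a ∧ g S = b ∧
      ∀ s ∈ Icc s₀ S, g s ∈ Icc a b ∧ HasDerivWithinAt g (k (g s))⁻¹ (Icc s₀ S) s := by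
  obtain ⟨K, hK⟩ := exists_antideriv_Icc hab.le hk
  have hK' : ∀ x ∈ Icc a b, HasDerivWithinAt (fun x => K x - K a + s₀) (k x) (Icc a b) x :=
    fun x hx => ((hK x hx).sub_const _).add_const _
  obtain ⟨hmono, -, g, hg, hgd⟩ := exists_inverse ordConnected_Icc hK' hpos
  have ha : a ∈ Icc a b := ⟨le_rfl, hab.le⟩
  have hb : b ∈ Icc a b := ⟨hab.le, le_rfl⟩
  have hcont : ContinuousOn (fun x => K x - K a + s₀) (Icc a b) := fun x hx =>
    (hK' x hx).continuousWithinAt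
  have himg : (fun x => K x - K a + s₀) '' Icc a b = Icc s₀ (K b - K a + s₀) := by
    apply Subset.antisymm
    · rintro _ ⟨x, hx, rfl⟩
      have h1 := hmono.monotoneOn ha hx hx.1
      have h2 := hmono.monotoneOn hx hb hx.2
      exact ⟨by simpa using h1, h2⟩
    · have := intermediate_value_Icc hab.le hcont
      simpa using this
  rw [himg] at hgd
  refine ⟨K b - K a + s₀, by have := hmono ha hb hab; simpa using this, g, ?_, hg b hb,
    fun s hs => ⟨?_, hgd s hs⟩⟩
  · have := hg a ha
    simpa using this
  · rw [← himg] at hs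
    obtain ⟨x, hx, rfl⟩ := hs
    rw [hg x hx]
    exact hx

/-- As in the closed case, but k may vanish at 0. Continuity of k up to 0 makes the parameter finite
there, and it is normalized to start at 0. -/
lemma exists_reparam_Ioc {k : ℝ → ℝ} {b : ℝ} (hb : 0 < b) (hk : ContinuousOn k (Icc 0 b))
    (hpos : ∀ x ∈ Ioc 0 b, 0 < k x) : ∃ S > 0, ∃ g : ℝ → ℝ, g S = b ∧
      (∀ s ∈ Ioc 0 S, g s ∈ Ioc 0 b ∧ HasDerivWithinAt g (k (g s))⁻¹ (Ioc 0 S) s) ∧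
      Tendsto g (𝓝[>] 0) (𝓝[>] 0) := by
  obtain ⟨K₀, hK₀⟩ := exists_antideriv_Icc hb.le hk
  set K : ℝ → ℝ := fun x => K₀ x - K₀ 0 with hKdef
  have hK : ∀ x ∈ Icc 0 b, HasDerivWithinAt K (k x) (Icc 0 b) x := fun x hx => (hK₀ x hx).sub_const _
  have hKz : K 0 = 0 := sub_self _
  have hcont : ContinuousOn K (Icc 0 b) := fun x hx => (hK x hx).continuousWithinAt
  have hmono : StrictMonoOn K (Icc 0 b) := by
    refine strictMonoOn_of_hasDerivWithinAt_pos (convex_Icc 0 b) hcont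
      (fun x hx => (hK x (interior_subset hx)).mono interior_subset) fun x hx => ?_
    rw [interior_Icc] at hx
    exact hpos x ⟨hx.1, hx.2.le⟩
  have h0m : (0 : ℝ) ∈ Icc 0 b := ⟨le_rfl, hb.le⟩
  have hbm : b ∈ Icc 0 b := ⟨hb.le, le_rfl⟩
  obtain ⟨-, -, g, hg, hgd⟩ := exists_inverse (f := K) ordConnected_Ioc
    (fun x hx => (hK x (Ioc_subset_Icc_self hx)).mono Ioc_subset_Icc_self) hpos
  have himg : K '' Ioc 0 b = Ioc 0 (K b) := by
    apply Subset.antisymm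
    · rintro _ ⟨x, hx, rfl⟩
      have h1 := hmono h0m (Ioc_subset_Icc_self hx) hx.1
      rw [hKz] at h1
      exact ⟨h1, hmono.monotoneOn (Ioc_subset_Icc_self hx) hbm hx.2⟩
    · intro y hy
      have := intermediate_value_Icc hb.le hcont
      rw [hKz] at this
      obtain ⟨x, hx, rfl⟩ := this ⟨hy.1.le, hy.2⟩
      refine ⟨x, ⟨lt_of_le_of_ne hx.1 fun h => ?_, hx.2⟩, rfl⟩
      rw [← h, hKz] at hy
      exact lt_irrefl _ hy.1
  rw [himg] at hgd
  have hKb : 0 < K b := by have := hmono h0m hbm hb; rwa [hKz] at this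
  have hgm : ∀ s ∈ Ioc 0 (K b), g s ∈ Ioc 0 b ∧ K (g s) = s := fun s hs => by
    rw [← himg] at hs
    obtain ⟨x, hx, rfl⟩ := hs
    rw [hg x hx]
    exact ⟨hx, rfl⟩
  refine ⟨K b, hKb, g, hg b ⟨hb, le_rfl⟩, fun s hs => ⟨(hgm s hs).1, hgd s hs⟩, ?_⟩
  rw [(nhdsGT_basis (0 : ℝ)).tendsto_right_iff]
  intro ε hε
  have hm : min ε b ∈ Icc 0 b := ⟨by positivity, min_le_right _ _⟩
  have hKm : 0 < K (min ε b) := by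
    have := hmono h0m hm (by positivity)
    rwa [hKz] at this
  filter_upwards [Ioo_mem_nhdsGT hKm] with s hs
  have hsI : s ∈ Ioc 0 (K b) := ⟨hs.1, hs.2.le.trans (hmono.monotoneOn hm hbm hm.2)⟩
  obtain ⟨h1, h2⟩ := hgm s hsI
  refine ⟨h1.1, ?_⟩
  have h3 : K (g s) < K (min ε b) := by rw [h2]; exact hs.2
  exact ((hmono.lt_iff_lt (Ioc_subset_Icc_self h1) hm).1 h3).trans_le (min_le_left _ _)

end reparametrization

/-! ### Construction of the exterior part of a ray -/

section exteriorConstruction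

/-- For ℓ = 1 and frequency κ the radial velocity is √(κ² - χ / R²), which is positive by
hypothesis. So R is found by inverting a quadrature, and then T and φ by two more. -/
theorem exists_exteriorGeodesic {M : ℝ → ℝ} (hM : ContDiffOn ℝ 1 M (Ioi 0)) {κ Rb R₀ : ℝ}
    (hRb : 0 < Rb) (hR₀ : Rb < R₀) (hκ : 0 < κ)
    (hχ : ∀ R ∈ Icc Rb R₀, 0 < chi M R ∧ chi M R < (κ * R) ^ 2) (s₀ φ₀ : ℝ) :
    ∃ S > s₀, ∃ X V : ℝ → Fin 4 → ℝ, IsNullGeodesicOn (exteriorMetric M) X V (Icc s₀ S) ∧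
      (X s₀ 1 = Rb ∧ X s₀ 2 = Real.pi / 2 ∧ X s₀ 3 = φ₀) ∧
      (V s₀ 1 = Real.sqrt ((κ * Rb) ^ 2 - chi M Rb) / Rb ∧ V s₀ 2 = 0 ∧ V s₀ 3 = 1 / Rb ^ 2) ∧
      chi M Rb * V s₀ 0 = κ ∧
      (∀ s ∈ Icc s₀ S, X s 2 = Real.pi / 2 ∧ 0 < chi M (X s 1) ∧ 0 < V s 0 ∧ 0 < V s 1) ∧
      X S 1 = R₀ := by
  set H : ℝ → ℝ := fun R => Real.sqrt ((κ * R) ^ 2 - chi M R) / R with hH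
  have hpos : ∀ R ∈ Icc Rb R₀, 0 < R := fun R hR => hRb.trans_le hR.1
  have hHpos : ∀ R ∈ Icc Rb R₀, 0 < H R := fun R hR =>
    div_pos (Real.sqrt_pos.2 (by linarith [(hχ R hR).2])) (hpos R hR)
  have hχd : ∀ R ∈ Icc Rb R₀, HasDerivAt (chi M) (deriv (chi M) R) R := fun R hR => by
    have h1 : DifferentiableAt ℝ M R := (hM.differentiableOn one_ne_zero).differentiableAt
      (Ioi_mem_nhds (hpos R hR))
    have h2 : DifferentiableAt ℝ (fun R => 1 - 2 * M R / R) R :=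
      ((h1.const_mul 2).div differentiableAt_id (hpos R hR).ne').const_sub 1
    exact h2.hasDerivAt
  have hHd : ∀ R ∈ Icc Rb R₀, HasDerivAt H
      ((-deriv (chi M) R / R ^ 2 + 2 * chi M R / R ^ 3) / (2 * H R)) R := fun R hR => by
    have h0 := hpos R hR
    have h1 : 0 < (κ * R) ^ 2 - chi M R := by linarith [(hχ R hR).2]
    have h2 := (((((hasDerivAt_id R).const_mul κ).fun_pow 2).fun_sub (hχd R hR)).sqrt h1.ne').fun_div
      (hasDerivAt_id R) h0.ne'
    refine h2.congr_deriv ?_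
    have h3 := Real.sqrt_pos.2 h1
    have h4 := Real.sq_sqrt h1.le
    simp only [hH, id]
    set q := Real.sqrt ((κ * R) ^ 2 - chi M R)
    simp only [Nat.cast_ofNat, Nat.add_one_sub_one, pow_one, mul_one]
    field_simp
    linear_combination (-2 : ℝ) * h4
  have hχc : ContinuousOn (chi M) (Icc Rb R₀) := fun R hR =>
    (hχd R hR).continuousAt.continuousWithinAt
  have hHc : ContinuousOn H (Icc Rb R₀) := fun R hR => (hHd R hR).continuousAt.continuousWithinAt
  obtain ⟨S, hS, g, hg0, hgS, hg⟩ := exists_reparam_Icc hR₀ (k := fun R => (H R)⁻¹)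
    (hHc.inv₀ fun R hR => (hHpos R hR).ne') (fun R hR => inv_pos.2 (hHpos R hR)) s₀
  simp only [inv_inv] at hg
  have hgc : ContinuousOn g (Icc s₀ S) := fun s hs => (hg s hs).2.continuousWithinAt
  have hmaps : MapsTo g (Icc s₀ S) (Icc Rb R₀) := fun s hs => (hg s hs).1
  obtain ⟨T, hT⟩ := exists_antideriv_Icc hS.le (k := fun s => κ / chi M (g s))
    (continuousOn_const.div (hχc.comp hgc hmaps) fun s hs => (hχ _ (hmaps hs)).1.ne')
  obtain ⟨Φ, hΦ⟩ := exists_antideriv_Icc hS.le (k := fun s => 1 / g s ^ 2)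
    (continuousOn_const.div (hgc.pow 2) fun s hs => by have := hpos _ (hmaps hs); positivity)
  set X : ℝ → Fin 4 → ℝ := fun s => ![T s, g s, Real.pi / 2, Φ s - Φ s₀ + φ₀] with hX
  set V : ℝ → Fin 4 → ℝ := fun s => ![κ / chi M (g s), H (g s), 0, 1 / g s ^ 2] with hV
  have hs₀ : s₀ ∈ Icc s₀ S := ⟨le_rfl, hS.le⟩
  refine ⟨S, hS, X, V, ?_, ⟨hg0, rfl, ?_⟩, ⟨?_, rfl, ?_⟩, ?_, fun s hs => ?_, hgS⟩
  · intro s hs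
    have hgs := hmaps hs
    have h0 := hpos _ hgs
    obtain ⟨c1, c2⟩ := hχ _ hgs
    have hH2 : H (g s) ^ 2 * g s ^ 2 = (κ * g s) ^ 2 - chi M (g s) := by
      simp only [hH]
      rw [div_pow, Real.sq_sqrt (by linarith)]
      field_simp
    have hHp := hHpos _ hgs
    refine ⟨hasDerivWithinAt_pi.2 fun i => ?_, ?_, fun μ => ?_⟩
    · fin_cases i
      · exact hT s hs
      · exact (hg s hs).2
      · exact hasDerivWithinAt_const s _ _
      · exact ((hΦ s hs).sub_const _).add_const _
    · rw [exterior_norm]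
      simp only [hX, hV, Matrix.cons_val]
      rw [Real.sin_pi_div_two]
      field_simp
      linear_combination hH2
    · fin_cases μ
      · refine ((hasDerivWithinAt_const s (Icc s₀ S) (-κ)).congr (f₁ := fun t =>
          ∑ ν, exteriorMetric M (X t) 0 ν * V t ν) (fun t ht => ?_) ?_).congr_deriv ?_
        · rw [exterior_momentum_zero]
          have := (hχ _ (hmaps ht)).1
          simp only [hX, hV, Matrix.cons_val]
          field_simp
        · rw [exterior_momentum_zero]
          simp only [hX, hV, Matrix.cons_val]
          field_simp
        · exact (exterior_force_zero _ _).symm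
      · have hχg := (hχd _ hgs).comp_hasDerivWithinAt s (hg s hs).2
        have hHg := (hHd _ hgs).comp_hasDerivWithinAt s (hg s hs).2
        refine (((hχg.fun_inv c1.ne').fun_mul hHg).congr (f₁ := fun t =>
          ∑ ν, exteriorMetric M (X t) 1 ν * V t ν) (fun t ht => ?_) ?_).congr_deriv ?_
        · rw [exterior_momentum_one]
          rfl
        · rw [exterior_momentum_one]
          rfl
        · refine Eq.trans ?_ (exterior_force_one (X s) (V s) rfl c1.ne' (hχd _ hgs)).symm
          simp only [hX, hV, Matrix.cons_val, Function.comp]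
          field_simp
          linear_combination (-deriv (chi M) (g s) * g s) * hH2
      · refine ((hasDerivWithinAt_const s (Icc s₀ S) (0 : ℝ)).congr (f₁ := fun t =>
          ∑ ν, exteriorMetric M (X t) 2 ν * V t ν) (fun t ht => ?_) ?_).congr_deriv ?_
        · rw [exterior_momentum_two]; simp [hV]
        · rw [exterior_momentum_two]; simp [hV]
        · exact (exterior_force_two _ _ rfl).symm
      · refine ((hasDerivWithinAt_const s (Icc s₀ S) (1 : ℝ)).congr (f₁ := fun t =>
          ∑ ν, exteriorMetric M (X t) 3 ν * V t ν) (fun t ht => ?_) ?_).congr_deriv ?_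
        · rw [exterior_momentum_three]
          have := hpos _ (hmaps ht)
          simp only [hX, hV, Matrix.cons_val]
          rw [Real.sin_pi_div_two]
          field_simp
        · rw [exterior_momentum_three]
          simp only [hX, hV, Matrix.cons_val]
          rw [Real.sin_pi_div_two]
          field_simp
        · exact (exterior_force_three _ _).symm
  · simp [hX]
  · simp only [hV, hH, Matrix.cons_val, hg0]
  · simp only [hV, Matrix.cons_val, hg0]
  · have := (hχ Rb ⟨le_rfl, hR₀.le⟩).1
    simp only [hV, Matrix.cons_val, hg0]
    field_simp
  · have h1 := hχ _ (hmaps hs)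
    exact ⟨rfl, h1.1, div_pos hκ h1.1, hHpos _ (hmaps hs)⟩

end exteriorConstruction

/-! ### Construction of the interior part of a ray -/

section interiorConstruction

variable {α ξ β γ δ rmax Z η r₀ T₀ : ℝ} {Ψ Y : ℝ → ℝ → ℝ} {z w : ℝ → ℝ}

/-- Solutions in the box of the equations of the rays, in the time `-log r`. -/
abbrev IsRaySolution (α Z T₀ : ℝ) (Ψ Y : ℝ → ℝ → ℝ) (z w : ℝ → ℝ) : Prop :=
  IsBoxSolution Z T₀ (fun p => rateA α Ψ Y (Real.exp (-p.1)) p.2.1 p.2.2)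
    (fun p => rateB α Ψ Y (Real.exp (-p.1)) p.2.1 p.2.2) z w

/-- The area radius along a solution. -/
noncomputable def areaRadius (α : ℝ) (z : ℝ → ℝ) (t : ℝ) : ℝ := α * z t ^ 2 * Real.exp (-t) ^ 3

/-- The frame energy along a solution, for unit angular momentum. -/
noncomputable def solutionEnergy (α : ℝ) (z w : ℝ → ℝ) (t : ℝ) : ℝ :=
  1 / (areaRadius α z t * Real.sqrt (1 - w t ^ 2))

lemma IsBoxRadius.facts (hr : IsBoxRadius α (ξ / α) rmax Z η Ψ Y r₀)
    (h : IsInterior α ξ β γ δ rmax Ψ Y) (hα : 0 < α) (hT : Real.exp (-T₀) < r₀)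
    (hsol : IsRaySolution α Z T₀ Ψ Y z w) {t : ℝ} (ht : t ∈ Ici T₀) :
    (0 < areaRadius α z t ∧ areaRadius α z t < Real.exp (-t) ∧ Real.exp (-t) < rmax) ∧
    WedgeBounds α (ξ / α) Ψ Y (Real.exp (-t)) (z t) ∧
    |dFst (Function.uncurry Y) (Real.exp (-t), areaRadius α z t)| * z t ^ 2 * Real.exp (-t) < 1 / 16 ∧
    0 < G Ψ Y (Real.exp (-t)) (areaRadius α z t) ∧
    0 < u Ψ Y (Real.exp (-t)) (areaRadius α z t) ∧
    0 < Y (Real.exp (-t)) (areaRadius α z t) := by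
  have hexp : Real.exp (-t) < r₀ := (Real.exp_le_exp.2 (neg_le_neg ht)).trans_lt hT
  have z1 := hsol.z_ge t ht
  have z2 := hsol.z_le t ht
  have z0 : 0 < z t := by linarith
  obtain ⟨-, b1, b2, b3⟩ := hr.box _ (z t) 1 (Real.exp_pos _) hexp z0 (by linarith) one_pos le_rfl
  have hR : 0 < areaRadius α z t := by unfold areaRadius; positivity
  have hrm := hexp.trans_le hr.le_rmax
  refine ⟨⟨hR, b1, hrm⟩, b2, b3, ?_, h.u_pos hR b1.le hrm.le, h.Y_pos _ _ hR.le b1.le hrm.le⟩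
  refine lt_of_lt_of_le ?_ b2.G_ge
  positivity

lemma IsRaySolution.hasDerivWithinAt_areaRadius (hsol : IsRaySolution α Z T₀ Ψ Y z w) (hα : 0 < α)
    {t : ℝ} (ht : t ∈ Ici T₀) : HasDerivWithinAt (areaRadius α z)
      (-(Real.exp (-t) * u Ψ Y (Real.exp (-t)) (areaRadius α z t) *
        G Ψ Y (Real.exp (-t)) (areaRadius α z t) * (Y (Real.exp (-t)) (areaRadius α z t) -
        u Ψ Y (Real.exp (-t)) (areaRadius α z t) / w t))) (Ici T₀) t := by
  have z0 : 0 < z t := by linarith [hsol.z_ge t ht]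
  have w0 : 0 < w t := by linarith [hsol.w_ge t ht]
  have hexp : HasDerivWithinAt (fun t : ℝ => Real.exp (-t)) (-Real.exp (-t)) (Ici T₀) t := by
    have := (hasDerivAt_neg t).exp.hasDerivWithinAt (s := Ici T₀)
    refine this.congr_deriv (by ring)
  have h1 := (((hsol.deriv_z t ht).fun_pow 2).const_mul α).fun_mul (hexp.fun_pow 3)
  refine HasDerivWithinAt.congr_deriv h1 ?_
  have e := Real.exp_pos (-t)
  have hR : areaRadius α z t = α * z t ^ 2 * Real.exp (-t) ^ 3 := rfl
  have hA := IsInterior.rateA_eq (Ψ := Ψ) (Y := Y) hα e z0 w0 hR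
  simp only at hA ⊢
  rw [hA]
  generalize u Ψ Y (Real.exp (-t)) (areaRadius α z t) = U
  generalize G Ψ Y (Real.exp (-t)) (areaRadius α z t) = g
  generalize Y (Real.exp (-t)) (areaRadius α z t) = y
  rw [hR]
  simp only [Nat.cast_ofNat, Nat.add_one_sub_one, pow_one]
  field_simp
  ring

set_option maxHeartbeats 400000 in
/-- Rays that leave the interior outside of the trapped region are always outside of it. -/
lemma IsRaySolution.u_lt_Y (hsol : IsRaySolution α Z T₀ Ψ Y z w)
    (hr : IsBoxRadius α (ξ / α) rmax Z η Ψ Y r₀) (h : IsInterior α ξ β γ δ rmax Ψ Y) (hα : 0 < α)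
    (hT : Real.exp (-T₀) < r₀)
    (h0 : u Ψ Y (Real.exp (-T₀)) (areaRadius α z T₀) < Y (Real.exp (-T₀)) (areaRadius α z T₀))
    {t : ℝ} (ht : t ∈ Ici T₀) :
    u Ψ Y (Real.exp (-t)) (areaRadius α z t) < Y (Real.exp (-t)) (areaRadius α z t) := by
  have hV : ∀ s ∈ Ici T₀, massV Ψ Y (Real.exp (-s), areaRadius α z s) =
      areaRadius α z s * u Ψ Y (Real.exp (-s)) (areaRadius α z s) ^ 2 := fun s hs => by
    obtain ⟨⟨b1, b2, b3⟩, -⟩ := hr.facts h hα hT hsol hs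
    rw [h.u_sq b1 b2.le b3.le]
    field_simp
  by_contra hcon
  rw [not_lt] at hcon
  set F' : ℝ → ℝ := fun s => (-(Real.exp (-s)) * dFst (massV Ψ Y) (Real.exp (-s), areaRadius α z s) +
      -(Real.exp (-s) * u Ψ Y (Real.exp (-s)) (areaRadius α z s) *
        G Ψ Y (Real.exp (-s)) (areaRadius α z s) * (Y (Real.exp (-s)) (areaRadius α z s) -
        u Ψ Y (Real.exp (-s)) (areaRadius α z s) / w s)) *
      dSnd (massV Ψ Y) (Real.exp (-s), areaRadius α z s)) -
    (-(Real.exp (-s) * u Ψ Y (Real.exp (-s)) (areaRadius α z s) *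
        G Ψ Y (Real.exp (-s)) (areaRadius α z s) * (Y (Real.exp (-s)) (areaRadius α z s) -
        u Ψ Y (Real.exp (-s)) (areaRadius α z s) / w s)) * Y (Real.exp (-s)) (areaRadius α z s) ^ 2 +
      areaRadius α z s * (2 * Y (Real.exp (-s)) (areaRadius α z s) *
        (-(Real.exp (-s)) * dFst (Function.uncurry Y) (Real.exp (-s), areaRadius α z s) +
      -(Real.exp (-s) * u Ψ Y (Real.exp (-s)) (areaRadius α z s) *
        G Ψ Y (Real.exp (-s)) (areaRadius α z s) * (Y (Real.exp (-s)) (areaRadius α z s) -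
        u Ψ Y (Real.exp (-s)) (areaRadius α z s) / w s)) *
      dSnd (Function.uncurry Y) (Real.exp (-s), areaRadius α z s)))) with hF'
  have hsub : Icc T₀ t ⊆ Ici T₀ := fun s hs => hs.1
  -- The function V - R Y² = R (u² - Y²) is shown to be strictly decreasing in t at its zeros. So a
  -- point that is not outside the trapped region at time t would force the same at the exit.
  have key := halfline_invariant_backward (a := T₀) (b := t) (f' := F')
    (f := fun s => massV Ψ Y (Real.exp (-s), areaRadius α z s) -
      areaRadius α z s * Y (Real.exp (-s)) (areaRadius α z s) ^ 2) (fun s hs => ?_) ?_ (fun s hs hz => ?_)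
      T₀ ⟨le_rfl, ht⟩
  · rw [hV T₀ self_mem_Ici] at key
    obtain ⟨⟨b1, -, -⟩, -, -, -, b4, -⟩ := hr.facts h hα hT hsol (self_mem_Ici (a := T₀))
    have := mul_lt_mul_of_pos_left (pow_lt_pow_left₀ h0 b4.le two_ne_zero) b1
    linarith
  · obtain ⟨⟨b1, b2, b3⟩, -⟩ := hr.facts h hα hT hsol (hsub hs)
    have hexp : HasDerivWithinAt (fun t : ℝ => Real.exp (-t)) (-Real.exp (-s)) (Icc T₀ t) s := by
      have := (hasDerivAt_neg s).exp.hasDerivWithinAt (s := Icc T₀ t)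
      refine this.congr_deriv (by ring)
    have hR := (hsol.hasDerivWithinAt_areaRadius hα (hsub hs)).mono hsub
    have d1 := hasDerivWithinAt_comp_pair ((h.contDiffAt_massV b1.le b2.le b3.le).differentiableAt
      (by norm_num)) hexp hR
    have d2 := hasDerivWithinAt_comp_pair (h.differentiableAt_Y b1.le b2.le b3.le) hexp hR
    simp only [Function.uncurry_apply_pair] at d2
    refine (d1.fun_sub (hR.fun_mul (d2.fun_pow 2))).congr_deriv ?_
    simp only [hF', Nat.cast_ofNat, Nat.add_one_sub_one, pow_one]
  · rw [hV t ht]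
    obtain ⟨⟨b1, -, -⟩, -, -, -, -, b5⟩ := hr.facts h hα hT hsol ht
    have := mul_le_mul_of_nonneg_left (pow_le_pow_left₀ b5.le hcon 2) b1.le
    linarith
  · obtain ⟨⟨b1, b2, b3⟩, hb, hYr, hG, hu, hY⟩ := hr.facts h hα hT hsol (hsub hs)
    have w0 : 0 < w s := by linarith [hsol.w_ge s (hsub hs)]
    have w1 := hsol.w_lt s (hsub hs)
    have z0 : 0 < z s := by linarith [hsol.z_ge s (hsub hs)]
    rw [hV s (hsub hs), ← mul_sub] at hz
    have hz' := (mul_eq_zero.1 hz).resolve_left b1.ne'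
    have huY : u Ψ Y (Real.exp (-s)) (areaRadius α z s) = Y (Real.exp (-s)) (areaRadius α z s) :=
      (pow_left_inj₀ hu.le hY.le two_ne_zero).1 (by linarith)
    obtain ⟨uz1, -⟩ := hb.u_mul_z_bounds hα (Real.exp_pos _) z0
    have y1 := hb.Y_gt
    have y2 := hb.Y_lt
    have v1 := hb.Vr_gt
    have v2 := hb.VR_lt
    have v3 := hb.YR_lt
    have hRd : α * z s ^ 2 * Real.exp (-s) ^ 3 = areaRadius α z s := rfl
    rw [hRd] at uz1 y1 y2 v1 v2 v3
    rw [huY] at uz1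
    simp only [hF', huY]
    have e := Real.exp_pos (-s)
    generalize dFst (massV Ψ Y) (Real.exp (-s), areaRadius α z s) = Vr at *
    generalize dSnd (massV Ψ Y) (Real.exp (-s), areaRadius α z s) = VR at *
    generalize dFst (Function.uncurry Y) (Real.exp (-s), areaRadius α z s) = Yr at *
    generalize dSnd (Function.uncurry Y) (Real.exp (-s), areaRadius α z s) = YR at *
    generalize G Ψ Y (Real.exp (-s)) (areaRadius α z s) = g at *
    generalize Y (Real.exp (-s)) (areaRadius α z s) = y at *
    generalize hRR : areaRadius α z s = R at *
    generalize Real.exp (-s) = r at *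
    -- At a zero u = Y, and ρ = dR/dt is positive because w < 1. The terms with ρ then contribute
    -- with a negative sign, and -r ∂_r V < -2 α r³ dominates what is left.
    set ρ := -(r * y * g * (y - y / w s)) with hρ
    have hρ0 : 0 < ρ := by
      have : ρ = r * y ^ 2 * g * ((1 - w s) / w s) := by rw [hρ]; field_simp; ring
      rw [this]
      have : 0 < 1 - w s := by linarith
      positivity
    have hzz : 3 / 4 < z s ^ 2 := by
      have : 15 / 17 < z s := by nlinarith
      nlinarith
    have hVR : VR < 1 / 12 := by
      have h5 := (abs_lt.1 v2).2
      by_contra hc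
      rw [not_lt] at hc
      nlinarith
    have hYR := (abs_lt.1 v3).1
    have h6 : -(2 * y * (R * YR)) < 1 / 4 := by
      have := mul_le_mul_of_nonneg_left hYR.le (by linarith : 0 ≤ 2 * y)
      linarith
    have h7 : 0 < ρ * (y ^ 2 + 2 * y * (R * YR) - VR) := by
      refine mul_pos hρ0 ?_
      have : (15 / 16) ^ 2 < y ^ 2 := pow_lt_pow_left₀ y1 (by norm_num) two_ne_zero
      linarith
    have h8 : R * (r * Yr) ≤ α * r ^ 3 * (1 / 16) := by
      have h9 : z s ^ 2 * r * Yr ≤ 1 / 16 := by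
        have := mul_le_mul_of_nonneg_left (le_abs_self Yr) (by positivity : 0 ≤ z s ^ 2 * r)
        linarith
      have h10 : 0 ≤ α * r ^ 3 := by positivity
      have h11 := mul_le_mul_of_nonneg_left h9 h10
      rw [← hRd]
      calc _ = α * r ^ 3 * (z s ^ 2 * r * Yr) := by ring
        _ ≤ _ := h11
    have h12 : r * (2 * (α * r ^ 2)) < r * Vr := mul_lt_mul_of_pos_left v1 e
    have h13 : 2 * y * (R * (r * Yr)) ≤ 2 * y * (α * r ^ 3 * (1 / 16)) :=
      mul_le_mul_of_nonneg_left h8 (by linarith)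
    have h14 : 0 < α * r ^ 3 := by positivity
    have h15 : 2 * y * (α * r ^ 3 * (1 / 16)) ≤ 1 * (α * r ^ 3) := by
      have := mul_le_mul_of_nonneg_right (show 2 * y * (1 / 16) ≤ 1 by linarith) h14.le
      linarith
    have h16 : (-r * Vr + ρ * VR) - (ρ * y ^ 2 + R * (2 * y * (-r * Yr + ρ * YR))) =
      -(r * Vr) - ρ * (y ^ 2 + 2 * y * (R * YR) - VR) + 2 * y * (R * (r * Yr)) := by ring
    rw [h16]
    have h17 : r * (2 * (α * r ^ 2)) = 2 * (α * r ^ 3) := by ring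
    linarith

lemma IsRaySolution.hasDerivWithinAt_energy (hsol : IsRaySolution α Z T₀ Ψ Y z w) (hα : 0 < α)
    {t : ℝ} (ht : t ∈ Ici T₀) : HasDerivWithinAt (solutionEnergy α z w)
      (solutionEnergy α z w t * (Real.exp (-t) * u Ψ Y (Real.exp (-t)) (areaRadius α z t) *
        G Ψ Y (Real.exp (-t)) (areaRadius α z t) * (Y (Real.exp (-t)) (areaRadius α z t) -
        u Ψ Y (Real.exp (-t)) (areaRadius α z t) / w t) / areaRadius α z t -
        w t * rateB α Ψ Y (Real.exp (-t)) (z t) (w t))) (Ici T₀) t := by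
  have z0 : 0 < z t := by linarith [hsol.z_ge t ht]
  have w0 : 0 < w t := by linarith [hsol.w_ge t ht]
  have w1 := hsol.w_lt t ht
  have hR : 0 < areaRadius α z t := by unfold areaRadius; positivity
  have hsq : 0 < 1 - w t ^ 2 := by nlinarith
  have hs0 := Real.sqrt_pos.2 hsq
  have h1 := (hasDerivWithinAt_const t (Ici T₀) (1 : ℝ)).fun_div
    ((hsol.hasDerivWithinAt_areaRadius hα ht).fun_mul
      ((((hsol.deriv_w t ht).fun_pow 2).const_sub 1).sqrt hsq.ne')) (mul_pos hR hs0).ne'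
  refine HasDerivWithinAt.congr_deriv h1 ?_
  unfold solutionEnergy
  have hs2 := Real.sq_sqrt hsq.le
  simp only [Nat.cast_ofNat, Nat.add_one_sub_one, pow_one]
  generalize u Ψ Y (Real.exp (-t)) (areaRadius α z t) = U
  generalize G Ψ Y (Real.exp (-t)) (areaRadius α z t) = g
  generalize Y (Real.exp (-t)) (areaRadius α z t) = y
  generalize areaRadius α z t = R at *
  generalize rateB α Ψ Y (Real.exp (-t)) (z t) (w t) = b
  have e : (1 - w t ^ 2) * b = Real.sqrt (1 - w t ^ 2) ^ 2 * b := by rw [hs2]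
  rw [e]
  generalize Real.sqrt (1 - w t ^ 2) = q at *
  field_simp
  ring

end interiorConstruction

/-! ### From a solution in the box to an affinely parametrized geodesic -/

section affineParameter

variable {α ξ β γ δ rmax rb Z η r₀ : ℝ} {Ψ Y : ℝ → ℝ → ℝ} {z w : ℝ → ℝ}

/-- The rate of change of the affine parameter, as a function of `r`. -/
noncomputable def affineRate (α : ℝ) (Ψ Y : ℝ → ℝ → ℝ) (z w : ℝ → ℝ) (r : ℝ) : ℝ :=
  u Ψ Y r (areaRadius α z (-Real.log r)) * G Ψ Y r (areaRadius α z (-Real.log r)) *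
    (α * z (-Real.log r) ^ 2 * r ^ 3) *
    (Real.sqrt (1 - w (-Real.log r) ^ 2) / w (-Real.log r))

lemma affineRate_eq {r : ℝ} (hr : 0 < r) : affineRate α Ψ Y z w r =
    u Ψ Y r (areaRadius α z (-Real.log r)) * G Ψ Y r (areaRadius α z (-Real.log r)) *
      areaRadius α z (-Real.log r) *
      (Real.sqrt (1 - w (-Real.log r) ^ 2) / w (-Real.log r)) := by
  have : areaRadius α z (-Real.log r) = α * z (-Real.log r) ^ 2 * r ^ 3 := by
    rw [areaRadius, neg_neg, Real.exp_log hr]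
  unfold affineRate
  rw [this]

/-- The rate of change of the angle, as a function of `r`. -/
noncomputable def angleRate (α : ℝ) (Ψ Y : ℝ → ℝ → ℝ) (z w : ℝ → ℝ) (r : ℝ) : ℝ :=
  affineRate α Ψ Y z w r / areaRadius α z (-Real.log r) ^ 2

lemma IsRaySolution.continuousOn_rates (hsol : IsRaySolution α Z (-Real.log rb) Ψ Y z w)
    (hr : IsBoxRadius α (ξ / α) rmax Z η Ψ Y r₀) (h : IsInterior α ξ β γ δ rmax Ψ Y) (hα : 0 < α)
    (hrb0 : 0 < rb) (hrb : rb < r₀) :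
    ContinuousOn (affineRate α Ψ Y z w) (Ioc 0 rb) ∧
      ContinuousOn (angleRate α Ψ Y z w) (Ioc 0 rb) := by
  have hT : Real.exp (-(-Real.log rb)) < r₀ := by rwa [neg_neg, Real.exp_log hrb0]
  have hmaps : MapsTo (fun r => -Real.log r) (Ioc 0 rb) (Ici (-Real.log rb)) := fun r hr =>
    neg_le_neg (Real.log_le_log hr.1 hr.2)
  have hlog : ContinuousOn (fun r => -Real.log r) (Ioc 0 rb) :=
    (Real.continuousOn_log.mono fun r hr => hr.1.ne').neg
  have hw : ContinuousOn (fun r => w (-Real.log r)) (Ioc 0 rb) :=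
    ContinuousOn.comp (g := w) (fun t ht => (hsol.deriv_w t ht).continuousWithinAt) hlog hmaps
  have hR : ContinuousOn (fun r => areaRadius α z (-Real.log r)) (Ioc 0 rb) :=
    ContinuousOn.comp (g := areaRadius α z)
      (fun t ht => (hsol.hasDerivWithinAt_areaRadius hα ht).continuousWithinAt) hlog hmaps
  have hfacts : ∀ r ∈ Ioc 0 rb, 0 < areaRadius α z (-Real.log r) ∧
      areaRadius α z (-Real.log r) < r ∧ r < rmax := fun r hrr => by
    have := (hr.facts h hα hT hsol (hmaps hrr)).1
    rwa [neg_neg, Real.exp_log hrr.1] at this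
  have hu : ContinuousOn (fun r => u Ψ Y r (areaRadius α z (-Real.log r))) (Ioc 0 rb) :=
    fun r hrr => by
      obtain ⟨f1, f2, f3⟩ := hfacts r hrr
      exact ContinuousAt.comp_continuousWithinAt (g := Function.uncurry (u Ψ Y))
        (f := fun r => (r, areaRadius α z (-Real.log r)))
        (h.differentiableAt_u f1 f2.le f3.le).continuousAt
        (continuousWithinAt_id.prodMk (hR r hrr))
  have hG : ContinuousOn (fun r => G Ψ Y r (areaRadius α z (-Real.log r))) (Ioc 0 rb) :=
    fun r hrr => by
      obtain ⟨f1, f2, f3⟩ := hfacts r hrr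
      exact ContinuousAt.comp_continuousWithinAt (g := Function.uncurry (G Ψ Y))
        (f := fun r => (r, areaRadius α z (-Real.log r)))
        (h.differentiableAt_G f1 f2 f3).continuousAt
        (continuousWithinAt_id.prodMk (hR r hrr))
  have h1 : ContinuousOn (affineRate α Ψ Y z w) (Ioc 0 rb) := by
    refine ContinuousOn.congr ?_ fun r hrr => affineRate_eq hrr.1
    refine ((hu.mul hG).mul hR).mul (ContinuousOn.div ?_ hw fun r hrr => ?_)
    · exact (continuousOn_const.sub (hw.pow 2)).sqrt
    · have := hsol.w_ge _ (hmaps hrr)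
      intro h0
      simp only at this h0
      linarith
  exact ⟨h1, h1.div (hR.pow 2) fun r hrr => pow_ne_zero 2 (hfacts r hrr).1.ne'⟩

/-- In the box u is bounded, G = O(r²), R = O(r³) and w ≥ 1/6, so the rate is O(r⁵). The singularity
therefore lies at finite affine distance. -/
lemma IsRaySolution.continuousOn_affineRate (hsol : IsRaySolution α Z (-Real.log rb) Ψ Y z w)
    (hr : IsBoxRadius α (ξ / α) rmax Z η Ψ Y r₀) (h : IsInterior α ξ β γ δ rmax Ψ Y) (hα : 0 < α)
    (hω : 0 < ξ / α) (hrb0 : 0 < rb) (hrb : rb < r₀) :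
    ContinuousOn (affineRate α Ψ Y z w) (Icc 0 rb) := by
  have hT : Real.exp (-(-Real.log rb)) < r₀ := by rwa [neg_neg, Real.exp_log hrb0]
  have hc := (hsol.continuousOn_rates hr h hα hrb0 hrb).1
  set ω := ξ / α with hωdef
  have hZ : 1 / 2 ≤ Z := (hsol.z_ge _ self_mem_Ici).trans (hsol.z_le _ self_mem_Ici)
  intro r hrr
  rcases eq_or_lt_of_le hrr.1 with h0 | h0
  · subst h0
    -- The explicit factor r³ in the definition gives the correct limit at r = 0, where log takes
    -- its default value 0 and `areaRadius` would not vanish.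
    have hk0 : affineRate α Ψ Y z w 0 = 0 := by simp [affineRate]
    set C : ℝ := 17 / 8 * (ω + 1 + 2 * Z ^ 3) * α * (α * Z ^ 2) * 6 with hC
    have hlim : Tendsto (fun r : ℝ => C * r ^ 5) (𝓝[Icc 0 rb] 0) (𝓝 0) := by
      have : Continuous fun r : ℝ => C * r ^ 5 := by fun_prop
      have := this.tendsto 0
      simp only [ne_eq, OfNat.ofNat_ne_zero, not_false_eq_true, zero_pow, mul_zero] at this
      exact this.mono_left nhdsWithin_le_nhds
    have hnn : ∀ᶠ r in 𝓝[Icc 0 rb] (0 : ℝ), |affineRate α Ψ Y z w r| ≤ C * r ^ 5 := by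
      filter_upwards [self_mem_nhdsWithin] with r hr1
      rcases eq_or_lt_of_le hr1.1 with h1 | h1
      · rw [← h1, hk0]; simp
      · have ht : -Real.log r ∈ Ici (-Real.log rb) := neg_le_neg (Real.log_le_log h1 hr1.2)
        obtain ⟨⟨b1, b2, b3⟩, hb, -, hG, hu, -⟩ := hr.facts h hα hT hsol ht
        have z1 := hsol.z_ge _ ht
        have z2 := hsol.z_le _ ht
        have w1 := hsol.w_ge _ ht
        have hgl := hb.G_le
        obtain ⟨-, u2⟩ := hb.u_mul_z_bounds hα (Real.exp_pos _) (by linarith)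
        have hRd : α * z (-Real.log r) ^ 2 * Real.exp (-(-Real.log r)) ^ 3 =
          areaRadius α z (-Real.log r) := rfl
        rw [hRd] at hgl u2
        rw [neg_neg, Real.exp_log h1] at hgl u2 hG hu b2
        have hRe : areaRadius α z (-Real.log r) = α * z (-Real.log r) ^ 2 * r ^ 3 := by
          unfold areaRadius; rw [neg_neg, Real.exp_log h1]
        have hR2 : areaRadius α z (-Real.log r) ≤ α * Z ^ 2 * r ^ 3 := by
          rw [hRe]
          have : z (-Real.log r) ^ 2 ≤ Z ^ 2 := pow_le_pow_left₀ (by linarith) z2 2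
          gcongr
        rw [affineRate_eq h1]
        have hu2 : u Ψ Y r (areaRadius α z (-Real.log r)) ≤ 17 / 8 := by nlinarith
        have hg2 : G Ψ Y r (areaRadius α z (-Real.log r)) ≤ (ω + 1 + 2 * Z ^ 3) * (α * r ^ 2) := by
          refine hgl.trans ?_
          have : z (-Real.log r) ^ 3 ≤ Z ^ 3 := pow_le_pow_left₀ (by linarith) z2 3
          gcongr
        have hq : Real.sqrt (1 - w (-Real.log r) ^ 2) / w (-Real.log r) ≤ 6 := by
          rw [div_le_iff₀ (by linarith)]
          have : Real.sqrt (1 - w (-Real.log r) ^ 2) ≤ 1 := Real.sqrt_le_one.2 (by nlinarith)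
          linarith
        have hq0 : 0 ≤ Real.sqrt (1 - w (-Real.log r) ^ 2) / w (-Real.log r) :=
          div_nonneg (Real.sqrt_nonneg _) (by linarith)
        generalize u Ψ Y r (areaRadius α z (-Real.log r)) = U at *
        generalize G Ψ Y r (areaRadius α z (-Real.log r)) = g at *
        generalize areaRadius α z (-Real.log r) = R at *
        generalize Real.sqrt (1 - w (-Real.log r) ^ 2) / w (-Real.log r) = q at *
        rw [abs_of_nonneg (by positivity)]
        calc U * g * R * q ≤ 17 / 8 * ((ω + 1 + 2 * Z ^ 3) * (α * r ^ 2)) * (α * Z ^ 2 * r ^ 3) * 6 := by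
              have hZ3 : 0 ≤ Z := by linarith
              gcongr
          _ = C * r ^ 5 := by rw [hC]; ring
    rw [ContinuousWithinAt, hk0]
    exact squeeze_zero_norm' hnn hlim
  · have hm : r ∈ Ioc 0 rb := ⟨h0, hrr.2⟩
    have hnhds : Ioc 0 rb ∈ 𝓝[Icc 0 rb] r := by
      rw [← Icc_sdiff_left]
      exact sdiff_mem self_mem_nhdsWithin
        (nhdsWithin_le_nhds (compl_singleton_mem_nhds h0.ne'))
    exact (hc r hm).mono_of_mem_nhdsWithin hnhds

set_option maxHeartbeats 800000 in
/-- A solution in the box is the interior part of a ray. -/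
theorem IsRaySolution.exists_interiorGeodesic (hsol : IsRaySolution α Z (-Real.log rb) Ψ Y z w)
    (hr : IsBoxRadius α (ξ / α) rmax Z η Ψ Y r₀) (h : IsInterior α ξ β γ δ rmax Ψ Y) (hα : 0 < α)
    (hω : 0 < ξ / α) (hrb0 : 0 < rb) (hrb : rb < r₀) :
    ∃ S > 0, ∃ X V : ℝ → Fin 4 → ℝ, IsNullGeodesicOn (interiorMetric Ψ Y) X V (Ioc 0 S) ∧
      Tendsto (fun s => X s 0) (𝓝[>] 0) (𝓝[>] 0) ∧ X S 0 = rb ∧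
      ∀ s ∈ Ioc 0 S, X s 0 ∈ Ioc 0 rb ∧ X s 1 = areaRadius α z (-Real.log (X s 0)) ∧
        X s 2 = Real.pi / 2 ∧ 0 < V s 0 ∧
        V s 1 = (Y (X s 0) (X s 1) * w (-Real.log (X s 0)) - u Ψ Y (X s 0) (X s 1)) *
          solutionEnergy α z w (-Real.log (X s 0)) ∧ V s 2 = 0 ∧ V s 3 = 1 / X s 1 ^ 2 ∧
        0 < frameEnergy Ψ Y (X s) (V s) := by
  have hT : Real.exp (-(-Real.log rb)) < r₀ := by rwa [neg_neg, Real.exp_log hrb0]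
  have hmaps : MapsTo (fun r => -Real.log r) (Ioc 0 rb) (Ici (-Real.log rb)) := fun r hr =>
    neg_le_neg (Real.log_le_log hr.1 hr.2)
  have hfacts : ∀ r ∈ Ioc 0 rb, (0 < areaRadius α z (-Real.log r) ∧
      areaRadius α z (-Real.log r) < r ∧ r < rmax) ∧
      0 < G Ψ Y r (areaRadius α z (-Real.log r)) ∧ 0 < u Ψ Y r (areaRadius α z (-Real.log r)) :=
    fun r hrr => by
      obtain ⟨b, -, -, bG, bu, -⟩ := hr.facts h hα hT hsol (hmaps hrr)
      rw [neg_neg, Real.exp_log hrr.1] at b bG bu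
      exact ⟨b, bG, bu⟩
  have hw : ∀ r ∈ Ioc 0 rb, 0 < w (-Real.log r) ∧ w (-Real.log r) < 1 ∧
      0 < Real.sqrt (1 - w (-Real.log r) ^ 2) ∧ Real.sqrt (1 - w (-Real.log r) ^ 2) ^ 2 =
        1 - w (-Real.log r) ^ 2 := fun r hrr => by
    have h1 := hsol.w_ge _ (hmaps hrr)
    have h2 := hsol.w_lt _ (hmaps hrr)
    have h3 : 0 < 1 - w (-Real.log r) ^ 2 := by nlinarith
    exact ⟨by linarith, h2, Real.sqrt_pos.2 h3, Real.sq_sqrt h3.le⟩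
  have hkpos : ∀ r ∈ Ioc 0 rb, 0 < affineRate α Ψ Y z w r := fun r hrr => by
    obtain ⟨⟨b1, -, -⟩, b4, b5⟩ := hfacts r hrr
    obtain ⟨w1, w2, w3, -⟩ := hw r hrr
    rw [affineRate_eq hrr.1]
    positivity
  have hepos : ∀ r ∈ Ioc 0 rb, 0 < solutionEnergy α z w (-Real.log r) := fun r hrr => by
    obtain ⟨⟨b1, -, -⟩, -, -⟩ := hfacts r hrr
    obtain ⟨-, -, w3, -⟩ := hw r hrr
    unfold solutionEnergy
    positivity
  -- The affine rate is the reciprocal of v⁰ = p / (u G) with p = w e, where e is the frame energy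
  -- for ℓ = 1.
  have hkinv : ∀ r ∈ Ioc 0 rb, (affineRate α Ψ Y z w r)⁻¹ = w (-Real.log r) *
      solutionEnergy α z w (-Real.log r) / (u Ψ Y r (areaRadius α z (-Real.log r)) *
        G Ψ Y r (areaRadius α z (-Real.log r))) := fun r hrr => by
    obtain ⟨⟨b1, -, -⟩, b4, b5⟩ := hfacts r hrr
    obtain ⟨w1, w2, w3, -⟩ := hw r hrr
    rw [affineRate_eq hrr.1]
    unfold solutionEnergy
    field_simp
  have hes : ∀ r ∈ Ioc 0 rb, solutionEnergy α z w (-Real.log r) ^ 2 *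
      (1 - w (-Real.log r) ^ 2) * areaRadius α z (-Real.log r) ^ 2 = 1 := fun r hrr => by
    obtain ⟨⟨b1, -, -⟩, -, -⟩ := hfacts r hrr
    obtain ⟨-, -, w3, w4⟩ := hw r hrr
    have h3 := lt_of_lt_of_eq (pow_pos w3 2) w4
    unfold solutionEnergy
    rw [div_pow, mul_pow, w4]
    field_simp
  -- Here `g` is r as a function of the affine parameter; the angle is then a quadrature in r,
  -- started away from r = 0 because it may diverge there.
  obtain ⟨S, hS, g, hgS, hg, hg0⟩ := exists_reparam_Ioc hrb0
    (hsol.continuousOn_affineRate hr h hα hω hrb0 hrb) hkpos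
  obtain ⟨Φ, hΦ⟩ := exists_antideriv_Ioc hrb0 (hsol.continuousOn_rates hr h hα hrb0 hrb).2
  set τ : ℝ → ℝ := fun s => -Real.log (g s) with hτ
  have hgm : ∀ s ∈ Ioc 0 S, g s ∈ Ioc 0 rb := fun s hs => (hg s hs).1
  have hτm : MapsTo τ (Ioc 0 S) (Ici (-Real.log rb)) := fun s hs => hmaps (hgm s hs)
  have hτd : ∀ s ∈ Ioc 0 S, HasDerivWithinAt τ (-((affineRate α Ψ Y z w (g s))⁻¹ / g s))
      (Ioc 0 S) s := fun s hs => ((hg s hs).2.log (hgm s hs).1.ne').neg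
  set X : ℝ → Fin 4 → ℝ := fun s => ![g s, areaRadius α z (τ s), Real.pi / 2, Φ (g s)] with hX
  set V : ℝ → Fin 4 → ℝ := fun s => ![(affineRate α Ψ Y z w (g s))⁻¹,
    (Y (g s) (areaRadius α z (τ s)) * w (τ s) - u Ψ Y (g s) (areaRadius α z (τ s))) *
      solutionEnergy α z w (τ s), 0, 1 / areaRadius α z (τ s) ^ 2] with hV
  have hexpτ : ∀ s ∈ Ioc 0 S, Real.exp (-τ s) = g s := fun s hs => by
    simp only [hτ, neg_neg]; exact Real.exp_log (hgm s hs).1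
  have hp : ∀ s ∈ Ioc 0 S, frameMomentum Ψ Y (X s) (V s) =
      w (τ s) * solutionEnergy α z w (τ s) := fun s hs => by
    obtain ⟨-, b4, b5⟩ := hfacts _ (hgm s hs)
    have e1 : frameMomentum Ψ Y (X s) (V s) = u Ψ Y (g s) (areaRadius α z (τ s)) *
      G Ψ Y (g s) (areaRadius α z (τ s)) * (affineRate α Ψ Y z w (g s))⁻¹ := rfl
    rw [e1, hkinv _ (hgm s hs)]
    simp only [hτ]
    field_simp
  have he : ∀ s ∈ Ioc 0 S, frameEnergy Ψ Y (X s) (V s) = solutionEnergy α z w (τ s) :=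
    fun s hs => by
      obtain ⟨-, b4, b5⟩ := hfacts _ (hgm s hs)
      have e1 : frameEnergy Ψ Y (X s) (V s) = G Ψ Y (g s) (areaRadius α z (τ s)) *
        Y (g s) (areaRadius α z (τ s)) * (affineRate α Ψ Y z w (g s))⁻¹ -
        (Y (g s) (areaRadius α z (τ s)) * w (τ s) - u Ψ Y (g s) (areaRadius α z (τ s))) *
        solutionEnergy α z w (τ s) / u Ψ Y (g s) (areaRadius α z (τ s)) := rfl
      rw [e1, hkinv _ (hgm s hs)]
      simp only [hτ]
      field_simp
      ring
  have hreg : ∀ s ∈ Ioc 0 S, 0 < X s 1 ∧ X s 1 < X s 0 ∧ X s 0 < rmax := fun s hs =>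
    (hfacts _ (hgm s hs)).1
  refine ⟨S, hS, X, V, ?_, hg0, hgS, fun s hs => ⟨hgm s hs, rfl, rfl, inv_pos.2 (hkpos _ (hgm s hs)),
    rfl, rfl, rfl, by rw [he s hs]; exact hepos _ (hgm s hs)⟩⟩
  refine h.isNullGeodesicOn (ℓ := 1) hreg (fun _ _ => rfl) (fun _ _ => rfl)
    (fun s hs => (hfacts _ (hgm s hs)).2.1) (fun s hs => (hg s hs).2) (fun s hs => ?_)
    (fun s hs => ?_) (fun s hs => inv_pos.2 (hkpos _ (hgm s hs))) (fun s hs => ?_)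
    (fun s hs => ?_) (fun s hs => ?_)
  · obtain ⟨⟨b1, -, -⟩, b4, b5⟩ := hfacts _ (hgm s hs)
    obtain ⟨w1, w2, w3, -⟩ := hw _ (hgm s hs)
    refine ((hsol.hasDerivWithinAt_areaRadius hα (hτm hs)).comp s (hτd s hs) hτm).congr_deriv ?_
    rw [hexpτ s hs, hkinv _ (hgm s hs)]
    have := (hgm s hs).1
    simp only [hV, hτ, Matrix.cons_val]
    field_simp
  · refine ((hΦ _ (hgm s hs)).comp s (hg s hs).2 hgm).congr_deriv ?_
    have := hkpos _ (hgm s hs)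
    simp only [hV, hτ, Matrix.cons_val, angleRate]
    field_simp
  · have : areaRadius α z (τ s) ≠ 0 := (hreg s hs).1.ne'
    simp only [hX, hV, Matrix.cons_val]
    field_simp
  · obtain ⟨⟨b1, -, -⟩, b4, b5⟩ := hfacts _ (hgm s hs)
    obtain ⟨w1, w2, w3, w4⟩ := hw _ (hgm s hs)
    rw [hp s hs, he s hs]
    have e1 := hes _ (hgm s hs)
    change solutionEnergy α z w (τ s) ^ 2 * (1 - w (τ s) ^ 2) * areaRadius α z (τ s) ^ 2 = 1 at e1
    have b1' : areaRadius α z (τ s) ≠ 0 := b1.ne'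
    simp only [hX, hV, Matrix.cons_val]
    field_simp
    linear_combination e1
  · obtain ⟨⟨b1, b2, b3⟩, b4, b5⟩ := hfacts _ (hgm s hs)
    obtain ⟨w1, w2, w3, w4⟩ := hw _ (hgm s hs)
    refine (((hsol.hasDerivWithinAt_energy hα (hτm hs)).comp s (hτd s hs) hτm).congr he
      (he s hs)).congr_deriv ?_
    have z0 : 0 < z (τ s) := by linarith [hsol.z_ge _ (hτm hs)]
    have hRd : areaRadius α z (τ s) = α * z (τ s) ^ 2 * g s ^ 3 := by
      rw [areaRadius, hexpτ s hs]
    have b1' : 0 < areaRadius α z (τ s) := b1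
    have w3' : 0 < Real.sqrt (1 - w (τ s) ^ 2) := w3
    have hg0 := (hgm s hs).1
    rw [hexpτ s hs, hkinv _ (hgm s hs), h.rateB_eq hα hg0 z0 w1 hRd b2 b3 b4]
    unfold energyRate
    rw [he s hs, hp s hs]
    simp only [hX, hV, Matrix.cons_val]
    have e1 := hes _ (hgm s hs)
    change solutionEnergy α z w (τ s) ^ 2 * (1 - w (τ s) ^ 2) * areaRadius α z (τ s) ^ 2 = 1 at e1
    have hep : 0 < solutionEnergy α z w (τ s) := hepos _ (hgm s hs)
    have w1' : 0 < w (τ s) := w1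
    change 0 < G Ψ Y (g s) (areaRadius α z (τ s)) at b4
    change 0 < u Ψ Y (g s) (areaRadius α z (τ s)) at b5
    change _ * -(w (τ s) * solutionEnergy α z w (τ s) / (u Ψ Y (g s) (areaRadius α z (τ s)) *
      G Ψ Y (g s) (areaRadius α z (τ s))) / g s) = _
    generalize dSnd (Function.uncurry (u Ψ Y)) (g s, areaRadius α z (τ s)) = uR at *
    generalize dSnd (Function.uncurry Y) (g s, areaRadius α z (τ s)) = YR at *
    generalize dSnd (Function.uncurry (G Ψ Y)) (g s, areaRadius α z (τ s)) = GR at *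
    generalize u Ψ Y (g s) (areaRadius α z (τ s)) = U at *
    generalize G Ψ Y (g s) (areaRadius α z (τ s)) = γ at *
    generalize Y (g s) (areaRadius α z (τ s)) = y at *
    generalize solutionEnergy α z w (τ s) = e at *
    generalize areaRadius α z (τ s) = R at *
    generalize w (τ s) = ω at *
    field_simp
    linear_combination (γ * U) * e1

end affineParameter

/-! ### Joining the interior and exterior pieces of a ray -/

section rayConstruction

variable {α ξ β γ δ rmax rb R₀ Z η r₀ κ : ℝ} {Ψ Y : ℝ → ℝ → ℝ} {M : ℝ → ℝ} {z w : ℝ → ℝ}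

/-- A solution in the box that converges to the saddle is the interior part of a ray of the second
class. -/
theorem IsRaySolution.exists_ray (hsol : IsRaySolution α Z (-Real.log rb) Ψ Y z w)
    (hr : IsBoxRadius α (ξ / α) rmax Z η Ψ Y r₀) (h : IsInterior α ξ β γ δ rmax Ψ Y) (hα : 0 < α)
    (hω : 0 < ξ / α) (hrb0 : 0 < rb) (hrb : rb < r₀) (hM : IsExteriorMass Ψ rb M) (hR₀ : rb < R₀)
    (hκ : 0 < κ) {Rb : ℝ} (hRb : Rb = α * z (-Real.log rb) ^ 2 * rb ^ 3)
    (huY : u Ψ Y rb Rb < Y rb Rb)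
    (hχ : ∀ R ∈ Icc Rb R₀, 0 < chi M R ∧ chi M R < (κ * R) ^ 2)
    (hw : w (-Real.log rb) = aimCos (Y rb Rb) (u Ψ Y rb Rb) (κ * Rb)) {z₂ : ℝ}
    (hz : Tendsto z atTop (𝓝 z₂)) :
    ∃ c : Ray, IsDetectedSingularRay Ψ Y rb M R₀ c ∧ c.HasDirection (α * z₂ ^ 2) ∧
      c.angularMomentum = 1 ∧ c.frequency M = κ := by
  have hT : Real.exp (-(-Real.log rb)) < r₀ := by rwa [neg_neg, Real.exp_log hrb0]
  have hRa : areaRadius α z (-Real.log rb) = Rb := by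
    rw [areaRadius, neg_neg, Real.exp_log hrb0, hRb]
  obtain ⟨⟨b1, b2, b3⟩, -, -, -, bu, bY⟩ := hr.facts h hα hT hsol (self_mem_Ici (a := -Real.log rb))
  rw [hRa] at b1 b2 bu bY
  rw [neg_neg, Real.exp_log hrb0] at b2 b3 bu bY
  obtain ⟨S, hS, X, V, hgeo, hlim, hXS, hXV⟩ := hsol.exists_interiorGeodesic hr h hα hω hrb0 hrb
  have hSm : S ∈ Ioc 0 S := ⟨hS, le_rfl⟩
  obtain ⟨-, s1, s2, -, s4, s5, s6, -⟩ := hXV S hSm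
  rw [hXS, hRa] at s1
  rw [hXS, s1, hw] at s4
  rw [s1] at s6
  obtain ⟨S', hS', X', V', hgeo', ⟨x1, x2, x3⟩, ⟨v1, v2, v3⟩, v0, hreg', hfin⟩ :=
    exists_exteriorGeodesic hM.contDiff b1 (b2.trans hR₀) hκ hχ S (X S 3)
  have huY' : ∀ s ∈ Ioc 0 S, u Ψ Y (X s 0) (X s 1) < Y (X s 0) (X s 1) := fun s hs => by
    obtain ⟨t1, t2, -⟩ := hXV s hs
    have h1 := hsol.u_lt_Y hr h hα hT (by rwa [hRa, neg_neg, Real.exp_log hrb0])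
      (t := -Real.log (X s 0)) (neg_le_neg (Real.log_le_log t1.1 t1.2))
    rw [neg_neg, Real.exp_log t1.1, ← t2] at h1
    exact h1
  have hregion : ∀ s ∈ Ioc 0 S, 0 < X s 1 ∧ X s 1 < X s 0 ∧ X s 0 < rmax := fun s hs => by
    obtain ⟨t1, t2, -⟩ := hXV s hs
    have h1 := (hr.facts h hα hT hsol (t := -Real.log (X s 0))
      (neg_le_neg (Real.log_le_log t1.1 t1.2))).1
    rwa [neg_neg, Real.exp_log t1.1, ← t2] at h1
  have hX0 : Tendsto (fun s => X s 0) (𝓝[>] 0) (𝓝 0) := hlim.mono_right nhdsWithin_le_nhds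
  have hlog : Tendsto (fun s => -Real.log (X s 0)) (𝓝[>] 0) atTop :=
    tendsto_neg_atBot_atTop.comp (Real.tendsto_log_nhdsGT_zero.comp hlim)
  have hquot : ∀ᶠ s in 𝓝[>] (0 : ℝ), X s 1 / X s 0 ^ 3 = α * z (-Real.log (X s 0)) ^ 2 := by
    filter_upwards [Ioc_mem_nhdsGT hS] with s hs
    obtain ⟨t1, t2, -⟩ := hXV s hs
    have := t1.1
    rw [t2, areaRadius, neg_neg, Real.exp_log t1.1]
    field_simp
  have hdir : Tendsto (fun s => X s 1 / X s 0 ^ 3) (𝓝[>] 0) (𝓝 (α * z₂ ^ 2)) :=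
    (((hz.comp hlog).pow 2).const_mul α).congr' (hquot.mono fun s hs => hs.symm)
  obtain ⟨c0, c1⟩ := hχ Rb ⟨le_rfl, (b2.trans hR₀).le⟩
  have hchi := hM.chi_eq h b3.le b1 b2.le
  refine ⟨⟨0, S, S', X, V, X', V'⟩, ?_, hdir, ?_, ?_⟩
  · refine ⟨hS, hS', hgeo, fun s hs => ?_, fun s hs => (hXV s hs).2.2.1,
      fun s hs => (hXV s hs).2.2.2.1, fun s hs => ?_, hX0, ?_, hXS, fun i hi => ?_, fun i hi => ?_,
      hgeo', fun s hs => (hreg' s hs).1, fun s hs => (hreg' s hs).2.1,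
      fun s hs => (hreg' s hs).2.2.1, fun s hs => (hreg' s hs).2.2.2, hfin, ?_⟩
    · obtain ⟨q1, q2, q3⟩ := hregion s hs
      refine ⟨q1.trans q2, q1, q2, ?_⟩
      have h1 := huY' s hs
      have h2 : u Ψ Y (X s 0) (X s 1) ^ 2 = uSq Ψ Y (X s 0) (X s 1) :=
        Real.sq_sqrt (h.uSq_pos _ _ q1 q2.le q3.le).le
      have h3 := h.u_pos q1 q2.le q3.le
      have h4 := pow_lt_pow_left₀ h1 h3.le two_ne_zero
      rw [h2, uSq] at h4
      have h5 : 2 * Ψ (X s 0) (X s 1) / X s 1 < 1 := by linarith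
      exact (div_lt_one q1).1 h5
    · obtain ⟨q1, q2, q3⟩ := hregion s hs
      have h1 := h.momentum_one (v := V s) q1 q2 q3
      rw [interior_momentum_one] at h1
      have h2 := div_pos (hXV s hs).2.2.2.2.2.2.2 (h.u_pos q1 q2.le q3.le)
      simp only
      linarith
    · have h1 : Tendsto (fun s => X s 1 / X s 0 ^ 3 * X s 0 ^ 2) (𝓝[>] 0) (𝓝 0) := by
        have := hdir.mul (hX0.pow 2)
        simpa using this
      refine h1.congr' ?_
      filter_upwards [Ioc_mem_nhdsGT hS] with s hs
      have := (hXV s hs).1.1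
      field_simp
    · fin_cases i
      · exact absurd rfl hi
      · exact x1.trans s1.symm
      · exact x2.trans s2.symm
      · exact x3
    · fin_cases i
      · exact absurd rfl hi
      · refine v1.trans (Eq.trans ?_ s4.symm)
        -- The interior radial velocity is (Y w - u) e with e = 1 / (R √(1 - w²)). With w = `aimCos`
        -- this is √((κ R)² - χ) / R, the exterior one.
        obtain ⟨q, q1, q2, q3, -⟩ := aimCos_spec bu huY (k := κ * Rb) (by positivity)
          (by rw [← hchi]; exact c1.le)
        rw [q3, solutionEnergy, hRa, hw, ← hchi]
        have : 1 - aimCos (Y rb Rb) (u Ψ Y rb Rb) (κ * Rb) ^ 2 = q ^ 2 := by linarith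
        rw [this, Real.sqrt_sq q1.le]
        field_simp
      · exact v2.trans s5.symm
      · exact v3.trans s6.symm
    · simp only [Ray.angularMomentum, x1, v3]
      field_simp
      exact one_ne_zero
  · simp only [Ray.angularMomentum, x1, v3]
    field_simp
  · simp only [Ray.frequency, x1]
    exact v0

end rayConstruction

/-! ### Shooting with a family of rays of decreasing frequency -/

section shooting

variable {α ξ β γ δ rmax rb R₀ Z η r₀ κ : ℝ} {Ψ Y : ℝ → ℝ → ℝ} {M : ℝ → ℝ}

/-- Close to the centre, points with `R ≥ (6/5)² α r³` are not trapped. -/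
lemma IsInterior.exists_untrapped (h : IsInterior α ξ β γ δ rmax Ψ Y) (hα : 0 < α) :
    ∃ ρ > 0, ρ ≤ rmax ∧ ∀ r R : ℝ, 0 < r → r < ρ → α * (6 / 5) ^ 2 * r ^ 3 ≤ R → R ≤ r →
      u Ψ Y r R < Y r R := by
  obtain ⟨ε₁, hε₁, hε₁m, hT⟩ := h.taylor_bound (show 0 < α / 16 by positivity)
  have hY : ∀ᶠ p in 𝓝 ((0 : ℝ), (0 : ℝ)), 63 / 64 < Y p.1 p.2 := by
    have := (h.contDiff_Y 0 0 le_rfl le_rfl h.rmax_pos.le).continuousAt.tendsto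
    simp only [Function.uncurry_apply_pair, h.Y_center] at this
    exact this.eventually (lt_mem_nhds (by norm_num))
  obtain ⟨ε₂, hε₂, hY⟩ := Metric.eventually_nhds_iff_ball.1 hY
  set K := |β| + |γ| + |δ| with hK
  have hK0 : 0 ≤ K := by positivity
  set ε₃ := 1 / (16 * (K + 1)) with hε₃
  have hε₃0 : 0 < ε₃ := by positivity
  refine ⟨min (min ε₁ ε₂) (min ε₃ 1), by positivity,
    ((min_le_left _ _).trans (min_le_left _ _)).trans hε₁m, fun r R hr hrρ hR hRr => ?_⟩
  have h1 : r < ε₁ := hrρ.trans_le ((min_le_left _ _).trans (min_le_left _ _))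
  have h2 : r < ε₂ := hrρ.trans_le ((min_le_left _ _).trans (min_le_right _ _))
  have h3 : r < ε₃ := hrρ.trans_le ((min_le_right _ _).trans (min_le_left _ _))
  have h4 : r < 1 := hrρ.trans_le ((min_le_right _ _).trans (min_le_right _ _))
  have hR0 : 0 < R := lt_of_lt_of_le (by positivity) hR
  have hrm : r ≤ rmax := h1.le.trans hε₁m
  have hV := (abs_le.1 (hT r R hr h1 hR0.le hRr)).2
  have hYr : 63 / 64 < Y r R := hY (r, R) (by
    change (r, R) ∈ Metric.ball (0 : ℝ × ℝ) ε₂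
    rw [mem_ball_zero_iff, Prod.norm_def, max_lt_iff, Real.norm_eq_abs, Real.norm_eq_abs,
      abs_of_pos hr, abs_of_pos hR0]
    exact ⟨h2, hRr.trans_lt h2⟩)
  have hKr : K * r ^ 2 ≤ 1 / 16 := by
    have e1 : K * ε₃ ≤ 1 / 16 := by
      rw [hε₃, mul_one_div, div_le_div_iff₀ (by positivity) (by norm_num)]
      linarith
    have e2 : r ^ 2 ≤ ε₃ := by nlinarith
    exact (mul_le_mul_of_nonneg_left e2 hK0).trans e1
  have t1 : β * r ^ 2 * R ≤ |β| * (r ^ 2 * R) := by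
    rw [mul_assoc]; exact mul_le_mul_of_nonneg_right (le_abs_self β) (by positivity)
  have t2 : γ * r * R ^ 2 ≤ |γ| * (r ^ 2 * R) := by
    have e1 : γ * r * R ^ 2 ≤ |γ| * (r * R ^ 2) := by
      rw [mul_assoc]; exact mul_le_mul_of_nonneg_right (le_abs_self γ) (by positivity)
    refine e1.trans (mul_le_mul_of_nonneg_left ?_ (abs_nonneg γ))
    have := mul_le_mul_of_nonneg_left hRr (by positivity : 0 ≤ r * R)
    nlinarith
  have t3 : δ * R ^ 3 ≤ |δ| * (r ^ 2 * R) := by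
    have e1 : δ * R ^ 3 ≤ |δ| * R ^ 3 :=
      mul_le_mul_of_nonneg_right (le_abs_self δ) (by positivity)
    refine e1.trans (mul_le_mul_of_nonneg_left ?_ (abs_nonneg δ))
    have := pow_le_pow_left₀ hR0.le hRr 2
    nlinarith
  have t4 : K * (r ^ 2 * R) ≤ 1 / 16 * R := by
    have := mul_le_mul_of_nonneg_right hKr hR0.le
    linarith
  -- Since α r³ ≤ R / (6/5)², one has V ≤ (17/16) α r³ + R / 16 < (15/16) R, while Y² > 15/16.
  have hVR : massV Ψ Y (r, R) < R * Y r R ^ 2 := by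
    have e1 : 15 / 16 < Y r R ^ 2 := by nlinarith
    have e2 : R * (15 / 16) < R * Y r R ^ 2 := mul_lt_mul_of_pos_left e1 hR0
    have e3 : 0 < α * r ^ 3 := by positivity
    rw [hK] at t4
    linarith
  rw [u_eq hR0.ne', Real.sqrt_lt' (h.Y_pos r R hR0.le hRr hrm), div_lt_iff₀ hR0]
  linarith

/-- Shooting: a family of rays with decreasing frequencies that begins in the basin of the quadrant
`{z < z₁, w₁ < w}` contains a ray of the second class. -/
theorem IsInterior.exists_ray_of_start (h : IsInterior α ξ β γ δ rmax Ψ Y) (hα : 0 < α)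
    {z₂ w₂ z₁ w₁ : ℝ} (hs : IsSaddle (ξ / α) z₂ w₂) (hZ : ξ / α ≤ 2 * Z ^ 3) (hZ0 : 0 < Z)
    (hz₁ : z₂ < z₁) (hz₁Z : z₁ < Z) (hw₁ : w₂ < w₁) (hw₁1 : w₁ < 1)
    (hP : η < driftZ (ξ / α) z₁ w₁) (hQ : driftW (ξ / α) z₁ w₁ < -η) (hη : η < ξ / α / 4)
    (hr : IsBoxRadius α (ξ / α) rmax Z η Ψ Y r₀) (hrb0 : 0 < rb) (hrb : rb < r₀)
    (hM : IsExteriorMass Ψ rb M) (hR₀ : rb < R₀) (hκ : 0 < κ) {zp Rp : ℝ} (hzp : 1 / 2 ≤ zp)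
    (hzpZ : zp ≤ Z) (hRp : Rp = α * zp ^ 2 * rb ^ 3)
    (hχ : ∀ R ∈ Icc Rp R₀, 0 < chi M R ∧ chi M R < (κ * R) ^ 2)
    (hstart : (zp < z₁ ∧ w₁ < aimCos (Y rb Rp) (u Ψ Y rb Rp) (κ * Rp)) ∨
      ∃ z w, IsRaySolution α Z (-Real.log rb) Ψ Y z w ∧ z (-Real.log rb) = zp ∧
        w (-Real.log rb) = aimCos (Y rb Rp) (u Ψ Y rb Rp) (κ * Rp) ∧
        ∃ t ∈ Ici (-Real.log rb), z t < z₁ ∧ w₁ < w t) :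
    ∃ c : Ray, IsDetectedSingularRay Ψ Y rb M R₀ c ∧ c.HasDirection (α * z₂ ^ 2) ∧
      c.angularMomentum = 1 ∧ c.frequency M < κ := by
  have hω : 0 < ξ / α := by linarith [hs.ω_gt]
  have hrbm : rb < rmax := hrb.trans_le hr.le_rmax
  have hT : Real.exp (-(-Real.log rb)) < r₀ := by rwa [neg_neg, Real.exp_log hrb0]
  have hRp0 : 0 < Rp := by rw [hRp]; positivity
  have hbox : ∀ ζ : ℝ, 0 < ζ → ζ ≤ Z + 1 → α * ζ ^ 2 * rb ^ 3 < rb := fun ζ h1 h2 =>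
    (hr.box rb ζ 1 hrb0 hrb h1 h2 one_pos le_rfl).2.1
  have hRprb : Rp < rb := by rw [hRp]; exact hbox zp (by linarith) (by linarith)
  -- a smaller frequency
  obtain ⟨κ₁, hκ₁0, hκ₁, hκ₁χ⟩ : ∃ κ₁ > 0, κ₁ < κ ∧ ∀ R ∈ Icc Rp R₀, chi M R < (κ₁ * R) ^ 2 := by
    -- The strict inequality χ / R² < κ² holds on a compact interval, so it has a margin that
    -- permits lowering κ.
    have hcont : ContinuousOn (fun R => chi M R / R ^ 2) (Icc Rp R₀) := by
      have hMc : ContinuousOn M (Icc Rp R₀) :=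
        hM.contDiff.continuousOn.mono fun R hR => hRp0.trans_le hR.1
      unfold chi
      refine ContinuousOn.div (continuousOn_const.sub ((continuousOn_const.mul hMc).div
        continuousOn_id fun R hR => (hRp0.trans_le hR.1).ne')) (by fun_prop) fun R hR =>
        pow_ne_zero 2 (hRp0.trans_le hR.1).ne'
    obtain ⟨Rm, hRm, hmax⟩ := isCompact_Icc.exists_isMaxOn
      (nonempty_Icc.2 (hRprb.trans hR₀).le) hcont
    have hRm0 := hRp0.trans_le hRm.1
    obtain ⟨m1, m2⟩ := hχ Rm hRm
    have hm : 0 < chi M Rm / Rm ^ 2 := by positivity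
    have hmκ : Real.sqrt (chi M Rm / Rm ^ 2) < κ := by
      rw [Real.sqrt_lt' hκ, div_lt_iff₀ (by positivity), ← mul_pow]
      exact m2
    have hm0 := Real.sqrt_pos.2 hm
    obtain ⟨κ₁, k1, k2⟩ := exists_between hmκ
    refine ⟨κ₁, hm0.trans k1, k2, fun R hR => ?_⟩
    have hR0 := hRp0.trans_le hR.1
    have h1 : chi M R / R ^ 2 ≤ chi M Rm / Rm ^ 2 := hmax hR
    have h2 := (Real.sqrt_lt' (hm0.trans k1)).1 k1
    have h3 := h1.trans_lt h2
    rwa [div_lt_iff₀ (by positivity), ← mul_pow] at h3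
  -- Along the curve the exit radius grows until z = Z + 1, beyond the box, while the frequency
  -- falls from κ to κ₁. The conditions for reaching R₀ persist, because the interval [R_s, R₀]
  -- shrinks and κ_s ≥ κ₁.
  set zs : ℝ → ℝ := fun s => zp + s * (Z + 1 - zp) with hzs
  set Rs : ℝ → ℝ := fun s => α * zs s ^ 2 * rb ^ 3 with hRs
  set κs : ℝ → ℝ := fun s => κ - s * (κ - κ₁) with hκs
  have hzsb : ∀ s ∈ Icc (0 : ℝ) 1, zp ≤ zs s ∧ zs s ≤ Z + 1 := fun s hs => by
    have h1 := mul_nonneg hs.1 (by linarith : 0 ≤ Z + 1 - zp)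
    have h2 := mul_nonneg (sub_nonneg.2 hs.2) (by linarith : 0 ≤ Z + 1 - zp)
    constructor <;> simp only [hzs] <;> linarith
  have hκsb : ∀ s ∈ Icc (0 : ℝ) 1, κ₁ ≤ κs s := fun s hs => by
    have h2 := mul_nonneg (sub_nonneg.2 hs.2) (by linarith : 0 ≤ κ - κ₁)
    simp only [hκs]; linarith
  have hRsb : ∀ s ∈ Icc (0 : ℝ) 1, Rp ≤ Rs s ∧ Rs s < rb := fun s hs => by
    obtain ⟨h1, h2⟩ := hzsb s hs
    refine ⟨?_, hbox _ (by linarith) h2⟩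
    have : zp ^ 2 ≤ zs s ^ 2 := pow_le_pow_left₀ (by linarith) h1 2
    rw [hRp]
    simp only [hRs]
    gcongr
  have hχs : ∀ s ∈ Icc (0 : ℝ) 1, ∀ R ∈ Icc (Rs s) R₀, 0 < chi M R ∧ chi M R < (κs s * R) ^ 2 :=
    fun s hs R hR => by
      have hR' : R ∈ Icc Rp R₀ := ⟨(hRsb s hs).1.trans hR.1, hR.2⟩
      have hR0 := hRp0.trans_le hR'.1
      refine ⟨(hχ R hR').1, (hκ₁χ R hR').trans_le ?_⟩
      have := hκsb s hs
      gcongr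
  have hus : ∀ s ∈ Icc (0 : ℝ) 1, 0 < u Ψ Y rb (Rs s) ∧ u Ψ Y rb (Rs s) < Y rb (Rs s) ∧
      Y rb (Rs s) ^ 2 - u Ψ Y rb (Rs s) ^ 2 < (κs s * Rs s) ^ 2 := fun s hs => by
    obtain ⟨h1, h2⟩ := hRsb s hs
    have h3 := hRp0.trans_le h1
    obtain ⟨c1, c2⟩ := hχs s hs (Rs s) ⟨le_rfl, (h2.trans hR₀).le⟩
    rw [hM.chi_eq h hrbm.le h3 h2.le] at c1 c2
    have hu := h.u_pos h3 h2.le hrbm.le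
    exact ⟨hu, lt_of_pow_lt_pow_left₀ 2 (h.Y_pos _ _ h3.le h2.le hrbm.le).le (by linarith), c2⟩
  set ws : ℝ → ℝ := fun s => aimCos (Y rb (Rs s)) (u Ψ Y rb (Rs s)) (κs s * Rs s) with hws
  have hRsc : ContinuousOn Rs (Icc 0 1) := by fun_prop
  have hYc : ContinuousOn (fun s => Y rb (Rs s)) (Icc 0 1) := fun s hs => by
    obtain ⟨h1, h2⟩ := hRsb s hs
    exact ContinuousAt.comp_continuousWithinAt (g := Function.uncurry Y) (f := fun s => (rb, Rs s))
      (h.differentiableAt_Y (hRp0.trans_le h1).le h2.le hrbm.le).continuousAt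
      (continuousWithinAt_const.prodMk (hRsc s hs))
  have huc : ContinuousOn (fun s => u Ψ Y rb (Rs s)) (Icc 0 1) := fun s hs => by
    obtain ⟨h1, h2⟩ := hRsb s hs
    exact ContinuousAt.comp_continuousWithinAt (g := Function.uncurry (u Ψ Y))
      (f := fun s => (rb, Rs s))
      (h.differentiableAt_u (hRp0.trans_le h1) h2.le hrbm.le).continuousAt
      (continuousWithinAt_const.prodMk (hRsc s hs))
  have hκsc : ContinuousOn (fun s => κs s * Rs s) (Icc 0 1) :=
    ContinuousOn.mul (by fun_prop) hRsc
  have hzs0 : zs 0 = zp := by simp [hzs]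
  have hRs0 : Rs 0 = Rp := by simp only [hRs, hzs0, hRp]
  have hws0 : ws 0 = aimCos (Y rb Rp) (u Ψ Y rb Rp) (κ * Rp) := by
    simp only [hws, hRs0, hκs, zero_mul, sub_zero]
  obtain ⟨s, hs1, hs0, z, w, hsol, hzT, hwT, hzlim, -⟩ := exists_boxSolution_tendsto_saddle hs hZ hZ0
    hz₁ hz₁Z hw₁ hw₁1 hP hQ hη (hr.rates _ hT) zero_le_one (z₀ := zs) (w₀ := ws) (by fun_prop)
    (continuousOn_aimCos hYc huc hκsc fun s hs => (hus s hs).1)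
    (fun s hs => hzp.trans (hzsb s hs).1)
    (fun s hs => aimCos_lt_one (hus s hs).1 (hus s hs).2.1
      (mul_pos (hκ₁0.trans_le (hκsb s hs)) (hRp0.trans_le (hRsb s hs).1)) (hus s hs).2.2.le)
    (by rw [hzs0, hws0]; exact hstart) (by simp [hzs])
  have hκs0 : 0 < κs s := hκ₁0.trans_le (hκsb s hs1)
  obtain ⟨c, c1, c2, c3, c4⟩ := IsRaySolution.exists_ray hsol hr h hα hω hrb0 hrb hM hR₀ hκs0
    (Rb := Rs s) (by rw [hzT]) (hus s hs1).2.1 (hχs s hs1) hwT hzlim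
  refine ⟨c, c1, c2, c3, ?_⟩
  rw [c4]
  -- The solution found differs from the trapped one at s = 0, which makes the frequency strictly
  -- smaller than κ.
  have : 0 < s := lt_of_le_of_ne hs1.1 (Ne.symm hs0)
  have := mul_pos this (sub_pos.2 hκ₁)
  simp only [hκs]
  linarith

end shooting

/-! ### Comparison of impact parameters -/

section impactParameter

variable {α ξ β γ δ rmax rb R₀ Z η r₀ ρ z₁ w₁ z₂ w₂ : ℝ} {Ψ Y : ℝ → ℝ → ℝ} {M : ℝ → ℝ} {c : Ray}

/-- Constants for which the trapping, shooting and box estimates are all available. -/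
structure IsTrapping (α ξ rmax Z η z₁ w₁ z₂ w₂ r₀ : ℝ) (Ψ Y : ℝ → ℝ → ℝ) : Prop where
  saddle : IsSaddle (ξ / α) z₂ w₂
  Z_cube : ξ / α ≤ 2 * Z ^ 3
  Z_ge : 3 / 2 ≤ Z
  z_gt : z₂ < z₁
  z_lt : z₁ < Z
  w_gt : w₂ < w₁
  w_lt : w₁ < 1
  drift_z : η < driftZ (ξ / α) z₁ w₁
  drift_w : driftW (ξ / α) z₁ w₁ < -η
  eta_lt : η < ξ / α / 4
  radius : IsBoxRadius α (ξ / α) rmax Z η Ψ Y r₀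

lemma IsInterior.exists_isTrapping (h : IsInterior α ξ β γ δ rmax Ψ Y) (hα : 0 < α)
    (hs : IsSaddle (ξ / α) z₂ w₂) :
    ∃ Z η z₁ w₁ r₀, IsTrapping α ξ rmax Z η z₁ w₁ z₂ w₂ r₀ Ψ Y := by
  have hω := hs.ω_gt
  have hw₂ := hs.w_lt
  obtain ⟨z₁, w₁, h1, h2, h3, h4, h5, h6⟩ := hs.exists_corner_I (sub_pos.2 hw₂)
  set ω := ξ / α with hωd
  have hη : 0 < min (min (driftZ ω z₁ w₁ / 2) (-driftW ω z₁ w₁ / 2)) (ω / 8) :=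
    lt_min (lt_min (by linarith) (by linarith)) (by linarith)
  have e1 : min (min (driftZ ω z₁ w₁ / 2) (-driftW ω z₁ w₁ / 2)) (ω / 8) ≤ driftZ ω z₁ w₁ / 2 :=
    (min_le_left _ _).trans (min_le_left _ _)
  have e2 : min (min (driftZ ω z₁ w₁ / 2) (-driftW ω z₁ w₁ / 2)) (ω / 8) ≤ -driftW ω z₁ w₁ / 2 :=
    (min_le_left _ _).trans (min_le_right _ _)
  have e3 := min_le_right (min (driftZ ω z₁ w₁ / 2) (-driftW ω z₁ w₁ / 2)) (ω / 8)
  set η := min (min (driftZ ω z₁ w₁ / 2) (-driftW ω z₁ w₁ / 2)) (ω / 8)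
  have hξ : α ≤ ξ := by
    have : ξ = ω * α := by rw [hωd, div_mul_cancel₀ _ hα.ne']
    nlinarith
  have hZ : 0 < ω := by linarith
  obtain ⟨r₀, hr⟩ := h.exists_isBoxRadius hα hξ hZ hη
  have hz := hs.z_lt'
  have hw := hs.w_gt
  -- The choice Z = ω is generous: ω > 25 gives both ω ≤ 2 Z³ and z₁ < z₂ + 1 < Z.
  refine ⟨ω, η, z₁, w₁, r₀, hs, ?_, by linarith, h1, by linarith, h3, by linarith, by linarith,
    by linarith, by linarith, hr⟩
  have : 1 ≤ ω ^ 2 := by nlinarith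
  nlinarith

lemma IsTrapping.hasDirection_iff (ht : IsTrapping α ξ rmax Z η z₁ w₁ z₂ w₂ r₀ Ψ Y)
    (hc : IsDetectedSingularRay Ψ Y rb M R₀ c) (h : IsInterior α ξ β γ δ rmax Ψ Y) (hα : 0 < α)
    (hrb : rb < r₀) (hℓ : 0 < c.angularMomentum) :
    c.HasDirection (α * z₂ ^ 2) ↔ c.AngleToNegInfinity :=
  hc.hasDirection_iff h hα ht.saddle ht.Z_cube ht.Z_ge ht.eta_lt ht.radius hrb hℓ

/-- The second class is not empty. -/
lemma IsTrapping.exists_ray (ht : IsTrapping α ξ rmax Z η z₁ w₁ z₂ w₂ r₀ Ψ Y)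
    (h : IsInterior α ξ β γ δ rmax Ψ Y) (hα : 0 < α) (hrb0 : 0 < rb) (hrb : rb < r₀)
    (hut : ∀ R, α * (6 / 5) ^ 2 * rb ^ 3 ≤ R → R ≤ rb → u Ψ Y rb R < Y rb R)
    (hM : IsExteriorMass Ψ rb M) (hR₀ : rb < R₀) (hMR : ∀ R ∈ Icc rb R₀, 2 * M R < R) :
    ∃ c : Ray, IsDetectedSingularRay Ψ Y rb M R₀ c ∧ c.HasDirection (α * z₂ ^ 2) ∧
      c.angularMomentum = 1 := by
  have hr := ht.radius
  have hz₂ := ht.saddle.z_gt'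
  have hw₂ := ht.saddle.w_gt
  have hw₁ := ht.w_gt
  have hw₁1 := ht.w_lt
  have hrbm : rb < rmax := hrb.trans_le hr.le_rmax
  obtain ⟨Rp, hRp⟩ : ∃ Rp, Rp = α * z₂ ^ 2 * rb ^ 3 := ⟨_, rfl⟩
  have hRp0 : 0 < Rp := by rw [hRp]; positivity
  have hRprb : Rp < rb := by
    rw [hRp]
    exact (hr.box rb z₂ 1 hrb0 hrb (by linarith) (by linarith [ht.z_gt, ht.z_lt]) one_pos
      le_rfl).2.1
  have hge : α * (6 / 5) ^ 2 * rb ^ 3 ≤ Rp := by rw [hRp]; gcongr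
  have hχ : ∀ R ∈ Icc Rp R₀, 0 < chi M R := fun R hR => by
    have hR0 := hRp0.trans_le hR.1
    rcases le_total R rb with h1 | h1
    · rw [hM.chi_eq h hrbm.le hR0 h1]
      have h2 := hut R (hge.trans hR.1) h1
      have h3 := h.u_pos hR0 h1 hrbm.le
      nlinarith
    · rw [chi, sub_pos, div_lt_one hR0]
      exact hMR R ⟨h1, hR.2⟩
  have hMc : ContinuousOn (chi M) (Icc Rp R₀) := by
    unfold chi
    exact continuousOn_const.sub ((continuousOn_const.mul (hM.contDiff.continuousOn.mono
      fun R hR => hRp0.trans_le hR.1)).div continuousOn_id fun R hR => (hRp0.trans_le hR.1).ne')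
  obtain ⟨C, hC⟩ := isCompact_Icc.bddAbove_image hMc
  have hw₁' : 0 < 1 - w₁ ^ 2 := by nlinarith
  set y := Y rb Rp
  set v := u Ψ Y rb Rp
  have hy : 0 < y := h.Y_pos _ _ hRp0.le hRprb.le hrbm.le
  have hv : 0 < v := h.u_pos hRp0 hRprb.le hrbm.le
  have hvy : v < y := hut Rp hge hRprb.le
  -- A large frequency means a nearly radial ray: from κ R_p s = Y - u w ≤ Y, the second condition
  -- gives s² < 1 - w₁², hence w > w₁. So the curve starts inside the trap, at z = z₂ < z₁. The
  -- first condition excludes turning points up to R₀.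
  obtain ⟨κ, hκ, hκC, hκw⟩ : ∃ κ > 0, C < (κ * Rp) ^ 2 ∧ y ^ 2 < (1 - w₁ ^ 2) * (κ * Rp) ^ 2 := by
    have hlim : Tendsto (fun κ : ℝ => (κ * Rp) ^ 2) atTop atTop :=
      (tendsto_pow_atTop two_ne_zero).comp (tendsto_id.atTop_mul_const hRp0)
    obtain ⟨κ, ⟨k1, k2⟩, k3⟩ := ((hlim.eventually_gt_atTop C).and
      ((hlim.const_mul_atTop hw₁').eventually_gt_atTop (y ^ 2))).and (eventually_gt_atTop 0) |>.exists
    exact ⟨κ, k3, k1, k2⟩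
  have hχκ : ∀ R ∈ Icc Rp R₀, 0 < chi M R ∧ chi M R < (κ * R) ^ 2 := fun R hR => by
    refine ⟨hχ R hR, (hC (mem_image_of_mem _ hR)).trans_lt (hκC.trans_le ?_)⟩
    have := hR.1
    gcongr
  have hk : 0 < κ * Rp := mul_pos hκ hRp0
  have hw : w₁ < aimCos y v (κ * Rp) := by
    have hk2 : y ^ 2 - v ^ 2 ≤ (κ * Rp) ^ 2 := by
      have := (hχκ Rp ⟨le_rfl, (hRprb.trans hR₀).le⟩).2
      rw [hM.chi_eq h hrbm.le hRp0 hRprb.le] at this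
      exact this.le
    obtain ⟨s, hs, h1, -, h3⟩ := aimCos_spec hv hvy hk hk2
    have h0 := aimCos_pos hv hvy hk
    have h4 : κ * Rp * s ≤ y := by rw [← h3]; nlinarith
    have h5 : (κ * Rp * s) ^ 2 ≤ y ^ 2 := pow_le_pow_left₀ (by positivity) h4 2
    have h6 : s ^ 2 < 1 - w₁ ^ 2 := by
      have : s ^ 2 * (κ * Rp) ^ 2 < (1 - w₁ ^ 2) * (κ * Rp) ^ 2 := by linarith [mul_pow (κ * Rp) s 2]
      exact lt_of_mul_lt_mul_right this (by positivity)
    exact lt_of_pow_lt_pow_left₀ 2 h0.le (by linarith)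
  obtain ⟨c, c1, c2, c3, -⟩ := h.exists_ray_of_start hα ht.saddle ht.Z_cube
    (by linarith [ht.Z_ge]) ht.z_gt ht.z_lt ht.w_gt ht.w_lt ht.drift_z ht.drift_w ht.eta_lt hr hrb0
    hrb hM hR₀ hκ (zp := z₂) (by linarith) (by linarith [ht.z_gt, ht.z_lt]) hRp hχκ
    (Or.inl ⟨ht.z_gt, hw⟩)
  exact ⟨c, c1, c2, c3⟩

/-- A ray that is not of the second class has a smaller impact parameter than one that is. -/
lemma IsTrapping.exists_impactParameter_gt (ht : IsTrapping α ξ rmax Z η z₁ w₁ z₂ w₂ r₀ Ψ Y)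
    (hc : IsDetectedSingularRay Ψ Y rb M R₀ c) (h : IsInterior α ξ β γ δ rmax Ψ Y) (hα : 0 < α)
    (hrb : rb < r₀) (hM : IsExteriorMass Ψ rb M) (hR₀ : rb < R₀) (hℓ : 0 < c.angularMomentum)
    (hdir : ¬ c.HasDirection (α * z₂ ^ 2)) :
    ∃ c' : Ray, IsDetectedSingularRay Ψ Y rb M R₀ c' ∧ c'.HasDirection (α * z₂ ^ 2) ∧
      c'.angularMomentum = 1 ∧ c.impactParameter M < c'.impactParameter M := by
  have hr := ht.radius
  have hrbm : rb < rmax := hrb.trans_le hr.le_rmax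
  have hrb0 : 0 < rb := by rw [← hc.exit_r]; exact (hc.region _ hc.exit_mem).1
  have hT : Real.exp (-(-Real.log rb)) < r₀ := by rwa [neg_neg, Real.exp_log hrb0]
  have hZ0 : 0 < Z := by linarith [ht.Z_ge]
  obtain ⟨z, w, hsol, hzT, hwT, hG, hlim, -⟩ :=
    hc.exists_boxSolution h hα ht.saddle.ω_gt ht.Z_cube ht.Z_ge ht.eta_lt hr hrb
  -- By the dichotomy, a ray outside the second class enters the trap and so can start the shooting
  -- curve.
  have hfreq : ∃ᶠ t in atTop, z t < z₁ ∧ w₁ < w t :=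
    (trajectory_dichotomy ht.saddle hZ0 hsol.isTrajectory (hsol.isAsymptotic (hr.rates _ hT))
      ht.z_gt ht.w_lt).resolve_right fun h' => hdir ((hlim z₂ ht.saddle.z_pos.le).2 h'.1)
  obtain ⟨t, htw, htT⟩ := (hfreq.and_eventually (eventually_ge_atTop (-Real.log rb))).exists
  have hz1 := hsol.z_ge _ self_mem_Ici
  have hz2 := hsol.z_le _ self_mem_Ici
  have hm := hc.exit_mem
  have hsq := hc.zVar_sq hα hm
  rw [hc.exit_r, ← hzT] at hsq
  obtain ⟨w1, w2, w3, w4⟩ := hc.wVar_eq h hrbm hm hG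
  have he := hc.energy_pos h hrbm hm
  obtain ⟨f1, f2⟩ := hc.frequency_eq hM h hrbm hG
  have hf := hc.frequency_pos
  have hχ := fun R hR => hc.frequency_sq_gt (R := R) hR
  obtain ⟨r1, r2, r3⟩ := hc.region' hrbm _ hm
  rw [hc.exit_r] at r2 r3
  have hu := h.u_pos r1 r2.le r3.le
  rw [w3] at f1 f2
  rw [← hwT] at w1 w2 w4 f1 f2
  set R := c.pos c.exit 1
  set e := frameEnergy Ψ Y (c.pos c.exit) (c.vel c.exit)
  set W := w (-Real.log rb)
  set ℓ := c.angularMomentum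
  set f := c.frequency M
  have hs : 0 < 1 - W ^ 2 := by nlinarith
  have hs0 := Real.sqrt_pos.2 hs
  have hss := Real.sq_sqrt hs.le
  set s := Real.sqrt (1 - W ^ 2)
  have hℓs : ℓ = s * (R * e) := by
    refine (pow_left_inj₀ hℓ.le (by positivity) two_ne_zero).1 ?_
    rw [mul_pow, hss, w4]
  -- Only the ratio of frequency to ℓ matters, so the given ray is the member with κ = f / ℓ of the
  -- family with unit angular momentum.
  have hw : W = aimCos (Y rb R) (u Ψ Y rb R) (f / ℓ * R) := by
    refine eq_aimCos hu hs0 (by linarith) ?_ ?_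
    · refine le_of_mul_le_mul_right ?_ he
      linarith
    · rw [f1, hℓs]
      field_simp
  obtain ⟨c', c1, c2, c3, c4⟩ := h.exists_ray_of_start hα ht.saddle ht.Z_cube hZ0 ht.z_gt ht.z_lt
    ht.w_gt ht.w_lt ht.drift_z ht.drift_w ht.eta_lt hr hrb0 hrb hM hR₀ (κ := f / ℓ) (by positivity)
    hz1 hz2 hsq (fun R' hR' => by
      obtain ⟨k1, k2⟩ := hχ R' hR'
      refine ⟨k1, ?_⟩
      rw [div_mul_eq_mul_div, div_pow, lt_div_iff₀ (by positivity)]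
      exact k2) (Or.inr ⟨z, w, hsol, rfl, hw, t, htT, htw⟩)
  refine ⟨c', c1, c2, c3, ?_⟩
  rw [Ray.impactParameter, Ray.impactParameter, c3]
  have := one_div_lt_one_div_of_lt c1.frequency_pos c4
  rwa [one_div_div] at this

/-- Every ray leaves the interior with z ≤ Z, hence reaches or passes R = α Z² r_b³ on its outgoing
way to R₀. The absence of a turning point at this common radius bounds ℓ / ω. -/
lemma IsTrapping.impactParameter_le (ht : IsTrapping α ξ rmax Z η z₁ w₁ z₂ w₂ r₀ Ψ Y)
    (hc : IsDetectedSingularRay Ψ Y rb M R₀ c) (h : IsInterior α ξ β γ δ rmax Ψ Y) (hα : 0 < α)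
    (hrb : rb < r₀) (hR₀ : rb < R₀) :
    c.impactParameter M ≤ α * Z ^ 2 * rb ^ 3 / Real.sqrt (chi M (α * Z ^ 2 * rb ^ 3)) := by
  have hr := ht.radius
  have hrb0 : 0 < rb := by rw [← hc.exit_r]; exact (hc.region _ hc.exit_mem).1
  have hZ0 : 0 < Z := by linarith [ht.Z_ge]
  obtain ⟨z, w, hsol, hzT, -, -, -, -⟩ :=
    hc.exists_boxSolution h hα ht.saddle.ω_gt ht.Z_cube ht.Z_ge ht.eta_lt hr hrb
  have hz1 := hsol.z_ge _ self_mem_Ici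
  have hz2 := hsol.z_le _ self_mem_Ici
  have hsq := hc.zVar_sq hα hc.exit_mem
  rw [hc.exit_r, ← hzT] at hsq
  have hlt : α * Z ^ 2 * rb ^ 3 < rb :=
    (hr.box rb Z 1 hrb0 hrb hZ0 (by linarith) one_pos le_rfl).2.1
  have h0 : 0 < α * Z ^ 2 * rb ^ 3 := by positivity
  obtain ⟨h1, h2⟩ := hc.frequency_sq_gt (R := α * Z ^ 2 * rb ^ 3)
    ⟨by rw [hsq]; gcongr, (hlt.trans hR₀).le⟩
  have hf := hc.frequency_pos
  rw [Ray.impactParameter, div_le_div_iff₀ hf (Real.sqrt_pos.2 h1)]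
  refine le_of_sq_le_sq ?_ (by positivity)
  rw [mul_pow, Real.sq_sqrt h1.le]
  linarith

lemma exists_isLUB_of_subset {S T : Set ℝ} (hTS : T ⊆ S) (hT : T.Nonempty) (hS : BddAbove S)
    (h : ∀ x ∈ S, ∃ y ∈ T, x ≤ y) : ∃ b, IsLUB S b ∧ IsLUB T b := by
  have hb := isLUB_csSup (hT.mono hTS) hS
  refine ⟨sSup S, hb, fun x hx => hb.1 (hTS hx), fun x hx => hb.2 fun y hy => ?_⟩
  obtain ⟨y', hy', hle⟩ := h y hy
  exact hle.trans (hx hy')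

end impactParameter

end AnisotropicCollapse

open AnisotropicCollapse

/-! ### The main theorem -/

theorem proposition4p1 (α ξ : ℝ) (hα : 0 < α) (hξ : α * omegaCrit < ξ) :
    ∃ x₂ : ℝ, α < x₂ ∧ IsSecondDirection α ξ x₂ ∧
      ∀ (β γ δ rmax : ℝ) (Ψ Y : ℝ → ℝ → ℝ), IsInterior α ξ β γ δ rmax Ψ Y →
        ∃ ρ : ℝ, 0 < ρ ∧ ρ ≤ rmax ∧ ∀ rb : ℝ, 0 < rb → rb < ρ →
          ∀ (M : ℝ → ℝ) (R₀ : ℝ), IsExteriorMass Ψ rb M → rb < R₀ →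
            (∀ R ∈ Set.Icc rb R₀, 2 * M R < R) →
            -- the second class is the class of those rays along which `φ → -∞`
            (∀ c : Ray, IsDetectedSingularRay Ψ Y rb M R₀ c → 0 < c.angularMomentum →
              (c.HasDirection x₂ ↔ c.AngleToNegInfinity)) ∧
            -- this class is not empty
            (∃ c : Ray, IsDetectedSingularRay Ψ Y rb M R₀ c ∧
              c.HasDirection x₂ ∧ c.AngleToNegInfinity) ∧
            -- any ray outside the class has an impact parameter below that of a ray in the class
            (∀ c : Ray, IsDetectedSingularRay Ψ Y rb M R₀ c →
              ¬ (c.HasDirection x₂ ∧ c.AngleToNegInfinity) →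
              ∃ c' : Ray, IsDetectedSingularRay Ψ Y rb M R₀ c' ∧
                c'.HasDirection x₂ ∧ c'.AngleToNegInfinity ∧
                c.impactParameter M < c'.impactParameter M) ∧
            -- the supremum of all impact parameters is finite, and that of the class
            (∃ b : ℝ,
              IsLUB {t : ℝ | ∃ c : Ray, IsDetectedSingularRay Ψ Y rb M R₀ c ∧
                c.impactParameter M = t} b ∧
              IsLUB {t : ℝ | ∃ c : Ray, IsDetectedSingularRay Ψ Y rb M R₀ c ∧
                c.HasDirection x₂ ∧ c.AngleToNegInfinity ∧ c.impactParameter M = t} b) := by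
  have hξα : omegaCrit < ξ / α := by rwa [lt_div_iff₀ hα, mul_comm]
  obtain ⟨z₂, w₂, hs, h5, hroot⟩ := exists_saddle hξα
  refine ⟨α * z₂ ^ 2, ?_, ⟨z₂, hs.z_pos, hs.z_gt, hroot, h5, rfl⟩, ?_⟩
  · nlinarith [hs.z_gt]
  intro β γ δ rmax Ψ Y h
  obtain ⟨Z, η, z₁, w₁, r₀, ht⟩ := h.exists_isTrapping hα hs
  obtain ⟨ρ, hρ, -, hut⟩ := h.exists_untrapped hα
  refine ⟨min r₀ ρ, lt_min ht.radius.pos hρ, (min_le_left _ _).trans ht.radius.le_rmax, ?_⟩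
  intro rb hrb0 hrb' M R₀ hM hR₀ hMR
  have hrb := hrb'.trans_le (min_le_left _ _)
  have hiff := fun c (hc : IsDetectedSingularRay Ψ Y rb M R₀ c) =>
    ht.hasDirection_iff hc h hα hrb
  have hone : ∀ c : Ray, IsDetectedSingularRay Ψ Y rb M R₀ c → c.HasDirection (α * z₂ ^ 2) →
      c.angularMomentum = 1 → c.AngleToNegInfinity := fun c hc hd h1 =>
    (hiff c hc (by rw [h1]; exact one_pos)).1 hd
  obtain ⟨c₁, hc₁, hd₁, hℓ₁⟩ := ht.exists_ray h hα hrb0 hrb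
    (fun R h1 h2 => hut rb R hrb0 (hrb'.trans_le (min_le_right _ _)) h1 h2) hM hR₀ hMR
  have hgt : ∀ c : Ray, IsDetectedSingularRay Ψ Y rb M R₀ c →
      ¬ (c.HasDirection (α * z₂ ^ 2) ∧ c.AngleToNegInfinity) →
      ∃ c' : Ray, IsDetectedSingularRay Ψ Y rb M R₀ c' ∧ c'.HasDirection (α * z₂ ^ 2) ∧
        c'.AngleToNegInfinity ∧ c.impactParameter M < c'.impactParameter M := fun c hc hn => by
    -- For ℓ < 0 the impact parameter is negative, and any ray of the second class with ℓ = 1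
    -- exceeds it; only ℓ > 0 requires shooting.
    rcases hc.nonradial.lt_or_gt with hℓ | hℓ
    · refine ⟨c₁, hc₁, hd₁, hone c₁ hc₁ hd₁ hℓ₁, ?_⟩
      have h1 := div_neg_of_neg_of_pos hℓ (hc.frequency_pos)
      have h2 := one_div_pos.2 hc₁.frequency_pos
      rw [Ray.impactParameter, Ray.impactParameter, hℓ₁]
      exact h1.trans h2
    · obtain ⟨c', hc', hd', hℓ', hlt⟩ := ht.exists_impactParameter_gt hc h hα hrb hM hR₀ hℓ
        fun hd => hn ⟨hd, (hiff c hc hℓ).1 hd⟩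
      exact ⟨c', hc', hd', hone c' hc' hd' hℓ', hlt⟩
  refine ⟨hiff, ⟨c₁, hc₁, hd₁, hone c₁ hc₁ hd₁ hℓ₁⟩, hgt, exists_isLUB_of_subset ?_ ?_ ?_ ?_⟩
  · rintro t ⟨c, hc, -, -, rfl⟩
    exact ⟨c, hc, rfl⟩
  · exact ⟨_, c₁, hc₁, hd₁, hone c₁ hc₁ hd₁ hℓ₁, rfl⟩
  · refine ⟨α * Z ^ 2 * rb ^ 3 / Real.sqrt (chi M (α * Z ^ 2 * rb ^ 3)), ?_⟩
    rintro t ⟨c, hc, rfl⟩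
    exact ht.impactParameter_le hc h hα hrb hR₀
  · rintro t ⟨c, hc, rfl⟩
    by_cases hcl : c.HasDirection (α * z₂ ^ 2) ∧ c.AngleToNegInfinity
    · exact ⟨_, ⟨c, hc, hcl.1, hcl.2, rfl⟩, le_rfl⟩
    · obtain ⟨c', h1, h2, h3, h4⟩ := hgt c hc hcl
      exact ⟨_, ⟨c', h1, h2, h3, rfl⟩, h4.le⟩
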